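/- **Setting.** Let $(X_1,Y_1),(X_2,Y_2),\dots$ be independent copies of $(X,Y)$, where $Y=r(X)+\varepsilon$ and $X$ and $\varepsilon$ are independent. Assume: * (F) $\varepsilon$ has mean zero, a finite absolute moment of some order greater than $8/3$, and a density $f$, and there are bounded and integrable functions $f'$ and $f''$ such that $f(z)=\int_{-\infty}^z f'(x)\,dx$ and $f'(z)=\int_{-\infty}^z f''(x)\,dx$ for all $z\in\mathbb{R}$. * (G) The density $g$ of $X$ is bounded and bounded away from zero on $[0,1]$, vanishes outside $[0,1]$, and is of bounded variation. * (R) $r$ is twice continuously differentiable on $[0,1]$, and $r'$ is strictly positive on $[0,1]$. Let $\ell=-f'/f$ and suppose that the Fisher information $J=\int \ell^2(z)f(z)\,dz$ is finite. Put $\lambda(z)=\ell(z)/J-z$, let $h(y)=\int f(y-r(x))g(x)\,dx$ be the density of $Y$, write $\varepsilon_j=Y_j-r(X_j)$, and set $$C(y)=\frac1n\sum_{j=1}^n\lambda(\varepsilon_j)\bigl(f'(y-r(X_j))-h'(y)\bigr),\qquad y\in\mathbb{R}.$$ **The estimator.** Let $m=\lfloor n/2\rfloor$. Let $\hat r_1$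 and $\hat r_2$ be local quadratic smoothers based on $(X_j,Y_j)$, $1\le j\le m$, and on $(X_j,Y_j)$, $m<j\le n$, respectively: for $x\in[0,1]$, $\hat r_i(x)$ is the first coordinate of a minimizer over $\beta\in\mathbb{R}^3$ of $$\sum_j w\Bigl(\frac{X_j-x}{c}\Bigr)\Bigl(Y_j-\beta_1-\beta_2\frac{X_j-x}{c}-\beta_3\Bigl(\frac{X_j-x}{c}\Bigr)^2\Bigr)^2,$$ the sum being over the respective half of the sample, where $w$ is a three times continuously differentiable symmetric density that vanishes outside $[-1,1]$ and the bandwidth $c=c_n$ is a positive constant times $n^{-1/4}$. Let $\hat\varepsilon_{i,j}=Y_j-\hat r_i(X_j)$. Let $\kappa$ be a twice continuously differentiable probability density such that $|\kappa'|\le B\kappa$ and $|\kappa''|\le B\kappa$ for some constant $B$ (for example the logistic density), let $a=a_n>0$ be a bandwidth, $\kappa_a(u)=\kappa(u/a)/a$, and put $$\hat f_1(z)=\frac1m\sum_{j=1}^m\kappa_a(z-\hat\varepsilon_{1,j}),\qquad \hat f_2(z)=\frac1{n-m}\sum_{j=m+1}^n\kappa_a(z-\hat\varepsilon_{2,j}),$$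 $$\hat f_3(z)=\frac1n\sum_{j=1}^m\kappa_a(z-\hat\varepsilon_{2,j})+\frac1n\sum_{j=m+1}^n\kappa_a(z-\hat\varepsilon_{1,j}),$$ $$\hat\ell_i(z)=-\frac{\hat f_i'(z)}{a+\hat f_i(z)},\qquad \hat J=\frac1n\sum_{j=1}^m\hat\ell_2^2(\hat\varepsilon_{1,j})+\frac1n\sum_{j=m+1}^n\hat\ell_1^2(\hat\varepsilon_{2,j}),\qquad \hat\lambda_i(z)=\frac{\hat\ell_i(z)}{\hat J}-z,\qquad i=1,2.$$ Finally let $\hat C=\hat C_1+\hat C_2$ with $$\hat C_1(y)=\frac1n\sum_{j=1}^m\Bigl(\hat f_3'(y-\hat r_2(X_j))-\frac1m\sum_{i=1}^m\hat f_3'(y-\hat r_2(X_i))\Bigr)\hat\lambda_2(\hat\varepsilon_{1,j}),$$ $$\hat C_2(y)=\frac1n\sum_{j=m+1}^n\Bigl(\hat f_3'(y-\hat r_1(X_j))-\frac1{n-m}\sum_{i=m+1}^n\hat f_3'(y-\hat r_1(X_i))\Bigr)\hat\lambda_1(\hat\varepsilon_{2,j}).$$ **Theorem.** Suppose that (F),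 (G) and (R) hold, that $f$ has finite Fisher information $J$, and that the bandwidth $a=a_n$ satisfies $a\to0$ and $a^8n\to\infty$. Then $$\|\hat C-C\|=\sup_{y\in\mathbb{R}}\bigl|\hat C(y)-C(y)\bigr|=o_p(n^{-1/2}).$$ -/

import Mathlib

open MeasureTheory ProbabilityTheory Filter Set
open scoped ENNReal Topology

noncomputable section

/-- A probability density on the real line. -/
structure IsDensity (p : ℝ → ℝ) : Prop where
  nonneg : ∀ z, 0 ≤ p z
  integral_eq_one : ∫ z, p z = 1

/-- The assumption on the error density `f`: mean zero, a moment of order greater than `8/3`,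
and bounded integrable functions `f'`, `f''` of which `f`, `f'` are the primitives that
vanish at minus infinity. -/
structure ErrorAssumption (f f' f'' : ℝ → ℝ) : Prop where
  density : IsDensity f
  mean_zero : ∫ z, z * f z = 0
  moment : ∃ p : ℝ, 8 / 3 < p ∧ Integrable (fun z => |z| ^ p * f z)
  bounded_fst : ∃ B, ∀ z, |f' z| ≤ B
  bounded_snd : ∃ B, ∀ z, |f'' z| ≤ B
  integrable_fst : Integrable f'
  integrable_snd : Integrable f''
  primitive_fst : ∀ z, f z = ∫ x in Iic z, f' x
  primitive_snd : ∀ z, f' z = ∫ x in Iic z, f'' x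

/-- The assumption on the covariate density `g`: quasi-uniform on `[0,1]` and of bounded
variation. -/
structure CovariateAssumption (g : ℝ → ℝ) : Prop where
  density : IsDensity g
  bounded : ∃ B, ∀ x ∈ Icc (0 : ℝ) 1, g x ≤ B
  bounded_below : ∃ b, 0 < b ∧ ∀ x ∈ Icc (0 : ℝ) 1, b ≤ g x
  zero_outside : ∀ x, x ∉ Icc (0 : ℝ) 1 → g x = 0
  boundedVariation : BoundedVariationOn g univ

/-- The assumption on the regression function `r`. -/
structure RegressionAssumption (r : ℝ → ℝ) : Prop where
  contDiffOn : ContDiffOn ℝ 2 r (Icc 0 1)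
  deriv_pos : ∀ x ∈ Icc (0 : ℝ) 1, 0 < derivWithin r (Icc 0 1) x

/-- Independent observations from the regression model: the pairs `(X j, ε j)` are independent
and identically distributed, `X j` has density `g` and is independent of `ε j`, which has
density `f`, and the response is `Y j = r (X j) + ε j`. -/
structure IsRegressionSample {Ω : Type*} [MeasurableSpace Ω] (P : Measure Ω)
    (f g r : ℝ → ℝ) (X ε Y : ℕ → Ω → ℝ) : Prop where
  measurable_covariate : ∀ j, Measurable (X j)
  measurable_error : ∀ j, Measurable (ε j)
  covariate_law : ∀ j, P.map (X j) = volume.withDensity (fun x => ENNReal.ofReal (g x))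
  error_law : ∀ j, P.map (ε j) = volume.withDensity (fun z => ENNReal.ofReal (f z))
  indep_error : ∀ j, IndepFun (X j) (ε j) P
  indep : iIndepFun (fun j ω => (X j ω, ε j ω)) P
  response : ∀ j ω, Y j ω = r (X j ω) + ε j ω

/-- The weight function of the local quadratic smoother. -/
structure IsSmootherWeight (w : ℝ → ℝ) : Prop where
  contDiff : ContDiff ℝ 3 w
  symmetric : ∀ u, w (-u) = w u
  density : IsDensity w
  support : ∀ u, u ∉ Icc (-1 : ℝ) 1 → w u = 0

/-- The kernel used for estimating the error density and its score: a twice continuously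
differentiable density whose first two derivatives are dominated by a multiple of it. -/
structure IsScoreKernel (κ : ℝ → ℝ) : Prop where
  density : IsDensity κ
  contDiff : ContDiff ℝ 2 κ
  dominated : ∃ B, ∀ u, |deriv κ u| ≤ B * κ u ∧ |deriv (deriv κ) u| ≤ B * κ u

/-- The score function for location, `ℓ = -f'/f`. -/
def score (f f' : ℝ → ℝ) (z : ℝ) : ℝ := -f' z / f z

/-- The Fisher information for location. -/
def fisherInfo (f f' : ℝ → ℝ) : ℝ := ∫ z, score f f' z ^ 2 * f z

/-- The Fisher information is finite. -/
def HasFiniteFisherInfo (f f' : ℝ → ℝ) : Prop := Integrable (fun z => score f f' z ^ 2 * f z)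

/-- The function `λ(z) = ℓ(z)/J - z`. -/
def lam (f f' : ℝ → ℝ) (z : ℝ) : ℝ := score f f' z / fisherInfo f f' - z

/-- The density `h` of the response `r(X) + ε`: the convolution of the error density with the
distribution of `r(X)`. -/
def responseDensity (f g r : ℝ → ℝ) (y : ℝ) : ℝ := ∫ x, f (y - r x) * g x

/-- The process `C` to be estimated, at sample size `n`, as a function of the covariates `x` and
the errors `e`; observations are numbered from `0`. -/
def correction (f f' g r : ℝ → ℝ) (n : ℕ) (x e : ℕ → ℝ) (y : ℝ) : ℝ :=
  1 / (n : ℝ) * ∑ j ∈ Finset.range n,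
    lam f f' (e j) * (f' (y - r (x j)) - deriv (responseDensity f g r) y)

/-- The weighted least squares criterion for the local quadratic fit at `t`, with bandwidth `c`,
based on the observations `(x j, y j)` with `j ∈ s`. -/
def localLoss (w : ℝ → ℝ) (c : ℝ) (s : Finset ℕ) (x y : ℕ → ℝ) (t : ℝ) (β : Fin 3 → ℝ) : ℝ :=
  1 / ((s.card : ℝ) * c) * ∑ j ∈ s, w ((x j - t) / c) *
    (y j - (β 0 + β 1 * ((x j - t) / c) + β 2 * ((x j - t) / c) ^ 2)) ^ 2

/-- `ρ` is a local quadratic smoother: at each point of `[0,1]` its value is the first coordinate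
of a minimizer of the weighted least squares criterion. -/
def IsLocalQuadraticSmoother (w : ℝ → ℝ) (c : ℝ) (s : Finset ℕ) (x y : ℕ → ℝ)
    (ρ : ℝ → ℝ) : Prop :=
  ∀ t ∈ Icc (0 : ℝ) 1, ∃ β : Fin 3 → ℝ,
    (∀ β' : Fin 3 → ℝ, localLoss w c s x y t β ≤ localLoss w c s x y t β') ∧ ρ t = β 0

/-- The ingredients of the sample-split correction term: kernel `κ`, bandwidth `a`, sample size
`n`, observations `(x j, y j)` with `j < n`, and the regression estimates `r₁`, `r₂` from the
first and the second half of the sample. -/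
structure SplitInput where
  κ : ℝ → ℝ
  a : ℝ
  n : ℕ
  x : ℕ → ℝ
  y : ℕ → ℝ
  r₁ : ℝ → ℝ
  r₂ : ℝ → ℝ

namespace SplitInput

/-- The size of the first half of the sample. -/
def m (S : SplitInput) : ℕ := S.n / 2

/-- The indices of the first half of the sample. -/
def I₁ (S : SplitInput) : Finset ℕ := Finset.range S.m

/-- The indices of the second half of the sample. -/
def I₂ (S : SplitInput) : Finset ℕ := Finset.Ico S.m S.n

/-- The scaled kernel `κ(u/a)/a`. -/
def scaledKernel (S : SplitInput) (u : ℝ) : ℝ := S.κ (u / S.a) / S.a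

/-- The residual `Y_j - r̂₁(X_j)`. -/
def res₁ (S : SplitInput) (j : ℕ) : ℝ := S.y j - S.r₁ (S.x j)

/-- The residual `Y_j - r̂₂(X_j)`. -/
def res₂ (S : SplitInput) (j : ℕ) : ℝ := S.y j - S.r₂ (S.x j)

/-- The density estimator `f̂₁`. -/
def f₁ (S : SplitInput) (z : ℝ) : ℝ :=
  1 / (S.m : ℝ) * ∑ j ∈ S.I₁, S.scaledKernel (z - S.res₁ j)

/-- The density estimator `f̂₂`. -/
def f₂ (S : SplitInput) (z : ℝ) : ℝ :=
  1 / ((S.n : ℝ) - S.m) * ∑ j ∈ S.I₂, S.scaledKernel (z - S.res₂ j)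

/-- The density estimator `f̂₃`. -/
def f₃ (S : SplitInput) (z : ℝ) : ℝ :=
  1 / (S.n : ℝ) * ∑ j ∈ S.I₁, S.scaledKernel (z - S.res₂ j) +
    1 / (S.n : ℝ) * ∑ j ∈ S.I₂, S.scaledKernel (z - S.res₁ j)

/-- The score estimator from the first half. -/
def score₁ (S : SplitInput) (z : ℝ) : ℝ := -deriv S.f₁ z / (S.a + S.f₁ z)

/-- The score estimator from the second half. -/
def score₂ (S : SplitInput) (z : ℝ) : ℝ := -deriv S.f₂ z / (S.a + S.f₂ z)

/-- The estimator of the Fisher information. -/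
def J (S : SplitInput) : ℝ :=
  1 / (S.n : ℝ) * ∑ j ∈ S.I₁, S.score₂ (S.res₁ j) ^ 2 +
    1 / (S.n : ℝ) * ∑ j ∈ S.I₂, S.score₁ (S.res₂ j) ^ 2

/-- The estimator `λ̂₁` of `λ`. -/
def lam₁ (S : SplitInput) (z : ℝ) : ℝ := S.score₁ z / S.J - z

/-- The estimator `λ̂₂` of `λ`. -/
def lam₂ (S : SplitInput) (z : ℝ) : ℝ := S.score₂ z / S.J - z

/-- The contribution `Ĉ₁` of the first half. -/
def C₁ (S : SplitInput) (y : ℝ) : ℝ :=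
  1 / (S.n : ℝ) * ∑ j ∈ S.I₁,
    (deriv S.f₃ (y - S.r₂ (S.x j)) -
      1 / (S.m : ℝ) * ∑ i ∈ S.I₁, deriv S.f₃ (y - S.r₂ (S.x i))) * S.lam₂ (S.res₁ j)

/-- The contribution `Ĉ₂` of the second half. -/
def C₂ (S : SplitInput) (y : ℝ) : ℝ :=
  1 / (S.n : ℝ) * ∑ j ∈ S.I₂,
    (deriv S.f₃ (y - S.r₁ (S.x j)) -
      1 / ((S.n : ℝ) - S.m) * ∑ i ∈ S.I₂, deriv S.f₃ (y - S.r₁ (S.x i))) * S.lam₁ (S.res₂ j)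

/-- The sample-split correction term `Ĉ`. -/
def C (S : SplitInput) (y : ℝ) : ℝ := S.C₁ y + S.C₂ y

end SplitInput

/-- The supremum norm of a real function, with value `∞` if the function is unbounded. -/
def supNorm (φ : ℝ → ℝ) : ℝ≥0∞ := ⨆ y, ENNReal.ofReal |φ y|

/-- `Z n = o_p(n^{-1/2})` for nonnegative extended real random variables `Z n`. -/
def IsLittleOpRootN {Ω : Type*} [MeasurableSpace Ω] (P : Measure Ω) (Z : ℕ → Ω → ℝ≥0∞) : Prop :=
  ∀ δ : ℝ, 0 < δ →
    Tendsto (fun n : ℕ => P {ω | ENNReal.ofReal δ < ENNReal.ofReal (Real.sqrt n) * Z n ω})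
      atTop (𝓝 0)

end

/-!
Split-sample estimation of the correction term `C`. Throughout, `s = n^(-1/8)` is the unit of the
asymptotics (`baseRate`): the smoothers have bandwidth of order `s ^ 2`, the assumption on the
bandwidth `a` of the density estimators says that `s / a → 0`, and the target precision `n^(-1/2)`
is `s ^ 4`. Of the moments of the errors only the first two are used.

**Conditioning on the covariates.** Where the covariates are locally rich enough (`GramBound`), the
normal equations show that any local quadratic smoother is a linear function of the responses. Its
estimation error at a point `j` is therefore an affine form `b j + ∑ i, W j i * e i` in the errors
of one half of the sample (`ShiftForm`), with bias of order `s ^ 4`, weights of order `s ^ 6` and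
row and column sums of order one (`exists_smootherForm_bounded`). For fixed covariates everything
is thus a function of two independent sequences of independent errors (`SplitDesign`), and the
statement is proved uniformly over all designs with these bounds
(`exists_opZero_estimate_sub_target`). By Chebyshev's inequality in each cell of a partition, the
covariates are with high probability evenly spread (`IsSpread`), which gives the bounds, and
Fubini's theorem carries the uniform result over to random covariates
(`eventually_measure_discrepancy_le`).

**Uniformity in `y`.** An increment of a primitive is the inner product in `L²` of its derivative
with a step function. So a weighted sum `∑ c j * F (y - t j)`, whose weights add up to zero, is at
most the `L²` norm of `F'` times the norm of the vector `∑ c j • stepL2 (t j)`, for every `y` at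
once (`abs_sum_shift_le`), and the supremum over `y` is replaced by second moments in a Hilbert
space. It remains to show that the second derivative of the pooled density estimator converges
to `f''` in `L²`, and that the sums with the weights `stepL2 (t j)` are as small as they should be.

**The estimated scores.** Given the errors of the other half, the score estimate is a fixed function
`L`, bounded by a multiple of `1 / a` and Lipschitz with a constant of order `1 / a ^ 2`, that is
close to the score in mean square (`IsScoreEstimate`, `isScoreEstimate_residualScore`). The
difference of `L (e j - D j) / J - (e j - D j)` and `λ (e j)`, where `D j` is the estimation error of
the smoother, has three parts. The conditional mean of `L (e j - D j)` is `-J * D j` to first order,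
which cancels the `D j` of the residual: this is where division by the Fisher information enters.
The quadratic remainder is of order `D j ^ 2 / a`, hence negligible. The centred fluctuation is
handled by a leave-two-out argument: two terms of the sum are correlated only through the mutual
influence of two observations, which is of order `s ^ 6` (`integral_norm_sq_sum_centred_le`). The
three parts are put together in `IsWeights.opZero_sum_estimated`; that `J` is estimated
consistently is `opZero_fisher_sub`.

**Centring.** In `C` the functions are centred at the derivative of the response density, in the
estimator at the mean over one half of the sample. The difference is a mean of `λ (e j)`, of order
`n^(-1/2)`, times the deviation of a mean of translates of `f'` from its expectation, which tends to
zero uniformly in `y` by the same device of step functions (`abs_mean_deriv_sub_le`).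
-/

/-! ### Boundedness and convergence in probability along a filter -/

/-- `Z i → 0` in probability along `l`. No measurability is required: for a set that is not
measurable the measure is the outer measure. -/
def OpZero {Ω ι : Type*} [MeasurableSpace Ω] (P : Measure Ω) (l : Filter ι)
    (Z : ι → Ω → ℝ) : Prop :=
  ∀ δ : ℝ, 0 < δ → ∀ η : ℝ, 0 < η → ∀ᶠ i in l, P {ω | δ < |Z i ω|} ≤ ENNReal.ofReal η

/-- `Z i` is bounded in probability along `l`. -/
def OpOne {Ω ι : Type*} [MeasurableSpace Ω] (P : Measure Ω) (l : Filter ι)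
    (Z : ι → Ω → ℝ) : Prop :=
  ∀ η : ℝ, 0 < η → ∃ K : ℝ, 0 < K ∧ ∀ᶠ i in l, P {ω | K < |Z i ω|} ≤ ENNReal.ofReal η

section OpCalculus

variable {Ω ι : Type*} [MeasurableSpace Ω] {P : Measure Ω} {l : Filter ι} {Y Z : ι → Ω → ℝ}

theorem OpZero.mono (hY : OpZero P l Y) (h : ∀ᶠ i in l, ∀ ω, |Z i ω| ≤ |Y i ω|) :
    OpZero P l Z := by
  intro δ hδ η hη
  filter_upwards [hY δ hδ η hη, h] with i hi h'
  exact (measure_mono fun ω hω => lt_of_lt_of_le hω (h' ω)).trans hi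

theorem OpOne.mono (hY : OpOne P l Y) (h : ∀ᶠ i in l, ∀ ω, |Z i ω| ≤ |Y i ω|) :
    OpOne P l Z := by
  intro η hη
  obtain ⟨K, hK, hY⟩ := hY η hη
  refine ⟨K, hK, ?_⟩
  filter_upwards [hY, h] with i hi h'
  exact (measure_mono fun ω hω => lt_of_lt_of_le hω (h' ω)).trans hi

theorem OpZero.opOne (hZ : OpZero P l Z) : OpOne P l Z :=
  fun η hη => ⟨1, one_pos, hZ 1 one_pos η hη⟩

theorem OpZero.add (hY : OpZero P l Y) (hZ : OpZero P l Z) :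
    OpZero P l (fun i ω => Y i ω + Z i ω) := by
  intro δ hδ η hη
  filter_upwards [hY (δ / 2) (half_pos hδ) (η / 2) (half_pos hη),
    hZ (δ / 2) (half_pos hδ) (η / 2) (half_pos hη)] with i h1 h2
  have hsub : {ω | δ < |Y i ω + Z i ω|} ⊆ {ω | δ / 2 < |Y i ω|} ∪ {ω | δ / 2 < |Z i ω|} := by
    intro ω hω
    simp only [mem_ofPred_eq, mem_union] at hω ⊢
    by_contra! h
    have := abs_add_le (Y i ω) (Z i ω)
    linarith
  calc P _ ≤ _ := measure_mono hsub
    _ ≤ _ := measure_union_le _ _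
    _ ≤ ENNReal.ofReal (η / 2) + ENNReal.ofReal (η / 2) := add_le_add h1 h2
    _ = ENNReal.ofReal η := by
      rw [← ENNReal.ofReal_add (half_pos hη).le (half_pos hη).le, add_halves]

theorem OpOne.add (hY : OpOne P l Y) (hZ : OpOne P l Z) :
    OpOne P l (fun i ω => Y i ω + Z i ω) := by
  intro η hη
  obtain ⟨K, hK, hY⟩ := hY (η / 2) (half_pos hη)
  obtain ⟨K', hK', hZ⟩ := hZ (η / 2) (half_pos hη)
  refine ⟨K + K', add_pos hK hK', ?_⟩
  filter_upwards [hY, hZ] with i h1 h2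
  have hsub : {ω | K + K' < |Y i ω + Z i ω|} ⊆ {ω | K < |Y i ω|} ∪ {ω | K' < |Z i ω|} := by
    intro ω hω
    simp only [mem_ofPred_eq, mem_union] at hω ⊢
    by_contra! h
    have := abs_add_le (Y i ω) (Z i ω)
    linarith
  calc P _ ≤ _ := measure_mono hsub
    _ ≤ _ := measure_union_le _ _
    _ ≤ ENNReal.ofReal (η / 2) + ENNReal.ofReal (η / 2) := add_le_add h1 h2
    _ = ENNReal.ofReal η := by
      rw [← ENNReal.ofReal_add (half_pos hη).le (half_pos hη).le, add_halves]

theorem OpZero.mul_opOne (hY : OpZero P l Y) (hZ : OpOne P l Z) :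
    OpZero P l (fun i ω => Y i ω * Z i ω) := by
  intro δ hδ η hη
  obtain ⟨K, hK, hZ⟩ := hZ (η / 2) (half_pos hη)
  filter_upwards [hY (δ / K) (div_pos hδ hK) (η / 2) (half_pos hη), hZ] with i h1 h2
  have hsub : {ω | δ < |Y i ω * Z i ω|} ⊆ {ω | δ / K < |Y i ω|} ∪ {ω | K < |Z i ω|} := by
    intro ω hω
    simp only [mem_ofPred_eq, mem_union, abs_mul] at hω ⊢
    by_contra! h
    have := mul_le_mul h.1 h.2 (abs_nonneg _) (div_pos hδ hK).le
    rw [div_mul_cancel₀ _ hK.ne'] at this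
    linarith
  calc P _ ≤ _ := measure_mono hsub
    _ ≤ _ := measure_union_le _ _
    _ ≤ ENNReal.ofReal (η / 2) + ENNReal.ofReal (η / 2) := add_le_add h1 h2
    _ = ENNReal.ofReal η := by
      rw [← ENNReal.ofReal_add (half_pos hη).le (half_pos hη).le, add_halves]

theorem OpOne.mul (hY : OpOne P l Y) (hZ : OpOne P l Z) :
    OpOne P l (fun i ω => Y i ω * Z i ω) := by
  intro η hη
  obtain ⟨K, hK, hY⟩ := hY (η / 2) (half_pos hη)
  obtain ⟨K', hK', hZ⟩ := hZ (η / 2) (half_pos hη)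
  refine ⟨K * K', mul_pos hK hK', ?_⟩
  filter_upwards [hY, hZ] with i h1 h2
  have hsub : {ω | K * K' < |Y i ω * Z i ω|} ⊆ {ω | K < |Y i ω|} ∪ {ω | K' < |Z i ω|} := by
    intro ω hω
    simp only [mem_ofPred_eq, mem_union, abs_mul] at hω ⊢
    by_contra! h
    have := mul_le_mul h.1 h.2 (abs_nonneg _) hK.le
    linarith
  calc P _ ≤ _ := measure_mono hsub
    _ ≤ _ := measure_union_le _ _
    _ ≤ ENNReal.ofReal (η / 2) + ENNReal.ofReal (η / 2) := add_le_add h1 h2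
    _ = ENNReal.ofReal η := by
      rw [← ENNReal.ofReal_add (half_pos hη).le (half_pos hη).le, add_halves]

theorem opZero_of_tendsto {c : ι → ℝ} (hc : Tendsto c l (𝓝 0)) :
    OpZero P l (fun i _ => c i) := by
  intro δ hδ η _
  have : ∀ᶠ i in l, |c i| < δ := by
    have := hc.abs
    rw [abs_zero] at this
    exact this.eventually_lt_const hδ
  filter_upwards [this] with i hi
  simp [not_lt.2 hi.le]

theorem opOne_const (c : ℝ) : OpOne P l (fun _ _ => c) := by
  intro η _
  refine ⟨|c| + 1, by positivity, ?_⟩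
  filter_upwards with i
  simp [not_lt.2 (le_add_of_nonneg_right zero_le_one : |c| ≤ |c| + 1)]

theorem OpZero.sqrt (hZ : OpZero P l Z) : OpZero P l (fun i ω => Real.sqrt (Z i ω)) := by
  intro δ hδ η hη
  filter_upwards [hZ (δ ^ 2) (by positivity) η hη] with i hi
  refine (measure_mono fun ω hω => ?_).trans hi
  simp only [mem_ofPred_eq, abs_of_nonneg (Real.sqrt_nonneg _)] at hω ⊢
  exact ((Real.lt_sqrt hδ.le).1 hω).trans_le (le_abs_self _)

theorem OpOne.sqrt (hZ : OpOne P l Z) : OpOne P l (fun i ω => Real.sqrt (Z i ω)) := by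
  intro η hη
  obtain ⟨K, hK, hZ⟩ := hZ η hη
  refine ⟨Real.sqrt K, Real.sqrt_pos.2 hK, ?_⟩
  filter_upwards [hZ] with i hi
  refine (measure_mono fun ω hω => ?_).trans hi
  simp only [mem_ofPred_eq, abs_of_nonneg (Real.sqrt_nonneg _)] at hω ⊢
  exact (Real.lt_sqrt (Real.sqrt_nonneg _)|>.1 hω).trans_le' (Real.sq_sqrt hK.le).ge
    |>.trans_le (le_abs_self _)

theorem OpZero.abs (hZ : OpZero P l Z) : OpZero P l (fun i ω => |Z i ω|) :=
  hZ.mono (Eventually.of_forall fun i ω => by rw [abs_abs])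


theorem OpZero.const_mul (hZ : OpZero P l Z) (c : ℝ) : OpZero P l (fun i ω => c * Z i ω) := by
  simpa only [mul_comm] using hZ.mul_opOne (opOne_const c)

theorem OpOne.const_mul (hZ : OpOne P l Z) (c : ℝ) : OpOne P l (fun i ω => c * Z i ω) :=
  (opOne_const c).mul hZ

theorem OpOne.mul_tendsto {c : ι → ℝ} (hZ : OpOne P l Z) (hc : Tendsto c l (𝓝 0)) :
    OpZero P l (fun i ω => c i * Z i ω) :=
  (opZero_of_tendsto hc).mul_opOne hZ

/-- If `Z i → J ≠ 0` in probability, then `1 / Z i → 1 / J` in probability. -/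
theorem OpZero.inv_sub_inv {J : ℝ} (hJ : J ≠ 0) (hZ : OpZero P l (fun i ω => Z i ω - J)) :
    OpZero P l (fun i ω => (Z i ω)⁻¹ - J⁻¹) := by
  intro δ hδ η hη
  have hJ' : 0 < |J| := abs_pos.2 hJ
  filter_upwards [hZ (min (|J| / 2) (δ * |J| ^ 2 / 2)) (by positivity) η hη] with i hi
  refine (measure_mono fun ω hω => ?_).trans hi
  simp only [mem_ofPred_eq] at hω ⊢
  by_contra! h
  obtain ⟨h1, h2⟩ := le_min_iff.1 h
  have h3 : |J| / 2 ≤ |Z i ω| := by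
    have := abs_sub_abs_le_abs_sub J (Z i ω)
    rw [abs_sub_comm] at this
    linarith
  have hz : Z i ω ≠ 0 := by
    intro h0
    rw [h0, abs_zero] at h3
    linarith
  have h4 : (Z i ω)⁻¹ - J⁻¹ = (J - Z i ω) / (Z i ω * J) := by
    field_simp
  rw [h4, abs_div, abs_mul, abs_sub_comm, lt_div_iff₀ (by positivity)] at hω
  have : δ * (|J| / 2 * |J|) ≤ δ * (|Z i ω| * |J|) := by gcongr
  nlinarith

end OpCalculus

section Markov

variable {Ω Ω' ι : Type*} [MeasurableSpace Ω] [MeasurableSpace Ω'] {P : Measure Ω}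
  {P' : Measure Ω'} {l : Filter ι}

theorem OpZero.comp_fst [IsProbabilityMeasure P] [IsProbabilityMeasure P'] {Z : ι → Ω → ℝ}
    (hZ : OpZero P l Z) : OpZero (P.prod P') l (fun i ω => Z i ω.1) := by
  intro δ hδ η hη
  filter_upwards [hZ δ hδ η hη] with i hi
  have : {ω : Ω × Ω' | δ < |Z i ω.1|} = {ω | δ < |Z i ω|} ×ˢ univ := by ext; simp
  rwa [this, Measure.prod_prod, measure_univ, mul_one]

theorem OpZero.comp_snd [IsProbabilityMeasure P] [IsProbabilityMeasure P'] {Z : ι → Ω' → ℝ}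
    (hZ : OpZero P' l Z) : OpZero (P.prod P') l (fun i ω => Z i ω.2) := by
  intro δ hδ η hη
  filter_upwards [hZ δ hδ η hη] with i hi
  have : {ω : Ω × Ω' | δ < |Z i ω.2|} = univ ×ˢ {ω | δ < |Z i ω|} := by ext; simp
  rwa [this, Measure.prod_prod, measure_univ, one_mul]

theorem OpOne.comp_fst [IsProbabilityMeasure P] [IsProbabilityMeasure P'] {Z : ι → Ω → ℝ}
    (hZ : OpOne P l Z) : OpOne (P.prod P') l (fun i ω => Z i ω.1) := by
  intro η hη
  obtain ⟨K, hK, hZ⟩ := hZ η hη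
  refine ⟨K, hK, ?_⟩
  filter_upwards [hZ] with i hi
  have : {ω : Ω × Ω' | K < |Z i ω.1|} = {ω | K < |Z i ω|} ×ˢ univ := by ext; simp
  rwa [this, Measure.prod_prod, measure_univ, mul_one]

theorem OpOne.comp_snd [IsProbabilityMeasure P] [IsProbabilityMeasure P'] {Z : ι → Ω' → ℝ}
    (hZ : OpOne P' l Z) : OpOne (P.prod P') l (fun i ω => Z i ω.2) := by
  intro η hη
  obtain ⟨K, hK, hZ⟩ := hZ η hη
  refine ⟨K, hK, ?_⟩
  filter_upwards [hZ] with i hi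
  have : {ω : Ω × Ω' | K < |Z i ω.2|} = univ ×ˢ {ω | K < |Z i ω|} := by ext; simp
  rwa [this, Measure.prod_prod, measure_univ, one_mul]

theorem OpZero.comp_swap [IsProbabilityMeasure P] [IsProbabilityMeasure P']
    {Z : ι → Ω × Ω' → ℝ} (hZ : OpZero (P.prod P') l Z) :
    OpZero (P'.prod P) l (fun i ω => Z i ω.swap) := by
  intro δ hδ η hη
  filter_upwards [hZ δ hδ η hη] with i hi
  have h : MeasurePreserving (MeasurableEquiv.prodComm : Ω' × Ω ≃ᵐ Ω × Ω')
    (P'.prod P) (P.prod P') := Measure.measurePreserving_swap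
  rw [← h.measure_preimage_equiv] at hi
  exact hi

/-- Conditional Markov inequality on a product space: `V` bounds the conditional mean of `|Z|`
given the second coordinate. -/
theorem measure_lt_abs_le_of_lintegral_le [IsProbabilityMeasure P] [IsProbabilityMeasure P']
    {Z : Ω × Ω' → ℝ} (hZ : Measurable Z) {V : Ω' → ℝ}
    (hV : ∀ ω', ∫⁻ ω, ENNReal.ofReal |Z (ω, ω')| ∂P ≤ ENNReal.ofReal (V ω')) {δ η : ℝ}
    (hδ : 0 < δ) :
    (P.prod P') {ω | δ < |Z ω|} ≤ P' {ω' | η < |V ω'|} + ENNReal.ofReal (η / δ) := by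
  have hS : MeasurableSet {ω | δ < |Z ω|} := measurableSet_lt measurable_const hZ.abs
  rw [Measure.prod_apply_symm hS]
  set T := toMeasurable P' {ω' | η < |V ω'|}
  have hpt : ∀ ω', P ((fun ω => (ω, ω')) ⁻¹' {ω | δ < |Z ω|}) ≤
      T.indicator 1 ω' + ENNReal.ofReal (η / δ) := by
    intro ω'
    by_cases h : ω' ∈ T
    · simp only [h, indicator_of_mem, Pi.one_apply]
      exact prob_le_one.trans le_self_add
    · have hn : |V ω'| ≤ η := by
        by_contra hc
        exact h (subset_toMeasurable _ _ (not_le.1 hc))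
      have hm : Measurable fun ω => ENNReal.ofReal |Z (ω, ω')| :=
        (hZ.comp measurable_prodMk_right).abs.ennreal_ofReal
      have := meas_ge_le_lintegral_div (μ := P) hm.aemeasurable
        (ENNReal.ofReal_pos.2 hδ).ne' ENNReal.ofReal_ne_top
      refine le_trans (measure_mono ?_) (this.trans ?_)
      · intro ω hω
        exact ENNReal.ofReal_le_ofReal (le_of_lt hω)
      · rw [ENNReal.ofReal_div_of_pos hδ]
        refine le_trans ?_ le_add_self
        gcongr
        exact (hV ω').trans (ENNReal.ofReal_le_ofReal ((le_abs_self _).trans hn))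
  calc _ ≤ ∫⁻ ω', T.indicator 1 ω' + ENNReal.ofReal (η / δ) ∂P' := lintegral_mono hpt
    _ = P' T + ENNReal.ofReal (η / δ) := by
      rw [lintegral_add_right _ measurable_const, lintegral_indicator_one
        (measurableSet_toMeasurable _ _), lintegral_const, measure_univ, mul_one]
    _ = _ := by rw [measure_toMeasurable]

theorem opZero_of_lintegral_le [IsProbabilityMeasure P] [IsProbabilityMeasure P']
    {Z : ι → Ω × Ω' → ℝ} (hZ : ∀ i, Measurable (Z i)) {V : ι → Ω' → ℝ}
    (hV : ∀ᶠ i in l, ∀ ω', ∫⁻ ω, ENNReal.ofReal |Z i (ω, ω')| ∂P ≤ ENNReal.ofReal (V i ω'))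
    (h : OpZero P' l V) : OpZero (P.prod P') l Z := by
  intro δ hδ η hη
  filter_upwards [hV, h (η / 2 * δ) (by positivity) (η / 2) (half_pos hη)] with i hi h2
  refine (measure_lt_abs_le_of_lintegral_le (hZ i) hi (η := η / 2 * δ) hδ).trans ?_
  rw [mul_div_cancel_right₀ _ hδ.ne']
  refine (add_le_add_left h2 _).trans ?_
  rw [← ENNReal.ofReal_add (half_pos hη).le (half_pos hη).le, add_halves]

theorem opOne_of_lintegral_le [IsProbabilityMeasure P] [IsProbabilityMeasure P']
    {Z : ι → Ω × Ω' → ℝ} (hZ : ∀ i, Measurable (Z i)) {V : ι → Ω' → ℝ}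
    (hV : ∀ᶠ i in l, ∀ ω', ∫⁻ ω, ENNReal.ofReal |Z i (ω, ω')| ∂P ≤ ENNReal.ofReal (V i ω'))
    (h : OpOne P' l V) : OpOne (P.prod P') l Z := by
  intro η hη
  obtain ⟨K, hK, h⟩ := h (η / 2) (half_pos hη)
  refine ⟨K / (η / 2), by positivity, ?_⟩
  filter_upwards [hV, h] with i hi h2
  refine (measure_lt_abs_le_of_lintegral_le (hZ i) hi (η := K) (by positivity)).trans ?_
  rw [div_div_cancel₀ hK.ne']
  refine (add_le_add_left h2 _).trans ?_
  rw [← ENNReal.ofReal_add (half_pos hη).le (half_pos hη).le, add_halves]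

theorem measure_lt_abs_le_of_lintegral {Z : Ω → ℝ} (hZ : Measurable Z) {V δ : ℝ} (hδ : 0 < δ)
    (hV : ∫⁻ ω, ENNReal.ofReal |Z ω| ∂P ≤ ENNReal.ofReal V) :
    P {ω | δ < |Z ω|} ≤ ENNReal.ofReal (V / δ) := by
  refine (measure_mono fun ω hω => ENNReal.ofReal_le_ofReal (le_of_lt hω)).trans
    ((meas_ge_le_lintegral_div (μ := P) hZ.abs.ennreal_ofReal.aemeasurable
        (ENNReal.ofReal_pos.2 hδ).ne' ENNReal.ofReal_ne_top).trans ?_)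
  rw [ENNReal.ofReal_div_of_pos hδ]
  gcongr

theorem opZero_of_lintegral {Z : ι → Ω → ℝ} (hZ : ∀ i, Measurable (Z i)) {V : ι → ℝ}
    (hV : ∀ᶠ i in l, ∫⁻ ω, ENNReal.ofReal |Z i ω| ∂P ≤ ENNReal.ofReal (V i))
    (h : Tendsto V l (𝓝 0)) : OpZero P l Z := by
  intro δ hδ η hη
  filter_upwards [hV, h.eventually_lt_const (show 0 < η * δ by positivity)] with i hi h2
  refine (measure_lt_abs_le_of_lintegral (hZ i) hδ hi).trans (ENNReal.ofReal_le_ofReal ?_)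
  rw [div_le_iff₀ hδ]
  exact h2.le

theorem opOne_of_lintegral {Z : ι → Ω → ℝ} (hZ : ∀ i, Measurable (Z i)) {V : ℝ}
    (hV : ∀ᶠ i in l, ∫⁻ ω, ENNReal.ofReal |Z i ω| ∂P ≤ ENNReal.ofReal V) : OpOne P l Z := by
  intro η hη
  refine ⟨(|V| + 1) / η, by positivity, ?_⟩
  filter_upwards [hV] with i hi
  refine (measure_lt_abs_le_of_lintegral (hZ i) (by positivity) hi).trans
    (ENNReal.ofReal_le_ofReal ?_)
  rw [div_le_iff₀ (by positivity), mul_div_cancel₀ _ hη.ne']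
  linarith [le_abs_self V]

end Markov

/-! ### Second moments of weighted sums -/

theorem lintegral_ofReal_abs_le {Ω : Type*} [MeasurableSpace Ω] {P : Measure Ω} {Z : Ω → ℝ}
    {V : ℝ} (hZ : Integrable Z P) (h0 : ∀ ω, 0 ≤ Z ω) (hV : ∫ ω, Z ω ∂P ≤ V) :
    ∫⁻ ω, ENNReal.ofReal |Z ω| ∂P ≤ ENNReal.ofReal V := by
  simp_rw [abs_of_nonneg (h0 _)]
  rw [← ofReal_integral_eq_lintegral_ofReal hZ (Eventually.of_forall h0)]
  exact ENNReal.ofReal_le_ofReal hV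

section Hilbert

variable {E : Type*} [NormedAddCommGroup E] [InnerProductSpace ℝ E]

theorem norm_sq_sum_eq (s : Finset ℕ) (v : ℕ → E) :
    ‖∑ j ∈ s, v j‖ ^ 2 = ∑ j ∈ s, ∑ k ∈ s, inner ℝ (v j) (v k) := by
  rw [← real_inner_self_eq_norm_sq, sum_inner]
  simp_rw [inner_sum]

/-- A sum of centred functions of pairwise independent identically distributed variables has
second moment at most the sum of the uncentred second moments. -/
theorem integral_norm_sq_sum_sub_mean_le [CompleteSpace E] {Ω S : Type*} [MeasurableSpace Ω]
    [MeasurableSpace S] {P : Measure Ω} [IsProbabilityMeasure P] {μ : Measure S}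
    [IsProbabilityMeasure μ] {e : ℕ → Ω → S} (he : ∀ j, Measurable (e j))
    (hlaw : ∀ j, P.map (e j) = μ) (hind : ∀ i j, i ≠ j → IndepFun (e i) (e j) P)
    (s : Finset ℕ) {Ψ : ℕ → S → E} (hΨ : ∀ j ∈ s, MemLp (Ψ j) 2 μ) :
    Integrable (fun ω => ‖∑ j ∈ s, (Ψ j (e j ω) - ∫ t, Ψ j t ∂μ)‖ ^ 2) P ∧
      ∫ ω, ‖∑ j ∈ s, (Ψ j (e j ω) - ∫ t, Ψ j t ∂μ)‖ ^ 2 ∂P ≤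
        ∑ j ∈ s, ∫ t, ‖Ψ j t‖ ^ 2 ∂μ := by
  set Φ : ℕ → S → E := fun j t => Ψ j t - ∫ t, Ψ j t ∂μ with hΦdef
  have hmp : ∀ j, MeasurePreserving (e j) P μ := fun j => ⟨he j, hlaw j⟩
  have hΦ : ∀ j ∈ s, MemLp (Φ j) 2 μ := fun j hj => (hΨ j hj).sub (memLp_const _)
  have hΦe : ∀ j ∈ s, MemLp (fun ω => Φ j (e j ω)) 2 P := fun j hj =>
    (hΦ j hj).comp_measurePreserving (hmp j)
  have hΦ0 : ∀ j ∈ s, ∫ t, Φ j t ∂μ = 0 := by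
    intro j hj
    simp only [hΦdef]
    rw [integral_sub ((hΨ j hj).integrable one_le_two) (integrable_const _)]
    simp
  have hint : ∀ i ∈ s, ∀ j ∈ s,
      Integrable (fun ω => (inner ℝ (Φ i (e i ω)) (Φ j (e j ω)) : ℝ)) P := by
    intro i hi j hj
    have h1 : Integrable (fun ω => ‖Φ i (e i ω)‖ * ‖Φ j (e j ω)‖) P :=
      MemLp.integrable_mul (hΦe i hi).norm (hΦe j hj).norm
    refine h1.mono ((hΦe i hi).1.inner (hΦe j hj).1) (Eventually.of_forall fun ω => ?_)
    rw [Real.norm_of_nonneg (by positivity : (0:ℝ) ≤ ‖Φ i (e i ω)‖ * ‖Φ j (e j ω)‖)]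
    exact norm_inner_le_norm _ _
  have hoff : ∀ i ∈ s, ∀ j ∈ s, i ≠ j →
      ∫ ω, (inner ℝ (Φ i (e i ω)) (Φ j (e j ω)) : ℝ) ∂P = 0 := by
    intro i hi j hj hij
    have hjoint : P.map (fun ω => (e i ω, e j ω)) = μ.prod μ := by
      rw [(indepFun_iff_map_prod_eq_prod_map_map (he i).aemeasurable
        (he j).aemeasurable).1 (hind i j hij), hlaw, hlaw]
    have hmeas : AEStronglyMeasurable (fun p : S × S => (inner ℝ (Φ i p.1) (Φ j p.2) : ℝ))
        (μ.prod μ) := ((hΦ i hi).1.comp_fst).inner ((hΦ j hj).1.comp_snd)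
    have h1 : ∫ ω, (inner ℝ (Φ i (e i ω)) (Φ j (e j ω)) : ℝ) ∂P =
        ∫ p, (inner ℝ (Φ i p.1) (Φ j p.2) : ℝ) ∂(μ.prod μ) := by
      rw [← hjoint, integral_map ((he i).prodMk (he j)).aemeasurable (by rwa [hjoint])]
    have hi2 : Integrable (fun p : S × S => (inner ℝ (Φ i p.1) (Φ j p.2) : ℝ)) (μ.prod μ) := by
      rw [← hjoint]
      rw [integrable_map_measure (by rwa [hjoint]) ((he i).prodMk (he j)).aemeasurable]
      exact hint i hi j hj
    rw [h1, integral_prod _ hi2]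
    have : ∀ a, ∫ b, (inner ℝ (Φ i a) (Φ j b) : ℝ) ∂μ = 0 := by
      intro a
      rw [integral_inner ((hΦ j hj).integrable one_le_two), hΦ0 j hj, inner_zero_right]
    simp [this]
  have hdiag : ∀ j ∈ s, ∫ ω, (inner ℝ (Φ j (e j ω)) (Φ j (e j ω)) : ℝ) ∂P ≤
      ∫ t, ‖Ψ j t‖ ^ 2 ∂μ := by
    intro j hj
    have h1 : ∫ ω, (inner ℝ (Φ j (e j ω)) (Φ j (e j ω)) : ℝ) ∂P =
        ∫ t, (inner ℝ (Φ j t) (Φ j t) : ℝ) ∂μ := by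
      rw [← hlaw j, integral_map (he j).aemeasurable]
      rw [hlaw j]
      exact (hΦ j hj).1.inner (hΦ j hj).1
    rw [h1]
    set mj := ∫ t, Ψ j t ∂μ
    have hI1 : Integrable (fun t => ‖Ψ j t‖ ^ 2) μ := (hΨ j hj).integrable_norm_pow two_ne_zero
    have hI2 : Integrable (fun t => (inner ℝ mj (Ψ j t) : ℝ)) μ :=
      ((hΨ j hj).integrable one_le_two).const_inner mj
    have h2 : ∀ t, (inner ℝ (Φ j t) (Φ j t) : ℝ) =
        ‖Ψ j t‖ ^ 2 - 2 * inner ℝ mj (Ψ j t) + ‖mj‖ ^ 2 := by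
      intro t
      rw [real_inner_self_eq_norm_sq, hΦdef]
      simp only
      rw [norm_sub_sq_real, real_inner_comm]
    simp_rw [h2]
    have hI3 : Integrable (fun t => ‖Ψ j t‖ ^ 2 - 2 * inner ℝ mj (Ψ j t)) μ :=
      hI1.sub (hI2.const_mul 2)
    rw [integral_add hI3 (integrable_const _),
      integral_sub hI1 (hI2.const_mul 2), integral_const_mul,
      integral_inner ((hΨ j hj).integrable one_le_two), real_inner_self_eq_norm_sq]
    simp
    nlinarith [sq_nonneg ‖mj‖]
  have hexp : ∀ ω, ‖∑ j ∈ s, (Ψ j (e j ω) - ∫ t, Ψ j t ∂μ)‖ ^ 2 =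
      ∑ i ∈ s, ∑ j ∈ s, (inner ℝ (Φ i (e i ω)) (Φ j (e j ω)) : ℝ) := fun ω =>
    norm_sq_sum_eq s fun j => Φ j (e j ω)
  simp_rw [hexp]
  refine ⟨integrable_finsetSum _ fun i hi => integrable_finsetSum _ fun j hj =>
    hint i hi j hj, ?_⟩
  rw [integral_finsetSum _ fun i hi => integrable_finsetSum _ fun j hj => hint i hi j hj]
  refine Finset.sum_le_sum fun i hi => ?_
  rw [integral_finsetSum _ fun j hj => hint i hi j hj,
    Finset.sum_eq_single_of_mem i hi fun j hj hji => hoff i hi j hj hji.symm]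
  exact hdiag i hi

end Hilbert

/-- The law of a sequence of independent errors with common law `μ`. -/
noncomputable abbrev errorLaw (μ : Measure ℝ) [IsProbabilityMeasure μ] : Measure (ℕ → ℝ) :=
  Measure.infinitePi fun _ : ℕ => μ

section ErrorLaw

variable {μ : Measure ℝ} [IsProbabilityMeasure μ]

theorem errorLaw_map_eval (j : ℕ) : (errorLaw μ).map (fun e => e j) = μ :=
  Measure.infinitePi_map_eval (fun _ : ℕ => μ) j

theorem measurePreserving_eval_errorLaw (j : ℕ) :
    MeasurePreserving (fun e : ℕ → ℝ => e j) (errorLaw μ) μ :=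
  ⟨measurable_pi_apply j, errorLaw_map_eval j⟩

theorem errorLaw_indepFun (i j : ℕ) (hij : i ≠ j) :
    IndepFun (fun e : ℕ → ℝ => e i) (fun e => e j) (errorLaw μ) :=
  (iIndepFun_infinitePi (P := fun _ : ℕ => μ) (X := fun _ x => x)
    (fun _ => measurable_id)).indepFun hij

theorem measurePreserving_update (k : ℕ) :
    MeasurePreserving (fun p : ℝ × (ℕ → ℝ) => Function.update p.2 k p.1)
      (μ.prod (errorLaw μ)) (errorLaw μ) := by
  have hm : Measurable (fun p : ℝ × (ℕ → ℝ) => Function.update p.2 k p.1) := by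
    refine measurable_pi_lambda _ fun j => ?_
    by_cases h : j = k
    · subst h; simpa using measurable_fst
    · simp only [Function.update_of_ne h]
      fun_prop
  refine ⟨hm, Measure.eq_infinitePi _ fun s t ht => ?_⟩
  rw [Measure.map_apply hm (MeasurableSet.pi s.countable_toSet fun i _ => ht i)]
  by_cases hk : k ∈ s
  · have : (fun p : ℝ × (ℕ → ℝ) => Function.update p.2 k p.1) ⁻¹' (Set.pi s t) =
        t k ×ˢ Set.pi (s.erase k) t := by
      ext p
      simp only [mem_preimage, Set.mem_pi, Finset.mem_coe, mem_prod, Finset.mem_erase]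
      constructor
      · intro h
        refine ⟨by simpa using h k hk, fun i hi => ?_⟩
        simpa [Function.update_of_ne hi.1] using h i hi.2
      · rintro ⟨h1, h2⟩ i hi
        by_cases hik : i = k
        · subst hik; simpa using h1
        · simpa [Function.update_of_ne hik] using h2 i ⟨hik, hi⟩
    rw [this, Measure.prod_prod, Measure.infinitePi_pi _ fun i _ => ht i,
      Finset.mul_prod_erase s (fun i => μ (t i)) hk]
  · have : (fun p : ℝ × (ℕ → ℝ) => Function.update p.2 k p.1) ⁻¹' (Set.pi s t) =
        univ ×ˢ Set.pi s t := by
      ext p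
      simp only [mem_preimage, Set.mem_pi, Finset.mem_coe, mem_prod, mem_univ, true_and]
      refine forall₂_congr fun i hi => ?_
      rw [Function.update_of_ne]
      rintro rfl
      exact hk hi
    rw [this, Measure.prod_prod, Measure.infinitePi_pi _ fun i _ => ht i, measure_univ, one_mul]

theorem integral_errorLaw_update (k : ℕ) {F : (ℕ → ℝ) → ℝ} (hF : Integrable F (errorLaw μ)) :
    ∫ e, F e ∂(errorLaw μ) = ∫ e, ∫ t, F (Function.update e k t) ∂μ ∂(errorLaw μ) := by
  have hmp := measurePreserving_update (μ := μ) k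
  have h1 : Integrable (fun p : ℝ × (ℕ → ℝ) => F (Function.update p.2 k p.1))
      (μ.prod (errorLaw μ)) := hmp.integrable_comp_of_integrable hF
  rw [← integral_prod_symm _ h1]
  conv_lhs => rw [← hmp.map_eq]
  rw [integral_map hmp.measurable.aemeasurable]
  rw [hmp.map_eq]
  exact hF.1

end ErrorLaw

section LeaveOneOut

variable {μ : Measure ℝ} [IsProbabilityMeasure μ] {E : Type*} [NormedAddCommGroup E]
  [InnerProductSpace ℝ E]

/-- The affine form `b j + ∑ i ∈ s, W j i * e i` of the errors. -/
def affineShift (s : Finset ℕ) (b : ℕ → ℝ) (W : ℕ → ℕ → ℝ) (e : ℕ → ℝ) (j : ℕ) : ℝ :=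
  b j + ∑ i ∈ s, W j i * e i

@[fun_prop]
theorem continuous_affineShift (s : Finset ℕ) (b : ℕ → ℝ) (W : ℕ → ℕ → ℝ) (j : ℕ) :
    Continuous fun e => affineShift s b W e j := by
  unfold affineShift
  fun_prop

@[fun_prop]
theorem measurable_affineShift (s : Finset ℕ) (b : ℕ → ℝ) (W : ℕ → ℕ → ℝ) (j : ℕ) :
    Measurable fun e => affineShift s b W e j := by
  unfold affineShift
  fun_prop

theorem affineShift_update_of_eq_zero {s : Finset ℕ} {b : ℕ → ℝ} {W : ℕ → ℕ → ℝ} {j k : ℕ}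
    (h : W j k = 0) (e : ℕ → ℝ) (t : ℝ) :
    affineShift s b W (Function.update e k t) j = affineShift s b W e j := by
  unfold affineShift
  congr 1
  refine Finset.sum_congr rfl fun i _ => ?_
  by_cases hik : i = k
  · subst hik; simp [h]
  · rw [Function.update_of_ne hik]

theorem affineShift_update_erase {s : Finset ℕ} {b : ℕ → ℝ} {W : ℕ → ℕ → ℝ} {j k : ℕ}
    (e : ℕ → ℝ) (t : ℝ) :
    affineShift (s.erase k) b W (Function.update e k t) j = affineShift (s.erase k) b W e j := by
  unfold affineShift
  congr 1
  refine Finset.sum_congr rfl fun i hi => ?_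
  rw [Function.update_of_ne (Finset.ne_of_mem_erase hi)]

theorem memLp_affineShift (h2 : MemLp (fun t : ℝ => t) 2 μ) (s : Finset ℕ) (b : ℕ → ℝ)
    (W : ℕ → ℕ → ℝ) (j : ℕ) : MemLp (fun e => affineShift s b W e j) 2 (errorLaw μ) := by
  have h3 : ∀ i, MemLp (fun e : ℕ → ℝ => e i) 2 (errorLaw μ) := fun i =>
    h2.comp_measurePreserving (measurePreserving_eval_errorLaw i)
  have h4 : MemLp (fun e : ℕ → ℝ => ∑ i ∈ s, W j i * e i) 2 (errorLaw μ) :=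
    memLp_finsetSum s fun i _ => (h3 i).const_mul _
  exact MemLp.add (memLp_const (b j)) h4

theorem integral_sq_affineShift_le (h2 : MemLp (fun t : ℝ => t) 2 μ) (h0 : ∫ t, t ∂μ = 0)
    (s : Finset ℕ) (b : ℕ → ℝ) (W : ℕ → ℕ → ℝ) (j : ℕ) :
    ∫ e, affineShift s b W e j ^ 2 ∂(errorLaw μ) ≤
      2 * b j ^ 2 + 2 * ((∑ i ∈ s, W j i ^ 2) * ∫ t, t ^ 2 ∂μ) := by
  have hA := integral_norm_sq_sum_sub_mean_le (P := errorLaw μ) (μ := μ)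
    (e := fun j (e : ℕ → ℝ) => e j) (fun j => measurable_pi_apply j) errorLaw_map_eval
    errorLaw_indepFun s (Ψ := fun i t => W j i * t) fun i _ => h2.const_mul _
  have hm : ∀ i, ∫ t, W j i * t ∂μ = 0 := fun i => by rw [integral_const_mul, h0, mul_zero]
  simp only [hm, sub_zero, Real.norm_eq_abs, sq_abs, mul_pow] at hA
  simp only [integral_const_mul] at hA
  rw [← Finset.sum_mul] at hA
  calc ∫ e, affineShift s b W e j ^ 2 ∂(errorLaw μ)
      ≤ ∫ e, (2 * b j ^ 2 + 2 * (∑ i ∈ s, W j i * e i) ^ 2) ∂(errorLaw μ) := by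
        refine integral_mono ((memLp_affineShift h2 s b W j).integrable_sq)
          ((integrable_const _).add (hA.1.const_mul 2)) fun e => ?_
        simp only [affineShift]
        nlinarith [sq_nonneg (b j - ∑ i ∈ s, W j i * e i)]
    _ = 2 * b j ^ 2 + 2 * ∫ e, (∑ i ∈ s, W j i * e i) ^ 2 ∂(errorLaw μ) := by
        rw [integral_add (integrable_const _) (hA.1.const_mul 2)]
        simp [integral_const_mul]
    _ ≤ _ := by linarith [hA.2]

variable {φ : ℝ → ℝ → ℝ}

/-- A function of the `k`-th error and of a quantity free of that error is orthogonal to all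
variables free of the `k`-th error, if it is centred in the `k`-th error. -/
theorem integral_mul_centred_eq_zero (hφ0 : ∀ D, ∫ t, φ t D ∂μ = 0) (k : ℕ)
    {G B : (ℕ → ℝ) → ℝ} (hG : ∀ e t, G (Function.update e k t) = G e)
    (hB : ∀ e t, B (Function.update e k t) = B e)
    (hint : Integrable (fun e => G e * φ (e k) (B e)) (errorLaw μ)) :
    ∫ e, G e * φ (e k) (B e) ∂(errorLaw μ) = 0 := by
  rw [integral_errorLaw_update k hint]
  simp only [hG, hB, Function.update_self, integral_const_mul, hφ0, mul_zero, integral_zero]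

/-- The leave-two-out bound: in a sum of centred functions of the errors, each perturbed by an
affine form of the other errors, the correlations between the summands are controlled by the
product of the two mutual influences. -/
theorem integral_norm_sq_sum_centred_le (h2 : MemLp (fun t : ℝ => t) 2 μ)
    (hφm : Measurable fun p : ℝ × ℝ => φ p.1 p.2)
    (hφ0 : ∀ D, ∫ t, φ t D ∂μ = 0) {Λ : ℝ} (hΛ : ∀ t D D', |φ t D - φ t D'| ≤ Λ * |D - D'|)
    (hφ2 : MemLp (fun t => φ t 0) 2 μ) {A B : ℝ}
    (hAB : ∀ D, ∫ t, φ t D ^ 2 ∂μ ≤ A + B * D ^ 2)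
    (s : Finset ℕ) (b : ℕ → ℝ) (W : ℕ → ℕ → ℝ) (hW : ∀ j, W j j = 0) (u : ℕ → E) :
    Integrable (fun e => ‖∑ j ∈ s, φ (e j) (affineShift s b W e j) • u j‖ ^ 2) (errorLaw μ) ∧
    ∫ e, ‖∑ j ∈ s, φ (e j) (affineShift s b W e j) • u j‖ ^ 2 ∂(errorLaw μ) ≤
      ∑ j ∈ s, ‖u j‖ ^ 2 * (A + B * ∫ e, affineShift s b W e j ^ 2 ∂(errorLaw μ)) +
      Λ ^ 2 * (∫ t, t ^ 2 ∂μ) *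
        ∑ j ∈ s, ∑ k ∈ s, ‖u j‖ * ‖u k‖ * (|W j k| * |W k j|) := by
  set P := errorLaw μ
  have hΛ0 : 0 ≤ Λ := by
    have h := hΛ 0 1 0
    have h' := abs_nonneg (φ 0 1 - φ 0 0)
    simp only [sub_zero, abs_one, mul_one] at h
    exact h'.trans h
  have hmem : ∀ (D : (ℕ → ℝ) → ℝ) (j : ℕ), Measurable D → MemLp D 2 P →
      MemLp (fun e => φ (e j) (D e)) 2 P := by
    intro D j hD hD2
    have h1 : MemLp (fun e : ℕ → ℝ => |φ (e j) 0| + Λ * |D e|) 2 P :=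
      ((hφ2.comp_measurePreserving (measurePreserving_eval_errorLaw j)).abs).add
        (hD2.abs.const_mul Λ)
    refine h1.mono' (hφm.comp ((measurable_pi_apply j).prodMk hD)).aestronglyMeasurable
      (Eventually.of_forall fun e => ?_)
    have := hΛ (e j) (D e) 0
    rw [sub_zero] at this
    have h3 := abs_sub_abs_le_abs_sub (φ (e j) (D e)) (φ (e j) 0)
    rw [Real.norm_eq_abs]
    linarith
  set D : ℕ → (ℕ → ℝ) → ℝ := fun j e => affineShift s b W e j with hDdef
  set D' : ℕ → ℕ → (ℕ → ℝ) → ℝ := fun j k e => affineShift (s.erase k) b W e j with hD'def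
  set ζ : ℕ → (ℕ → ℝ) → ℝ := fun j e => φ (e j) (D j e) with hζ
  set ζ' : ℕ → ℕ → (ℕ → ℝ) → ℝ := fun j k e => φ (e j) (D' j k e) with hζ'
  have hζm : ∀ j, MemLp (ζ j) 2 P := fun j =>
    hmem _ j (measurable_affineShift s b W j) (memLp_affineShift h2 s b W j)
  have hζ'm : ∀ j k, MemLp (ζ' j k) 2 P := fun j k =>
    hmem _ j (measurable_affineShift _ b W j) (memLp_affineShift h2 _ b W j)
  have hprod : ∀ {X Y : (ℕ → ℝ) → ℝ}, MemLp X 2 P → MemLp Y 2 P →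
      Integrable (fun e => X e * Y e) P := fun hX hY => MemLp.integrable_mul hX hY
  have hid : ∀ j, MemLp (fun e : ℕ → ℝ => e j) 2 P := fun j =>
    h2.comp_measurePreserving (measurePreserving_eval_errorLaw j)
  have hid2 : ∀ j, ∫ e, e j ^ 2 ∂P = ∫ t, t ^ 2 ∂μ := by
    intro j
    rw [← errorLaw_map_eval (μ := μ) j, integral_map (measurable_pi_apply j).aemeasurable
      (by fun_prop)]
  -- For `j ≠ k` nothing changes if the influence of `k` on the `j`-th summand and that of `j` on
  -- the `k`-th are removed from both, so the covariance is that of two differences of order `W`.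
  have hoff : ∀ j ∈ s, ∀ k ∈ s, j ≠ k →
      |∫ e, ζ j e * ζ k e ∂P| ≤ Λ ^ 2 * (∫ t, t ^ 2 ∂μ) * (|W j k| * |W k j|) := by
    intro j hj k hk hjk
    have hinv : ∀ j k, j ≠ k → ∀ e t, ζ' j k (Function.update e k t) = ζ' j k e := by
      intro j k hjk e t
      simp only [hζ', hD'def, affineShift_update_erase, Function.update_of_ne hjk]
    have hinvD : ∀ k e t, D k (Function.update e k t) = D k e := fun k e t =>
      affineShift_update_of_eq_zero (hW k) e t
    have hinvD' : ∀ k j e t, D' k j (Function.update e k t) = D' k j e := fun k j e t =>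
      affineShift_update_of_eq_zero (hW k) e t
    have o1 : ∫ e, ζ' j k e * ζ k e ∂P = 0 :=
      integral_mul_centred_eq_zero hφ0 k (hinv j k hjk) (hinvD k) (hprod (hζ'm j k) (hζm k))
    have o2 : ∫ e, ζ' k j e * ζ j e ∂P = 0 :=
      integral_mul_centred_eq_zero hφ0 j (hinv k j hjk.symm) (hinvD j)
        (hprod (hζ'm k j) (hζm j))
    have o3 : ∫ e, ζ' j k e * ζ' k j e ∂P = 0 :=
      integral_mul_centred_eq_zero hφ0 k (hinv j k hjk) (hinvD' k j)
        (hprod (hζ'm j k) (hζ'm k j))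
    have hdec : ∫ e, ζ j e * ζ k e ∂P =
        ∫ e, (ζ j e - ζ' j k e) * (ζ k e - ζ' k j e) ∂P := by
      have : ∀ e, (ζ j e - ζ' j k e) * (ζ k e - ζ' k j e) =
          ζ j e * ζ k e - ζ' j k e * ζ k e - ζ' k j e * ζ j e + ζ' j k e * ζ' k j e := by
        intro e; ring
      simp_rw [this]
      have i1 := hprod (hζm j) (hζm k)
      have i2 := hprod (hζ'm j k) (hζm k)
      have i3 := hprod (hζ'm k j) (hζm j)
      have i4 := hprod (hζ'm j k) (hζ'm k j)
      have i12 : Integrable (fun e => ζ j e * ζ k e - ζ' j k e * ζ k e) P := i1.sub i2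
      have i123 : Integrable
        (fun e => ζ j e * ζ k e - ζ' j k e * ζ k e - ζ' k j e * ζ j e) P := i12.sub i3
      rw [integral_add i123 i4, integral_sub i12 i3, integral_sub i1 i2, o1, o2, o3]
      ring
    have hdiff : ∀ j k e, k ∈ s → |ζ j e - ζ' j k e| ≤ Λ * |W j k| * |e k| := by
      intro j k e hk
      refine (hΛ _ _ _).trans (le_of_eq ?_)
      have : D j e - D' j k e = W j k * e k := by
        simp only [hDdef, hD'def, affineShift]
        rw [← Finset.add_sum_erase s _ hk]
        ring
      rw [this, abs_mul, mul_assoc]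
    rw [hdec]
    have hb : ∀ e, ‖(ζ j e - ζ' j k e) * (ζ k e - ζ' k j e)‖ ≤
        Λ ^ 2 * (|W j k| * |W k j|) * ((e j ^ 2 + e k ^ 2) / 2) := by
      intro e
      rw [Real.norm_eq_abs, abs_mul]
      calc _ ≤ (Λ * |W j k| * |e k|) * (Λ * |W k j| * |e j|) :=
            mul_le_mul (hdiff j k e hk) (hdiff k j e hj) (abs_nonneg _) (by positivity)
        _ = Λ ^ 2 * (|W j k| * |W k j|) * (|e k| * |e j|) := by ring
        _ ≤ _ := by
            gcongr
            nlinarith [sq_nonneg (|e k| - |e j|), sq_abs (e k), sq_abs (e j)]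
    have hI : Integrable (fun e : ℕ → ℝ => (e j ^ 2 + e k ^ 2) / 2) P :=
      ((hid j).integrable_sq.add (hid k).integrable_sq).div_const 2
    refine (norm_integral_le_of_norm_le (hI.const_mul _) (Eventually.of_forall hb)).trans
      (le_of_eq ?_)
    rw [integral_const_mul, integral_div, integral_add (hid j).integrable_sq
      (hid k).integrable_sq, hid2, hid2]
    ring
  have hdiag : ∀ j, ∫ e, ζ j e * ζ j e ∂P ≤ A + B * ∫ e, D j e ^ 2 ∂P := by
    intro j
    have h1 : ∀ e, ζ j e * ζ j e = ζ j e ^ 2 := fun e => (sq _).symm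
    simp_rw [h1]
    have hsq := (hζm j).integrable_sq
    rw [integral_errorLaw_update j hsq]
    have h3 : ∀ e, ∫ t, ζ j (Function.update e j t) ^ 2 ∂μ ≤ A + B * D j e ^ 2 := by
      intro e
      simp only [hζ, Function.update_self, hDdef, affineShift_update_of_eq_zero (hW j)]
      exact hAB _
    have hD2 := (memLp_affineShift (μ := μ) h2 s b W j).integrable_sq
    have hI : Integrable (fun e => A + B * D j e ^ 2) P :=
      (integrable_const A).add (hD2.const_mul B)
    refine (integral_mono_of_nonneg (Eventually.of_forall fun e =>
      integral_nonneg fun t => sq_nonneg _) hI (Eventually.of_forall h3)).trans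
      (le_of_eq ?_)
    rw [integral_add (integrable_const A) (hD2.const_mul B)]
    simp [P, hDdef, integral_const_mul]
  have hexp : ∀ e, ‖∑ j ∈ s, φ (e j) (affineShift s b W e j) • u j‖ ^ 2 =
      ∑ j ∈ s, ∑ k ∈ s, ζ j e * ζ k e * inner ℝ (u j) (u k) := by
    intro e
    rw [norm_sq_sum_eq]
    refine Finset.sum_congr rfl fun j _ => Finset.sum_congr rfl fun k _ => ?_
    rw [real_inner_smul_left, real_inner_smul_right, mul_assoc]
  have hint : ∀ j k, Integrable (fun e => ζ j e * ζ k e * inner ℝ (u j) (u k)) P := fun j k =>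
    (hprod (hζm j) (hζm k)).mul_const _
  simp_rw [hexp]
  refine ⟨integrable_finsetSum _ fun j _ => integrable_finsetSum _ fun k _ => hint j k, ?_⟩
  rw [integral_finsetSum _ fun j _ => integrable_finsetSum _ fun k _ => hint j k]
  rw [Finset.mul_sum, ← Finset.sum_add_distrib]
  refine Finset.sum_le_sum fun j hj => ?_
  rw [integral_finsetSum _ fun k _ => hint j k, ← Finset.add_sum_erase s _ hj]
  refine add_le_add ?_ ?_
  · rw [integral_mul_const, real_inner_self_eq_norm_sq, mul_comm]
    exact mul_le_mul_of_nonneg_left (hdiag j) (sq_nonneg _)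
  · rw [Finset.mul_sum]
    refine (Finset.sum_le_sum (g := fun k => Λ ^ 2 * (∫ t, t ^ 2 ∂μ) *
      (‖u j‖ * ‖u k‖ * (|W j k| * |W k j|))) fun k hk => ?_).trans
      (Finset.sum_le_sum_of_subset_of_nonneg (Finset.erase_subset j s) fun k _ _ => ?_)
    · rw [integral_mul_const]
      refine (le_abs_self _).trans ?_
      rw [abs_mul]
      calc _ ≤ (Λ ^ 2 * (∫ t, t ^ 2 ∂μ) * (|W j k| * |W k j|)) * (‖u j‖ * ‖u k‖) :=
            mul_le_mul (hoff j hj k (Finset.mem_of_mem_erase hk)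
              (Finset.ne_of_mem_erase hk).symm) (abs_real_inner_le_norm _ _) (abs_nonneg _)
              (by have := integral_nonneg (μ := μ) (f := fun t : ℝ => t ^ 2)
                    fun t => sq_nonneg t
                  positivity)
        _ = _ := by ring
    · have := integral_nonneg (μ := μ) (f := fun t : ℝ => t ^ 2) fun t => sq_nonneg t
      positivity

end LeaveOneOut

/-! ### Step functions in `L²` and shifted primitives -/

/-- The Hilbert space of square integrable functions on the line. -/
abbrev L2Line : Type := Lp ℝ 2 (volume : Measure ℝ)

theorem norm_toLp_sq {h : ℝ → ℝ} (hh : MemLp h 2) : ‖hh.toLp h‖ ^ 2 = ∫ z, h z ^ 2 := by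
  rw [← real_inner_self_eq_norm_sq, L2.inner_def]
  refine integral_congr_ae ?_
  filter_upwards [hh.coeFn_toLp] with z hz
  simp [hz, sq]

theorem inner_toLp {h k : ℝ → ℝ} (hh : MemLp h 2) (hk : MemLp k 2) :
    (inner ℝ (hh.toLp h) (hk.toLp k) : ℝ) = ∫ z, h z * k z := by
  rw [L2.inner_def]
  refine integral_congr_ae ?_
  filter_upwards [hh.coeFn_toLp, hk.coeFn_toLp] with z hz hz'
  simp [hz, hz', mul_comm]

/-- The step function that jumps at `ρ`, normalized to be of compact support. -/
noncomputable def stepFun (ρ s : ℝ) : ℝ := (Ici ρ).indicator 1 s - (Ici (0 : ℝ)).indicator 1 s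

theorem measurable_stepFun (ρ : ℝ) : Measurable (stepFun ρ) :=
  (measurable_one.indicator measurableSet_Ici).sub (measurable_one.indicator measurableSet_Ici)

theorem stepFun_sub_sq (ρ ρ' s : ℝ) : (stepFun ρ s - stepFun ρ' s) ^ 2 =
    (Ico (min ρ ρ') (max ρ ρ')).indicator 1 s := by
  simp only [stepFun, indicator, mem_Ici, mem_Ico, min_le_iff, lt_max_iff, Pi.one_apply]
  by_cases h1 : ρ ≤ s <;> by_cases h2 : ρ' ≤ s <;> by_cases h3 : 0 ≤ s <;>
    simp [h1, h2, h3, not_lt.2, not_le.1]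

theorem integral_stepFun_sub_sq (ρ ρ' : ℝ) :
    ∫ s, (stepFun ρ s - stepFun ρ' s) ^ 2 = |ρ - ρ'| := by
  simp_rw [stepFun_sub_sq]
  rw [integral_indicator_one measurableSet_Ico, Measure.real, Real.volume_Ico,
    max_sub_min_eq_abs, ENNReal.toReal_ofReal (abs_nonneg _), abs_sub_comm]

theorem stepFun_zero (s : ℝ) : stepFun 0 s = 0 := by simp [stepFun]

theorem memLp_stepFun (ρ : ℝ) : MemLp (stepFun ρ) 2 := by
  rw [memLp_two_iff_integrable_sq (measurable_stepFun ρ).aestronglyMeasurable]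
  have : ∀ s, stepFun ρ s ^ 2 = (Ico (min ρ 0) (max ρ 0)).indicator 1 s := by
    intro s
    rw [← stepFun_sub_sq, stepFun_zero, sub_zero]
  simp_rw [this]
  exact (integrable_indicator_iff measurableSet_Ico).2
    (integrableOn_const (by simp [Real.volume_Ico]))

/-- The step function `stepFun ρ` as an element of `L²`. -/
noncomputable def stepL2 (ρ : ℝ) : L2Line := (memLp_stepFun ρ).toLp

theorem norm_stepL2_sub_sq (ρ ρ' : ℝ) : ‖stepL2 ρ - stepL2 ρ'‖ ^ 2 = |ρ - ρ'| := by
  rw [stepL2, stepL2, ← MemLp.toLp_sub, norm_toLp_sq, ← integral_stepFun_sub_sq]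
  rfl

theorem stepL2_zero : stepL2 0 = 0 := by
  have h : ‖stepL2 0‖ ^ 2 = 0 := by
    rw [stepL2, norm_toLp_sq]
    simp [stepFun_zero]
  simpa using h

theorem norm_stepL2_sq (ρ : ℝ) : ‖stepL2 ρ‖ ^ 2 = |ρ| := by
  have := norm_stepL2_sub_sq ρ 0
  rwa [stepL2_zero, sub_zero, sub_zero] at this

@[fun_prop]
theorem continuous_stepL2 : Continuous stepL2 := by
  rw [continuous_iff_continuousAt]
  intro ρ
  rw [ContinuousAt, tendsto_iff_norm_sub_tendsto_zero]
  have h : ∀ x, ‖stepL2 x - stepL2 ρ‖ = Real.sqrt |x - ρ| := fun x => by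
    rw [← norm_stepL2_sub_sq, Real.sqrt_sq (norm_nonneg _)]
  simp_rw [h]
  have : Continuous fun x : ℝ => Real.sqrt |x - ρ| := by fun_prop
  simpa using this.tendsto ρ

theorem memLp_comp_sub_left {h : ℝ → ℝ} (hh : MemLp h 2) (y : ℝ) :
    MemLp (fun s => h (y - s)) 2 :=
  hh.comp_measurePreserving (Measure.measurePreserving_sub_left volume y)

/-- The increments of a primitive are inner products with step functions. -/
theorem inner_reflect_stepL2 {b b' : ℝ → ℝ} (hb2 : MemLp b' 2) (hb1 : Integrable b')
    (hb : ∀ z, b z = ∫ x in Iic z, b' x) (y ρ : ℝ) :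
    (inner ℝ ((memLp_comp_sub_left hb2 y).toLp) (stepL2 ρ) : ℝ) = b (y - ρ) - b y := by
  rw [stepL2, inner_toLp]
  have h1 : ∀ ρ, b (y - ρ) = ∫ s, b' (y - s) * (Ici ρ).indicator 1 s := by
    intro ρ
    rw [hb, ← integral_indicator measurableSet_Iic,
      ← integral_sub_left_eq_self _ volume y]
    refine integral_congr_ae (Eventually.of_forall fun s => ?_)
    simp only [indicator, mem_Iic, mem_Ici, Pi.one_apply, sub_le_sub_iff_left]
    split_ifs <;> simp
  have h2 : ∀ ρ, Integrable fun s => b' (y - s) * (Ici ρ).indicator 1 s := by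
    intro ρ
    have h3 : Integrable fun s => b' (y - s) := hb1.comp_sub_left y
    refine (h3.indicator (measurableSet_Ici (a := ρ))).congr (Eventually.of_forall fun s => ?_)
    simp only [indicator, Pi.one_apply]
    split_ifs <;> simp
  have h0 := h1 0
  rw [sub_zero] at h0
  rw [h1 ρ, h0, ← integral_sub (h2 ρ) (h2 0)]
  refine integral_congr_ae (Eventually.of_forall fun s => ?_)
  simp only [stepFun]
  ring

theorem norm_toLp_reflect {h : ℝ → ℝ} (hh : MemLp h 2) (y : ℝ) :
    ‖(memLp_comp_sub_left hh y).toLp‖ = ‖hh.toLp‖ := by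
  rw [Lp.norm_toLp, Lp.norm_toLp]
  congr 1
  exact eLpNorm_comp_measurePreserving (g := h) hh.1
    (Measure.measurePreserving_sub_left volume y)

/-- A contrast of shifts of a primitive is bounded, uniformly in the argument, by the `L²` norm of
the derivative and the `L²` norm of the same contrast of step functions. -/
theorem abs_sum_shift_le {b b' : ℝ → ℝ} (hb2 : MemLp b' 2) (hb1 : Integrable b')
    (hb : ∀ z, b z = ∫ x in Iic z, b' x) (s : Finset ℕ) {c : ℕ → ℝ} (hc : ∑ j ∈ s, c j = 0)
    (ρ : ℕ → ℝ) (y : ℝ) :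
    |∑ j ∈ s, c j * b (y - ρ j)| ≤ ‖hb2.toLp‖ * ‖∑ j ∈ s, c j • stepL2 (ρ j)‖ := by
  have h : ∑ j ∈ s, c j * b (y - ρ j) =
      inner ℝ ((memLp_comp_sub_left hb2 y).toLp) (∑ j ∈ s, c j • stepL2 (ρ j)) := by
    rw [inner_sum]
    simp_rw [real_inner_smul_right, inner_reflect_stepL2 hb2 hb1 hb, mul_sub]
    rw [Finset.sum_sub_distrib, ← Finset.sum_mul, hc]
    ring
  rw [h, ← norm_toLp_reflect hb2 y]
  exact abs_real_inner_le_norm _ _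

/-! ### Convolution with a probability measure -/

/-- The convolution of `h` with the measure `ν`. -/
noncomputable def convMeasure (ν : Measure ℝ) (h : ℝ → ℝ) (z : ℝ) : ℝ := ∫ s, h (z - s) ∂ν

section Conv

variable {ν : Measure ℝ} [IsProbabilityMeasure ν] {h : ℝ → ℝ}

theorem lintegral_lintegral_comp_sub {g : ℝ → ℝ≥0∞} (hg : Measurable g) :
    ∫⁻ z, ∫⁻ s, g (z - s) ∂ν = ∫⁻ z, g z := by
  rw [lintegral_lintegral_swap (by fun_prop)]
  simp_rw [lintegral_sub_right_eq_self]
  simp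

theorem ae_integrable_comp_sub (hm : Measurable h) (hi : Integrable h) :
    ∀ᵐ z, Integrable (fun s => h (z - s)) ν := by
  have h1 : ∫⁻ z, ∫⁻ s, ‖h (z - s)‖ₑ ∂ν ≠ ∞ := by
    rw [lintegral_lintegral_comp_sub (g := fun z => ‖h z‖ₑ) (by fun_prop)]
    exact hi.2.ne
  have hm2 : Measurable fun z => ∫⁻ s, ‖h (z - s)‖ₑ ∂ν := by
    refine Measurable.lintegral_prod_right' (f := fun p : ℝ × ℝ => ‖h (p.1 - p.2)‖ₑ) ?_
    fun_prop
  filter_upwards [ae_lt_top hm2 h1] with z hz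
  exact ⟨(by fun_prop : Measurable fun s => h (z - s)).aestronglyMeasurable, hz⟩

theorem measurable_convMeasure (hm : Measurable h) : Measurable (convMeasure ν h) := by
  have : StronglyMeasurable fun p : ℝ × ℝ => h (p.1 - p.2) := by
    have : Measurable fun p : ℝ × ℝ => h (p.1 - p.2) := by fun_prop
    exact this.stronglyMeasurable
  exact this.integral_prod_right.measurable

theorem enorm_integral_rpow_le {α : Type*} [MeasurableSpace α] {ν : Measure α}
    [IsProbabilityMeasure ν] {g : α → ℝ} (hg : AEStronglyMeasurable g ν) {p : ℝ} (hp : 1 ≤ p) :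
    ‖∫ s, g s ∂ν‖ₑ ^ p ≤ ∫⁻ s, ‖g s‖ₑ ^ p ∂ν := by
  have h1 := eLpNorm'_le_eLpNorm'_of_exponent_le one_pos hp ν hg
  simp only [eLpNorm', ENNReal.rpow_one, div_one] at h1
  have hp0 : 0 < p := by linarith
  have h2 := ENNReal.rpow_le_rpow ((enorm_integral_le_lintegral_enorm g).trans h1) hp0.le
  rwa [← ENNReal.rpow_mul, one_div_mul_cancel hp0.ne', ENNReal.rpow_one] at h2

/-- Jensen's inequality and Fubini's theorem: the distance in `Lᵖ` of a convolution from the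
function is an average of the distances of the translates. -/
theorem lintegral_convMeasure_sub_le (hm : Measurable h) (hi : Integrable h) {p : ℝ}
    (hp : 1 ≤ p) :
    ∫⁻ z, ‖convMeasure ν h z - h z‖ₑ ^ p ≤
      ∫⁻ s, ∫⁻ z, ‖h (z - s) - h z‖ₑ ^ p ∂volume ∂ν := by
  have hm2 : Measurable fun q : ℝ × ℝ => ‖h (q.2 - q.1) - h q.2‖ₑ ^ p := by fun_prop
  rw [lintegral_lintegral_swap hm2.aemeasurable]
  refine lintegral_mono_ae ?_
  filter_upwards [ae_integrable_comp_sub (ν := ν) hm hi] with z hz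
  have : convMeasure ν h z - h z = ∫ s, (h (z - s) - h z) ∂ν := by
    rw [integral_sub hz (integrable_const _)]
    simp [convMeasure]
  rw [this]
  exact enorm_integral_rpow_le
    (by fun_prop : Measurable fun s => h (z - s) - h z).aestronglyMeasurable hp

theorem eLpNorm_comp_sub_eq {p : ℝ≥0∞} (hm : Measurable h) (s : ℝ) :
    eLpNorm (fun z => h (z - s)) p volume = eLpNorm h p volume :=
  eLpNorm_comp_measurePreserving (g := h) hm.aestronglyMeasurable
    (measurePreserving_sub_right volume s)

/-- Translation is continuous in `Lᵖ`, at zero. -/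
theorem tendsto_eLpNorm_translate {p : ℝ≥0∞} [Fact (1 ≤ p)] (hp : p ≠ ∞)
    (hi : MemLp h p) :
    Tendsto (fun s => eLpNorm (fun z => h (z - s) - h z) p volume) (𝓝 0) (𝓝 0) := by
  have hmp : ∀ s : ℝ, MeasurePreserving (fun z : ℝ => z - s) volume volume := fun s =>
    measurePreserving_sub_right volume s
  let F : ℝ → C(ℝ, ℝ) := fun s => ⟨fun z => z - s, by fun_prop⟩
  have hF : Continuous F := by
    refine ContinuousMap.continuous_of_continuous_uncurry F ?_
    simp only [Function.uncurry_def, F, ContinuousMap.coe_mk]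
    fun_prop
  have hc : Continuous fun s => Lp.compMeasurePreserving (F s) (hmp s) (hi.toLp h) :=
    Continuous.compMeasurePreservingLp (continuous_const (y := hi.toLp h)) hF hmp hp
  have h0 : Lp.compMeasurePreserving (F 0) (hmp 0) (hi.toLp h) = hi.toLp h := by
    rw [Lp.toLp_compMeasurePreserving]
    refine MemLp.toLp_congr _ _ (Eventually.of_forall fun z => ?_)
    simp [F]
  have ht := tendsto_iff_edist_tendsto_0.1 (hc.tendsto 0)
  rw [h0] at ht
  refine ht.congr fun s => ?_
  rw [Lp.toLp_compMeasurePreserving, Lp.edist_toLp_toLp]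
  rfl

/-- The law with density `κ`, scaled by `a`. -/
noncomputable def scaledLaw (κ : ℝ → ℝ) (a : ℝ) : Measure ℝ :=
  (volume.withDensity fun u => ENNReal.ofReal (κ u)).map (a * ·)

/-- Convolution with the scaled law is an approximate identity in `Lᵖ`. -/
theorem tendsto_lintegral_convMeasure_sub {κ : ℝ → ℝ}
    [IsProbabilityMeasure (volume.withDensity fun u => ENNReal.ofReal (κ u))]
    (hm : Measurable h) (hi : Integrable h) {p : ℝ} (hp : 1 ≤ p) (hip : MemLp h (ENNReal.ofReal p))
    {ι : Type*} {l : Filter ι} {a : ι → ℝ} (ha : Tendsto a l (𝓝 0)) :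
    Tendsto (fun i => ∫⁻ z, ‖convMeasure (scaledLaw κ (a i)) h z - h z‖ₑ ^ p) l (𝓝 0) := by
  set ν := volume.withDensity fun u => ENNReal.ofReal (κ u)
  have hp0 : 0 < p := by linarith
  have hprob : ∀ a, IsProbabilityMeasure (scaledLaw κ a) := fun a =>
    Measure.isProbabilityMeasure_map (by fun_prop)
  set G : ℝ → ℝ≥0∞ := fun s => ∫⁻ z, ‖h (z - s) - h z‖ₑ ^ p with hG
  have hGm : Measurable G := by
    refine Measurable.lintegral_prod_right' (f := fun q : ℝ × ℝ => ‖h (q.2 - q.1) - h q.2‖ₑ ^ p) ?_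
    fun_prop
  have hpne : ENNReal.ofReal p ≠ 0 := (ENNReal.ofReal_pos.2 hp0).ne'
  have hGe : ∀ s, G s = eLpNorm (fun z => h (z - s) - h z) (ENNReal.ofReal p) volume ^ p := by
    intro s
    rw [eLpNorm_eq_lintegral_rpow_enorm_toReal hpne ENNReal.ofReal_ne_top,
      ENNReal.toReal_ofReal hp0.le, ← ENNReal.rpow_mul, one_div_mul_cancel hp0.ne',
      ENNReal.rpow_one]
  have : Fact (1 ≤ ENNReal.ofReal p) := ⟨by
    rw [← ENNReal.ofReal_one]; exact ENNReal.ofReal_le_ofReal hp⟩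
  have hG0 : Tendsto G (𝓝 0) (𝓝 0) := by
    have h1 := (tendsto_eLpNorm_translate ENNReal.ofReal_ne_top hip).ennrpow_const p
    rw [ENNReal.zero_rpow_of_pos hp0] at h1
    exact h1.congr fun s => (hGe s).symm
  have hGb : ∀ s, G s ≤ (2 * eLpNorm h (ENNReal.ofReal p) volume) ^ p := by
    intro s
    rw [hGe]
    refine ENNReal.rpow_le_rpow ?_ hp0.le
    refine (eLpNorm_sub_le (by fun_prop : Measurable fun z => h (z - s)).aestronglyMeasurable
      hm.aestronglyMeasurable (Fact.out : 1 ≤ ENNReal.ofReal p)).trans ?_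
    rw [eLpNorm_comp_sub_eq hm, two_mul]
  have hlim : Tendsto (fun a : ℝ => ∫⁻ u, G (a * u) ∂ν) (𝓝 0) (𝓝 0) := by
    have := tendsto_lintegral_filter_of_dominated_convergence (μ := ν) (l := 𝓝 (0:ℝ))
      (F := fun a u => G (a * u)) (f := fun _ => 0)
      (fun _ => (2 * eLpNorm h (ENNReal.ofReal p) volume) ^ p)
      (Eventually.of_forall fun a => by fun_prop)
      (Eventually.of_forall fun a => Eventually.of_forall fun u => hGb _)
      (by
        simp only [lintegral_const, measure_univ, mul_one]
        exact ENNReal.rpow_ne_top_of_nonneg hp0.le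
          (ENNReal.mul_ne_top ENNReal.ofNat_ne_top hip.2.ne))
      (Eventually.of_forall fun u => by
        refine hG0.comp ?_
        have : Continuous fun a : ℝ => a * u := by fun_prop
        simpa using this.tendsto 0)
    simpa using this
  refine tendsto_of_tendsto_of_tendsto_of_le_of_le tendsto_const_nhds (hlim.comp ha)
    (fun _ => zero_le) fun i => ?_
  refine (lintegral_convMeasure_sub_le hm hi hp).trans (le_of_eq ?_)
  rw [Function.comp_apply, scaledLaw, lintegral_map hGm (by fun_prop)]

end Conv

/-! ### Shifts and primitives -/

theorem sub_eq_integral_unit {k k' : ℝ → ℝ} (hk : ∀ z, HasDerivAt k (k' z) z)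
    (hc : Continuous k') (z t : ℝ) :
    k (z + t) - k z = ∫ θ in Ioc (0 : ℝ) 1, t * k' (z + θ * t) := by
  have h1 : ∀ θ ∈ uIcc (0 : ℝ) 1, HasDerivAt (fun θ => k (z + θ * t)) (t * k' (z + θ * t)) θ := by
    intro θ _
    have h2 : HasDerivAt (fun θ : ℝ => z + θ * t) t θ := by
      simpa using ((hasDerivAt_id θ).mul_const t).const_add z
    have := (hk (z + θ * t)).comp θ h2
    rwa [mul_comm] at this
  have h3 := intervalIntegral.integral_eq_sub_of_hasDerivAt h1
    (Continuous.intervalIntegrable (by fun_prop) _ _)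
  rw [intervalIntegral.integral_of_le zero_le_one] at h3
  rw [h3]
  simp

instance : IsProbabilityMeasure (volume.restrict (Ioc (0 : ℝ) 1)) :=
  ⟨by simp [Real.volume_Ioc]⟩

theorem lintegral_shift_sub_sq_le {k k' : ℝ → ℝ} (hk : ∀ z, HasDerivAt k (k' z) z)
    (hc : Continuous k') (t : ℝ) :
    ∫⁻ z, ‖k (z + t) - k z‖ₑ ^ (2 : ℝ) ≤ ‖t‖ₑ ^ (2 : ℝ) * ∫⁻ z, ‖k' z‖ₑ ^ (2 : ℝ) := by
  have hcm := hc.measurable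
  calc ∫⁻ z, ‖k (z + t) - k z‖ₑ ^ (2 : ℝ)
      ≤ ∫⁻ z, ∫⁻ θ in Ioc (0 : ℝ) 1, ‖t * k' (z + θ * t)‖ₑ ^ (2 : ℝ) := by
        refine lintegral_mono fun z => ?_
        rw [sub_eq_integral_unit hk hc]
        exact enorm_integral_rpow_le (by fun_prop) one_le_two
    _ = ∫⁻ θ in Ioc (0 : ℝ) 1, ∫⁻ z, ‖t * k' (z + θ * t)‖ₑ ^ (2 : ℝ) := by
        rw [lintegral_lintegral_swap]
        exact (by fun_prop : Measurable fun p : ℝ × ℝ =>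
          ‖t * k' (p.1 + p.2 * t)‖ₑ ^ (2 : ℝ)).aemeasurable
    _ = ∫⁻ θ in Ioc (0 : ℝ) 1, ‖t‖ₑ ^ (2 : ℝ) * ∫⁻ z, ‖k' z‖ₑ ^ (2 : ℝ) := by
        refine lintegral_congr fun θ => ?_
        simp_rw [enorm_mul, ENNReal.mul_rpow_of_nonneg _ _ zero_le_two]
        rw [lintegral_const_mul _ (by fun_prop)]
        congr 1
        exact lintegral_add_right_eq_self (fun z => ‖k' z‖ₑ ^ (2 : ℝ)) (θ * t)
    _ = _ := by simp

theorem sub_eq_integral_uIoc_le {F g : ℝ → ℝ} (hg : Integrable g)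
    (hF : ∀ z, F z = ∫ x in Iic z, g x) (z s : ℝ) :
    ‖F (z + s) - F z‖ₑ ≤ ∫⁻ x, (uIoc z (z + s)).indicator (fun x => ‖g x‖ₑ) x := by
  have h1 : F (z + s) - F z = ∫ x in z..(z + s), g x := by
    rw [hF, hF, intervalIntegral.integral_Iic_sub_Iic hg.integrableOn hg.integrableOn]
  rw [h1, lintegral_indicator measurableSet_uIoc, ← enorm_norm,
    intervalIntegral.norm_intervalIntegral_eq, enorm_norm]
  exact enorm_integral_le_lintegral_enorm _

/-- Translation of a primitive moves it, in `L¹`, by at most the shift times the `L¹` norm of the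
derivative. -/
theorem lintegral_shift_sub_le {F g : ℝ → ℝ} (hgm : Measurable g) (hg : Integrable g)
    (hF : ∀ z, F z = ∫ x in Iic z, g x) (s : ℝ) :
    ∫⁻ z, ‖F (z + s) - F z‖ₑ ≤ ‖s‖ₑ * ∫⁻ z, ‖g z‖ₑ := by
  have hind : ∀ z x, (uIoc z (z + s)).indicator (fun x => ‖g x‖ₑ) x =
      ‖g x‖ₑ * (uIoc 0 s).indicator 1 (x - z) := by
    intro z x
    have h : x ∈ uIoc z (z + s) ↔ x - z ∈ uIoc 0 s := by
      simp only [mem_uIoc]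
      constructor
      · rintro (h | h)
        · left; constructor <;> linarith
        · right; constructor <;> linarith
      · rintro (h | h)
        · left; constructor <;> linarith
        · right; constructor <;> linarith
    by_cases hx : x ∈ uIoc z (z + s)
    · simp [indicator_of_mem hx, indicator_of_mem (h.1 hx)]
    · simp [indicator_of_notMem hx, indicator_of_notMem (mt h.2 hx)]
  have hi : Measurable ((uIoc 0 s).indicator (1 : ℝ → ℝ≥0∞)) :=
    measurable_one.indicator measurableSet_uIoc
  calc ∫⁻ z, ‖F (z + s) - F z‖ₑ
      ≤ ∫⁻ z, ∫⁻ x, ‖g x‖ₑ * (uIoc 0 s).indicator 1 (x - z) := by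
        refine lintegral_mono fun z => (sub_eq_integral_uIoc_le hg hF z s).trans (le_of_eq ?_)
        simp_rw [hind]
    _ = ∫⁻ x, ‖g x‖ₑ * ∫⁻ z, (uIoc 0 s).indicator 1 (x - z) := by
        rw [lintegral_lintegral_swap (by fun_prop)]
        refine lintegral_congr fun x => ?_
        rw [lintegral_const_mul _ (by fun_prop)]
    _ = ∫⁻ x, ‖g x‖ₑ * ‖s‖ₑ := by
        refine lintegral_congr fun x => ?_
        rw [lintegral_sub_left_eq_self, lintegral_indicator_one measurableSet_uIoc, uIoc,
          Real.volume_Ioc, max_sub_min_eq_abs, sub_zero, ← Real.enorm_eq_ofReal_abs]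
    _ = _ := by rw [lintegral_mul_const _ (by fun_prop), mul_comm]

/-- Integration by parts in convolution form: the derivative is moved from the kernel `K` to the
primitive `F`. -/
theorem integral_deriv_mul_primitive {K K' F g : ℝ → ℝ} (hK' : Integrable K')
    (hK : ∀ z, K z = ∫ x in Iic z, K' x) (hg : Integrable g) (hF : ∀ z, F z = ∫ x in Iic z, g x)
      (z : ℝ) :
    ∫ e, K' (z - e) * F e = ∫ x, K (z - x) * g x := by
  have h1 : ∀ e, K' (z - e) * F e = ∫ x, (Iic e).indicator (fun x => K' (z - e) * g x) x := by
    intro e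
    rw [hF, integral_indicator measurableSet_Iic, integral_const_mul]
  have h2 : ∀ x, K (z - x) * g x = ∫ e, (Iic e).indicator (fun x => K' (z - e) * g x) x := by
    intro x
    rw [hK, ← integral_indicator measurableSet_Iic, ← integral_sub_left_eq_self _ volume z,
      ← integral_mul_const]
    refine integral_congr_ae (Eventually.of_forall fun e => ?_)
    simp only [indicator, mem_Iic, sub_le_sub_iff_left]
    split_ifs <;> simp
  simp_rw [h1, h2]
  rw [integral_integral_swap]
  have hb : Integrable (fun p : ℝ × ℝ => K' (z - p.1) * g p.2) (volume.prod volume) :=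
    (hK'.comp_sub_left z).mul_prod hg
  have hS : MeasurableSet {p : ℝ × ℝ | p.2 ≤ p.1} := measurableSet_le measurable_snd measurable_fst
  refine (hb.indicator hS).congr (Eventually.of_forall fun p => ?_)
  simp only [Function.uncurry, indicator, mem_Iic, mem_ofPred_eq]

/-! ### Kernels and error densities -/

/-- A twice continuously differentiable density `k₀` with first two derivatives `k₁`, `k₂`
dominated by multiples of `k₀`. -/
structure IsKernelTriple (k₀ k₁ k₂ : ℝ → ℝ) (B₁ B₂ : ℝ) : Prop where
  nonneg : ∀ u, 0 ≤ k₀ u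
  integral_eq_one : ∫ u, k₀ u = 1
  hasDerivAt_fst : ∀ u, HasDerivAt k₀ (k₁ u) u
  hasDerivAt_snd : ∀ u, HasDerivAt k₁ (k₂ u) u
  continuous_snd : Continuous k₂
  abs_fst_le : ∀ u, |k₁ u| ≤ B₁ * k₀ u
  abs_snd_le : ∀ u, |k₂ u| ≤ B₂ * k₀ u

namespace IsKernelTriple

variable {k₀ k₁ k₂ : ℝ → ℝ} {B₁ B₂ : ℝ}

theorem continuous_zero (h : IsKernelTriple k₀ k₁ k₂ B₁ B₂) : Continuous k₀ :=
  continuous_iff_continuousAt.2 fun u => (h.hasDerivAt_fst u).continuousAt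

theorem continuous_fst (h : IsKernelTriple k₀ k₁ k₂ B₁ B₂) : Continuous k₁ :=
  continuous_iff_continuousAt.2 fun u => (h.hasDerivAt_snd u).continuousAt

theorem integrable_zero (h : IsKernelTriple k₀ k₁ k₂ B₁ B₂) : Integrable k₀ :=
  integrable_of_integral_eq_one h.integral_eq_one

theorem integrable_fst (h : IsKernelTriple k₀ k₁ k₂ B₁ B₂) : Integrable k₁ :=
  (h.integrable_zero.const_mul B₁).mono' h.continuous_fst.aestronglyMeasurable
    (Eventually.of_forall h.abs_fst_le)

theorem integrable_snd (h : IsKernelTriple k₀ k₁ k₂ B₁ B₂) : Integrable k₂ :=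
  (h.integrable_zero.const_mul B₂).mono' h.continuous_snd.aestronglyMeasurable
    (Eventually.of_forall h.abs_snd_le)

theorem eq_integral_zero (h : IsKernelTriple k₀ k₁ k₂ B₁ B₂) (z : ℝ) :
    k₀ z = ∫ x in Iic z, k₁ x := by
  have h0 := tendsto_zero_of_hasDerivAt_of_integrableOn_Iic (a := z)
    (fun x _ => h.hasDerivAt_fst x) h.integrable_fst.integrableOn h.integrable_zero.integrableOn
  rw [integral_Iic_of_hasDerivAt_of_tendsto' (fun x _ => h.hasDerivAt_fst x)
    h.integrable_fst.integrableOn h0, sub_zero]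

theorem eq_integral_fst (h : IsKernelTriple k₀ k₁ k₂ B₁ B₂) (z : ℝ) :
    k₁ z = ∫ x in Iic z, k₂ x := by
  have h0 := tendsto_zero_of_hasDerivAt_of_integrableOn_Iic (a := z)
    (fun x _ => h.hasDerivAt_snd x) h.integrable_snd.integrableOn h.integrable_fst.integrableOn
  rw [integral_Iic_of_hasDerivAt_of_tendsto' (fun x _ => h.hasDerivAt_snd x)
    h.integrable_snd.integrableOn h0, sub_zero]

theorem le_zero (h : IsKernelTriple k₀ k₁ k₂ B₁ B₂) (z : ℝ) : k₀ z ≤ ∫ x, |k₁ x| := by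
  rw [h.eq_integral_zero z]
  calc ∫ x in Iic z, k₁ x ≤ ∫ x in Iic z, |k₁ x| :=
        integral_mono h.integrable_fst.integrableOn h.integrable_fst.abs.integrableOn
          fun x => le_abs_self _
    _ ≤ _ := setIntegral_le_integral h.integrable_fst.abs
          (Eventually.of_forall fun x => abs_nonneg _)

theorem memLp_zero (h : IsKernelTriple k₀ k₁ k₂ B₁ B₂) : MemLp k₀ 2 := by
  rw [memLp_two_iff_integrable_sq h.continuous_zero.aestronglyMeasurable]
  refine (h.integrable_zero.const_mul (∫ x, |k₁ x|)).mono'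
    (h.continuous_zero.pow 2).aestronglyMeasurable (Eventually.of_forall fun u => ?_)
  rw [Real.norm_of_nonneg (sq_nonneg _), sq]
  exact mul_le_mul_of_nonneg_right (h.le_zero u) (h.nonneg u)

theorem memLp_fst (h : IsKernelTriple k₀ k₁ k₂ B₁ B₂) : MemLp k₁ 2 :=
  (h.memLp_zero.const_mul B₁).mono' h.continuous_fst.aestronglyMeasurable
    (Eventually.of_forall h.abs_fst_le)

theorem memLp_snd (h : IsKernelTriple k₀ k₁ k₂ B₁ B₂) : MemLp k₂ 2 :=
  (h.memLp_zero.const_mul B₂).mono' h.continuous_snd.aestronglyMeasurable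
    (Eventually.of_forall h.abs_snd_le)

end IsKernelTriple

/-- The function `k (u / a) / a ^ (q + 1)`, which is the `q`-th derivative of the scaled kernel
if `k` is the `q`-th derivative of the kernel. -/
noncomputable def kernelScale (k : ℝ → ℝ) (q : ℕ) (a u : ℝ) : ℝ := k (u / a) / a ^ (q + 1)

theorem integral_kernelScale_sq (k : ℝ → ℝ) (q : ℕ) {a : ℝ} (ha : 0 < a) :
    ∫ u, kernelScale k q a u ^ 2 = (∫ u, k u ^ 2) / a ^ (2 * q + 1) := by
  simp only [kernelScale, div_pow]
  rw [integral_div, Measure.integral_comp_div (fun u => k u ^ 2), abs_of_pos ha, smul_eq_mul,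
    ← pow_mul, show (q + 1) * 2 = 2 * q + 1 + 1 by ring, pow_succ a (2 * q + 1)]
  field_simp

theorem IsKernelTriple.scale {κ κ' κ'' : ℝ → ℝ} {B₁ B₂ : ℝ} (h : IsKernelTriple κ κ' κ'' B₁ B₂)
    {a : ℝ} (ha : 0 < a) :
    IsKernelTriple (kernelScale κ 0 a) (kernelScale κ' 1 a) (kernelScale κ'' 2 a)
      (B₁ / a) (B₂ / a ^ 2) := by
  have hd : ∀ u, HasDerivAt (fun u : ℝ => u / a) (1 / a) u := fun u =>
    (hasDerivAt_id u).div_const a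
  refine ⟨fun u => ?_, ?_, fun u => ?_, fun u => ?_, ?_, fun u => ?_, fun u => ?_⟩
  · exact div_nonneg (h.nonneg _) (by positivity)
  · simp only [kernelScale]
    rw [integral_div, Measure.integral_comp_div κ, h.integral_eq_one, abs_of_pos ha]
    simp [ha.ne']
  · have := ((h.hasDerivAt_fst (u / a)).comp u (hd u)).div_const (a ^ (0 + 1))
    refine this.congr_deriv ?_
    simp only [kernelScale]
    field_simp
    ring
  · have := ((h.hasDerivAt_snd (u / a)).comp u (hd u)).div_const (a ^ (1 + 1))
    refine this.congr_deriv ?_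
    simp only [kernelScale]
    field_simp
    ring
  · unfold kernelScale
    have := h.continuous_snd
    fun_prop
  · simp only [kernelScale, abs_div, abs_of_pos (pow_pos ha _)]
    rw [div_mul_div_comm, ← pow_succ']
    gcongr
    exact h.abs_fst_le _
  · simp only [kernelScale, abs_div, abs_of_pos (pow_pos ha _)]
    rw [div_mul_div_comm, ← pow_add]
    gcongr
    exact h.abs_snd_le _

/-- An error density `f` with derivative `f'`, which is a primitive of the integrable and square
integrable function `φ`; the constant `M` bounds `f` and `f'`. -/
structure IsSmoothDensity (f f' φ : ℝ → ℝ) (M : ℝ) : Prop where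
  nonneg : ∀ z, 0 ≤ f z
  integral_eq_one : ∫ z, f z = 1
  hasDerivAt : ∀ z, HasDerivAt f (f' z) z
  continuous_deriv : Continuous f'
  integrable_deriv : Integrable f'
  le_bound : ∀ z, f z ≤ M
  abs_deriv_le : ∀ z, |f' z| ≤ M
  measurable_snd : Measurable φ
  integrable_snd : Integrable φ
  memLp_snd : MemLp φ 2
  eq_integral : ∀ z, f z = ∫ x in Iic z, f' x
  deriv_eq_integral : ∀ z, f' z = ∫ x in Iic z, φ x

namespace IsSmoothDensity

variable {f f' φ : ℝ → ℝ} {M : ℝ}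

theorem continuous (h : IsSmoothDensity f f' φ M) : Continuous f :=
  continuous_iff_continuousAt.2 fun u => (h.hasDerivAt u).continuousAt

theorem integrable (h : IsSmoothDensity f f' φ M) : Integrable f :=
  integrable_of_integral_eq_one h.integral_eq_one

theorem bound_nonneg (h : IsSmoothDensity f f' φ M) : 0 ≤ M := (h.nonneg 0).trans (h.le_bound 0)

theorem abs_sub_le (h : IsSmoothDensity f f' φ M) (x y : ℝ) : |f x - f y| ≤ M * |x - y| :=
  Convex.norm_image_sub_le_of_norm_hasDerivWithin_le (f := f) (f' := f') (s := univ)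
    (fun x _ => (h.hasDerivAt x).hasDerivWithinAt) (fun x _ => h.abs_deriv_le x) convex_univ
    (mem_univ y) (mem_univ x)

/-- A nonnegative function has a vanishing derivative at its zeros; so `f' = -ℓ * f` holds also
where the score `ℓ = -f' / f` has the junk value zero. -/
theorem deriv_eq_zero (h : IsSmoothDensity f f' φ M) {z : ℝ} (hz : f z = 0) : f' z = 0 := by
  have : IsLocalMin f z := Eventually.of_forall fun x => by rw [hz]; exact h.nonneg x
  exact this.hasDerivAt_eq_zero (h.hasDerivAt z)

end IsSmoothDensity

/-- The measure with density `f`. -/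
noncomputable abbrev densityMeasure (f : ℝ → ℝ) : Measure ℝ :=
  volume.withDensity fun z => ENNReal.ofReal (f z)

theorem isProbabilityMeasure_densityMeasure {f : ℝ → ℝ} (h0 : ∀ z, 0 ≤ f z)
    (h1 : ∫ z, f z = 1) : IsProbabilityMeasure (densityMeasure f) := by
  refine ⟨?_⟩
  rw [withDensity_apply _ MeasurableSet.univ, Measure.restrict_univ,
    ← ofReal_integral_eq_lintegral_ofReal (integrable_of_integral_eq_one h1)
      (Eventually.of_forall h0), h1, ENNReal.ofReal_one]

theorem integral_densityMeasure {f : ℝ → ℝ} (hf : AEMeasurable f) (h0 : ∀ z, 0 ≤ f z)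
    (g : ℝ → ℝ) : ∫ z, g z ∂(densityMeasure f) = ∫ z, f z * g z := by
  rw [integral_withDensity_eq_integral_toReal_smul₀ hf.ennreal_ofReal
    (Eventually.of_forall fun _ => ENNReal.ofReal_lt_top)]
  simp [ENNReal.toReal_ofReal (h0 _)]

theorem integrable_densityMeasure_iff {f : ℝ → ℝ} (hf : Measurable f) (h0 : ∀ z, 0 ≤ f z)
    {g : ℝ → ℝ} : Integrable g (densityMeasure f) ↔ Integrable fun z => f z * g z := by
  rw [integrable_withDensity_iff_integrable_smul' hf.ennreal_ofReal
    (Eventually.of_forall fun _ => ENNReal.ofReal_lt_top)]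
  simp [ENNReal.toReal_ofReal (h0 _)]

/-! ### Smoothed densities and their scores -/

/-- The regularized score `-F' / (a + F)`. -/
noncomputable def regScore (a : ℝ) (F F' : ℝ → ℝ) (z : ℝ) : ℝ := -F' z / (a + F z)

section RegScore

variable {a b₁ b₂ : ℝ} {F F₁ F₂ : ℝ → ℝ}

theorem abs_regScore_le (ha : 0 < a) (h0 : ∀ z, 0 ≤ F z) (h1 : ∀ z, |F₁ z| ≤ b₁ * F z)
    (hb : 0 ≤ b₁) (z : ℝ) : |regScore a F F₁ z| ≤ b₁ := by
  have hp : 0 < a + F z := by linarith [h0 z]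
  rw [regScore, abs_div, abs_neg, abs_of_pos hp, div_le_iff₀ hp]
  have := mul_nonneg hb ha.le
  linarith [h1 z]

theorem abs_regScore_sub_le (ha : 0 < a) (h0 : ∀ z, 0 ≤ F z) (hd : ∀ z, HasDerivAt F (F₁ z) z)
    (hd' : ∀ z, HasDerivAt F₁ (F₂ z) z) (h1 : ∀ z, |F₁ z| ≤ b₁ * F z)
    (h2 : ∀ z, |F₂ z| ≤ b₂ * F z) (hb₁ : 0 ≤ b₁) (hb₂ : 0 ≤ b₂) (x y : ℝ) :
    |regScore a F F₁ x - regScore a F F₁ y| ≤ (b₂ + b₁ ^ 2) * |x - y| := by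
  have hp : ∀ z, 0 < a + F z := fun z => by linarith [h0 z]
  have hder : ∀ z, HasDerivAt (regScore a F F₁)
      ((-F₂ z * (a + F z) - -F₁ z * F₁ z) / (a + F z) ^ 2) z := fun z =>
    (hd' z).neg.div ((hd z).const_add a) (hp z).ne'
  refine Convex.norm_image_sub_le_of_norm_hasDerivWithin_le (f := regScore a F F₁) (s := univ)
    (fun z _ => (hder z).hasDerivWithinAt) (fun z _ => ?_) convex_univ
    (mem_univ y) (mem_univ x)
  have e1 : (-F₂ z * (a + F z) - -F₁ z * F₁ z) / (a + F z) ^ 2 =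
      -F₂ z / (a + F z) + (regScore a F F₁ z) ^ 2 := by
    have := (hp z).ne'
    rw [regScore]
    field_simp
    ring
  rw [e1, Real.norm_eq_abs]
  refine (abs_add_le _ _).trans (add_le_add ?_ ?_)
  · rw [abs_div, abs_neg, abs_of_pos (hp z), div_le_iff₀ (hp z)]
    have := mul_nonneg hb₂ ha.le
    linarith [h2 z]
  · rw [abs_pow]
    exact pow_le_pow_left₀ (abs_nonneg _) (abs_regScore_le ha h0 h1 hb₁ z) 2

end RegScore

section Smoothing

variable {κ κ' κ'' f f' φ : ℝ → ℝ} {B₁ B₂ M : ℝ}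

theorem isProbabilityMeasure_scaledLaw (hκ : IsKernelTriple κ κ' κ'' B₁ B₂) (a : ℝ) :
    IsProbabilityMeasure (scaledLaw κ a) :=
  have := isProbabilityMeasure_densityMeasure hκ.nonneg hκ.integral_eq_one
  Measure.isProbabilityMeasure_map (by fun_prop)

theorem integral_scaledLaw (hκ : IsKernelTriple κ κ' κ'' B₁ B₂) {a : ℝ} (ha : 0 < a)
    {g : ℝ → ℝ} (hg : Measurable g) :
    ∫ s, g s ∂(scaledLaw κ a) = ∫ u, kernelScale κ 0 a u * g u := by
  rw [scaledLaw, integral_map (by fun_prop) hg.aestronglyMeasurable,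
    integral_densityMeasure hκ.continuous_zero.aemeasurable hκ.nonneg]
  have h := Measure.integral_comp_mul_left (fun u => kernelScale κ 0 a u * g u) a
  rw [abs_of_pos (inv_pos.2 ha), smul_eq_mul] at h
  have h2 : ∫ u, kernelScale κ 0 a u * g u = a * ∫ x, kernelScale κ 0 a (a * x) * g (a * x) := by
    rw [h, ← mul_assoc, mul_inv_cancel₀ ha.ne', one_mul]
  rw [h2, ← integral_const_mul]
  refine integral_congr_ae (Eventually.of_forall fun u => ?_)
  simp only [kernelScale]
  rw [mul_div_cancel_left₀ _ ha.ne']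
  field_simp
  simp only [zero_add, pow_one]
  ring

theorem convMeasure_scaledLaw (hκ : IsKernelTriple κ κ' κ'' B₁ B₂) {a : ℝ} (ha : 0 < a)
    {g : ℝ → ℝ} (hg : Measurable g) (z : ℝ) :
    convMeasure (scaledLaw κ a) g z = ∫ x, kernelScale κ 0 a (z - x) * g x := by
  rw [convMeasure, integral_scaledLaw hκ ha (by fun_prop), ← integral_sub_left_eq_self _ volume z]
  simp

theorem convMeasure_density_zero (hκ : IsKernelTriple κ κ' κ'' B₁ B₂)
    (hf : IsSmoothDensity f f' φ M) {a : ℝ} (ha : 0 < a) :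
    convMeasure (densityMeasure f) (kernelScale κ 0 a) = convMeasure (scaledLaw κ a) f := by
  ext z
  rw [convMeasure_scaledLaw hκ ha hf.continuous.measurable, convMeasure,
    integral_densityMeasure hf.continuous.aemeasurable hf.nonneg]
  simp_rw [mul_comm]

theorem convMeasure_density_fst (hκ : IsKernelTriple κ κ' κ'' B₁ B₂)
    (hf : IsSmoothDensity f f' φ M) {a : ℝ} (ha : 0 < a) :
    convMeasure (densityMeasure f) (kernelScale κ' 1 a) = convMeasure (scaledLaw κ a) f' := by
  ext z
  have hs := hκ.scale ha
  rw [convMeasure_scaledLaw hκ ha hf.continuous_deriv.measurable, convMeasure,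
    integral_densityMeasure hf.continuous.aemeasurable hf.nonneg]
  simp_rw [mul_comm (f _)]
  exact integral_deriv_mul_primitive hs.integrable_fst hs.eq_integral_zero
    hf.integrable_deriv hf.eq_integral z

theorem convMeasure_density_snd (hκ : IsKernelTriple κ κ' κ'' B₁ B₂)
    (hf : IsSmoothDensity f f' φ M) {a : ℝ} (ha : 0 < a) :
    convMeasure (densityMeasure f) (kernelScale κ'' 2 a) = convMeasure (scaledLaw κ a) φ := by
  ext z
  have hs := hκ.scale ha
  rw [convMeasure_scaledLaw hκ ha hf.measurable_snd, convMeasure,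
    integral_densityMeasure hf.continuous.aemeasurable hf.nonneg]
  simp_rw [mul_comm (f _)]
  rw [integral_deriv_mul_primitive hs.integrable_snd hs.eq_integral_fst
    hf.integrable_deriv hf.eq_integral z]
  exact integral_deriv_mul_primitive hs.integrable_fst hs.eq_integral_zero
    hf.integrable_snd hf.deriv_eq_integral z

theorem tendsto_convMeasure_scaledLaw (hκ : IsKernelTriple κ κ' κ'' B₁ B₂) {h : ℝ → ℝ}
    (hc : Continuous h) {K : ℝ} (hb : ∀ z, |h z| ≤ K) (z : ℝ) :
    Tendsto (fun a => convMeasure (scaledLaw κ a) h z) (𝓝 0) (𝓝 (h z)) := by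
  have := isProbabilityMeasure_densityMeasure hκ.nonneg hκ.integral_eq_one
  have h1 : ∀ a, convMeasure (scaledLaw κ a) h z = ∫ u, h (z - a * u) ∂(densityMeasure κ) := by
    intro a
    rw [convMeasure, scaledLaw, integral_map (by fun_prop) (by fun_prop)]
  simp_rw [h1]
  have h2 : ∫ _, h z ∂(densityMeasure κ) = h z := by simp
  rw [← h2]
  refine tendsto_integral_filter_of_dominated_convergence (fun _ => K)
    (Eventually.of_forall fun a => by fun_prop)
    (Eventually.of_forall fun a => Eventually.of_forall fun u => hb _) (integrable_const _)
    (Eventually.of_forall fun u => ?_)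
  have : Continuous fun a : ℝ => h (z - a * u) := by fun_prop
  simpa using this.tendsto 0

theorem convMeasure_nonneg {ν : Measure ℝ} {h : ℝ → ℝ} (h0 : ∀ z, 0 ≤ h z) (z : ℝ) :
    0 ≤ convMeasure ν h z := integral_nonneg fun _ => h0 _

/-- The density is dominated by its smoothed version, up to a term of the order of the
bandwidth. -/
theorem exists_le_mul_add_convMeasure (hκ : IsKernelTriple κ κ' κ'' B₁ B₂)
    (hf : IsSmoothDensity f f' φ M) : ∃ C, 0 < C ∧ ∀ a, 0 < a → ∀ z,
      f z ≤ C * (a + convMeasure (scaledLaw κ a) f z) := by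
  have hp := isProbabilityMeasure_densityMeasure hκ.nonneg hκ.integral_eq_one
  set ν := densityMeasure κ
  have ht : Tendsto (fun n : ℕ => ν.real {u | (n : ℝ) < |u|}) atTop (𝓝 0) := by
    have h1 : Tendsto (fun n : ℕ => ν {u | (n : ℝ) < |u|}) atTop
        (𝓝 (ν (⋂ n : ℕ, {u : ℝ | (n : ℝ) < |u|}))) := by
      refine tendsto_measure_iInter_atTop (fun n => (measurableSet_lt measurable_const
        measurable_id.abs).nullMeasurableSet) ?_ ⟨0, measure_ne_top _ _⟩
      intro n m hnm u hu
      exact lt_of_le_of_lt (Nat.cast_le.2 hnm : (n : ℝ) ≤ m) hu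
    have h2 : (⋂ n : ℕ, {u : ℝ | (n : ℝ) < |u|}) = ∅ := by
      ext u
      simp only [mem_iInter, mem_ofPred_eq, mem_empty_iff_false, iff_false, not_forall, not_lt]
      exact exists_nat_ge |u|
    rw [h2, measure_empty] at h1
    exact (ENNReal.tendsto_toReal ENNReal.zero_ne_top).comp h1
  -- the kernel has at least half of its mass in `[-R, R]`
  obtain ⟨R, hR⟩ := (ht.eventually_le_const (show (0 : ℝ) < 1 / 2 by norm_num)).exists
  have hM := hf.bound_nonneg
  refine ⟨2 + 2 * M * R, by positivity, fun a ha z => ?_⟩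
  have hfm := hf.continuous
  have hint : Integrable (fun u => f (z - a * u)) ν :=
    (integrable_const M).mono' (by fun_prop) (Eventually.of_forall fun u => by
      rw [Real.norm_of_nonneg (hf.nonneg _)]; exact hf.le_bound _)
  have hS : MeasurableSet {u : ℝ | (R : ℝ) < |u|} :=
    measurableSet_lt measurable_const measurable_id.abs
  have h1 : convMeasure (scaledLaw κ a) f z = ∫ u, f (z - a * u) ∂ν := by
    rw [convMeasure, scaledLaw, integral_map (by fun_prop) (by fun_prop)]
  have h2 : f z - ∫ u, f (z - a * u) ∂ν ≤ M * R * a + f z / 2 := by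
    have h3 : f z - ∫ u, f (z - a * u) ∂ν = ∫ u, (f z - f (z - a * u)) ∂ν := by
      rw [integral_sub (integrable_const _) hint]; simp
    rw [h3]
    have h4 : ∀ u, f z - f (z - a * u) ≤
        M * R * a + f z * {u : ℝ | (R : ℝ) < |u|}.indicator 1 u := by
      intro u
      by_cases hu : (R : ℝ) < |u|
      · rw [indicator_of_mem (by exact hu)]
        have := hf.nonneg (z - a * u)
        have : 0 ≤ M * R * a := by positivity
        simp only [Pi.one_apply]
        linarith
      · rw [indicator_of_notMem (by exact hu), mul_zero, add_zero]
        have h5 := (le_abs_self _).trans (hf.abs_sub_le z (z - a * u))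
        refine h5.trans ?_
        rw [sub_sub_cancel, abs_mul, abs_of_pos ha, mul_assoc, mul_comm (R : ℝ) a]
        gcongr
        exact not_lt.1 hu
    have hind : Integrable ({u : ℝ | (R : ℝ) < |u|}.indicator (1 : ℝ → ℝ)) ν :=
      (integrable_const (1 : ℝ)).indicator hS
    have h6 : Integrable (fun u => M * R * a + f z * {u : ℝ | (R : ℝ) < |u|}.indicator 1 u) ν :=
      (integrable_const _).add (hind.const_mul _)
    refine (integral_mono ((integrable_const _).sub hint) h6 h4).trans ?_
    rw [integral_add (integrable_const _) (hind.const_mul _), integral_const_mul (f z),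
      integral_indicator_one hS]
    simp only [integral_const, probReal_univ, one_smul]
    have := mul_le_mul_of_nonneg_left hR (hf.nonneg z)
    linarith
  rw [h1]
  have h0 : 0 ≤ ∫ u, f (z - a * u) ∂ν := integral_nonneg fun _ => hf.nonneg _
  have : 0 ≤ M * R * ∫ u, f (z - a * u) ∂ν := by positivity
  nlinarith

/-- The Cauchy–Schwarz inequality behind the monotonicity of the Fisher information under
convolution. -/
theorem ae_sq_convMeasure_deriv_le {ν : Measure ℝ} [IsProbabilityMeasure ν]
    (hf : IsSmoothDensity f f' φ M) (hJ : Integrable (fun z => score f f' z ^ 2 * f z)) :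
    ∀ᵐ z, convMeasure ν f' z ^ 2 ≤
      convMeasure ν (fun z => score f f' z ^ 2 * f z) z * convMeasure ν f z := by
  have hfm := hf.continuous
  have hfm' := hf.continuous_deriv
  have hm : Measurable fun z => score f f' z ^ 2 * f z := by
    unfold score
    fun_prop
  filter_upwards [ae_integrable_comp_sub (ν := ν) hm hJ] with z hz
  have i1 : Integrable (fun s => f (z - s)) ν :=
    (integrable_const M).mono' (by fun_prop) (Eventually.of_forall fun u => by
      rw [Real.norm_of_nonneg (hf.nonneg _)]; exact hf.le_bound _)
  have i2 : Integrable (fun s => f' (z - s)) ν :=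
    (integrable_const M).mono' (by fun_prop) (Eventually.of_forall fun u => hf.abs_deriv_le _)
  -- the discriminant of a nonnegative quadratic polynomial
  have hq : ∀ q : ℝ, 0 ≤ convMeasure ν f z * (q * q) + (-2 * convMeasure ν f' z) * q +
      convMeasure ν (fun z => score f f' z ^ 2 * f z) z := by
    intro q
    have e : convMeasure ν f z * (q * q) + (-2 * convMeasure ν f' z) * q +
        convMeasure ν (fun z => score f f' z ^ 2 * f z) z =
        ∫ s, (score f f' (z - s) + q) ^ 2 * f (z - s) ∂ν := by
      have e1 : ∀ s, (score f f' (z - s) + q) ^ 2 * f (z - s) =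
          f (z - s) * (q * q) + (-2 * q) * f' (z - s) +
            score f f' (z - s) ^ 2 * f (z - s) := by
        intro s
        have h3 : score f f' (z - s) * f (z - s) = -f' (z - s) := by
          by_cases h0 : f (z - s) = 0
          · rw [h0, hf.deriv_eq_zero h0]; simp
          · rw [score, div_mul_cancel₀ _ h0]
        linear_combination (2 * q) * h3
      simp_rw [e1]
      have i3 : Integrable (fun s => f (z - s) * (q * q) + (-2 * q) * f' (z - s)) ν :=
        (i1.mul_const _).add (i2.const_mul _)
      rw [integral_add i3 hz, integral_add (i1.mul_const _) (i2.const_mul _),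
        integral_mul_const, integral_const_mul]
      simp only [convMeasure]
      ring
    rw [e]
    exact integral_nonneg fun s => mul_nonneg (sq_nonneg _) (hf.nonneg _)
  have := discrim_le_zero hq
  rw [discrim] at this
  nlinarith

/-- The regularized scores of the smoothed densities converge to the score, in mean square. -/
theorem tendsto_integral_regScore_convMeasure_sub (hκ : IsKernelTriple κ κ' κ'' B₁ B₂)
    (hf : IsSmoothDensity f f' φ M) (hJ : Integrable (fun z => score f f' z ^ 2 * f z))
    {ι : Type*} {l : Filter ι} {a : ι → ℝ} (ha0 : ∀ i, 0 < a i) (ha : Tendsto a l (𝓝 0)) :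
    Tendsto (fun i => ∫ z, f z * (regScore (a i) (convMeasure (scaledLaw κ (a i)) f)
      (convMeasure (scaledLaw κ (a i)) f') z - score f f' z) ^ 2) l (𝓝 0) := by
  have hp := isProbabilityMeasure_densityMeasure hκ.nonneg hκ.integral_eq_one
  have hpa := isProbabilityMeasure_scaledLaw hκ
  have hfm := hf.continuous.measurable
  have hfm' := hf.continuous_deriv.measurable
  obtain ⟨C, hC, hfC⟩ := exists_le_mul_add_convMeasure hκ hf
  set ψ : ℝ → ℝ := fun z => score f f' z ^ 2 * f z with hψ
  have hψ0 : ∀ z, 0 ≤ ψ z := fun z => mul_nonneg (sq_nonneg _) (hf.nonneg z)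
  have hψm : Measurable ψ := by
    simp only [hψ, score]
    fun_prop
  have hsm : Measurable (score f f') := by
    unfold score
    fun_prop
  set X : ℝ → ℝ → ℝ := fun a z => f z * (regScore a (convMeasure (scaledLaw κ a) f)
      (convMeasure (scaledLaw κ a) f') z - score f f' z) ^ 2 with hX
  have hXm : ∀ a, Measurable (X a) := by
    intro a
    have h1 := measurable_convMeasure (ν := scaledLaw κ a) hfm
    have h2 := measurable_convMeasure (ν := scaledLaw κ a) hfm'
    simp only [hX, regScore]
    fun_prop
  have hX0 : ∀ a z, 0 ≤ X a z := fun a z => mul_nonneg (hf.nonneg z) (sq_nonneg _)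
  set G : ℝ → ℝ := fun z => (2 * C + 2) * ψ z with hG
  -- The part below `G` is covered by dominated convergence; the excess over `G` is at most the
  -- distance of `ψ` from its convolution, which tends to zero in `L¹`.
  have hbound : ∀ a, 0 < a → ∀ᵐ z, X a z ≤
      min (X a z) (G z) + 2 * C * |convMeasure (scaledLaw κ a) ψ z - ψ z| := by
    intro a ha
    filter_upwards [ae_sq_convMeasure_deriv_le (ν := scaledLaw κ a) hf hJ] with z hz
    have hF0 : 0 ≤ convMeasure (scaledLaw κ a) f z := convMeasure_nonneg hf.nonneg z
    have hk0 : 0 ≤ convMeasure (scaledLaw κ a) ψ z := convMeasure_nonneg hψ0 z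
    set F := convMeasure (scaledLaw κ a) f z
    set F' := convMeasure (scaledLaw κ a) f' z
    set k := convMeasure (scaledLaw κ a) ψ z
    have hp : 0 < a + F := by linarith
    have h1 : f z * (-F' / (a + F)) ^ 2 ≤ C * k := by
      rw [div_pow, neg_sq, mul_div_assoc', div_le_iff₀ (by positivity)]
      calc f z * F' ^ 2 ≤ (C * (a + F)) * (k * F) :=
            mul_le_mul (hfC a ha z) hz (sq_nonneg _) (by positivity)
        _ ≤ (C * (a + F)) * (k * (a + F)) := by gcongr; linarith
        _ = _ := by ring
    have h2 : X a z ≤ 2 * (C * k) + 2 * ψ z := by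
      simp only [hX, hψ, regScore]
      have := mul_nonneg (hf.nonneg z) (sq_nonneg (-F' / (a + F) + score f f' z))
      nlinarith [hf.nonneg z]
    have h3 : k ≤ ψ z + |k - ψ z| := by linarith [le_abs_self (k - ψ z)]
    rcases le_total (X a z) (G z) with h | h
    · rw [min_eq_left h]
      have : 0 ≤ 2 * C * |k - ψ z| := by positivity
      linarith
    · rw [min_eq_right h]
      simp only [hG]
      nlinarith
  have hpt : ∀ z, Tendsto (fun a => X a z) (𝓝[>] 0) (𝓝 0) := by
    intro z
    by_cases h0 : f z = 0
    · simp [hX, h0]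
    · have t1 := (tendsto_convMeasure_scaledLaw hκ hf.continuous
        (fun z => by rw [abs_of_nonneg (hf.nonneg z)]; exact hf.le_bound z) z).mono_left
        (nhdsWithin_le_nhds (s := Ioi (0:ℝ)))
      have t2 := (tendsto_convMeasure_scaledLaw hκ hf.continuous_deriv hf.abs_deriv_le z).mono_left
        (nhdsWithin_le_nhds (s := Ioi (0:ℝ)))
      have t3 : Tendsto (fun a : ℝ => a) (𝓝[>] 0) (𝓝 0) :=
        tendsto_id.mono_left nhdsWithin_le_nhds
      have t4 := t2.neg.div (t3.add t1) (by simpa using h0)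
      have t5 := ((t4.sub_const (score f f' z)).pow 2).const_mul (f z)
      refine (t5.congr fun a => ?_).trans (le_of_eq ?_)
      · simp [hX, regScore]
      · simp [score]
  have hlim : Tendsto (fun a => ∫⁻ z, ENNReal.ofReal (X a z)) (𝓝[>] 0) (𝓝 0) := by
    have l1 : Tendsto (fun a => ∫⁻ z, ENNReal.ofReal (min (X a z) (G z))) (𝓝[>] 0) (𝓝 0) := by
      have := tendsto_lintegral_filter_of_dominated_convergence (μ := volume) (l := 𝓝[>] (0:ℝ))
        (F := fun a z => ENNReal.ofReal (min (X a z) (G z))) (f := fun _ => 0)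
        (fun z => ENNReal.ofReal (G z))
        (Eventually.of_forall fun a => ((hXm a).min (hψm.const_mul _)).ennreal_ofReal)
        (Eventually.of_forall fun a => Eventually.of_forall fun z =>
          ENNReal.ofReal_le_ofReal (min_le_right _ _))
        (hJ.const_mul (2 * C + 2)).lintegral_lt_top.ne
        (Eventually.of_forall fun z => by
          have h0 : 0 ≤ G z := mul_nonneg (by positivity) (hψ0 z)
          have := ENNReal.tendsto_ofReal ((hpt z).min (tendsto_const_nhds (x := G z)))
          simpa [h0] using this)
      simpa using this
    have l2 : Tendsto (fun a => ENNReal.ofReal (2 * C) *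
        ∫⁻ z, ‖convMeasure (scaledLaw κ a) ψ z - ψ z‖ₑ ^ (1 : ℝ)) (𝓝[>] 0) (𝓝 0) := by
      have := tendsto_lintegral_convMeasure_sub (κ := κ) hψm hJ le_rfl
        (by rw [ENNReal.ofReal_one]; exact memLp_one_iff_integrable.2 hJ)
        (tendsto_id.mono_left (nhdsWithin_le_nhds (s := Ioi (0:ℝ)) (a := (0:ℝ))))
      have := ENNReal.Tendsto.const_mul this (Or.inr (ENNReal.ofReal_ne_top (r := 2 * C)))
      simpa using this
    have l3 := l1.add l2
    rw [add_zero] at l3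
    refine tendsto_of_tendsto_of_tendsto_of_le_of_le' tendsto_const_nhds l3
      (Eventually.of_forall fun _ => zero_le) ?_
    filter_upwards [self_mem_nhdsWithin] with a ha
    have hcm := measurable_convMeasure (ν := scaledLaw κ a) hψm
    rw [← lintegral_const_mul _ (by fun_prop), ← lintegral_add_right _ (by fun_prop)]
    refine lintegral_mono_ae ?_
    filter_upwards [hbound a ha] with z hz
    refine (ENNReal.ofReal_le_ofReal hz).trans (ENNReal.ofReal_add_le.trans ?_)
    rw [ENNReal.ofReal_mul (by positivity), ENNReal.rpow_one, Real.enorm_eq_ofReal_abs]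
  have hreal : Tendsto (fun a => ∫ z, X a z) (𝓝[>] 0) (𝓝 0) := by
    have := (ENNReal.tendsto_toReal ENNReal.zero_ne_top).comp hlim
    refine this.congr fun a => ?_
    rw [integral_eq_lintegral_of_nonneg_ae (Eventually.of_forall (hX0 a))
      (hXm a).aestronglyMeasurable]
    rfl
  exact hreal.comp (tendsto_nhdsWithin_iff.2 ⟨ha, Eventually.of_forall ha0⟩)

end Smoothing

/-! ### Translates in `L²` -/

theorem memLp_comp_sub_right {k : ℝ → ℝ} (hk : MemLp k 2) (s : ℝ) :
    MemLp (fun z => k (z - s)) 2 :=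
  hk.comp_measurePreserving (measurePreserving_sub_right volume s)

/-- The translate of `k` by `s`, as an element of `L²`. -/
noncomputable def translateL2 {k : ℝ → ℝ} (hk : MemLp k 2) (s : ℝ) : L2Line :=
  (memLp_comp_sub_right hk s).toLp

section Translate

variable {k k' : ℝ → ℝ}

theorem norm_translateL2 (hk : MemLp k 2) (s : ℝ) : ‖translateL2 hk s‖ = ‖hk.toLp‖ := by
  rw [translateL2, Lp.norm_toLp, Lp.norm_toLp]
  congr 1
  exact eLpNorm_comp_measurePreserving (g := k) hk.1 (measurePreserving_sub_right volume s)

theorem norm_translateL2_sub (hk : MemLp k 2) (s t : ℝ) :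
    ‖translateL2 hk s - translateL2 hk t‖ =
      (eLpNorm (fun z => k (z - (s - t)) - k z) 2 volume).toReal := by
  rw [translateL2, translateL2, ← MemLp.toLp_sub, Lp.norm_toLp]
  congr 1
  have h1 : AEStronglyMeasurable (fun z => k (z - (s - t)) - k z) volume :=
    (memLp_comp_sub_right hk _).1.sub hk.1
  rw [← eLpNorm_comp_measurePreserving h1 (measurePreserving_sub_right volume t)]
  congr 1
  ext z
  simp

@[fun_prop]
theorem continuous_translateL2 (hk : MemLp k 2) : Continuous (translateL2 hk) := by
  rw [continuous_iff_continuousAt]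
  intro t
  rw [ContinuousAt, tendsto_iff_norm_sub_tendsto_zero]
  simp_rw [norm_translateL2_sub]
  have h1 : Tendsto (fun s : ℝ => s - t) (𝓝 t) (𝓝 0) := by
    have : Continuous fun s : ℝ => s - t := by fun_prop
    simpa using this.tendsto t
  have h2 := (tendsto_eLpNorm_translate (p := 2) ENNReal.ofNat_ne_top hk).comp h1
  have h3 := (ENNReal.tendsto_toReal ENNReal.zero_ne_top).comp h2
  exact h3

theorem norm_toLp_eq (hk : MemLp k 2) :
    ‖hk.toLp‖ = ((∫⁻ z, ‖k z‖ₑ ^ (2 : ℝ)) ^ (1 / (2:ℝ))).toReal := by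
  rw [Lp.norm_toLp, eLpNorm_eq_lintegral_rpow_enorm_toReal two_ne_zero ENNReal.ofNat_ne_top]
  simp

theorem norm_translateL2_sub_le (hk : MemLp k 2) (hk' : MemLp k' 2)
    (hd : ∀ z, HasDerivAt k (k' z) z) (hc : Continuous k') (s t : ℝ) :
    ‖translateL2 hk s - translateL2 hk t‖ ≤ |s - t| * ‖hk'.toLp‖ := by
  have h := lintegral_shift_sub_sq_le hd hc (t - s)
  rw [norm_translateL2_sub, norm_toLp_eq,
    eLpNorm_eq_lintegral_rpow_enorm_toReal two_ne_zero ENNReal.ofNat_ne_top]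
  have hfin : (∫⁻ z, ‖k' z‖ₑ ^ (2:ℝ)) ≠ ∞ := by
    have := hk'.2.ne
    rw [eLpNorm_eq_lintegral_rpow_enorm_toReal two_ne_zero ENNReal.ofNat_ne_top] at this
    intro hcon
    rw [ENNReal.toReal_ofNat, hcon] at this
    simp at this
  have h2 := ENNReal.rpow_le_rpow h (show (0:ℝ) ≤ 1 / 2 by norm_num)
  rw [ENNReal.mul_rpow_of_nonneg _ _ (by norm_num), ← ENNReal.rpow_mul,
    show (2:ℝ) * (1 / 2) = 1 by norm_num, ENNReal.rpow_one] at h2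
  have h3 := ENNReal.toReal_mono (ENNReal.mul_ne_top (by simp)
    (ENNReal.rpow_ne_top_of_nonneg (by norm_num) hfin)) h2
  rw [ENNReal.toReal_mul, toReal_enorm, Real.norm_eq_abs, abs_sub_comm] at h3
  have e : ∀ z, k (z - (s - t)) - k z = k (z + (t - s)) - k z := fun z => by
    rw [sub_sub_eq_add_sub, add_sub]
  simp_rw [e, ENNReal.toReal_ofNat]
  exact h3

theorem memLp_convMeasure {ν : Measure ℝ} [IsProbabilityMeasure ν] (hm : Measurable k)
    (hk : MemLp k 2) : MemLp (convMeasure ν k) 2 := by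
  refine ⟨(measurable_convMeasure hm).aestronglyMeasurable, ?_⟩
  have h2 := hk.2
  rw [eLpNorm_lt_top_iff_lintegral_rpow_enorm_lt_top two_ne_zero ENNReal.ofNat_ne_top] at h2 ⊢
  refine lt_of_le_of_lt ?_ h2
  rw [ENNReal.toReal_ofNat, ← lintegral_lintegral_comp_sub (ν := ν) (g := fun z => ‖k z‖ₑ ^ (2:ℝ))
    (by fun_prop)]
  refine lintegral_mono fun z => ?_
  exact enorm_integral_rpow_le (by fun_prop : Measurable fun s => k (z - s)).aestronglyMeasurable
    one_le_two

/-- The mean, in `L²`, of a randomly translated function is its convolution with the law of the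
translation. -/
theorem integral_translateL2 {ν : Measure ℝ} [IsProbabilityMeasure ν] (hm : Measurable k)
    (hk : MemLp k 2) (D : ℝ) :
    ∫ t, translateL2 hk (t - D) ∂ν = translateL2 (memLp_convMeasure (ν := ν) hm hk) (-D) := by
  have hc : Continuous fun t => translateL2 hk (t - D) := by fun_prop
  have hint : Integrable (fun t => translateL2 hk (t - D)) ν :=
    (integrable_const ‖hk.toLp‖).mono' hc.aestronglyMeasurable
      (Eventually.of_forall fun t => by rw [norm_translateL2])
  refine ext_inner_left ℝ fun v => ?_
  rw [← integral_inner hint]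
  have e1 : ∀ t, (inner ℝ v (translateL2 hk (t - D)) : ℝ) = ∫ z, v z * k (z - (t - D)) := by
    intro t
    rw [L2.inner_def]
    refine integral_congr_ae ?_
    filter_upwards [(memLp_comp_sub_right hk (t - D)).coeFn_toLp] with z hz
    rw [translateL2, hz]
    simp [mul_comm]
  have e2 : (inner ℝ v (translateL2 (memLp_convMeasure (ν := ν) hm hk) (-D)) : ℝ) =
      ∫ z, ∫ t, v z * k (z - (t - D)) ∂ν := by
    rw [L2.inner_def]
    refine integral_congr_ae ?_
    filter_upwards [(memLp_comp_sub_right (memLp_convMeasure (ν := ν) hm hk) (-D)).coeFn_toLp]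
      with z hz
    rw [translateL2, hz, integral_const_mul]
    simp only [convMeasure, RCLike.inner_apply, conj_trivial]
    rw [mul_comm]
    congr 1
    refine integral_congr_ae (Eventually.of_forall fun t => ?_)
    ring_nf
  simp_rw [e1]
  rw [e2, integral_integral_swap]
  have hv : MemLp (fun z => v z) 2 := Lp.memLp v
  have hmeas : AEStronglyMeasurable (Function.uncurry fun (t z : ℝ) => v z * k (z - (t - D)))
      (ν.prod volume) := by
    refine AEStronglyMeasurable.mul ?_ ?_
    · exact hv.1.comp_snd
    · exact (by fun_prop : Measurable fun p : ℝ × ℝ => k (p.2 - (p.1 - D))).aestronglyMeasurable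
  refine (integrable_prod_iff hmeas).2 ⟨Eventually.of_forall fun t =>
    MemLp.integrable_mul hv (memLp_comp_sub_right hk (t - D)), ?_⟩
  refine (integrable_const ((∫ z, v z ^ 2) + ∫ z, k z ^ 2)).mono'
    hmeas.norm.integral_prod_right' (Eventually.of_forall fun t => ?_)
  rw [Real.norm_of_nonneg (integral_nonneg fun _ => norm_nonneg _)]
  have i1 : Integrable (fun z => v z ^ 2) := hv.integrable_sq
  have i2 : Integrable (fun z => k (z - (t - D)) ^ 2) := (memLp_comp_sub_right hk _).integrable_sq
  have e3 : ∫ z, k z ^ 2 = ∫ z, k (z - (t - D)) ^ 2 :=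
    (integral_sub_right_eq_self (fun z => k z ^ 2) _).symm
  rw [e3, ← integral_add i1 i2]
  refine integral_mono_of_nonneg (Eventually.of_forall fun _ => norm_nonneg _) (i1.add i2)
    (Eventually.of_forall fun z => ?_)
  simp only [Function.uncurry, Real.norm_eq_abs, abs_mul]
  nlinarith [sq_nonneg (|v z| - |k (z - (t - D))|), sq_abs (v z), sq_abs (k (z - (t - D))),
    sq_nonneg (v z), sq_nonneg (k (z - (t - D)))]

/-- The mean square of the centred sum of randomly translated functions. -/
theorem integral_norm_sq_sum_translateL2_le {ν : Measure ℝ} [IsProbabilityMeasure ν]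
    (hm : Measurable k) (hk : MemLp k 2) (N : ℕ) (D : ℕ → ℝ) :
    Integrable (fun e : ℕ → ℝ => ‖∑ j ∈ Finset.range N, (translateL2 hk (e j - D j) -
      translateL2 (memLp_convMeasure (ν := ν) hm hk) (-D j))‖ ^ 2) (errorLaw ν) ∧
    ∫ e : ℕ → ℝ, ‖∑ j ∈ Finset.range N, (translateL2 hk (e j - D j) -
      translateL2 (memLp_convMeasure (ν := ν) hm hk) (-D j))‖ ^ 2 ∂(errorLaw ν) ≤
      N * ∫ z, k z ^ 2 := by
  have hc : ∀ D : ℝ, Continuous fun t => translateL2 hk (t - D) := fun D => by fun_prop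
  have h := integral_norm_sq_sum_sub_mean_le (P := errorLaw ν) (μ := ν)
    (e := fun j (e : ℕ → ℝ) => e j) (fun j => measurable_pi_apply j) errorLaw_map_eval
    errorLaw_indepFun (Finset.range N) (Ψ := fun j t => translateL2 hk (t - D j)) fun j _ =>
      MemLp.of_bound (hc _).aestronglyMeasurable ‖hk.toLp‖
        (Eventually.of_forall fun t => by rw [norm_translateL2])
  simp only [integral_translateL2 hm hk, norm_translateL2, norm_toLp_sq] at h
  simpa using h

end Translate

/-! ### Means of shifted functions -/

/-- The mean of a bounded function of a shifted error, expanded to second order in the shift. -/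
theorem abs_integral_shift_sub_le {f f' φ : ℝ → ℝ} {M : ℝ} (hf : IsSmoothDensity f f' φ M)
    {L : ℝ → ℝ} (hLm : Measurable L) {b : ℝ} (hL : ∀ z, |L z| ≤ b) (t : ℝ) :
    |∫ z, L (z - t) ∂(densityMeasure f) - ∫ z, L z ∂(densityMeasure f) +
      t * ∫ z, L z * score f f' z ∂(densityMeasure f)| ≤ b * (∫ z, |φ z|) * t ^ 2 := by
  have hfm := hf.continuous
  have hfm' := hf.continuous_deriv
  have hb : 0 ≤ b := (abs_nonneg _).trans (hL 0)
  simp_rw [integral_densityMeasure hf.continuous.aemeasurable hf.nonneg]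
  have hbd : ∀ {g : ℝ → ℝ}, Integrable g → Integrable fun z => L z * g z := fun hg =>
    hg.bdd_mul hLm.aestronglyMeasurable (Eventually.of_forall hL)
  have e1 : ∫ z, f z * L (z - t) = ∫ z, L z * f (z + t) := by
    rw [← integral_add_right_eq_self _ t]
    simp_rw [add_sub_cancel_right, mul_comm]
  have e3 : ∀ z, f z * (L z * score f f' z) = -(L z * f' z) := by
    intro z
    by_cases h0 : f z = 0
    · rw [h0, hf.deriv_eq_zero h0]; simp
    · rw [score]; field_simp
  have i1 := hbd (hf.integrable.comp_add_right t)
  have i2 := hbd hf.integrable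
  have i3 := hbd hf.integrable_deriv
  have e4 : (∫ z, f z * L (z - t)) - (∫ z, f z * L z) + t * ∫ z, f z * (L z * score f f' z) =
      ∫ z, L z * (f (z + t) - f z - t * f' z) := by
    simp_rw [e3]
    rw [e1, integral_neg]
    have i12 : Integrable fun z => L z * f (z + t) - L z * f z := i1.sub i2
    have : ∀ z, L z * (f (z + t) - f z - t * f' z) =
        L z * f (z + t) - L z * f z - t * (L z * f' z) := fun z => by ring
    simp_rw [this]
    rw [integral_sub i12 (i3.const_mul t), integral_sub i1 i2, integral_const_mul]
    simp_rw [mul_comm (f _)]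
    ring
  rw [e4]
  have hrem : ∀ z, f (z + t) - f z - t * f' z =
      ∫ θ in Ioc (0 : ℝ) 1, t * (f' (z + θ * t) - f' z) := by
    intro z
    rw [sub_eq_integral_unit hf.hasDerivAt hf.continuous_deriv]
    have i4 : IntegrableOn (fun θ => t * f' (z + θ * t)) (Ioc 0 1) := by
      refine (Continuous.integrableOn_Icc ?_).mono_set Ioc_subset_Icc_self
      fun_prop
    simp_rw [mul_sub]
    rw [integral_sub i4 (integrable_const _)]
    simp
  have hlin : ∫⁻ z, ‖f (z + t) - f z - t * f' z‖ₑ ≤ ENNReal.ofReal ((∫ z, |φ z|) * t ^ 2) := by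
    calc ∫⁻ z, ‖f (z + t) - f z - t * f' z‖ₑ
        ≤ ∫⁻ z, ∫⁻ θ in Ioc (0 : ℝ) 1, ‖t * (f' (z + θ * t) - f' z)‖ₑ := by
          refine lintegral_mono fun z => ?_
          rw [hrem]
          exact enorm_integral_le_lintegral_enorm _
      _ = ∫⁻ θ in Ioc (0 : ℝ) 1, ∫⁻ z, ‖t * (f' (z + θ * t) - f' z)‖ₑ := by
          rw [lintegral_lintegral_swap]
          exact (by fun_prop : Measurable fun p : ℝ × ℝ =>
            ‖t * (f' (p.1 + p.2 * t) - f' p.1)‖ₑ).aemeasurable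
      _ ≤ ∫⁻ θ in Ioc (0 : ℝ) 1, ‖t‖ₑ * (‖t‖ₑ * ∫⁻ z, ‖φ z‖ₑ) := by
          refine setLIntegral_mono measurable_const fun θ hθ => ?_
          simp_rw [enorm_mul]
          rw [lintegral_const_mul _ (by fun_prop)]
          gcongr
          refine (lintegral_shift_sub_le hf.measurable_snd hf.integrable_snd
            hf.deriv_eq_integral (θ * t)).trans ?_
          gcongr
          rw [enorm_mul]
          refine mul_le_of_le_one_left zero_le ?_
          rw [Real.enorm_eq_ofReal_abs, abs_of_pos hθ.1]
          exact ENNReal.ofReal_le_one.2 hθ.2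
      _ = ‖t‖ₑ * (‖t‖ₑ * ∫⁻ z, ‖φ z‖ₑ) := by simp
      _ = _ := by
          have : ∫⁻ z, ‖φ z‖ₑ = ENNReal.ofReal (∫ z, |φ z|) := by
            rw [← ofReal_integral_norm_eq_lintegral_enorm hf.integrable_snd]
            rfl
          rw [this, Real.enorm_eq_ofReal_abs, ← ENNReal.ofReal_mul (abs_nonneg _),
            ← ENNReal.ofReal_mul (abs_nonneg _), ← sq_abs t]
          congr 1
          ring
  have i5 : Integrable fun z => f (z + t) - f z - t * f' z :=
    ((hf.integrable.comp_add_right t).sub hf.integrable).sub (hf.integrable_deriv.const_mul t)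
  have hreal : ∫ z, |f (z + t) - f z - t * f' z| ≤ (∫ z, |φ z|) * t ^ 2 := by
    have h1 := ofReal_integral_norm_eq_lintegral_enorm i5
    rw [← h1] at hlin
    refine (ENNReal.ofReal_le_ofReal_iff ?_).1 hlin
    exact mul_nonneg (integral_nonneg fun _ => abs_nonneg _) (sq_nonneg _)
  calc |∫ z, L z * (f (z + t) - f z - t * f' z)|
      ≤ ∫ z, b * |f (z + t) - f z - t * f' z| := by
        rw [← Real.norm_eq_abs]
        refine norm_integral_le_of_norm_le (i5.abs.const_mul b) (Eventually.of_forall fun z => ?_)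
        rw [Real.norm_eq_abs, abs_mul]
        exact mul_le_mul_of_nonneg_right (hL z) (abs_nonneg _)
    _ = b * ∫ z, |f (z + t) - f z - t * f' z| := by rw [integral_const_mul]
    _ ≤ _ := by
        rw [mul_assoc]
        exact mul_le_mul_of_nonneg_left hreal hb

/-! ### Residual-based kernel estimators -/

/-- The data of an affine form `b j + ∑ i < N, W j i * e i` in the errors, one for every point
`j`; the estimation error of a linear smoother at a design point has this form. -/
structure ShiftForm where
  b : ℕ → ℝ
  W : ℕ → ℕ → ℝ

namespace ShiftForm

/-- The value of the affine form at the point `j`, for the errors `e i`, `i < N`. -/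
noncomputable def eval (A : ShiftForm) (N : ℕ) (e : ℕ → ℝ) (j : ℕ) : ℝ :=
  affineShift (Finset.range N) A.b A.W e j

/-- The size of the bias and of the weights of a local quadratic smoother at `M` points that is
based on `N` observations, in terms of `s = n^(-1/8)`, for which the bandwidth is of order `s²`:
the bias is of order `n^(-1/2)` and the weights are of order `n^(-3/4)`. -/
structure Bounded (A : ShiftForm) (K s : ℝ) (M N : ℕ) : Prop where
  abs_b_le : ∀ j < M, |A.b j| ≤ K * s ^ 4
  abs_W_le : ∀ j < M, ∀ i < N, |A.W j i| ≤ K * s ^ 6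
  row_le : ∀ j < M, ∑ i ∈ Finset.range N, |A.W j i| ≤ K
  col_le : ∀ i < N, ∑ j ∈ Finset.range M, |A.W j i| ≤ K

/-- The affine form with the influence of the `j`-th error on the `j`-th value removed. -/
noncomputable def offDiag (A : ShiftForm) : ShiftForm where
  b := A.b
  W j i := if j = i then 0 else A.W j i

variable {A : ShiftForm} {K s : ℝ} {M N : ℕ} {μ : Measure ℝ} [IsProbabilityMeasure μ]

@[fun_prop]
theorem continuous_eval (A : ShiftForm) (N j : ℕ) : Continuous fun e => A.eval N e j :=
  continuous_affineShift _ _ _ _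

@[fun_prop]
theorem measurable_eval (A : ShiftForm) (N j : ℕ) : Measurable fun e => A.eval N e j :=
  (A.continuous_eval N j).measurable

theorem offDiag_self (A : ShiftForm) (j : ℕ) : A.offDiag.W j j = 0 := by simp [offDiag]

theorem abs_offDiag_le (A : ShiftForm) (j i : ℕ) : |A.offDiag.W j i| ≤ |A.W j i| := by
  simp only [offDiag]
  split_ifs
  · simp
  · rfl

theorem Bounded.offDiag (h : A.Bounded K s M N) : A.offDiag.Bounded K s M N where
  abs_b_le := h.abs_b_le
  abs_W_le j hj i hi := (A.abs_offDiag_le j i).trans (h.abs_W_le j hj i hi)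
  row_le j hj := (Finset.sum_le_sum fun i _ => A.abs_offDiag_le j i).trans (h.row_le j hj)
  col_le i hi := (Finset.sum_le_sum fun j _ => A.abs_offDiag_le j i).trans (h.col_le i hi)

theorem eval_sub_eval_offDiag (A : ShiftForm) {j : ℕ} (hj : j < N) (e : ℕ → ℝ) :
    A.eval N e j - A.offDiag.eval N e j = A.W j j * e j := by
  simp only [eval, affineShift, ShiftForm.offDiag]
  rw [add_sub_add_left_eq_sub, ← Finset.sum_sub_distrib,
    Finset.sum_eq_single_of_mem j (Finset.mem_range.2 hj)]
  · simp
  · intro i _ hij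
    simp [hij.symm]

theorem integrable_sq_eval (h2 : MemLp (fun t : ℝ => t) 2 μ) (A : ShiftForm) (N j : ℕ) :
    Integrable (fun e => A.eval N e j ^ 2) (errorLaw μ) :=
  (memLp_affineShift h2 _ _ _ _).integrable_sq

/-- A bound for the mean square of the estimation error, in units of `s ^ 6`. -/
noncomputable def varBound (μ : Measure ℝ) (K : ℝ) : ℝ := 2 * K ^ 2 + 2 * (K ^ 2 * ∫ t, t ^ 2 ∂μ)

theorem varBound_nonneg (μ : Measure ℝ) (K : ℝ) : 0 ≤ varBound μ K := by
  have := integral_nonneg (μ := μ) (f := fun t : ℝ => t ^ 2) fun t => sq_nonneg t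
  unfold varBound
  positivity

theorem Bounded.integral_sq_eval_le (h : A.Bounded K s M N) (hs : 0 < s) (hs1 : s ≤ 1)
    (h2 : MemLp (fun t : ℝ => t) 2 μ) (h0 : ∫ t, t ∂μ = 0) {j : ℕ} (hj : j < M) :
    ∫ e, A.eval N e j ^ 2 ∂(errorLaw μ) ≤ varBound μ K * s ^ 6 := by
  have hV := integral_nonneg (μ := μ) (f := fun t : ℝ => t ^ 2) fun t => sq_nonneg t
  have hb := h.abs_b_le j hj
  have hK : 0 ≤ K := by
    have := (abs_nonneg _).trans hb
    exact nonneg_of_mul_nonneg_left this (by positivity)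
  have h1 : A.b j ^ 2 ≤ K ^ 2 * s ^ 6 := by
    rw [← sq_abs]
    calc |A.b j| ^ 2 ≤ (K * s ^ 4) ^ 2 := by gcongr
      _ = K ^ 2 * (s ^ 6 * s ^ 2) := by ring
      _ ≤ K ^ 2 * (s ^ 6 * 1) := by
        gcongr
        exact pow_le_one₀ hs.le hs1
      _ = _ := by ring
  have h3 : ∑ i ∈ Finset.range N, A.W j i ^ 2 ≤ K ^ 2 * s ^ 6 := by
    calc ∑ i ∈ Finset.range N, A.W j i ^ 2
        ≤ ∑ i ∈ Finset.range N, (K * s ^ 6) * |A.W j i| := by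
          refine Finset.sum_le_sum fun i hi => ?_
          rw [← sq_abs, sq]
          exact mul_le_mul_of_nonneg_right (h.abs_W_le j hj i (Finset.mem_range.1 hi))
            (abs_nonneg _)
      _ ≤ (K * s ^ 6) * K := by
          rw [← Finset.mul_sum]
          exact mul_le_mul_of_nonneg_left (h.row_le j hj) (by positivity)
      _ = _ := by ring
  refine (integral_sq_affineShift_le h2 h0 _ _ _ _).trans ?_
  have := mul_le_mul_of_nonneg_right h3 hV
  unfold varBound
  nlinarith

/-- The mean over the points of the squared values. -/
noncomputable def meanSq (A : ShiftForm) (M N : ℕ) (e : ℕ → ℝ) : ℝ :=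
  (M : ℝ)⁻¹ * ∑ j ∈ Finset.range M, A.eval N e j ^ 2

theorem meanSq_nonneg (A : ShiftForm) (M N : ℕ) (e : ℕ → ℝ) : 0 ≤ A.meanSq M N e :=
  mul_nonneg (by positivity) (Finset.sum_nonneg fun _ _ => sq_nonneg _)

@[fun_prop]
theorem measurable_meanSq (A : ShiftForm) (M N : ℕ) : Measurable (A.meanSq M N) := by
  unfold meanSq
  fun_prop

theorem integrable_meanSq (h2 : MemLp (fun t : ℝ => t) 2 μ) (A : ShiftForm) (M N : ℕ) :
    Integrable (A.meanSq M N) (errorLaw μ) :=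
  (integrable_finsetSum _ fun j _ => integrable_sq_eval h2 A N j).const_mul _

theorem Bounded.integral_meanSq_le (h : A.Bounded K s M N) (hs : 0 < s) (hs1 : s ≤ 1)
    (h2 : MemLp (fun t : ℝ => t) 2 μ) (h0 : ∫ t, t ∂μ = 0) :
    ∫ e, A.meanSq M N e ∂(errorLaw μ) ≤ varBound μ K * s ^ 6 := by
  have hc := varBound_nonneg μ K
  unfold meanSq
  rw [integral_const_mul, integral_finsetSum _ fun j _ => integrable_sq_eval h2 A N j]
  calc _ ≤ (M : ℝ)⁻¹ * ∑ j ∈ Finset.range M, varBound μ K * s ^ 6 := by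
        gcongr with j hj
        exact h.integral_sq_eval_le hs hs1 h2 h0 (Finset.mem_range.1 hj)
    _ ≤ _ := by
        rw [Finset.sum_const, Finset.card_range, nsmul_eq_mul, ← mul_assoc]
        exact mul_le_of_le_one_left (by positivity) (inv_mul_le_one)

end ShiftForm

/-- The asymptotic regime: `s = n^(-1/8)` and the bandwidth `a` of the kernel density estimators
tend to zero, `s` faster than `a`. -/
structure Regime {ι : Type*} (l : Filter ι) (s a : ι → ℝ) : Prop where
  s_pos : ∀ i, 0 < s i
  s_le_one : ∀ i, s i ≤ 1
  a_pos : ∀ i, 0 < a i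
  tendsto_s : Tendsto s l (𝓝 0)
  tendsto_a : Tendsto a l (𝓝 0)
  tendsto_ratio : Tendsto (fun i => s i / a i) l (𝓝 0)

/-- Powers of `s` dominate the same or smaller powers of `1 / a`. -/
theorem Regime.tendsto_pow {ι : Type*} {l : Filter ι} {s a : ι → ℝ} (h : Regime l s a) {p q : ℕ}
    (hq : q ≤ p) (hp : 0 < p) (c : ℝ) : Tendsto (fun i => c * (s i ^ p / a i ^ q)) l (𝓝 0) := by
  have h1 : ∀ i, s i ^ p / a i ^ q = (s i / a i) ^ q * s i ^ (p - q) := by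
    intro i
    rw [div_pow, div_mul_eq_mul_div, ← pow_add, Nat.add_sub_cancel' hq]
  simp_rw [h1]
  have h2 : Tendsto (fun i => c * ((s i / a i) ^ q * s i ^ (p - q))) l
      (𝓝 (c * (0 ^ q * 0 ^ (p - q)))) :=
    ((h.tendsto_ratio.pow q).mul (h.tendsto_s.pow (p - q))).const_mul c
  have h3 : (0 : ℝ) ^ q * 0 ^ (p - q) = 0 := by
    rw [← pow_add, Nat.add_sub_cancel' hq, zero_pow hp.ne']
  rwa [h3, mul_zero] at h2

theorem toLp_finsetSum {α : Type*} (S : Finset α) {h : α → ℝ → ℝ} (hh : ∀ j, MemLp (h j) 2) :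
    (memLp_finsetSum S fun j _ => hh j).toLp (fun z => ∑ j ∈ S, h j z) =
      ∑ j ∈ S, (hh j).toLp (h j) := by
  classical
  induction S using Finset.induction_on with
  | empty =>
    refine Lp.ext ?_
    simp only [Finset.sum_empty]
    exact (MemLp.coeFn_toLp _).trans (Lp.coeFn_zero ℝ 2 volume).symm
  | insert j S hj ih =>
    rw [Finset.sum_insert hj, ← ih, ← MemLp.toLp_add]
    congr 1
    funext z
    rw [Finset.sum_insert hj]
    rfl

/-- The average of the functions `k (· - t j)`, `j < N`. -/
noncomputable def kernelMean (k : ℝ → ℝ) (N : ℕ) (t : ℕ → ℝ) (z : ℝ) : ℝ :=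
  (N : ℝ)⁻¹ * ∑ j ∈ Finset.range N, k (z - t j)

section KernelMean

variable {k g : ℝ → ℝ}

theorem memLp_kernelMean (hk : MemLp k 2) (N : ℕ) (t : ℕ → ℝ) : MemLp (kernelMean k N t) 2 :=
  (memLp_finsetSum _ fun j _ => memLp_comp_sub_right hk (t j)).const_mul _

theorem toLp_kernelMean (hk : MemLp k 2) (N : ℕ) (t : ℕ → ℝ) :
    (memLp_kernelMean hk N t).toLp = (N : ℝ)⁻¹ • ∑ j ∈ Finset.range N, translateL2 hk (t j) := by
  unfold translateL2
  rw [← toLp_finsetSum (Finset.range N) (h := fun j z => k (z - t j))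
      fun j => memLp_comp_sub_right hk (t j), ← MemLp.toLp_const_smul]
  rfl

theorem norm_toLp_kernelMean_sub (hk : MemLp k 2) (hg : MemLp g 2 volume) {N : ℕ} (hN : 0 < N)
    (t : ℕ → ℝ) :
    ‖(memLp_kernelMean hk N t).toLp (kernelMean k N t) - hg.toLp g‖ =
      (N : ℝ)⁻¹ * ‖∑ j ∈ Finset.range N, (translateL2 hk (t j) - hg.toLp g)‖ := by
  have : (memLp_kernelMean hk N t).toLp (kernelMean k N t) - hg.toLp g =
      (N : ℝ)⁻¹ • ∑ j ∈ Finset.range N, (translateL2 hk (t j) - hg.toLp g) := by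
    rw [toLp_kernelMean hk, Finset.sum_sub_distrib, smul_sub, Finset.sum_const,
      Finset.card_range, ← Nat.cast_smul_eq_nsmul ℝ, smul_smul,
      inv_mul_cancel₀ (by positivity), one_smul]
  rw [this, norm_smul, Real.norm_of_nonneg (by positivity)]

theorem sq_inv_mul_sum_abs_le (N : ℕ) (D : ℕ → ℝ) :
    ((N : ℝ)⁻¹ * ∑ j ∈ Finset.range N, |D j|) ^ 2 ≤
      (N : ℝ)⁻¹ * ∑ j ∈ Finset.range N, D j ^ 2 := by
  rcases Nat.eq_zero_or_pos N with rfl | hN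
  · simp
  have h := sq_sum_le_card_mul_sum_sq (s := Finset.range N) (f := fun j => |D j|)
  simp only [Finset.card_range, sq_abs] at h
  have hN' : (0 : ℝ) < N := by exact_mod_cast hN
  calc _ = (N : ℝ)⁻¹ ^ 2 * (∑ j ∈ Finset.range N, |D j|) ^ 2 := by ring
    _ ≤ (N : ℝ)⁻¹ ^ 2 * (N * ∑ j ∈ Finset.range N, D j ^ 2) := by gcongr
    _ = _ := by field_simp

/-- The stochastic error of a kernel estimator based on the true errors. -/
noncomputable def kernelNoise {k : ℝ → ℝ} (hk : MemLp k 2) (g : L2Line) (N : ℕ)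
    (e : ℕ → ℝ) : ℝ :=
  ((N : ℝ)⁻¹ * ‖∑ j ∈ Finset.range N, (translateL2 hk (e j) - g)‖) ^ 2

theorem measurable_kernelNoise (hk : MemLp k 2) (g : L2Line) (N : ℕ) :
    Measurable (kernelNoise hk g N) := by
  have h : Continuous (kernelNoise hk g N) := by
    unfold kernelNoise
    have := continuous_translateL2 hk
    fun_prop
  exact h.measurable

theorem integral_kernelNoise_le {ν : Measure ℝ} [IsProbabilityMeasure ν] (hm : Measurable k)
    (hk : MemLp k 2) (N : ℕ) :
    Integrable (kernelNoise hk ((memLp_convMeasure (ν := ν) hm hk).toLp) N) (errorLaw ν) ∧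
    ∫ e, kernelNoise hk ((memLp_convMeasure (ν := ν) hm hk).toLp) N e ∂(errorLaw ν) ≤
      (N : ℝ)⁻¹ * ∫ z, k z ^ 2 := by
  obtain ⟨h1, h2⟩ := integral_norm_sq_sum_translateL2_le (ν := ν) hm hk N (fun _ => 0)
  have h3 : translateL2 (memLp_convMeasure (ν := ν) hm hk) (-0) =
      (memLp_convMeasure (ν := ν) hm hk).toLp := by
    simp [translateL2]
  simp only [h3, sub_zero] at h1 h2
  unfold kernelNoise
  simp_rw [mul_pow]
  refine ⟨h1.const_mul _, ?_⟩
  rw [integral_const_mul]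
  rcases Nat.eq_zero_or_pos N with rfl | hN
  · simp
  have hN' : (0 : ℝ) < N := by exact_mod_cast hN
  calc _ ≤ (N : ℝ)⁻¹ ^ 2 * (N * ∫ z, k z ^ 2) := by gcongr
    _ = _ := by field_simp

/-- The distance in `L²` of a kernel estimator based on the residuals `e j - D j` to its target,
in terms of the mean square of the estimation errors `D j` and of the stochastic error. -/
theorem integral_kernelMean_sub_sq_le {k' : ℝ → ℝ} (hk : MemLp k 2) (hk' : MemLp k' 2)
    (hd : ∀ z, HasDerivAt k (k' z) z) (hc : Continuous k') (hg : MemLp g 2) {N : ℕ} (hN : 0 < N)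
    (e D : ℕ → ℝ) :
    ∫ z, (kernelMean k N (fun j => e j - D j) z - g z) ^ 2 ≤
      2 * ((∫ z, k' z ^ 2) * ((N : ℝ)⁻¹ * ∑ j ∈ Finset.range N, D j ^ 2)) +
        2 * kernelNoise hk hg.toLp N e := by
  have h0 := norm_toLp_sq ((memLp_kernelMean hk N fun j => e j - D j).sub hg)
  simp only [Pi.sub_apply] at h0
  rw [← h0, MemLp.toLp_sub (memLp_kernelMean hk N fun j => e j - D j) hg, norm_toLp_kernelMean_sub
      hk hg hN]
  have h1 : ‖∑ j ∈ Finset.range N, (translateL2 hk (e j - D j) - hg.toLp)‖ ≤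
      (∑ j ∈ Finset.range N, |D j|) * ‖hk'.toLp‖ +
        ‖∑ j ∈ Finset.range N, (translateL2 hk (e j) - hg.toLp)‖ := by
    have : ∑ j ∈ Finset.range N, (translateL2 hk (e j - D j) - hg.toLp) =
        ∑ j ∈ Finset.range N, (translateL2 hk (e j - D j) - translateL2 hk (e j)) +
          ∑ j ∈ Finset.range N, (translateL2 hk (e j) - hg.toLp) := by
      rw [← Finset.sum_add_distrib]
      exact Finset.sum_congr rfl fun j _ => by abel
    rw [this]
    refine (norm_add_le _ _).trans (add_le_add ((norm_sum_le _ _).trans ?_) le_rfl)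
    rw [Finset.sum_mul]
    refine Finset.sum_le_sum fun j _ => ?_
    have := norm_translateL2_sub_le hk hk' hd hc (e j - D j) (e j)
    rwa [sub_sub_cancel_left, abs_neg] at this
  have h2 := sq_inv_mul_sum_abs_le N D
  unfold kernelNoise
  rw [← norm_toLp_sq hk']
  set X := ‖∑ j ∈ Finset.range N, (translateL2 hk (e j - D j) - hg.toLp)‖
  set Y := ‖∑ j ∈ Finset.range N, (translateL2 hk (e j) - hg.toLp)‖
  set S := ∑ j ∈ Finset.range N, |D j|
  have hX : 0 ≤ X := norm_nonneg _
  calc ((N : ℝ)⁻¹ * X) ^ 2 ≤ ((N : ℝ)⁻¹ * (S * ‖hk'.toLp‖ + Y)) ^ 2 := by gcongr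
    _ = (‖hk'.toLp‖ * ((N : ℝ)⁻¹ * S) + (N : ℝ)⁻¹ * Y) ^ 2 := by ring
    _ ≤ 2 * (‖hk'.toLp‖ * ((N : ℝ)⁻¹ * S)) ^ 2 + 2 * ((N : ℝ)⁻¹ * Y) ^ 2 := by
        nlinarith [sq_nonneg (‖hk'.toLp‖ * ((N : ℝ)⁻¹ * S) - (N : ℝ)⁻¹ * Y)]
    _ ≤ _ := by
        rw [mul_pow]
        gcongr

end KernelMean

/-! ### The score estimator from one half of the sample -/

/-- A sequence of random functions `L i e` that are bounded and Lipschitz at the rates of the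
regularized score estimator with bandwidth `a i`, and that converge to `ℓ` in `L²(μ)` in
probability. -/
structure IsScoreEstimate {ι : Type*} (μ : Measure ℝ) [IsProbabilityMeasure μ] (l : Filter ι)
    (a : ι → ℝ) (Λ : ℝ) (ℓ : ℝ → ℝ) (L : ι → (ℕ → ℝ) → ℝ → ℝ) : Prop where
  measurable : ∀ i, Measurable fun p : (ℕ → ℝ) × ℝ => L i p.1 p.2
  abs_le : ∀ i e z, |L i e z| ≤ Λ / a i
  lipschitz : ∀ i e x y, |L i e x - L i e y| ≤ Λ / a i ^ 2 * |x - y|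
  opZero : OpZero (errorLaw μ) l fun i e => ∫ z, (L i e z - ℓ z) ^ 2 ∂μ

/-- The regularized score estimator that is based on the residuals `e j - D j`, where the
estimation error `D` is an affine form in the errors `e`. -/
noncomputable def residualScore (κ κ' : ℝ → ℝ) (a : ℝ) (A : ShiftForm) (N : ℕ) (e : ℕ → ℝ)
    (z : ℝ) : ℝ :=
  regScore a (kernelMean (kernelScale κ 0 a) N fun j => e j - A.eval N e j)
    (kernelMean (kernelScale κ' 1 a) N fun j => e j - A.eval N e j) z

/-- If `x` is at most of the order of `a + G`, only one factor `1 / a` is lost in the comparison of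
the regularized scores of `F` and `G`. -/
theorem mul_regScore_sub_sq_le {a b C x F F' G G' : ℝ} (ha : 0 < a) (hF : 0 ≤ F)
    (hF' : |F'| ≤ b * F) (hb : 0 ≤ b) (hG : 0 ≤ G)
    (hx : x ≤ C * (a + G)) (hC : 0 ≤ C) :
    x * (-F' / (a + F) - -G' / (a + G)) ^ 2 ≤
      2 * C / a * ((F' - G') ^ 2 + b ^ 2 * (F - G) ^ 2) := by
  have h1 : 0 < a + F := by linarith
  have h2 : 0 < a + G := by linarith
  set v := F' / (a + F) with hv
  have hvb : v ^ 2 ≤ b ^ 2 := by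
    rw [sq_le_sq, abs_of_nonneg hb, hv, abs_div, abs_of_pos h1, div_le_iff₀ h1]
    nlinarith
  have hid : -F' / (a + F) - -G' / (a + G) = (-(F' - G') + v * (F - G)) / (a + G) := by
    rw [hv]; field_simp; ring
  have hCx : x / (a + G) ^ 2 ≤ C / a := by
    rw [div_le_div_iff₀ (by positivity) ha]
    calc x * a ≤ C * (a + G) * (a + G) := mul_le_mul hx (by linarith) ha.le (by positivity)
      _ = _ := by ring
  have h3 : (-(F' - G') + v * (F - G)) ^ 2 ≤ 2 * ((F' - G') ^ 2 + b ^ 2 * (F - G) ^ 2) := by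
    nlinarith [sq_nonneg ((F' - G') + v * (F - G)),
      mul_le_mul_of_nonneg_right hvb (sq_nonneg (F - G))]
  rw [hid, div_pow]
  calc x * ((-(F' - G') + v * (F - G)) ^ 2 / (a + G) ^ 2)
      = x / (a + G) ^ 2 * (-(F' - G') + v * (F - G)) ^ 2 := by ring
    _ ≤ C / a * (2 * ((F' - G') ^ 2 + b ^ 2 * (F - G) ^ 2)) := by
        exact mul_le_mul hCx h3 (sq_nonneg _) (by positivity)
    _ = _ := by ring

section

variable {f f' φ κ κ' κ'' : ℝ → ℝ} {M B₁ B₂ : ℝ}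

theorem hasDerivAt_kernelMean {k k' : ℝ → ℝ} (h : ∀ z, HasDerivAt k (k' z) z) (N : ℕ)
    (t : ℕ → ℝ) (z : ℝ) : HasDerivAt (kernelMean k N t) (kernelMean k' N t z) z := by
  unfold kernelMean
  refine HasDerivAt.const_mul _ (HasDerivAt.fun_sum fun j _ => ?_)
  exact (h _).comp_sub_const z (t j)

theorem abs_kernelMean_le {k k' : ℝ → ℝ} {b : ℝ} (h : ∀ z, |k' z| ≤ b * k z) (N : ℕ)
    (t : ℕ → ℝ) (z : ℝ) : |kernelMean k' N t z| ≤ b * kernelMean k N t z := by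
  unfold kernelMean
  rw [abs_mul, abs_of_nonneg (by positivity), mul_left_comm]
  gcongr
  rw [Finset.mul_sum]
  exact (Finset.abs_sum_le_sum_abs _ _).trans (Finset.sum_le_sum fun j _ => h _)

theorem kernelMean_nonneg {k : ℝ → ℝ} (h : ∀ z, 0 ≤ k z) (N : ℕ) (t : ℕ → ℝ) (z : ℝ) :
    0 ≤ kernelMean k N t z :=
  mul_nonneg (by positivity) (Finset.sum_nonneg fun _ _ => h _)

theorem IsKernelTriple.bound_nonneg (h : IsKernelTriple κ κ' κ'' B₁ B₂) : 0 ≤ B₁ ∧ 0 ≤ B₂ := by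
  have : ∃ u, κ u ≠ 0 := by
    by_contra! h0
    have := h.integral_eq_one
    simp [h0] at this
  obtain ⟨u, hu⟩ := this
  have hu' : 0 < κ u := lt_of_le_of_ne (h.nonneg u) hu.symm
  exact ⟨nonneg_of_mul_nonneg_left ((abs_nonneg _).trans (h.abs_fst_le u)) hu',
    nonneg_of_mul_nonneg_left ((abs_nonneg _).trans (h.abs_snd_le u)) hu'⟩

theorem continuous_residualScore_uncurry (hκ : IsKernelTriple κ κ' κ'' B₁ B₂) {a : ℝ}
    (ha : 0 < a) (A : ShiftForm) (N : ℕ) :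
    Continuous fun p : (ℕ → ℝ) × ℝ => residualScore κ κ' a A N p.1 p.2 := by
  have h0 := (hκ.scale ha).continuous_zero
  have h1 := (hκ.scale ha).continuous_fst
  have hA : ∀ j, Continuous fun p : (ℕ → ℝ) × ℝ => A.eval N p.1 j := fun j =>
    (A.continuous_eval N j).comp continuous_fst
  unfold residualScore regScore
  refine Continuous.div ?_ ?_ fun p => ?_
  · unfold kernelMean
    fun_prop
  · unfold kernelMean
    fun_prop
  · have := kernelMean_nonneg (hκ.scale ha).nonneg N (fun j => p.1 j - A.eval N p.1 j) p.2
    linarith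

/-- The `L²` error of the score estimator is controlled by its deterministic part and by the
errors of the kernel estimators of the density and of its derivative. -/
theorem integral_residualScore_sub_sq_le (hκ : IsKernelTriple κ κ' κ'' B₁ B₂)
    (hf : IsSmoothDensity f f' φ M) (hJ : Integrable (fun z => score f f' z ^ 2 * f z)) {a C : ℝ}
    (ha : 0 < a) (hC : 0 < C) (hfC : ∀ z, f z ≤ C * (a + convMeasure (scaledLaw κ a) f z))
    (F F' : ℝ → ℝ) (hF0 : ∀ z, 0 ≤ F z) (hF1 : ∀ z, |F' z| ≤ B₁ / a * F z) (hF2 : MemLp F 2)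
      (hF2' : MemLp F' 2) :
    ∫ z, (regScore a F F' z - score f f' z) ^ 2 ∂(densityMeasure f) ≤
      2 * (∫ z, f z * (regScore a (convMeasure (scaledLaw κ a) f)
        (convMeasure (scaledLaw κ a) f') z - score f f' z) ^ 2) +
      4 * C / a * ((∫ z, (F' z - convMeasure (scaledLaw κ a) f' z) ^ 2) +
        (B₁ / a) ^ 2 * ∫ z, (F z - convMeasure (scaledLaw κ a) f z) ^ 2) := by
  have hν := isProbabilityMeasure_scaledLaw hκ a
  have hμ := isProbabilityMeasure_densityMeasure hf.nonneg hf.integral_eq_one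
  have hb := hκ.bound_nonneg.1
  set G := convMeasure (scaledLaw κ a) f with hG
  set G' := convMeasure (scaledLaw κ a) f' with hG'
  have hG0 : ∀ z, 0 ≤ G z := convMeasure_nonneg hf.nonneg
  have hGm : Measurable G := measurable_convMeasure hf.continuous.measurable
  have hGm' : Measurable G' := measurable_convMeasure hf.continuous_deriv.measurable
  have hS := hκ.scale ha
  have hG2 : MemLp G 2 := by
    rw [hG, ← convMeasure_density_zero hκ hf ha]
    exact memLp_convMeasure hS.continuous_zero.measurable hS.memLp_zero
  have hG2' : MemLp G' 2 := by
    rw [hG', ← convMeasure_density_fst hκ hf ha]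
    exact memLp_convMeasure hS.continuous_fst.measurable hS.memLp_fst
  have hG1 : ∀ z, |G' z| ≤ B₁ / a * G z := by
    intro z
    rw [hG, hG', ← convMeasure_density_zero hκ hf ha, ← convMeasure_density_fst hκ hf ha]
    unfold convMeasure
    rw [← integral_const_mul, ← Real.norm_eq_abs]
    refine norm_integral_le_of_norm_le ?_ (Eventually.of_forall fun s => ?_)
    · refine Integrable.const_mul ?_ _
      refine Integrable.mono' (integrable_const (∫ x, |kernelScale κ' 1 a x|))
        (by have := hS.continuous_zero; fun_prop) (Eventually.of_forall fun s => ?_)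
      rw [Real.norm_of_nonneg (hS.nonneg _)]
      exact hS.le_zero _
    · exact hS.abs_fst_le _
  have i1 : Integrable fun z => (F' z - G' z) ^ 2 := (hF2'.sub hG2').integrable_sq
  have i0 : Integrable fun z => (F z - G z) ^ 2 := (hF2.sub hG2).integrable_sq
  have hLm : Measurable (regScore a G G') := by
    unfold regScore
    exact hGm'.neg.div (measurable_const.add hGm)
  have hsm : Measurable (score f f') :=
    hf.continuous_deriv.measurable.neg.div hf.continuous.measurable
  have hLb := abs_regScore_le ha hG0 hG1 (by positivity)
  have id : Integrable fun z => f z * (regScore a G G' z - score f f' z) ^ 2 := by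
    have hfm := hf.continuous.measurable
    refine Integrable.mono' ((hf.integrable.const_mul (2 * (B₁ / a) ^ 2)).add (hJ.const_mul 2))
      (by fun_prop) (Eventually.of_forall fun z => ?_)
    rw [Real.norm_of_nonneg (mul_nonneg (hf.nonneg z) (sq_nonneg _))]
    have h1 : regScore a G G' z ^ 2 ≤ (B₁ / a) ^ 2 := by
      rw [← sq_abs]
      exact pow_le_pow_left₀ (abs_nonneg _) (hLb z) 2
    have h2 : (regScore a G G' z - score f f' z) ^ 2 ≤ 2 * (B₁ / a) ^ 2 + 2 * score f f' z ^ 2 := by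
      nlinarith [sq_nonneg (regScore a G G' z + score f f' z)]
    calc _ ≤ f z * (2 * (B₁ / a) ^ 2 + 2 * score f f' z ^ 2) :=
          mul_le_mul_of_nonneg_left h2 (hf.nonneg z)
      _ = _ := by simp only [Pi.add_apply]; ring
  have iR := (i1.fun_add (i0.const_mul ((B₁ / a) ^ 2))).const_mul (4 * C / a)
  rw [integral_densityMeasure hf.continuous.measurable.aemeasurable hf.nonneg]
  have hsum : Integrable fun z => 2 * (f z * (regScore a G G' z - score f f' z) ^ 2) +
      4 * C / a * ((F' z - G' z) ^ 2 + (B₁ / a) ^ 2 * (F z - G z) ^ 2) :=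
    (id.const_mul 2).add iR
  calc ∫ z, f z * (regScore a F F' z - score f f' z) ^ 2
      ≤ ∫ z, (2 * (f z * (regScore a G G' z - score f f' z) ^ 2) +
      4 * C / a * ((F' z - G' z) ^ 2 + (B₁ / a) ^ 2 * (F z - G z) ^ 2)) := by
        refine integral_mono_of_nonneg (Eventually.of_forall fun z =>
          mul_nonneg (hf.nonneg z) (sq_nonneg _)) hsum (Eventually.of_forall fun z => ?_)
        have h1 := mul_regScore_sub_sq_le (F' := F' z) (G' := G' z) ha (hF0 z) (hF1 z)
          (by positivity) (hG0 z) (hfC z) hC.le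
        have h2 : (regScore a F F' z - score f f' z) ^ 2 ≤
            2 * (regScore a G G' z - score f f' z) ^ 2 +
            2 * (regScore a F F' z - regScore a G G' z) ^ 2 := by
          nlinarith [sq_nonneg ((regScore a G G' z - score f f' z) -
            (regScore a F F' z - regScore a G G' z))]
        have h3 := mul_le_mul_of_nonneg_left h2 (hf.nonneg z)
        simp only [regScore] at h1 h3 ⊢
        have h4 : 4 * C / a * ((F' z - G' z) ^ 2 + (B₁ / a) ^ 2 * (F z - G z) ^ 2) =
          2 * (2 * C / a * ((F' z - G' z) ^ 2 + (B₁ / a) ^ 2 * (F z - G z) ^ 2)) := by ring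
        rw [h4]
        nlinarith
    _ = _ := by
        rw [integral_add (id.const_mul 2) iR, integral_const_mul]
        congr 1
        rw [integral_const_mul (4 * C / a)]
        congr 1
        rw [integral_add i1 (i0.const_mul _), integral_const_mul ((B₁ / a) ^ 2)]

variable {ι : Type*} {l : Filter ι} {s a : ι → ℝ}

/-- The density estimators have variances of order `1 / (n * a)` and, for the derivative,
`1 / (n * a ^ 3)`; shifting the kernels by the errors of the smoother costs a power of `s` that
dominates the powers of `1 / a`. -/
theorem isScoreEstimate_residualScore (hκ : IsKernelTriple κ κ' κ'' B₁ B₂)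
    (hf : IsSmoothDensity f f' φ M) (hJ : Integrable (fun z => score f f' z ^ 2 * f z))
    [IsProbabilityMeasure (densityMeasure f)]
    (h2 : MemLp (fun t : ℝ => t) 2 (densityMeasure f)) (h0 : ∫ t, t ∂(densityMeasure f) = 0)
    (hr : Regime l s a) {A : ι → ShiftForm} {N : ι → ℕ} {K : ℝ} (hN : ∀ i, 0 < N i)
    (hNs : ∀ i, (N i : ℝ)⁻¹ ≤ 3 * s i ^ 8) (hA : ∀ i, (A i).Bounded K (s i) (N i) (N i)) :
    IsScoreEstimate (densityMeasure f) l a (B₁ + B₂ + B₁ ^ 2) (score f f')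
      fun i => residualScore κ κ' (a i) (A i) (N i) := by
  obtain ⟨hB₁, hB₂⟩ := hκ.bound_nonneg
  have hK : ∀ i, IsKernelTriple _ _ _ _ _ := fun i => hκ.scale (hr.a_pos i)
  have h0' : ∀ i e z, 0 ≤ kernelMean (kernelScale κ 0 (a i)) (N i)
    (fun j => e j - (A i).eval (N i) e j) z := fun i e =>
      kernelMean_nonneg (hK i).nonneg _ _
  have h1' : ∀ i e z, |kernelMean (kernelScale κ' 1 (a i)) (N i)
    (fun j => e j - (A i).eval (N i) e j) z| ≤ B₁ / a i * kernelMean (kernelScale κ 0 (a i)) (N i)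
    (fun j => e j - (A i).eval (N i) e j) z := fun i e =>
      abs_kernelMean_le (hK i).abs_fst_le _ _
  refine ⟨fun i => (continuous_residualScore_uncurry hκ (hr.a_pos i) _ _).measurable,
    fun i e z => ?_, fun i e x y => ?_, ?_⟩
  · have ha := hr.a_pos i
    refine (abs_regScore_le ha (h0' i e) (h1' i e) (by positivity) z).trans ?_
    gcongr
    nlinarith [sq_nonneg B₁]
  · have ha := hr.a_pos i
    refine (abs_regScore_sub_le ha (h0' i e) (hasDerivAt_kernelMean (hK i).hasDerivAt_fst _ _)
      (hasDerivAt_kernelMean (hK i).hasDerivAt_snd _ _) (h1' i e)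
      (abs_kernelMean_le (hK i).abs_snd_le _ _) (by positivity) (by positivity) x y).trans ?_
    gcongr
    rw [div_pow, ← add_div]
    gcongr
    linarith
  obtain ⟨C, hC, hfC⟩ := exists_le_mul_add_convMeasure hκ hf
  -- the random part of the bound
  set c₀ := ∫ u, κ u ^ 2
  set c₁ := ∫ u, κ' u ^ 2
  set c₂ := ∫ u, κ'' u ^ 2
  have hc₀ : 0 ≤ c₀ := integral_nonneg fun _ => sq_nonneg _
  have hc₁ : 0 ≤ c₁ := integral_nonneg fun _ => sq_nonneg _
  have hc₂ : 0 ≤ c₂ := integral_nonneg fun _ => sq_nonneg _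
  set V := ShiftForm.varBound (densityMeasure f) K
  have hV : 0 ≤ V := ShiftForm.varBound_nonneg _ _
  set g₀ := fun i => (memLp_convMeasure (ν := densityMeasure f) (hK i).continuous_zero.measurable
    (hK i).memLp_zero).toLp
  set g₁ := fun i => (memLp_convMeasure (ν := densityMeasure f) (hK i).continuous_fst.measurable
    (hK i).memLp_fst).toLp
  set U : ι → (ℕ → ℝ) → ℝ := fun i e => 4 * C / a i *
    ((2 * (c₂ / a i ^ 5 * (A i).meanSq (N i) (N i) e) +
      2 * kernelNoise (hK i).memLp_fst (g₁ i) (N i) e) +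
      (B₁ / a i) ^ 2 * (2 * (c₁ / a i ^ 3 * (A i).meanSq (N i) (N i) e) +
      2 * kernelNoise (hK i).memLp_zero (g₀ i) (N i) e)) with hU
  have hU0 : ∀ i e, 0 ≤ U i e := by
    intro i e
    have := hr.a_pos i
    have h1 := (A i).meanSq_nonneg (N i) (N i) e
    have h2 : 0 ≤ kernelNoise (hK i).memLp_fst (g₁ i) (N i) e := sq_nonneg _
    have h3 : 0 ≤ kernelNoise (hK i).memLp_zero (g₀ i) (N i) e := sq_nonneg _
    positivity
  have hbound : ∀ i e, ∫ z, (residualScore κ κ' (a i) (A i) (N i) e z - score f f' z) ^ 2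
      ∂(densityMeasure f) ≤ 2 * (∫ z, f z * (regScore (a i) (convMeasure (scaledLaw κ (a i)) f)
        (convMeasure (scaledLaw κ (a i)) f') z - score f f' z) ^ 2) + U i e := by
    intro i e
    have ha := hr.a_pos i
    refine (integral_residualScore_sub_sq_le hκ hf hJ ha hC (hfC _ ha) _ _
      (h0' i e) (h1' i e)
      (memLp_kernelMean (hK i).memLp_zero _ _)
      (memLp_kernelMean (hK i).memLp_fst _ _)).trans ?_
    have e1 := integral_kernelMean_sub_sq_le (hK i).memLp_fst (hK i).memLp_snd
      (hK i).hasDerivAt_snd (hK i).continuous_snd (memLp_convMeasure (ν := densityMeasure f)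
      (hK i).continuous_fst.measurable (hK i).memLp_fst) (hN i) e ((A i).eval (N i) e)
    have e0 := integral_kernelMean_sub_sq_le (hK i).memLp_zero (hK i).memLp_fst
      (hK i).hasDerivAt_fst (hK i).continuous_fst (memLp_convMeasure (ν := densityMeasure f)
      (hK i).continuous_zero.measurable (hK i).memLp_zero) (hN i) e ((A i).eval (N i) e)
    rw [integral_kernelScale_sq _ _ ha] at e0 e1
    rw [← convMeasure_density_fst hκ hf ha, ← convMeasure_density_zero hκ hf ha]
    simp only [hU]
    gcongr
    · exact e1
    · exact e0
  have hint : ∀ i, Integrable (U i) (errorLaw (densityMeasure f)) ∧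
      ∫ e, U i e ∂(errorLaw (densityMeasure f)) ≤
        (8 * C * V * (c₂ + B₁ ^ 2 * c₁)) * (s i ^ 6 / a i ^ 6) +
        (24 * C * (c₁ + B₁ ^ 2 * c₀)) * (s i ^ 8 / a i ^ 4) := by
    intro i
    have ha := hr.a_pos i
    have hs := hr.s_pos i
    have m1 := ShiftForm.integrable_meanSq h2 (A i) (N i) (N i)
    have m2 := (hA i).integral_meanSq_le hs (hr.s_le_one i) h2 h0
    obtain ⟨n1, n1'⟩ := integral_kernelNoise_le (ν := densityMeasure f)
      (hK i).continuous_fst.measurable (hK i).memLp_fst (N i)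
    obtain ⟨n0, n0'⟩ := integral_kernelNoise_le (ν := densityMeasure f)
      (hK i).continuous_zero.measurable (hK i).memLp_zero (N i)
    rw [integral_kernelScale_sq _ _ ha] at n0' n1'
    have t1 := (((m1.const_mul (c₂ / a i ^ 5)).const_mul 2).fun_add (n1.const_mul 2))
    have t0 := (((m1.const_mul (c₁ / a i ^ 3)).const_mul 2).fun_add
      (n0.const_mul 2)).const_mul ((B₁ / a i) ^ 2)
    refine ⟨(t1.add t0).const_mul (4 * C / a i), ?_⟩
    have hval : ∫ e, U i e ∂(errorLaw (densityMeasure f)) = 4 * C / a i *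
      ((2 * (c₂ / a i ^ 5 * ∫ e, (A i).meanSq (N i) (N i) e ∂(errorLaw (densityMeasure f))) +
      2 * ∫ e, kernelNoise (hK i).memLp_fst (g₁ i) (N i) e ∂(errorLaw (densityMeasure f))) +
      (B₁ / a i) ^ 2 * (2 * (c₁ / a i ^ 3 *
        ∫ e, (A i).meanSq (N i) (N i) e ∂(errorLaw (densityMeasure f))) +
      2 * ∫ e, kernelNoise (hK i).memLp_zero (g₀ i) (N i) e ∂(errorLaw (densityMeasure f)))) := by
      simp only [hU]
      rw [integral_const_mul (4 * C / a i)]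
      congr 1
      rw [integral_add t1 t0, integral_const_mul ((B₁ / a i) ^ 2)]
      congr 1
      · rw [integral_add ((m1.const_mul _).const_mul 2) (n1.const_mul 2), integral_const_mul,
          integral_const_mul, integral_const_mul]
      · congr 1
        rw [integral_add ((m1.const_mul _).const_mul 2) (n0.const_mul 2), integral_const_mul,
          integral_const_mul, integral_const_mul]
    rw [hval]
    have hp1 : 0 ≤ c₁ / a i ^ (2 * 1 + 1) := by positivity
    have hp0 : 0 ≤ c₀ / a i ^ (2 * 0 + 1) := by positivity
    calc _ ≤ 4 * C / a i * ((2 * (c₂ / a i ^ 5 * (V * s i ^ 6)) +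
          2 * ((3 * s i ^ 8) * (c₁ / a i ^ (2 * 1 + 1)))) +
          (B₁ / a i) ^ 2 * (2 * (c₁ / a i ^ 3 * (V * s i ^ 6)) +
          2 * ((3 * s i ^ 8) * (c₀ / a i ^ (2 * 0 + 1))))) := by
            gcongr
            · exact n1'.trans (mul_le_mul_of_nonneg_right (hNs i) hp1)
            · exact n0'.trans (mul_le_mul_of_nonneg_right (hNs i) hp0)
      _ = _ := by
          field_simp
          ring
  have hdet := tendsto_integral_regScore_convMeasure_sub hκ hf hJ hr.a_pos hr.tendsto_a
  have hUz : OpZero (errorLaw (densityMeasure f)) l U := by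
    refine opZero_of_lintegral (fun i => ?_) (Eventually.of_forall fun i =>
      lintegral_ofReal_abs_le (hint i).1 (hU0 i) (hint i).2) ?_
    · have h1 := measurable_kernelNoise (hK i).memLp_fst (g₁ i) (N i)
      have h2 := measurable_kernelNoise (hK i).memLp_zero (g₀ i) (N i)
      simp only [hU]
      fun_prop
    · simpa using (hr.tendsto_pow (p := 6) (q := 6) le_rfl (by norm_num)
        (8 * C * V * (c₂ + B₁ ^ 2 * c₁))).add (hr.tendsto_pow (p := 8) (q := 4) (by norm_num)
        (by norm_num) (24 * C * (c₁ + B₁ ^ 2 * c₀)))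
  refine (((opZero_of_tendsto hdet).const_mul 2).add hUz).mono (Eventually.of_forall fun i e => ?_)
  rw [abs_of_nonneg (integral_nonneg fun _ => sq_nonneg _)]
  exact (hbound i e).trans (le_abs_self _)

end

/-! ### Consistency of the estimator of the Fisher information -/

theorem OpZero.comp_tendsto {Ω ι ι' : Type*} [MeasurableSpace Ω] {P : Measure Ω} {l : Filter ι}
    {l' : Filter ι'} {Z : ι → Ω → ℝ} (hZ : OpZero P l Z) {u : ι' → ι} (hu : Tendsto u l' l) :
    OpZero P l' fun i ω => Z (u i) ω :=
  fun δ hδ η hη => hu.eventually (hZ δ hδ η hη)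


/-- The weak law of large numbers, from the strong law. -/
theorem opZero_mean_sub_integral {Ω : Type*} [MeasurableSpace Ω] {P : Measure Ω}
    [IsProbabilityMeasure P] {μ : Measure ℝ} {e : ℕ → Ω → ℝ} (he : ∀ j, Measurable (e j))
    (hlaw : ∀ j, P.map (e j) = μ) (hind : Pairwise fun i j => IndepFun (e i) (e j) P)
    {g : ℝ → ℝ} (hgm : Measurable g) (hg : Integrable g μ) :
    OpZero P atTop fun (n : ℕ) ω =>
      (n : ℝ)⁻¹ * ∑ j ∈ Finset.range n, g (e j ω) - ∫ t, g t ∂μ := by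
  have hint : ∫ ω, g (e 0 ω) ∂P = ∫ t, g t ∂μ := by
    rw [← hlaw 0, integral_map (he 0).aemeasurable hgm.aestronglyMeasurable]
  have h1 := strong_law_ae_real (μ := P) (fun j ω => g (e j ω))
    (by
      have : Integrable g (P.map (e 0)) := by rwa [hlaw 0]
      exact this.comp_measurable (he 0))
    (fun i j hij => (hind hij).comp hgm hgm)
    (fun i => (IdentDistrib.mk (he i).aemeasurable (he 0).aemeasurable
      (by rw [hlaw, hlaw])).comp hgm)
  rw [hint] at h1
  have h2 := tendstoInMeasure_of_tendsto_ae (μ := P)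
    (f := fun (n : ℕ) ω => (∑ j ∈ Finset.range n, g (e j ω)) / n)
    (g := fun _ => ∫ t, g t ∂μ) (fun n => by
      have : ∀ j, Measurable fun ω => g (e j ω) := fun j => hgm.comp (he j)
      exact Measurable.aestronglyMeasurable (by fun_prop)) h1
  intro δ hδ η hη
  have h3 := h2 (ENNReal.ofReal δ) (ENNReal.ofReal_pos.2 hδ)
  have h4 : (0 : ℝ≥0∞) < ENNReal.ofReal η := ENNReal.ofReal_pos.2 hη
  filter_upwards [h3.eventually_lt_const h4] with n hn
  refine (measure_mono fun ω hω => ?_).trans hn.le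
  simp only [mem_ofPred_eq] at hω ⊢
  rw [edist_dist, Real.dist_eq]
  refine ENNReal.ofReal_le_ofReal ?_
  rw [div_eq_inv_mul]
  exact hω.le

theorem opZero_errorLaw_mean {μ : Measure ℝ} [IsProbabilityMeasure μ] {g : ℝ → ℝ}
    (hgm : Measurable g) (hg : Integrable g μ) :
    OpZero (errorLaw μ) atTop fun (n : ℕ) e =>
      (n : ℝ)⁻¹ * ∑ j ∈ Finset.range n, g (e j) - ∫ t, g t ∂μ :=
  opZero_mean_sub_integral (e := fun j (e : ℕ → ℝ) => e j) (fun j => measurable_pi_apply j)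
    errorLaw_map_eval errorLaw_indepFun hgm hg

section

variable {μ : Measure ℝ} [IsProbabilityMeasure μ] {ι : Type*} {l : Filter ι} {s a : ι → ℝ}
  {ℓ : ℝ → ℝ} {Λ : ℝ} {L : ι → (ℕ → ℝ) → ℝ → ℝ}

theorem integral_mean_sq_le {ψ : ℝ → ℝ} (hψ : MemLp ψ 2 μ) (N : ℕ) :
    Integrable (fun e => (N : ℝ)⁻¹ * ∑ j ∈ Finset.range N, ψ (e j) ^ 2) (errorLaw μ) ∧
    ∫ e, (N : ℝ)⁻¹ * ∑ j ∈ Finset.range N, ψ (e j) ^ 2 ∂(errorLaw μ) ≤ ∫ t, ψ t ^ 2 ∂μ := by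
  have hi : ∀ j, Integrable (fun e : ℕ → ℝ => ψ (e j) ^ 2) (errorLaw μ) := fun j =>
    (measurePreserving_eval_errorLaw j).integrable_comp_of_integrable hψ.integrable_sq
  have hv : ∀ j, ∫ e, ψ (e j) ^ 2 ∂(errorLaw μ) = ∫ t, ψ t ^ 2 ∂μ := by
    intro j
    have h := hψ.integrable_sq.aestronglyMeasurable
    rw [← errorLaw_map_eval (μ := μ) j] at h
    exact (integral_map (μ := errorLaw μ) (φ := fun e : ℕ → ℝ => e j)
      (measurable_pi_apply j).aemeasurable h).symm.trans (by rw [errorLaw_map_eval])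
  refine ⟨(integrable_finsetSum _ fun j _ => hi j).const_mul _, ?_⟩
  rw [integral_const_mul, integral_finsetSum _ fun j _ => hi j]
  simp only [hv, Finset.sum_const, Finset.card_range, nsmul_eq_mul]
  rw [← mul_assoc]
  exact mul_le_of_le_one_left (integral_nonneg fun _ => sq_nonneg _) inv_mul_le_one

theorem IsScoreEstimate.measurable_apply (hL : IsScoreEstimate μ l a Λ ℓ L) (i : ι) (e : ℕ → ℝ) :
    Measurable (L i e) :=
  (hL.measurable i).comp (measurable_const.prodMk measurable_id)

theorem IsScoreEstimate.memLp (hL : IsScoreEstimate μ l a Λ ℓ L) (i : ι) (e : ℕ → ℝ) (D : ℝ) :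
    MemLp (fun z => L i e (z - D)) 2 μ :=
  MemLp.of_bound ((hL.measurable_apply i e).comp (measurable_id.sub_const D)).aestronglyMeasurable
    (Λ / a i) (Eventually.of_forall fun _ => hL.abs_le i e _)

theorem IsScoreEstimate.nonneg (hL : IsScoreEstimate μ l a Λ ℓ L) {i : ι} (ha : 0 < a i) :
    0 ≤ Λ := by
  have := (abs_nonneg _).trans (hL.abs_le i (fun _ => 0) 0)
  rw [div_eq_mul_inv] at this
  exact nonneg_of_mul_nonneg_left this (by positivity)

theorem abs_mean_sq_sub_le (N : ℕ) (x y : ℕ → ℝ) {E : ℝ}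
    (hD : (N : ℝ)⁻¹ * ∑ j ∈ Finset.range N, (x j - y j) ^ 2 ≤ E) :
    |(N : ℝ)⁻¹ * ∑ j ∈ Finset.range N, x j ^ 2 - (N : ℝ)⁻¹ * ∑ j ∈ Finset.range N, y j ^ 2| ≤
      E + 2 * (√E * √((N : ℝ)⁻¹ * ∑ j ∈ Finset.range N, y j ^ 2)) := by
  have hNi : (0 : ℝ) ≤ (N : ℝ)⁻¹ := by positivity
  have hd : 0 ≤ (N : ℝ)⁻¹ * ∑ j ∈ Finset.range N, (x j - y j) ^ 2 :=
    mul_nonneg hNi (Finset.sum_nonneg fun _ _ => sq_nonneg _)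
  have hy : 0 ≤ (N : ℝ)⁻¹ * ∑ j ∈ Finset.range N, y j ^ 2 :=
    mul_nonneg hNi (Finset.sum_nonneg fun _ _ => sq_nonneg _)
  have hcs : |(N : ℝ)⁻¹ * ∑ j ∈ Finset.range N, (x j - y j) * y j| ≤
      √E * √((N : ℝ)⁻¹ * ∑ j ∈ Finset.range N, y j ^ 2) := by
    have h := Finset.sum_mul_sq_le_sq_mul_sq (Finset.range N) (fun j => x j - y j) y
    rw [← Real.sqrt_mul (hd.trans hD)]
    refine Real.abs_le_sqrt ?_
    calc _ = (N : ℝ)⁻¹ ^ 2 * (∑ j ∈ Finset.range N, (x j - y j) * y j) ^ 2 := by ring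
      _ ≤ (N : ℝ)⁻¹ ^ 2 * ((∑ j ∈ Finset.range N, (x j - y j) ^ 2) *
          ∑ j ∈ Finset.range N, y j ^ 2) := by gcongr
      _ = ((N : ℝ)⁻¹ * ∑ j ∈ Finset.range N, (x j - y j) ^ 2) *
          ((N : ℝ)⁻¹ * ∑ j ∈ Finset.range N, y j ^ 2) := by ring
      _ ≤ _ := mul_le_mul_of_nonneg_right hD hy
  have hid : (N : ℝ)⁻¹ * ∑ j ∈ Finset.range N, x j ^ 2 -
      (N : ℝ)⁻¹ * ∑ j ∈ Finset.range N, y j ^ 2 =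
      (N : ℝ)⁻¹ * ∑ j ∈ Finset.range N, (x j - y j) ^ 2 +
        2 * ((N : ℝ)⁻¹ * ∑ j ∈ Finset.range N, (x j - y j) * y j) := by
    rw [← mul_sub, mul_left_comm, ← mul_add]
    congr 1
    rw [Finset.mul_sum, ← Finset.sum_add_distrib, ← Finset.sum_sub_distrib]
    exact Finset.sum_congr rfl fun j _ => by ring
  rw [hid]
  refine (abs_add_le _ _).trans (add_le_add ?_ ?_)
  · rwa [abs_of_nonneg hd]
  · rw [abs_mul, abs_two]
    gcongr

theorem opZero_mul_meanSq (h2 : MemLp (fun t : ℝ => t) 2 μ) (h0 : ∫ t, t ∂μ = 0)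
    (hr : Regime l s a) {A : ι → ShiftForm} {M N : ι → ℕ} {K : ℝ}
    (hA : ∀ i, (A i).Bounded K (s i) (M i) (N i)) {c : ι → ℝ} (hc : ∀ i, 0 ≤ c i)
    (hc0 : Tendsto (fun i => c i * s i ^ 6) l (𝓝 0)) :
    OpZero (errorLaw μ) l fun i e => c i * (A i).meanSq (M i) (N i) e := by
  refine opZero_of_lintegral (V := fun i => ShiftForm.varBound μ K * (c i * s i ^ 6))
    (fun i => (ShiftForm.measurable_meanSq _ _ _).const_mul _) (Eventually.of_forall fun i =>
    lintegral_ofReal_abs_le ((ShiftForm.integrable_meanSq h2 (A i) (M i) (N i)).const_mul _)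
      (fun e => mul_nonneg (hc i) ((A i).meanSq_nonneg _ _ _)) ?_) ?_
  · rw [integral_const_mul, mul_left_comm]
    exact mul_le_mul_of_nonneg_left
      ((hA i).integral_meanSq_le (hr.s_pos i) (hr.s_le_one i) h2 h0) (hc i)
  · simpa using hc0.const_mul (ShiftForm.varBound μ K)

/-- A score estimator from an independent sample, averaged over residuals, consistently estimates
the second moment of its limit. -/
theorem IsScoreEstimate.opZero_mean_sq_sub (hL : IsScoreEstimate μ l a Λ ℓ L) (hℓm : Measurable ℓ)
    (hℓ : MemLp ℓ 2 μ) (h2 : MemLp (fun t : ℝ => t) 2 μ) (h0 : ∫ t, t ∂μ = 0)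
    (hr : Regime l s a) {A : ι → ShiftForm} {N : ι → ℕ} {K : ℝ} (hN : Tendsto N l atTop)
    (hA : ∀ i, (A i).Bounded K (s i) (N i) (N i)) :
    OpZero ((errorLaw μ).prod (errorLaw μ)) l fun i ω =>
      (N i : ℝ)⁻¹ * ∑ j ∈ Finset.range (N i), L i ω.2 (ω.1 j - (A i).eval (N i) ω.1 j) ^ 2 -
        ∫ t, ℓ t ^ 2 ∂μ := by
  -- the squared differences at the true errors
  have z1 : OpZero ((errorLaw μ).prod (errorLaw μ)) l fun i ω =>
      (N i : ℝ)⁻¹ * ∑ j ∈ Finset.range (N i), (L i ω.2 (ω.1 j) - ℓ (ω.1 j)) ^ 2 := by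
    refine opZero_of_lintegral_le (fun i => ?_) (Eventually.of_forall fun i e => ?_) hL.opZero
    · have : ∀ j, Measurable fun ω : (ℕ → ℝ) × (ℕ → ℝ) => L i ω.2 (ω.1 j) := fun j =>
        (hL.measurable i).comp (measurable_snd.prodMk ((measurable_pi_apply j).comp measurable_fst))
      have h' : ∀ j, Measurable fun ω : (ℕ → ℝ) × (ℕ → ℝ) => ℓ (ω.1 j) := fun j =>
        hℓm.comp ((measurable_pi_apply j).comp measurable_fst)
      exact (Finset.measurable_sum _ fun j _ => ((this j).sub (h' j)).pow_const 2).const_mul _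
    · have hm : MemLp (fun z => L i e z - ℓ z) 2 μ :=
        MemLp.sub (by simpa using hL.memLp i e 0) hℓ
      obtain ⟨g1, g2⟩ := integral_mean_sq_le hm (N i)
      exact lintegral_ofReal_abs_le g1 (fun e => mul_nonneg (by positivity)
        (Finset.sum_nonneg fun _ _ => sq_nonneg _)) g2
  have z2 : OpZero ((errorLaw μ).prod (errorLaw μ)) l fun i ω =>
      (Λ / a i ^ 2) ^ 2 * (A i).meanSq (N i) (N i) ω.1 := by
    have h := opZero_mul_meanSq h2 h0 hr hA (c := fun i => (Λ / a i ^ 2) ^ 2)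
      (fun i => sq_nonneg _) ?_
    · exact h.comp_fst
    · refine (hr.tendsto_pow (p := 6) (q := 4) (by norm_num) (by norm_num) (Λ ^ 2)).congr
        fun i => ?_
      have := hr.a_pos i
      field_simp
  have z3 : OpZero ((errorLaw μ).prod (errorLaw μ)) l fun i ω =>
      (N i : ℝ)⁻¹ * ∑ j ∈ Finset.range (N i), ℓ (ω.1 j) ^ 2 - ∫ t, ℓ t ^ 2 ∂μ := by
    have h := opZero_errorLaw_mean (μ := μ) (g := fun t => ℓ t ^ 2) (hℓm.pow_const 2)
      hℓ.integrable_sq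
    exact (h.comp_tendsto hN).comp_fst
  have z4 : OpOne ((errorLaw μ).prod (errorLaw μ)) l fun i ω =>
      (N i : ℝ)⁻¹ * ∑ j ∈ Finset.range (N i), ℓ (ω.1 j) ^ 2 := by
    have h := z3.opOne.add (opOne_const (∫ t, ℓ t ^ 2 ∂μ))
    refine h.mono (Eventually.of_forall fun i ω => ?_)
    rw [sub_add_cancel]
  have zD := (z1.const_mul 2).add (z2.const_mul 2)
  refine ((zD.add ((zD.sqrt.mul_opOne z4.sqrt).const_mul 2)).abs.add z3.abs).mono
    (Eventually.of_forall fun i ω => ?_)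
  have hD : (N i : ℝ)⁻¹ * ∑ j ∈ Finset.range (N i),
      (L i ω.2 (ω.1 j - (A i).eval (N i) ω.1 j) - ℓ (ω.1 j)) ^ 2 ≤
      2 * ((N i : ℝ)⁻¹ * ∑ j ∈ Finset.range (N i), (L i ω.2 (ω.1 j) - ℓ (ω.1 j)) ^ 2) +
        2 * ((Λ / a i ^ 2) ^ 2 * (A i).meanSq (N i) (N i) ω.1) := by
    rw [ShiftForm.meanSq, mul_left_comm, mul_left_comm ((Λ / a i ^ 2) ^ 2),
      mul_left_comm 2 ((N i : ℝ)⁻¹), ← mul_add]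
    refine mul_le_mul_of_nonneg_left ?_ (by positivity)
    rw [Finset.mul_sum, Finset.mul_sum, Finset.mul_sum, ← Finset.sum_add_distrib]
    refine Finset.sum_le_sum fun j _ => ?_
    have hl := hL.lipschitz i ω.2 (ω.1 j - (A i).eval (N i) ω.1 j) (ω.1 j)
    rw [sub_sub_cancel_left, abs_neg] at hl
    have hl2 := pow_le_pow_left₀ (abs_nonneg _) hl 2
    rw [mul_pow, sq_abs, sq_abs] at hl2
    nlinarith [sq_nonneg ((L i ω.2 (ω.1 j - (A i).eval (N i) ω.1 j) - L i ω.2 (ω.1 j)) -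
      (L i ω.2 (ω.1 j) - ℓ (ω.1 j)))]
  have h := abs_mean_sq_sub_le (N i) _ _ hD
  have h' := abs_sub_le ((N i : ℝ)⁻¹ *
    ∑ j ∈ Finset.range (N i), L i ω.2 (ω.1 j - (A i).eval (N i) ω.1 j) ^ 2)
    ((N i : ℝ)⁻¹ * ∑ j ∈ Finset.range (N i), ℓ (ω.1 j) ^ 2) (∫ t, ℓ t ^ 2 ∂μ)
  refine le_trans ?_ (le_abs_self _)
  refine h'.trans ?_
  exact add_le_add (h.trans (le_abs_self _)) le_rfl

end

/-! ### Weighted sums of estimated scores -/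

theorem memLp_smul_const {μ : Measure ℝ} {g : ℝ → ℝ} (hg : MemLp g 2 μ) (w : L2Line) :
    MemLp (fun t => g t • w) 2 μ :=
  MemLp.smul (p := 2) (q := ∞) (r := 2) (f := fun _ => w) (φ := g) (memLp_top_const w) hg

namespace ShiftForm

variable {A : ShiftForm} {K s : ℝ} {N : ℕ} {μ : Measure ℝ} [IsProbabilityMeasure μ]

theorem Bounded.nonneg (h : A.Bounded K s N N) (hN : 0 < N) : 0 ≤ K :=
  (Finset.sum_nonneg fun _ _ => abs_nonneg _).trans (h.row_le 0 hN)

/-- The total mutual influence of pairs of observations. -/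
theorem Bounded.sum_mutual_le (h : A.Bounded K s N N) (hs : 0 < s) (v : ℕ → ℝ)
    (hv : ∀ j, 0 ≤ v j) :
    ∑ j ∈ Finset.range N, ∑ k ∈ Finset.range N, v j * v k * (|A.W j k| * |A.W k j|) ≤
      K ^ 2 * s ^ 6 * ∑ j ∈ Finset.range N, v j ^ 2 := by
  rcases Nat.eq_zero_or_pos N with rfl | hN
  · simp
  have hK := h.nonneg hN
  have h1 : ∑ j ∈ Finset.range N, ∑ k ∈ Finset.range N, v j ^ 2 * |A.W j k| ≤
      K * ∑ j ∈ Finset.range N, v j ^ 2 := by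
    rw [Finset.mul_sum]
    refine Finset.sum_le_sum fun j hj => ?_
    rw [← Finset.mul_sum, mul_comm]
    exact mul_le_mul_of_nonneg_right (h.row_le j (Finset.mem_range.1 hj)) (sq_nonneg _)
  have h2 : ∑ j ∈ Finset.range N, ∑ k ∈ Finset.range N, v k ^ 2 * |A.W j k| ≤
      K * ∑ j ∈ Finset.range N, v j ^ 2 := by
    rw [Finset.sum_comm, Finset.mul_sum]
    refine Finset.sum_le_sum fun j hj => ?_
    rw [← Finset.mul_sum, mul_comm]
    exact mul_le_mul_of_nonneg_right (h.col_le j (Finset.mem_range.1 hj)) (sq_nonneg _)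
  calc _ ≤ ∑ j ∈ Finset.range N, ∑ k ∈ Finset.range N,
        (K * s ^ 6 / 2) * (v j ^ 2 * |A.W j k| + v k ^ 2 * |A.W j k|) := by
        refine Finset.sum_le_sum fun j hj => Finset.sum_le_sum fun k hk => ?_
        have e1 := h.abs_W_le k (Finset.mem_range.1 hk) j (Finset.mem_range.1 hj)
        calc _ ≤ (v j ^ 2 + v k ^ 2) / 2 * (|A.W j k| * (K * s ^ 6)) := by
              have := mul_nonneg (hv j) (hv k)
              gcongr
              nlinarith [sq_nonneg (v j - v k)]
          _ = _ := by ring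
    _ = (K * s ^ 6 / 2) * (∑ j ∈ Finset.range N, ∑ k ∈ Finset.range N, v j ^ 2 * |A.W j k| +
        ∑ j ∈ Finset.range N, ∑ k ∈ Finset.range N, v k ^ 2 * |A.W j k|) := by
        simp only [← Finset.mul_sum, Finset.sum_add_distrib]
    _ ≤ (K * s ^ 6 / 2) * (K * ∑ j ∈ Finset.range N, v j ^ 2 +
        K * ∑ j ∈ Finset.range N, v j ^ 2) := by gcongr
    _ = _ := by ring

/-- The estimation errors form a weakly correlated sequence: weighted sums with weights in a
Hilbert space are of the same order as for independent variables with bounded variance. -/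
theorem Bounded.integral_norm_sq_sum_eval_le (h : A.Bounded K s N N) (hs : 0 < s)
    (hNs : (N : ℝ) * s ^ 8 ≤ 1) (h2 : MemLp (fun t : ℝ => t) 2 μ) (h0 : ∫ t, t ∂μ = 0)
    (u : ℕ → L2Line) :
    Integrable (fun e => ‖∑ j ∈ Finset.range N, A.eval N e j • u j‖ ^ 2) (errorLaw μ) ∧
    ∫ e, ‖∑ j ∈ Finset.range N, A.eval N e j • u j‖ ^ 2 ∂(errorLaw μ) ≤
      varBound μ K * ∑ j ∈ Finset.range N, ‖u j‖ ^ 2 := by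
  rcases Nat.eq_zero_or_pos N with rfl | hN
  · simp
  have hK := h.nonneg hN
  have hσ := integral_nonneg (μ := μ) (f := fun t : ℝ => t ^ 2) fun t => sq_nonneg t
  set w : ℕ → L2Line := fun i => ∑ j ∈ Finset.range N, A.W j i • u j with hw
  have hdec : ∀ e, ∑ j ∈ Finset.range N, A.eval N e j • u j =
      ∑ j ∈ Finset.range N, A.b j • u j + ∑ i ∈ Finset.range N, e i • w i := by
    intro e
    simp only [hw, Finset.smul_sum]
    rw [Finset.sum_comm, ← Finset.sum_add_distrib]
    refine Finset.sum_congr rfl fun j _ => ?_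
    rw [eval, affineShift, add_smul, Finset.sum_smul]
    congr 1
    refine Finset.sum_congr rfl fun i _ => ?_
    rw [smul_smul, mul_comm]
  have hb : ‖∑ j ∈ Finset.range N, A.b j • u j‖ ^ 2 ≤
      K ^ 2 * ∑ j ∈ Finset.range N, ‖u j‖ ^ 2 := by
    have h1 : ‖∑ j ∈ Finset.range N, A.b j • u j‖ ≤
        K * s ^ 4 * ∑ j ∈ Finset.range N, ‖u j‖ := by
      refine (norm_sum_le _ _).trans ?_
      rw [Finset.mul_sum]
      refine Finset.sum_le_sum fun j hj => ?_
      rw [norm_smul, Real.norm_eq_abs]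
      exact mul_le_mul_of_nonneg_right (h.abs_b_le j (Finset.mem_range.1 hj)) (norm_nonneg _)
    have h3 := sq_sum_le_card_mul_sum_sq (s := Finset.range N) (f := fun j => ‖u j‖)
    rw [Finset.card_range] at h3
    calc _ ≤ (K * s ^ 4 * ∑ j ∈ Finset.range N, ‖u j‖) ^ 2 := by gcongr
      _ = K ^ 2 * s ^ 8 * (∑ j ∈ Finset.range N, ‖u j‖) ^ 2 := by ring
      _ ≤ K ^ 2 * s ^ 8 * (N * ∑ j ∈ Finset.range N, ‖u j‖ ^ 2) := by gcongr
      _ = K ^ 2 * (N * s ^ 8) * ∑ j ∈ Finset.range N, ‖u j‖ ^ 2 := by ring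
      _ ≤ K ^ 2 * 1 * ∑ j ∈ Finset.range N, ‖u j‖ ^ 2 := by
          gcongr
      _ = _ := by ring
  have hwn : ∑ i ∈ Finset.range N, ‖w i‖ ^ 2 ≤ K ^ 2 * ∑ j ∈ Finset.range N, ‖u j‖ ^ 2 := by
    have h1 : ∀ i ∈ Finset.range N, ‖w i‖ ^ 2 ≤
        K * ∑ j ∈ Finset.range N, |A.W j i| * ‖u j‖ ^ 2 := by
      intro i hi
      have e1 : ‖w i‖ ≤ ∑ j ∈ Finset.range N, |A.W j i| * ‖u j‖ := by
        refine (norm_sum_le _ _).trans (Finset.sum_le_sum fun j _ => ?_)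
        rw [norm_smul, Real.norm_eq_abs]
      have e2 : (∑ j ∈ Finset.range N, |A.W j i| * ‖u j‖) ^ 2 ≤
          (∑ j ∈ Finset.range N, |A.W j i|) * ∑ j ∈ Finset.range N, |A.W j i| * ‖u j‖ ^ 2 := by
        refine Finset.sum_sq_le_sum_mul_sum_of_sq_le_mul _ (fun j _ => abs_nonneg _)
          (fun j _ => by positivity) fun j _ => le_of_eq (by ring)
      have e3 := h.col_le i (Finset.mem_range.1 hi)
      calc _ ≤ (∑ j ∈ Finset.range N, |A.W j i| * ‖u j‖) ^ 2 := by gcongr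
        _ ≤ _ := e2.trans (mul_le_mul_of_nonneg_right e3
            (Finset.sum_nonneg fun j _ => by positivity))
    refine (Finset.sum_le_sum h1).trans ?_
    rw [← Finset.mul_sum, sq, mul_assoc]
    refine mul_le_mul_of_nonneg_left ?_ hK
    rw [Finset.sum_comm, Finset.mul_sum]
    refine Finset.sum_le_sum fun j hj => ?_
    rw [← Finset.sum_mul]
    exact mul_le_mul_of_nonneg_right (h.row_le j (Finset.mem_range.1 hj)) (sq_nonneg _)
  have hA := integral_norm_sq_sum_sub_mean_le (P := errorLaw μ) (μ := μ)
    (e := fun j (e : ℕ → ℝ) => e j) (fun j => measurable_pi_apply j) errorLaw_map_eval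
    errorLaw_indepFun (Finset.range N) (Ψ := fun i t => t • w i)
    fun i _ => memLp_smul_const h2 (w i)
  have hm : ∀ i, ∫ t, t • w i ∂μ = 0 := fun i => by rw [integral_smul_const, h0, zero_smul]
  simp only [hm, sub_zero, norm_smul, mul_pow, integral_mul_const, Real.norm_eq_abs, sq_abs]
    at hA
  rw [← Finset.mul_sum] at hA
  have hle : ∀ e, ‖∑ j ∈ Finset.range N, A.eval N e j • u j‖ ^ 2 ≤
      2 * (K ^ 2 * ∑ j ∈ Finset.range N, ‖u j‖ ^ 2) +
        2 * ‖∑ i ∈ Finset.range N, e i • w i‖ ^ 2 := by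
    intro e
    rw [hdec]
    have := norm_add_le (∑ j ∈ Finset.range N, A.b j • u j) (∑ i ∈ Finset.range N, e i • w i)
    have h3 := pow_le_pow_left₀ (norm_nonneg _) this 2
    nlinarith [sq_nonneg (‖∑ j ∈ Finset.range N, A.b j • u j‖ -
      ‖∑ i ∈ Finset.range N, e i • w i‖)]
  have hI : Integrable (fun e => 2 * (K ^ 2 * ∑ j ∈ Finset.range N, ‖u j‖ ^ 2) +
        2 * ‖∑ i ∈ Finset.range N, e i • w i‖ ^ 2) (errorLaw μ) :=
    (integrable_const _).add (hA.1.const_mul 2)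
  have hc : Continuous fun e => ‖∑ j ∈ Finset.range N, A.eval N e j • u j‖ ^ 2 := by fun_prop
  refine ⟨hI.mono' hc.measurable.aestronglyMeasurable (Eventually.of_forall fun e => by
    rw [Real.norm_of_nonneg (sq_nonneg _)]; exact hle e), ?_⟩
  refine (integral_mono_of_nonneg (Eventually.of_forall fun e => sq_nonneg _) hI
    (Eventually.of_forall hle)).trans ?_
  rw [integral_add (integrable_const _) (hA.1.const_mul 2), integral_const, integral_const_mul
      (2 : ℝ)]
  simp only [probReal_univ, one_smul, varBound]
  nlinarith [hA.2, mul_le_mul_of_nonneg_left hwn hσ]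

end ShiftForm

section

variable {Ω Ω' ι : Type*} [MeasurableSpace Ω] [MeasurableSpace Ω'] {P : Measure Ω}
  {P' : Measure Ω'} [IsProbabilityMeasure P] [IsProbabilityMeasure P'] {l : Filter ι}

theorem opZero_of_integral_sq_le {Z : ι → Ω × Ω' → ℝ} (hZ : ∀ i, Measurable (Z i))
    {V : ι → Ω' → ℝ} (hV : ∀ i ω', Integrable (fun ω => Z i (ω, ω') ^ 2) P ∧
      ∫ ω, Z i (ω, ω') ^ 2 ∂P ≤ V i ω') (h : OpZero P' l V) : OpZero (P.prod P') l Z := by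
  have h1 : OpZero (P.prod P') l fun i ω => Z i ω ^ 2 :=
    opZero_of_lintegral_le (fun i => (hZ i).pow_const 2) (Eventually.of_forall fun i ω' =>
      lintegral_ofReal_abs_le (hV i ω').1 (fun _ => sq_nonneg _) (hV i ω').2) h
  exact h1.sqrt.mono (Eventually.of_forall fun i ω => by rw [Real.sqrt_sq_eq_abs, abs_abs])

theorem opOne_of_integral_sq_le {Z : ι → Ω × Ω' → ℝ} (hZ : ∀ i, Measurable (Z i))
    {V : ι → Ω' → ℝ} (hV : ∀ i ω', Integrable (fun ω => Z i (ω, ω') ^ 2) P ∧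
      ∫ ω, Z i (ω, ω') ^ 2 ∂P ≤ V i ω') (h : OpOne P' l V) : OpOne (P.prod P') l Z := by
  have h1 : OpOne (P.prod P') l fun i ω => Z i ω ^ 2 :=
    opOne_of_lintegral_le (fun i => (hZ i).pow_const 2) (Eventually.of_forall fun i ω' =>
      lintegral_ofReal_abs_le (hV i ω').1 (fun _ => sq_nonneg _) (hV i ω').2) h
  exact h1.sqrt.mono (Eventually.of_forall fun i ω => by rw [Real.sqrt_sq_eq_abs, abs_abs])

/-- Measurability of the norm of a weighted sum in a Hilbert space. -/
theorem measurable_norm_sum_smul {c : ℕ → Ω × Ω' → ℝ} (hc : ∀ j, Measurable (c j))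
    {u : Ω' → ℕ → L2Line} (hu : ∀ j, StronglyMeasurable fun ω => u ω j) (N : ℕ) (x : ℝ) :
    Measurable fun ω : Ω × Ω' => x * ‖∑ j ∈ Finset.range N, c j ω • u ω.2 j‖ := by
  refine Measurable.const_mul ?_ _
  refine StronglyMeasurable.measurable (StronglyMeasurable.norm ?_)
  refine Finset.stronglyMeasurable_fun_sum _ fun j _ => ?_
  exact (hc j).stronglyMeasurable.smul ((hu j).comp_measurable measurable_snd)

end

section

variable {f f' φ : ℝ → ℝ} {M : ℝ}

theorem measurable_score (hf : IsSmoothDensity f f' φ M) : Measurable (score f f') :=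
  hf.continuous_deriv.measurable.neg.div hf.continuous.measurable

theorem memLp_score (hf : IsSmoothDensity f f' φ M)
    (hJ : Integrable (fun z => score f f' z ^ 2 * f z)) :
    MemLp (score f f') 2 (densityMeasure f) := by
  rw [memLp_two_iff_integrable_sq (measurable_score hf).aestronglyMeasurable,
    integrable_densityMeasure_iff hf.continuous.measurable hf.nonneg]
  simpa only [mul_comm] using hJ

theorem integral_score_sq (hf : IsSmoothDensity f f' φ M) :
    ∫ z, score f f' z ^ 2 ∂(densityMeasure f) = fisherInfo f f' := by
  rw [integral_densityMeasure hf.continuous.measurable.aemeasurable hf.nonneg, fisherInfo]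
  simp only [mul_comm]

theorem mul_score (hf : IsSmoothDensity f f' φ M) (z : ℝ) : f z * score f f' z = -f' z := by
  unfold score
  by_cases h : f z = 0
  · rw [h, hf.deriv_eq_zero h]; simp
  · field_simp

theorem integral_score (hf : IsSmoothDensity f f' φ M) :
    ∫ z, score f f' z ∂(densityMeasure f) = 0 := by
  rw [integral_densityMeasure hf.continuous.measurable.aemeasurable hf.nonneg]
  simp_rw [mul_score hf]
  rw [integral_neg, neg_eq_zero]
  -- the primitive of `f'` is integrable, hence vanishes at both ends
  exact integral_eq_zero_of_hasDerivAt_of_integrable hf.hasDerivAt hf.integrable_deriv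
    hf.integrable

/-- The Fisher information is positive: otherwise `f` would be constant. -/
theorem fisherInfo_pos (hf : IsSmoothDensity f f' φ M)
    (hJ : Integrable (fun z => score f f' z ^ 2 * f z)) : 0 < fisherInfo f f' := by
  have h0 : 0 ≤ᵐ[volume] fun z => score f f' z ^ 2 * f z :=
    Eventually.of_forall fun z => mul_nonneg (sq_nonneg _) (hf.nonneg z)
  refine lt_of_le_of_ne (integral_nonneg fun z => mul_nonneg (sq_nonneg _) (hf.nonneg z)) ?_
  intro h
  have h1 := (integral_eq_zero_iff_of_nonneg_ae h0 hJ).1 h.symm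
  have h2 : f' =ᵐ[volume] 0 := by
    filter_upwards [h1] with z hz
    simp only [Pi.zero_apply, mul_eq_zero, pow_eq_zero_iff two_ne_zero] at hz ⊢
    rcases hz with hz | hz
    · have := mul_score hf z
      rw [hz] at this
      linarith
    · exact hf.deriv_eq_zero hz
  have h3 : ∀ z, f z = 0 := by
    intro z
    rw [hf.eq_integral z]
    exact integral_eq_zero_of_ae (ae_restrict_of_ae h2)
  have := hf.integral_eq_one
  simp [h3] at this

end

section

variable {f f' φ : ℝ → ℝ} {M : ℝ} [IsProbabilityMeasure (densityMeasure f)]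
  {ι : Type*} {l : Filter ι} {s a : ι → ℝ} {Λ K : ℝ} {L : ι → (ℕ → ℝ) → ℝ → ℝ}
  {A : ι → ShiftForm} {N : ι → ℕ} {u : ι → (ℕ → ℝ) → ℕ → L2Line}

/-- The weights `u i e j` may depend on the errors of the other half of the sample; the mean of
their squared norms is bounded in probability. Here `s ^ 8` stands for the reciprocal of the
sample size. -/
structure IsWeights (P : Measure (ℕ → ℝ)) (l : Filter ι) (s : ι → ℝ) (N : ι → ℕ)
    (u : ι → (ℕ → ℝ) → ℕ → L2Line) : Prop where
  stronglyMeasurable : ∀ i j, StronglyMeasurable fun e => u i e j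
  sum_eq_zero : ∀ i e, ∑ j ∈ Finset.range (N i), u i e j = 0
  opOne : OpOne P l fun i e => s i ^ 8 * ∑ j ∈ Finset.range (N i), ‖u i e j‖ ^ 2

/-- Sums of independent centred functions of the errors. -/
theorem integral_norm_sq_sum_smul_le {μ : Measure ℝ} [IsProbabilityMeasure μ]
    {g : ℝ → ℝ} (hg : MemLp g 2 μ) (hg0 : ∫ t, g t ∂μ = 0) (N : ℕ) (u : ℕ → L2Line) (x : ℝ) :
    Integrable (fun e => (x ^ 4 * ‖∑ j ∈ Finset.range N, g (e j) • u j‖) ^ 2) (errorLaw μ) ∧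
    ∫ e, (x ^ 4 * ‖∑ j ∈ Finset.range N, g (e j) • u j‖) ^ 2 ∂(errorLaw μ) ≤
      (∫ t, g t ^ 2 ∂μ) * (x ^ 8 * ∑ j ∈ Finset.range N, ‖u j‖ ^ 2) := by
  have hA := integral_norm_sq_sum_sub_mean_le (P := errorLaw μ) (μ := μ)
    (e := fun j (e : ℕ → ℝ) => e j) (fun j => measurable_pi_apply j) errorLaw_map_eval
    errorLaw_indepFun (Finset.range N) (Ψ := fun i t => g t • u i)
    fun i _ => memLp_smul_const hg (u i)
  have hm : ∀ i, ∫ t, g t • u i ∂μ = 0 := fun i => by rw [integral_smul_const, hg0, zero_smul]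
  simp only [hm, sub_zero, norm_smul, mul_pow, integral_mul_const, Real.norm_eq_abs, sq_abs]
    at hA
  rw [← Finset.mul_sum] at hA
  simp_rw [mul_pow]
  refine ⟨hA.1.const_mul _, ?_⟩
  rw [integral_const_mul]
  calc _ ≤ (x ^ 4) ^ 2 * ((∫ t, g t ^ 2 ∂μ) * ∑ j ∈ Finset.range N, ‖u j‖ ^ 2) := by
        gcongr
        exact hA.2
    _ = _ := by ring

theorem IsWeights.opOne_sum
    (hu : IsWeights (errorLaw (densityMeasure f)) l s N u) {g : ℝ → ℝ} (hgm : Measurable g)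
      (hg : MemLp g 2 (densityMeasure f))
    (hg0 : ∫ t, g t ∂(densityMeasure f) = 0) :
    OpOne ((errorLaw (densityMeasure f)).prod (errorLaw (densityMeasure f))) l
      fun i ω => s i ^ 4 * ‖∑ j ∈ Finset.range (N i), g (ω.1 j) • u i ω.2 j‖ := by
  refine opOne_of_integral_sq_le (fun i => measurable_norm_sum_smul (fun j =>
    hgm.comp ((measurable_pi_apply j).comp measurable_fst)) (hu.stronglyMeasurable i) _ _)
    (fun i e => integral_norm_sq_sum_smul_le hg hg0 (N i) (u i e) (s i)) (hu.opOne.const_mul _)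

theorem IsWeights.opOne_sum_eval
    (hu : IsWeights (errorLaw (densityMeasure f)) l s N u) (h2 : MemLp (fun t : ℝ => t) 2
      (densityMeasure f))
    (h0 : ∫ t, t ∂(densityMeasure f) = 0) (hr : Regime l s a)
    (hNs : ∀ i, (N i : ℝ) * s i ^ 8 ≤ 1) (hA : ∀ i, (A i).Bounded K (s i) (N i) (N i)) :
    OpOne ((errorLaw (densityMeasure f)).prod (errorLaw (densityMeasure f))) l
      fun i ω => s i ^ 4 * ‖∑ j ∈ Finset.range (N i), (A i).eval (N i) ω.1 j • u i ω.2 j‖ := by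
  refine opOne_of_integral_sq_le (fun i => measurable_norm_sum_smul (fun j =>
    (ShiftForm.measurable_eval _ _ _).comp measurable_fst) (hu.stronglyMeasurable i) _ _)
    (fun i e => ?_) (hu.opOne.const_mul (ShiftForm.varBound (densityMeasure f) K))
  obtain ⟨h1, h3⟩ := (hA i).integral_norm_sq_sum_eval_le (hr.s_pos i) (hNs i) h2 h0 (u i e)
  simp_rw [mul_pow]
  refine ⟨h1.const_mul _, ?_⟩
  rw [integral_const_mul]
  calc _ ≤ (s i ^ 4) ^ 2 * (ShiftForm.varBound (densityMeasure f) K *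
        ∑ j ∈ Finset.range (N i), ‖u i e j‖ ^ 2) := by gcongr
    _ = _ := by ring

theorem IsWeights.opOne_sum_abs
    (hu : IsWeights (errorLaw (densityMeasure f)) l s N u) (h2 : MemLp (fun t : ℝ => t) 2
      (densityMeasure f))
    (hNs : ∀ i, (N i : ℝ) * s i ^ 8 ≤ 1) (hs : ∀ i, 0 < s i) :
    OpOne ((errorLaw (densityMeasure f)).prod (errorLaw (densityMeasure f))) l
      fun i ω => s i ^ 8 * ∑ j ∈ Finset.range (N i), |ω.1 j| * ‖u i ω.2 j‖ := by
  have h1 : OpOne (errorLaw (densityMeasure f)) l fun i e =>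
      (N i : ℝ)⁻¹ * ∑ j ∈ Finset.range (N i), e j ^ 2 :=
    opOne_of_lintegral (fun i => by fun_prop) (Eventually.of_forall fun i =>
      lintegral_ofReal_abs_le (integral_mean_sq_le h2 (N i)).1 (fun e =>
        mul_nonneg (by positivity) (Finset.sum_nonneg fun _ _ => sq_nonneg _))
        (integral_mean_sq_le h2 (N i)).2)
  refine (h1.comp_fst.add hu.opOne.comp_snd).mono (Eventually.of_forall fun i ω => ?_)
  have hs := hs i
  have hp : 0 ≤ s i ^ 8 * ∑ j ∈ Finset.range (N i), |ω.1 j| * ‖u i ω.2 j‖ := by positivity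
  rw [abs_of_nonneg hp]
  refine le_trans ?_ (le_abs_self _)
  have h3 : s i ^ 8 ≤ (N i : ℝ)⁻¹ ∨ N i = 0 := by
    rcases Nat.eq_zero_or_pos (N i) with h | h
    · exact Or.inr h
    · left
      have : (0 : ℝ) < N i := by exact_mod_cast h
      rw [le_inv_comm₀ (by positivity) this, ← one_div, le_div_iff₀ (by positivity)]
      exact hNs i
  rcases h3 with h3 | h3
  · have h4 : ∑ j ∈ Finset.range (N i), |ω.1 j| * ‖u i ω.2 j‖ ≤
        ∑ j ∈ Finset.range (N i), ω.1 j ^ 2 + ∑ j ∈ Finset.range (N i), ‖u i ω.2 j‖ ^ 2 := by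
      rw [← Finset.sum_add_distrib]
      refine Finset.sum_le_sum fun j _ => ?_
      nlinarith [sq_nonneg (|ω.1 j| - ‖u i ω.2 j‖), sq_abs (ω.1 j), norm_nonneg (u i ω.2 j),
        abs_nonneg (ω.1 j)]
    calc _ ≤ s i ^ 8 * (∑ j ∈ Finset.range (N i), ω.1 j ^ 2 +
          ∑ j ∈ Finset.range (N i), ‖u i ω.2 j‖ ^ 2) := by gcongr
      _ ≤ _ := by
          rw [mul_add]
          gcongr
  · simp [h3]

/-- The quadratic terms in the estimation errors are negligible. -/
theorem IsWeights.opZero_sum_sq_eval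
    (hu : IsWeights (errorLaw (densityMeasure f)) l s N u) (h2 : MemLp (fun t : ℝ => t) 2
      (densityMeasure f))
    (h0 : ∫ t, t ∂(densityMeasure f) = 0) (hr : Regime l s a)
    (hNs : ∀ i, (N i : ℝ) * s i ^ 8 ≤ 1) (hA : ∀ i, (A i).Bounded K (s i) (N i) (N i)) :
    OpZero ((errorLaw (densityMeasure f)).prod (errorLaw (densityMeasure f))) l
      fun i ω => s i ^ 4 / a i *
        ∑ j ∈ Finset.range (N i), (A i).eval (N i) ω.1 j ^ 2 * ‖u i ω.2 j‖ := by
  set V := ShiftForm.varBound (densityMeasure f) K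
  have hV : 0 ≤ V := ShiftForm.varBound_nonneg _ _
  have hlim : OpZero (errorLaw (densityMeasure f)) l fun i e => (V * (s i ^ 2 / a i ^ 1)) *
      (1 + s i ^ 8 * ∑ j ∈ Finset.range (N i), ‖u i e j‖ ^ 2) :=
    ((opOne_const 1).add hu.opOne).mul_tendsto
      (hr.tendsto_pow (p := 2) (q := 1) (by norm_num) (by norm_num) V)
  refine opZero_of_lintegral_le (fun i => ?_) (Eventually.of_forall fun i e =>
    lintegral_ofReal_abs_le ?_ (fun e' => ?_) ?_) hlim
  · have hm : ∀ j, Measurable fun ω : (ℕ → ℝ) × (ℕ → ℝ) => ‖u i ω.2 j‖ := fun j =>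
      ((hu.stronglyMeasurable i j).norm.measurable).comp measurable_snd
    have hm' : ∀ j, Measurable fun ω : (ℕ → ℝ) × (ℕ → ℝ) => (A i).eval (N i) ω.1 j ^ 2 :=
      fun j => ((ShiftForm.measurable_eval _ _ _).comp measurable_fst).pow_const 2
    exact (Finset.measurable_fun_sum _ fun j _ => (hm' j).mul (hm j)).const_mul _
  · exact (integrable_finsetSum (Finset.range (N i)) fun j _ =>
      (ShiftForm.integrable_sq_eval h2 (A i) (N i) j).mul_const ‖u i e j‖).const_mul _
  · have := hr.a_pos i
    have := hr.s_pos i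
    positivity
  · have ha := hr.a_pos i
    have hs := hr.s_pos i
    dsimp only
    rw [integral_const_mul, integral_finsetSum _ fun j _ =>
      (ShiftForm.integrable_sq_eval h2 (A i) (N i) j).mul_const _]
    simp_rw [integral_mul_const]
    calc _ ≤ s i ^ 4 / a i * ∑ j ∈ Finset.range (N i), (V * s i ^ 6) * ‖u i e j‖ := by
          gcongr with j hj
          exact (hA i).integral_sq_eval_le hs (hr.s_le_one i) h2 h0 (Finset.mem_range.1 hj)
      _ = (V * (s i ^ 2 / a i ^ 1)) * (s i ^ 8 * ∑ j ∈ Finset.range (N i), ‖u i e j‖) := by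
          rw [← Finset.mul_sum]
          field_simp
      _ ≤ _ := by
          have h3 : ∑ j ∈ Finset.range (N i), ‖u i e j‖ ≤
              N i + ∑ j ∈ Finset.range (N i), ‖u i e j‖ ^ 2 := by
            have : (N i : ℝ) = ∑ j ∈ Finset.range (N i), (1 : ℝ) := by simp
            rw [this, ← Finset.sum_add_distrib]
            refine Finset.sum_le_sum fun j _ => ?_
            nlinarith [sq_nonneg (‖u i e j‖ - 1), norm_nonneg (u i e j)]
          have h4 := mul_le_mul_of_nonneg_left h3 (show 0 ≤ s i ^ 8 by positivity)
          gcongr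
          linarith [hNs i]

end

section

variable {f f' φ : ℝ → ℝ} {M : ℝ} [IsProbabilityMeasure (densityMeasure f)]
  {ι : Type*} {l : Filter ι} {s a : ι → ℝ} {Λ K : ℝ} {L : ι → (ℕ → ℝ) → ℝ → ℝ}
  {A : ι → ShiftForm} {N : ι → ℕ} {u : ι → (ℕ → ℝ) → ℕ → L2Line}

/-- The mean of a score estimate at a shifted error. -/
noncomputable def meanShift (μ : Measure ℝ) (L : ℝ → ℝ) (D : ℝ) : ℝ := ∫ z, L (z - D) ∂μ

theorem IsScoreEstimate.measurable_meanShift {μ : Measure ℝ} [IsProbabilityMeasure μ]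
    {ℓ : ℝ → ℝ} (hL : IsScoreEstimate μ l a Λ ℓ L) (i : ι) :
    Measurable fun p : (ℕ → ℝ) × ℝ => meanShift μ (L i p.1) p.2 := by
  have h : Measurable fun q : ((ℕ → ℝ) × ℝ) × ℝ => L i q.1.1 (q.2 - q.1.2) :=
    (hL.measurable i).comp ((measurable_fst.comp measurable_fst).prodMk
      (measurable_snd.sub (measurable_snd.comp measurable_fst)))
  exact (h.stronglyMeasurable.integral_prod_right (ν := μ)).measurable

/-- The fluctuation of a score estimate at a shifted error, less that of the score. -/
noncomputable def centredScore (μ : Measure ℝ) (L ℓ : ℝ → ℝ) (t D : ℝ) : ℝ :=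
  L (t - D) - ℓ t - meanShift μ L D

theorem integral_sub_mean_sq_le {μ : Measure ℝ} [IsProbabilityMeasure μ] {g : ℝ → ℝ}
    (hg : MemLp g 2 μ) : ∫ t, (g t - ∫ x, g x ∂μ) ^ 2 ∂μ ≤ ∫ t, g t ^ 2 ∂μ := by
  have h1 := variance_eq_integral (μ := μ) hg.aestronglyMeasurable.aemeasurable
  have h2 := variance_le_expectation_sq (μ := μ) hg.aestronglyMeasurable
  rw [h1] at h2
  exact h2

theorem integral_mul_sq_le {μ : Measure ℝ} {g h : ℝ → ℝ} (hg : MemLp g 2 μ) (hh : MemLp h 2 μ) :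
    (∫ t, g t * h t ∂μ) ^ 2 ≤ (∫ t, g t ^ 2 ∂μ) * ∫ t, h t ^ 2 ∂μ := by
  have h1 : ∀ x : ℝ, 0 ≤ (∫ t, h t ^ 2 ∂μ) * (x * x) + (2 * ∫ t, g t * h t ∂μ) * x +
      ∫ t, g t ^ 2 ∂μ := by
    intro x
    have e : ∫ t, (g t + x * h t) ^ 2 ∂μ = (∫ t, h t ^ 2 ∂μ) * (x * x) +
        (2 * ∫ t, g t * h t ∂μ) * x + ∫ t, g t ^ 2 ∂μ := by
      have e1 : ∀ t, (g t + x * h t) ^ 2 =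
          (x * x) * h t ^ 2 + (2 * x) * (g t * h t) + g t ^ 2 := fun t => by ring
      simp_rw [e1]
      have i1 : Integrable (fun t => g t * h t) μ := hg.integrable_mul hh
      rw [integral_add ((hh.integrable_sq.const_mul _).fun_add (i1.const_mul _)) hg.integrable_sq,
        integral_add (hh.integrable_sq.const_mul _) (i1.const_mul _), integral_const_mul (x * x),
        integral_const_mul (2 * x)]
      ring
    rw [← e]
    exact integral_nonneg fun _ => sq_nonneg _
  have h2 := discrim_le_zero h1
  unfold discrim at h2
  nlinarith

section Centred

variable {μ : Measure ℝ} [IsProbabilityMeasure μ] {L ℓ : ℝ → ℝ} {b c : ℝ}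

theorem abs_meanShift_sub_le (hLm : Measurable L) (hLb : ∀ z, |L z| ≤ b)
    (hLip : ∀ x y, |L x - L y| ≤ c * |x - y|) (D D' : ℝ) :
    |meanShift μ L D - meanShift μ L D'| ≤ c * |D - D'| := by
  have hi : ∀ D, Integrable (fun z => L (z - D)) μ := fun D =>
    Integrable.of_bound (hLm.comp (measurable_id.sub_const D)).aestronglyMeasurable b
      (Eventually.of_forall fun _ => hLb _)
  unfold meanShift
  rw [← integral_sub (hi D) (hi D'), ← Real.norm_eq_abs]
  refine (norm_integral_le_of_norm_le (integrable_const (c * |D - D'|))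
    (Eventually.of_forall fun z => ?_)).trans (by simp)
  rw [Real.norm_eq_abs]
  refine (hLip _ _).trans (le_of_eq ?_)
  rw [sub_sub_sub_cancel_left, abs_sub_comm]

theorem integral_centredScore (hLm : Measurable L) (hLb : ∀ z, |L z| ≤ b) (hℓ : MemLp ℓ 2 μ)
    (hℓ0 : ∫ t, ℓ t ∂μ = 0) (D : ℝ) : ∫ t, centredScore μ L ℓ t D ∂μ = 0 := by
  have hi : Integrable (fun z => L (z - D)) μ :=
    Integrable.of_bound (hLm.comp (measurable_id.sub_const D)).aestronglyMeasurable b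
      (Eventually.of_forall fun _ => hLb _)
  have hi' := hℓ.integrable one_le_two
  unfold centredScore
  have hd : Integrable (fun z => L (z - D) - ℓ z) μ := hi.sub hi'
  rw [integral_sub hd (integrable_const _), integral_sub hi hi', hℓ0]
  simp [meanShift]

theorem abs_centredScore_sub_le (hLm : Measurable L) (hLb : ∀ z, |L z| ≤ b)
    (hLip : ∀ x y, |L x - L y| ≤ c * |x - y|) (t D D' : ℝ) :
    |centredScore μ L ℓ t D - centredScore μ L ℓ t D'| ≤ 2 * c * |D - D'| := by
  have h1 := abs_meanShift_sub_le (μ := μ) hLm hLb hLip D D'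
  have h2 := hLip (t - D) (t - D')
  rw [sub_sub_sub_cancel_left, abs_sub_comm D' D] at h2
  have : centredScore μ L ℓ t D - centredScore μ L ℓ t D' =
      (L (t - D) - L (t - D')) - (meanShift μ L D - meanShift μ L D') := by
    unfold centredScore; ring
  rw [this]
  refine (abs_sub _ _).trans ?_
  linarith

theorem integral_centredScore_sq_le (hLm : Measurable L) (hLb : ∀ z, |L z| ≤ b)
    (hLip : ∀ x y, |L x - L y| ≤ c * |x - y|) (hℓ : MemLp ℓ 2 μ) (hℓ0 : ∫ t, ℓ t ∂μ = 0) (D : ℝ) :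
    ∫ t, centredScore μ L ℓ t D ^ 2 ∂μ ≤ 2 * ∫ t, (L t - ℓ t) ^ 2 ∂μ + 2 * c ^ 2 * D ^ 2 := by
  have hm : ∀ D, MemLp (fun z => L (z - D)) 2 μ := fun D =>
    MemLp.of_bound (hLm.comp (measurable_id.sub_const D)).aestronglyMeasurable b
      (Eventually.of_forall fun _ => hLb _)
  have hm0 : MemLp (fun z => L z - ℓ z) 2 μ := MemLp.sub (by simpa using hm 0) hℓ
  have hmD : MemLp (fun z => L (z - D) - ℓ z) 2 μ := MemLp.sub (hm D) hℓ
  have hmean : ∫ t, (L (t - D) - ℓ t) ∂μ = meanShift μ L D := by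
    rw [integral_sub ((hm D).integrable one_le_two) (hℓ.integrable one_le_two), hℓ0, sub_zero]
    rfl
  have h1 := integral_sub_mean_sq_le hmD
  rw [hmean] at h1
  refine h1.trans ?_
  have hI : Integrable (fun t => 2 * (L t - ℓ t) ^ 2 + 2 * c ^ 2 * D ^ 2) μ :=
    (hm0.integrable_sq.const_mul 2).add (integrable_const _)
  refine (integral_mono_of_nonneg (Eventually.of_forall fun _ => sq_nonneg _) hI
    (Eventually.of_forall fun t => ?_)).trans (le_of_eq ?_)
  · have h2 := hLip (t - D) t
    rw [sub_sub_cancel_left, abs_neg] at h2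
    have h3 := pow_le_pow_left₀ (abs_nonneg _) h2 2
    rw [mul_pow, sq_abs, sq_abs] at h3
    dsimp only
    nlinarith [sq_nonneg ((L (t - D) - L t) - (L t - ℓ t))]
  · rw [integral_add (hm0.integrable_sq.const_mul 2) (integrable_const _),
      integral_const_mul (2 : ℝ)]
    simp

end Centred

/-- The centred part of the estimated score contributes a negligible term: the leave-two-out
bound. -/
theorem IsWeights.opZero_sum_centredScore
    (hu : IsWeights (errorLaw (densityMeasure f)) l s N u) (hf : IsSmoothDensity f f' φ M)
    (hJ : Integrable (fun z => score f f' z ^ 2 * f z))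
    (h2 : MemLp (fun t : ℝ => t) 2 (densityMeasure f))
    (h0 : ∫ t, t ∂(densityMeasure f) = 0) (hr : Regime l s a)
    (hA : ∀ i, (A i).Bounded K (s i) (N i) (N i))
    (hA0 : ∀ i j, (A i).W j j = 0)
    (hL : IsScoreEstimate (densityMeasure f) l a Λ (score f f') L) :
    OpZero ((errorLaw (densityMeasure f)).prod (errorLaw (densityMeasure f))) l
      fun i ω => s i ^ 4 * ‖∑ j ∈ Finset.range (N i), centredScore (densityMeasure f) (L i ω.2)
        (score f f') (ω.1 j) ((A i).eval (N i) ω.1 j) • u i ω.2 j‖ := by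
  set V := ShiftForm.varBound (densityMeasure f) K
  have hV : 0 ≤ V := ShiftForm.varBound_nonneg _ _
  set σ := ∫ t, t ^ 2 ∂(densityMeasure f)
  have hσ : 0 ≤ σ := integral_nonneg fun _ => sq_nonneg _
  have hℓ := memLp_score hf hJ
  have hℓ0 := integral_score hf
  have hℓm := measurable_score hf
  have hlim : OpZero (errorLaw (densityMeasure f)) l fun i e =>
      (2 * (∫ t, (L i e t - score f f' t) ^ 2 ∂(densityMeasure f)) +
        (Λ ^ 2 * (2 * V + 4 * σ * K ^ 2)) * (s i ^ 6 / a i ^ 4)) *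
      (s i ^ 8 * ∑ j ∈ Finset.range (N i), ‖u i e j‖ ^ 2) :=
    ((hL.opZero.const_mul 2).add (opZero_of_tendsto (hr.tendsto_pow (p := 6) (q := 4)
      (by norm_num) (by norm_num) _))).mul_opOne hu.opOne
  have hdist : ∀ i, Measurable fun q : (ℕ → ℝ) × ℝ × ℝ =>
      centredScore (densityMeasure f) (L i q.1) (score f f') q.2.1 q.2.2 := by
    intro i
    unfold centredScore
    have m1 : Measurable fun q : (ℕ → ℝ) × ℝ × ℝ => L i q.1 (q.2.1 - q.2.2) :=
      (hL.measurable i).comp (measurable_fst.prodMk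
        ((measurable_fst.comp measurable_snd).sub (measurable_snd.comp measurable_snd)))
    have m2 : Measurable fun q : (ℕ → ℝ) × ℝ × ℝ => meanShift (densityMeasure f) (L i q.1) q.2.2 :=
      (hL.measurable_meanShift i).comp (measurable_fst.prodMk (measurable_snd.comp measurable_snd))
    exact (m1.sub (hℓm.comp (measurable_fst.comp measurable_snd))).sub m2
  refine opZero_of_integral_sq_le (fun i => measurable_norm_sum_smul (fun j => ?_)
    (hu.stronglyMeasurable i) _ _) (fun i e => ?_) hlim
  · exact (hdist i).comp (measurable_snd.prodMk (((measurable_pi_apply j).comp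
      measurable_fst).prodMk ((ShiftForm.measurable_eval _ _ _).comp measurable_fst)))
  · have ha := hr.a_pos i
    have hs := hr.s_pos i
    have hLm := hL.measurable_apply i e
    have hLb := hL.abs_le i e
    have hLip := hL.lipschitz i e
    obtain ⟨g1, g2⟩ := integral_norm_sq_sum_centred_le (μ := densityMeasure f)
      (φ := centredScore (densityMeasure f) (L i e) (score f f')) (Λ := 2 * (Λ / a i ^ 2))
      (A := 2 * ∫ t, (L i e t - score f f' t) ^ 2 ∂(densityMeasure f)) (B := 2 *
        (Λ / a i ^ 2) ^ 2) h2
      ((hdist i).comp (measurable_const.prodMk measurable_id))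
      (integral_centredScore hLm hLb hℓ hℓ0) (abs_centredScore_sub_le hLm hLb hLip)
      (((hL.memLp i e 0).sub hℓ).sub (memLp_const _))
      (integral_centredScore_sq_le hLm hLb hLip hℓ hℓ0) (Finset.range (N i)) (A i).b (A i).W
      (hA0 i) (u i e)
    simp_rw [mul_pow]
    refine ⟨g1.const_mul _, ?_⟩
    rw [integral_const_mul]
    set v := ∫ t, (L i e t - score f f' t) ^ 2 ∂(densityMeasure f)
    set S := ∑ j ∈ Finset.range (N i), ‖u i e j‖ ^ 2
    have b1 : ∑ j ∈ Finset.range (N i), ‖u i e j‖ ^ 2 * (2 * v + 2 * (Λ / a i ^ 2) ^ 2 *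
        ∫ e, affineShift (Finset.range (N i)) (A i).b (A i).W e j ^ 2 ∂(errorLaw
            (densityMeasure f))) ≤
        S * (2 * v + 2 * (Λ / a i ^ 2) ^ 2 * (V * s i ^ 6)) := by
      rw [Finset.sum_mul]
      refine Finset.sum_le_sum fun j hj => ?_
      gcongr
      exact (hA i).integral_sq_eval_le hs (hr.s_le_one i) h2 h0 (Finset.mem_range.1 hj)
    have b2 := (hA i).sum_mutual_le hs (fun j => ‖u i e j‖) fun j => norm_nonneg _
    calc _ ≤ (s i ^ 4) ^ 2 * (S * (2 * v + 2 * (Λ / a i ^ 2) ^ 2 * (V * s i ^ 6)) +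
          (2 * (Λ / a i ^ 2)) ^ 2 * σ * (K ^ 2 * s i ^ 6 * S)) := by
          gcongr
          exact g2.trans (add_le_add b1 (mul_le_mul_of_nonneg_left b2 (by positivity)))
      _ = _ := by
          simp only [S]
          field_simp
          ring

/-- The estimated scores `L (e j - D j) / J`, less the residuals `e j - D j`, with weights that sum
to zero: replacing them by the true ones changes the sum by less than the order of its standard
deviation. -/
theorem IsWeights.opZero_sum_estimated (hu : IsWeights (errorLaw (densityMeasure f)) l s N u)
    (hf : IsSmoothDensity f f' φ M) (hJ : Integrable (fun z => score f f' z ^ 2 * f z))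
    (h2 : MemLp (fun t : ℝ => t) 2 (densityMeasure f))
    (h0 : ∫ t, t ∂(densityMeasure f) = 0) (hr : Regime l s a)
    (hN : ∀ i, 0 < N i) (hNs : ∀ i, (N i : ℝ) * s i ^ 8 ≤ 1)
    (hA : ∀ i, (A i).Bounded K (s i) (N i) (N i))
    (hL : IsScoreEstimate (densityMeasure f) l a Λ (score f f') L)
    {q : ι → (ℕ → ℝ) × (ℕ → ℝ) → ℝ}
    (hq : OpZero ((errorLaw (densityMeasure f)).prod (errorLaw (densityMeasure f))) l
      fun i ω => q i ω - (fisherInfo f f')⁻¹) :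
    OpZero ((errorLaw (densityMeasure f)).prod (errorLaw (densityMeasure f))) l
      fun i ω => s i ^ 4 * ‖∑ j ∈ Finset.range (N i),
        (q i ω * L i ω.2 (ω.1 j - (A i).eval (N i) ω.1 j) - (ω.1 j - (A i).eval (N i) ω.1 j) -
          lam f f' (ω.1 j)) • u i ω.2 j‖ := by
  have hℓ := memLp_score hf hJ
  have hℓ0 := integral_score hf
  have hℓm := measurable_score hf
  have hJpos := fisherInfo_pos hf hJ
  have hJ2 := integral_score_sq hf
  set J := fisherInfo f f'
  have hAo : ∀ i, (A i).offDiag.Bounded K (s i) (N i) (N i) := fun i => (hA i).offDiag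
  set C := ∫ z, |φ z|
  have hC : 0 ≤ C := integral_nonneg fun _ => abs_nonneg _
  -- the covariance of the estimated score and the score
  set S : ι → (ℕ → ℝ) → ℝ := fun i e => ∫ z, L i e z * score f f' z ∂(densityMeasure f) with hS
  have zS : OpZero ((errorLaw (densityMeasure f)).prod (errorLaw
      (densityMeasure f))) l fun i ω => S i ω.2 - J := by
    refine OpZero.comp_snd (Z := fun i e => S i e - J) ?_
    refine ((hL.opZero.sqrt).const_mul √J).mono (Eventually.of_forall fun i e => ?_)
    have hm : MemLp (fun z => L i e z - score f f' z) 2 (densityMeasure f) :=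
      MemLp.sub (by simpa using hL.memLp i e 0) hℓ
    have hm' : MemLp (fun z => L i e z) 2 (densityMeasure f) := by simpa using hL.memLp i e 0
    have i1 : Integrable (fun z => L i e z * score f f' z) (densityMeasure f) :=
      hm'.integrable_mul hℓ
    have e1 : S i e - J = ∫ z, (L i e z - score f f' z) * score f f' z ∂(densityMeasure f) := by
      rw [← hJ2, ← integral_sub i1 hℓ.integrable_sq]
      congr 1
      funext z
      ring
    rw [e1, abs_of_nonneg (mul_nonneg (Real.sqrt_nonneg _) (Real.sqrt_nonneg _)),
      ← Real.sqrt_mul hJpos.le]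
    refine Real.abs_le_sqrt ?_
    rw [← hJ2, mul_comm]
    exact integral_mul_sq_le hm hℓ
  have oq : OpOne ((errorLaw (densityMeasure f)).prod (errorLaw (densityMeasure f))) l q := by
    have h := hq.opOne.add (opOne_const J⁻¹)
    refine h.mono (Eventually.of_forall fun i ω => ?_)
    rw [sub_add_cancel]
  have zqS : OpZero ((errorLaw (densityMeasure f)).prod (errorLaw
      (densityMeasure f))) l fun i ω => 1 - q i ω * S i ω.2 := by
    refine ((zS.mul_opOne oq).add (hq.const_mul J)).mono (Eventually.of_forall fun i ω => ?_)
    rw [← abs_neg]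
    refine le_of_eq (congrArg _ ?_)
    field_simp
    ring
  have o1 := hu.opOne_sum hℓm hℓ hℓ0
  have o2 := hu.opOne_sum_eval h2 h0 hr hNs hAo
  have o3 := hu.opOne_sum_abs h2 hNs hr.s_pos
  have o4 := hu.opZero_sum_sq_eval h2 h0 hr hNs hAo
  have o5 := hu.opZero_sum_centredScore hf hJ h2 h0 hr hAo (fun i j => (A i).offDiag_self j) hL
  have c1 := hr.tendsto_pow (p := 2) (q := 2) le_rfl (by norm_num) (Λ * K)
  have c2 := hr.tendsto_pow (p := 2) (q := 0) (by norm_num) (by norm_num) K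
  have t1 := (o3.mul oq).mul_tendsto c1
  have t2 := o3.mul_tendsto c2
  have t3 := (o4.mul_opOne oq).const_mul (Λ * C)
  have t4 := o5.mul_opOne oq
  have t5 := zqS.mul_opOne o2
  have t6 := hq.mul_opOne o1
  -- `t1`, `t2`: influence of an error on its own residual; `t3`: quadratic remainder;
  -- `t4`: centred fluctuation; `t5`: linear drift, cancelled by the residual;
  -- `t6`: estimation of `1 / J`
  refine (((t1.abs.add t2.abs).add (t3.abs.add t4.abs)).add (t5.abs.add t6.abs)).mono
    (Eventually.of_forall fun i ω => ?_)
  have ha := hr.a_pos i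
  have hs := hr.s_pos i
  have hΛ := hL.nonneg ha
  have hK := (hA i).nonneg (hN i)
  set R := Finset.range (N i)
  set Q := q i ω
  set Do : ℕ → ℝ := fun j => (A i).offDiag.eval (N i) ω.1 j
  set D : ℕ → ℝ := fun j => (A i).eval (N i) ω.1 j
  set Lω := L i ω.2
  set m := meanShift (densityMeasure f) Lω
  set v : ℕ → L2Line := u i ω.2
  set r : ℕ → ℝ := fun j => Q * (Lω (ω.1 j - D j) - Lω (ω.1 j - Do j)) +
    Q * (m (Do j) - m 0 + Do j * S i ω.2) + (D j - Do j) with hrdef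
  have hdec : ∀ j, (Q * Lω (ω.1 j - D j) - (ω.1 j - D j) - lam f f' (ω.1 j)) =
      r j + Q * centredScore (densityMeasure f) Lω (score f f') (ω.1 j) (Do j) + Q * m 0 +
        (1 - Q * S i ω.2) * Do j + (Q - J⁻¹) * score f f' (ω.1 j) := by
    intro j
    simp only [hrdef, centredScore, lam, div_eq_mul_inv]
    ring
  have hsum : ∑ j ∈ R, (Q * Lω (ω.1 j - D j) - (ω.1 j - D j) - lam f f' (ω.1 j)) • v j =
      ∑ j ∈ R, r j • v j + Q • ∑ j ∈ R, centredScore (densityMeasure f) Lω (score f f') (ω.1 j)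
          (Do j) • v j +
      (1 - Q * S i ω.2) • ∑ j ∈ R, Do j • v j +
      (Q - J⁻¹) • ∑ j ∈ R, score f f' (ω.1 j) • v j := by
    -- the mean of the score estimate is not of smaller order, but the weights sum to zero
    have h0' : (Q * m 0) • ∑ j ∈ R, v j = 0 := by rw [hu.sum_eq_zero, smul_zero]
    rw [← add_zero (∑ j ∈ R, r j • v j + _), ← h0']
    simp only [Finset.smul_sum, smul_smul, ← Finset.sum_add_distrib, hdec, add_smul]
  have hrj : ∀ j ∈ R, |r j| ≤ (|Q| * (Λ / a i ^ 2) + 1) * (K * s i ^ 6) * |ω.1 j| +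
      |Q| * (Λ / a i * C) * Do j ^ 2 := by
    intro j hj
    have hj' := Finset.mem_range.1 hj
    have d1 : D j - Do j = (A i).W j j * ω.1 j := (A i).eval_sub_eval_offDiag hj' ω.1
    have d2 : |D j - Do j| ≤ K * s i ^ 6 * |ω.1 j| := by
      rw [d1, abs_mul]
      exact mul_le_mul_of_nonneg_right ((hA i).abs_W_le j hj' j hj') (abs_nonneg _)
    have d3 : |Lω (ω.1 j - D j) - Lω (ω.1 j - Do j)| ≤ Λ / a i ^ 2 * |D j - Do j| := by
      refine (hL.lipschitz i ω.2 _ _).trans (le_of_eq ?_)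
      rw [sub_sub_sub_cancel_left, abs_sub_comm]
    have d4 : |m (Do j) - m 0 + Do j * S i ω.2| ≤ Λ / a i * C * Do j ^ 2 := by
      have := abs_integral_shift_sub_le hf (hL.measurable_apply i ω.2) (hL.abs_le i ω.2) (Do j)
      simpa only [m, meanShift, sub_zero] using this
    have n1 : |r j| ≤ |Q| * (Λ / a i ^ 2 * |D j - Do j|) + |Q| * (Λ / a i * C * Do j ^ 2) +
        |D j - Do j| := by
      simp only [hrdef]
      refine (abs_add_le _ _).trans (add_le_add_left ((abs_add_le _ _).trans ?_) _)
      rw [abs_mul, abs_mul]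
      gcongr
    calc |r j| ≤ _ := n1
      _ = (|Q| * (Λ / a i ^ 2) + 1) * |D j - Do j| + |Q| * (Λ / a i * C) * Do j ^ 2 := by ring
      _ ≤ (|Q| * (Λ / a i ^ 2) + 1) * (K * s i ^ 6 * |ω.1 j|) +
          |Q| * (Λ / a i * C) * Do j ^ 2 := by gcongr
      _ = _ := by ring
  have hrs : ‖∑ j ∈ R, r j • v j‖ ≤ (|Q| * (Λ / a i ^ 2) + 1) * (K * s i ^ 6) *
      (∑ j ∈ R, |ω.1 j| * ‖v j‖) + |Q| * (Λ / a i * C) * ∑ j ∈ R, Do j ^ 2 * ‖v j‖ := by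
    refine (norm_sum_le _ _).trans ?_
    rw [Finset.mul_sum, Finset.mul_sum, ← Finset.sum_add_distrib]
    refine Finset.sum_le_sum fun j hj => ?_
    rw [norm_smul, Real.norm_eq_abs]
    refine (mul_le_mul_of_nonneg_right (hrj j hj) (norm_nonneg _)).trans (le_of_eq ?_)
    ring
  rw [abs_of_nonneg (by positivity : 0 ≤ s i ^ 4 * ‖∑ j ∈ R,
    (Q * Lω (ω.1 j - D j) - (ω.1 j - D j) - lam f f' (ω.1 j)) • v j‖), hsum]
  refine le_trans ?_ (le_abs_self _)
  set G := ∑ j ∈ R, |ω.1 j| * ‖v j‖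
  set H := ∑ j ∈ R, Do j ^ 2 * ‖v j‖
  set X₀ := ∑ j ∈ R, r j • v j
  set X₁ := ∑ j ∈ R, centredScore (densityMeasure f) Lω (score f f') (ω.1 j) (Do j) • v j
  set X₂ := ∑ j ∈ R, Do j • v j
  set X₃ := ∑ j ∈ R, score f f' (ω.1 j) • v j
  have hG : 0 ≤ G := Finset.sum_nonneg fun _ _ => by positivity
  have hH : 0 ≤ H := Finset.sum_nonneg fun _ _ => by positivity
  have hn : ‖X₀ + Q • X₁ + (1 - Q * S i ω.2) • X₂ + (Q - J⁻¹) • X₃‖ ≤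
      ((|Q| * (Λ / a i ^ 2) + 1) * (K * s i ^ 6) * G + |Q| * (Λ / a i * C) * H) + |Q| * ‖X₁‖ +
      |1 - Q * S i ω.2| * ‖X₂‖ + |Q - J⁻¹| * ‖X₃‖ := by
    refine (norm_add_le _ _).trans (add_le_add ((norm_add_le _ _).trans (add_le_add
      ((norm_add_le _ _).trans (add_le_add hrs ?_)) ?_)) ?_) <;>
    rw [norm_smul, Real.norm_eq_abs]
  refine (mul_le_mul_of_nonneg_left hn (by positivity)).trans (le_of_eq ?_)
  have p1 : |Λ * K * (s i ^ 2 / a i ^ 2) * (s i ^ 8 * G * Q)| =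
      Λ * K * (s i ^ 2 / a i ^ 2) * (s i ^ 8 * G * |Q|) := by
    rw [abs_mul, abs_mul _ Q, abs_of_nonneg (by positivity), abs_of_nonneg (by positivity)]
  have p2 : |K * (s i ^ 2 / a i ^ 0) * (s i ^ 8 * G)| = K * s i ^ 2 * (s i ^ 8 * G) := by
    rw [pow_zero, div_one, abs_of_nonneg (by positivity)]
  have p3 : |Λ * C * (s i ^ 4 / a i * H * Q)| = Λ * C * (s i ^ 4 / a i * H * |Q|) := by
    rw [abs_mul, abs_mul _ Q, abs_of_nonneg (by positivity), abs_of_nonneg (by positivity)]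
  have p4 : |s i ^ 4 * ‖X₁‖ * Q| = s i ^ 4 * ‖X₁‖ * |Q| := by
    rw [abs_mul _ Q, abs_of_nonneg (by positivity)]
  have p5 : |(1 - Q * S i ω.2) * (s i ^ 4 * ‖X₂‖)| = |1 - Q * S i ω.2| * (s i ^ 4 * ‖X₂‖) := by
    rw [abs_mul, abs_of_nonneg (by positivity : 0 ≤ s i ^ 4 * ‖X₂‖)]
  have p6 : |(Q - J⁻¹) * (s i ^ 4 * ‖X₃‖)| = |Q - J⁻¹| * (s i ^ 4 * ‖X₃‖) := by
    rw [abs_mul, abs_of_nonneg (by positivity : 0 ≤ s i ^ 4 * ‖X₃‖)]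
  rw [p1, p2, p3, p4, p5, p6]
  field_simp
  ring

end

/-! ### The second derivative of the error density estimator -/

section

variable {f f' φ κ κ' κ'' : ℝ → ℝ} {M B₁ B₂ : ℝ} {ι : Type*} {l : Filter ι} {s a : ι → ℝ} {K : ℝ}

theorem norm_translateL2_sub_translateL2 {k g : ℝ → ℝ} (hk : MemLp k 2) (hg : MemLp g 2)
    (t : ℝ) : ‖translateL2 hk t - translateL2 hg t‖ = ‖(hk.sub hg).toLp (k - g)‖ := by
  rw [← norm_translateL2 (hk.sub hg) t]
  unfold translateL2
  rw [← MemLp.toLp_sub]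
  rfl

theorem translateL2_zero {k : ℝ → ℝ} (hk : MemLp k 2) : translateL2 hk 0 = hk.toLp := by
  simp [translateL2]

theorem tendsto_norm_convMeasure_sub (hκ : IsKernelTriple κ κ' κ'' B₁ B₂)
    (hf : IsSmoothDensity f f' φ M) [IsProbabilityMeasure (densityMeasure f)]
    (hr : Regime l s a) :
    Tendsto (fun i => ‖((memLp_convMeasure (ν := densityMeasure f)
      (hκ.scale (hr.a_pos i)).continuous_snd.measurable (hκ.scale (hr.a_pos i)).memLp_snd).sub
      hf.memLp_snd).toLp (convMeasure (densityMeasure f) (kernelScale κ'' 2 (a i)) - φ)‖) l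
      (𝓝 0) := by
  have hp := isProbabilityMeasure_densityMeasure hκ.nonneg hκ.integral_eq_one
  have h := tendsto_lintegral_convMeasure_sub (κ := κ) hf.measurable_snd hf.integrable_snd
    one_le_two (by simpa using hf.memLp_snd) hr.tendsto_a
  have h1 := (ENNReal.continuous_rpow_const (y := 1 / (2 : ℝ))).continuousAt.tendsto.comp h
  rw [ENNReal.zero_rpow_of_pos (by norm_num)] at h1
  have h2 := (ENNReal.tendsto_toReal ENNReal.zero_ne_top).comp h1
  refine h2.congr fun i => ?_
  rw [norm_toLp_eq]
  simp only [Function.comp_apply, Pi.sub_apply]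
  rw [convMeasure_density_snd hκ hf (hr.a_pos i)]

/-- A modulus of continuity of translations in `L²`, in quadratic form. -/
theorem exists_norm_translateL2_sub_le {g : ℝ → ℝ} (hg : MemLp g 2 volume) {η : ℝ} (hη : 0 < η) :
    ∃ C, 0 ≤ C ∧ ∀ D, ‖translateL2 hg (-D) - hg.toLp‖ ≤ η + C * D ^ 2 := by
  have hc : ContinuousAt (translateL2 hg) 0 := (continuous_translateL2 hg).continuousAt
  obtain ⟨δ, hδ, h⟩ := Metric.continuousAt_iff.1 hc η hη
  refine ⟨2 * ‖translateL2 hg 0‖ / δ ^ 2, by positivity, fun D => ?_⟩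
  rw [← translateL2_zero]
  rcases lt_or_ge |D| δ with hD | hD
  · have h1 := h (x := -D) (by simpa using hD)
    rw [dist_eq_norm] at h1
    have : 0 ≤ 2 * ‖translateL2 hg 0‖ / δ ^ 2 * D ^ 2 := by positivity
    linarith
  · have h1 : δ ^ 2 ≤ D ^ 2 := by
      rw [← sq_abs D]
      exact pow_le_pow_left₀ hδ.le hD 2
    have h2 : 2 * ‖translateL2 hg 0‖ ≤ 2 * ‖translateL2 hg 0‖ / δ ^ 2 * D ^ 2 := by
      rw [div_mul_eq_mul_div, le_div_iff₀ (by positivity)]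
      gcongr
    have h3 := norm_sub_le (translateL2 hg (-D)) (translateL2 hg 0)
    rw [norm_translateL2 hg (-D), ← norm_translateL2 hg 0] at h3
    linarith

theorem opZero_of_forall_le {Ω : Type*} [MeasurableSpace Ω] {P : Measure Ω} {Z : ι → Ω → ℝ}
    {Y : ℝ → ι → Ω → ℝ} (hY : ∀ η, 0 < η → OpZero P l (Y η))
    (h : ∀ η, 0 < η → ∀ i ω, |Z i ω| ≤ η + Y η i ω) : OpZero P l Z := by
  intro δ hδ η hη
  filter_upwards [hY (δ / 2) (half_pos hδ) (δ / 2) (half_pos hδ) η hη] with i hi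
  refine (measure_mono fun ω hω => ?_).trans hi
  simp only [mem_ofPred_eq] at hω ⊢
  have h1 := h (δ / 2) (half_pos hδ) i ω
  have h2 := le_abs_self (Y (δ / 2) i ω)
  linarith

/-- The residual-based estimator of the second derivative of the error density is consistent in
`L²` if the residuals come from a smoother that is based on an independent sample. -/
theorem opZero_kernelMean_snd (hκ : IsKernelTriple κ κ' κ'' B₁ B₂)
    (hf : IsSmoothDensity f f' φ M) [IsProbabilityMeasure (densityMeasure f)]
    (h2 : MemLp (fun t : ℝ => t) 2 (densityMeasure f))
    (h0 : ∫ t, t ∂(densityMeasure f) = 0) (hr : Regime l s a) {B : ι → ShiftForm} {m k : ι → ℕ}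
    (hm : ∀ i, 0 < m i) (hms : ∀ i, (m i : ℝ)⁻¹ ≤ 3 * s i ^ 8)
    (hB : ∀ i, (B i).Bounded K (s i) (m i) (k i)) :
    OpZero ((errorLaw (densityMeasure f)).prod (errorLaw (densityMeasure f))) l fun i ω =>
      (m i : ℝ)⁻¹ * ‖∑ j ∈ Finset.range (m i), (translateL2 (hκ.scale (hr.a_pos i)).memLp_snd
        (ω.1 j - (B i).eval (k i) ω.2 j) - hf.memLp_snd.toLp φ)‖ := by
  have hK : ∀ i, IsKernelTriple _ _ _ _ _ := fun i => hκ.scale (hr.a_pos i)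
  set g := fun i => memLp_convMeasure (ν := densityMeasure f) (hK i).continuous_snd.measurable
    (hK i).memLp_snd
  -- the stochastic part
  have z1 : OpZero ((errorLaw (densityMeasure f)).prod (errorLaw (densityMeasure f))) l fun i ω =>
      (m i : ℝ)⁻¹ * ‖∑ j ∈ Finset.range (m i), (translateL2 (hK i).memLp_snd
        (ω.1 j - (B i).eval (k i) ω.2 j) - translateL2 (g i) (-(B i).eval (k i) ω.2 j))‖ := by
    refine opZero_of_integral_sq_le (fun i => ?_) (V := fun i _ =>
      3 * (∫ u, κ'' u ^ 2) * (s i ^ 8 / a i ^ 5)) (fun i e => ?_)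
      (opZero_of_tendsto (hr.tendsto_pow (by norm_num) (by norm_num) _))
    · have c1 := continuous_translateL2 (hK i).memLp_snd
      have c2 := continuous_translateL2 (g i)
      have c3 : ∀ j, Continuous fun ω : (ℕ → ℝ) × (ℕ → ℝ) => (B i).eval (k i) ω.2 j := fun j =>
        ((B i).continuous_eval (k i) j).comp continuous_snd
      exact Continuous.measurable (by fun_prop)
    · obtain ⟨g1, g2⟩ := integral_norm_sq_sum_translateL2_le (ν := densityMeasure f)
        (hK i).continuous_snd.measurable (hK i).memLp_snd (m i) fun j => (B i).eval (k i) e j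
      simp_rw [mul_pow]
      refine ⟨g1.const_mul _, ?_⟩
      rw [integral_const_mul]
      rw [integral_kernelScale_sq _ _ (hr.a_pos i)] at g2
      have hmi : (0 : ℝ) < m i := by exact_mod_cast hm i
      have ha := hr.a_pos i
      have hc : 0 ≤ ∫ u, κ'' u ^ 2 := integral_nonneg fun _ => sq_nonneg _
      calc _ ≤ (m i : ℝ)⁻¹ ^ 2 * (m i * ((∫ u, κ'' u ^ 2) / a i ^ (2 * 2 + 1))) := by gcongr
        _ = (m i : ℝ)⁻¹ * ((∫ u, κ'' u ^ 2) / a i ^ 5) := by field_simp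
        _ ≤ (3 * s i ^ 8) * ((∫ u, κ'' u ^ 2) / a i ^ 5) := by
            gcongr
            exact hms i
        _ = _ := by ring
  have z2 := opZero_of_tendsto (P := (errorLaw (densityMeasure f)).prod
    (errorLaw (densityMeasure f))) (tendsto_norm_convMeasure_sub hκ hf hr)
  -- the translation of the limit
  have z3 : OpZero ((errorLaw (densityMeasure f)).prod (errorLaw (densityMeasure f))) l fun i ω =>
      (m i : ℝ)⁻¹ * ∑ j ∈ Finset.range (m i),
        ‖translateL2 hf.memLp_snd (-(B i).eval (k i) ω.2 j) - hf.memLp_snd.toLp φ‖ := by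
    choose! C hC0 hC using fun η (hη : 0 < η) =>
      exists_norm_translateL2_sub_le hf.memLp_snd hη
    refine opZero_of_forall_le (Y := fun η i ω => C η * (B i).meanSq (m i) (k i) ω.2)
      (fun η hη => ?_) fun η hη i ω => ?_
    · have := opZero_mul_meanSq h2 h0 hr hB (c := fun _ => C η) (fun _ => hC0 η hη)
        (by simpa using (hr.tendsto_s.pow 6).const_mul (C η))
      exact this.comp_snd
    · rw [abs_of_nonneg (by positivity)]
      have hmi : (0 : ℝ) < m i := by exact_mod_cast hm i
      calc _ ≤ (m i : ℝ)⁻¹ * ∑ j ∈ Finset.range (m i),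
            (η + C η * (B i).eval (k i) ω.2 j ^ 2) := by
            gcongr with j
            exact hC η hη _
        _ = _ := by
            rw [Finset.sum_add_distrib, ← Finset.mul_sum]
            simp only [Finset.sum_const, Finset.card_range, nsmul_eq_mul, ShiftForm.meanSq]
            field_simp
  refine ((z1.add z2).add z3).mono (Eventually.of_forall fun i ω => ?_)
  rw [abs_of_nonneg (by positivity), abs_of_nonneg (by positivity)]
  have hmi : (0 : ℝ) < m i := by exact_mod_cast hm i
  set T := ‖((g i).sub hf.memLp_snd).toLp (convMeasure (densityMeasure f)
    (kernelScale κ'' 2 (a i)) - φ)‖ with hT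
  have h3 : ‖∑ j ∈ Finset.range (m i), (translateL2 (hK i).memLp_snd
        (ω.1 j - (B i).eval (k i) ω.2 j) - hf.memLp_snd.toLp φ)‖ ≤
      ‖∑ j ∈ Finset.range (m i), (translateL2 (hK i).memLp_snd
        (ω.1 j - (B i).eval (k i) ω.2 j) - translateL2 (g i) (-(B i).eval (k i) ω.2 j))‖ +
      ∑ j ∈ Finset.range (m i), (T +
        ‖translateL2 hf.memLp_snd (-(B i).eval (k i) ω.2 j) - hf.memLp_snd.toLp φ‖) := by
    have e1 : ∑ j ∈ Finset.range (m i), (translateL2 (hK i).memLp_snd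
        (ω.1 j - (B i).eval (k i) ω.2 j) - hf.memLp_snd.toLp φ) =
        ∑ j ∈ Finset.range (m i), (translateL2 (hK i).memLp_snd
        (ω.1 j - (B i).eval (k i) ω.2 j) - translateL2 (g i) (-(B i).eval (k i) ω.2 j)) +
        ∑ j ∈ Finset.range (m i), ((translateL2 (g i) (-(B i).eval (k i) ω.2 j) -
          translateL2 hf.memLp_snd (-(B i).eval (k i) ω.2 j)) +
          (translateL2 hf.memLp_snd (-(B i).eval (k i) ω.2 j) - hf.memLp_snd.toLp φ)) := by
      rw [← Finset.sum_add_distrib]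
      exact Finset.sum_congr rfl fun j _ => by abel
    rw [e1]
    refine (norm_add_le _ _).trans (add_le_add le_rfl ((norm_sum_le _ _).trans
      (Finset.sum_le_sum fun j _ => (norm_add_le _ _).trans (add_le_add (le_of_eq ?_) le_rfl))))
    exact norm_translateL2_sub_translateL2 _ _ _
  refine (mul_le_mul_of_nonneg_left h3 (by positivity)).trans (le_of_eq ?_)
  rw [Finset.sum_add_distrib, Finset.sum_const, Finset.card_range, nsmul_eq_mul, mul_add, mul_add,
    inv_mul_cancel_left₀ hmi.ne', add_assoc]

end

/-! ### The split-sample estimator for a fixed design -/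

/-- The data of the sample-splitting procedure for fixed covariates. The first half of the sample
has `m` points, the second half has `k` points; `ρ₁`, `ρ₂` are the values of the regression
function at these points. The error of a regression estimate at a design point is an affine form
in the errors of the half on which the estimate is based: `own₁`, `own₂` for the estimate from the
same half as the point, `cross₁`, `cross₂` for the estimate from the other half. -/
structure SplitDesign where
  m : ℕ
  k : ℕ
  ρ₁ : ℕ → ℝ
  ρ₂ : ℕ → ℝ
  own₁ : ShiftForm
  own₂ : ShiftForm
  cross₁ : ShiftForm
  cross₂ : ShiftForm

namespace SplitDesign

/-- The two halves of the sample interchanged. -/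
def swap (D : SplitDesign) : SplitDesign where
  m := D.k
  k := D.m
  ρ₁ := D.ρ₂
  ρ₂ := D.ρ₁
  own₁ := D.own₂
  own₂ := D.own₁
  cross₁ := D.cross₂
  cross₂ := D.cross₁

/-- A design of size `s ^ (-8)` whose halves are of comparable size and for which the smoothers
have bias and weights of the right order. -/
structure Regular (D : SplitDesign) (K s : ℝ) : Prop where
  size : s ^ 8 * ((D.m : ℝ) + D.k) = 1
  m_pos : 0 < D.m
  k_pos : 0 < D.k
  le_m : (D.m : ℝ) + D.k ≤ 3 * D.m
  le_k : (D.m : ℝ) + D.k ≤ 3 * D.k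
  abs_ρ₁_le : ∀ j < D.m, |D.ρ₁ j| ≤ K
  abs_ρ₂_le : ∀ j < D.k, |D.ρ₂ j| ≤ K
  own₁ : D.own₁.Bounded K s D.m D.m
  own₂ : D.own₂.Bounded K s D.k D.k
  cross₁ : D.cross₁.Bounded K s D.m D.k
  cross₂ : D.cross₂.Bounded K s D.k D.m

theorem Regular.swap {D : SplitDesign} {K s : ℝ} (h : D.Regular K s) : D.swap.Regular K s where
  size := by rw [← h.size, add_comm (D.m : ℝ)]; rfl
  m_pos := h.k_pos
  k_pos := h.m_pos
  le_m := by rw [add_comm]; exact h.le_k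
  le_k := by rw [add_comm]; exact h.le_m
  abs_ρ₁_le := h.abs_ρ₂_le
  abs_ρ₂_le := h.abs_ρ₁_le
  own₁ := h.own₂
  own₂ := h.own₁
  cross₁ := h.cross₂
  cross₂ := h.cross₁

section Estimators

variable (D : SplitDesign) (κ κ' : ℝ → ℝ) (a : ℝ) (ω : (ℕ → ℝ) × (ℕ → ℝ))

/-- The residual of a point of the first half, for the regression estimate from that half. -/
noncomputable def res (j : ℕ) : ℝ := ω.1 j - D.own₁.eval D.m ω.1 j

/-- The residual of a point of the first half, for the regression estimate from the other half. -/
noncomputable def crossRes (j : ℕ) : ℝ := ω.1 j - D.cross₁.eval D.k ω.2 j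

/-- The regression estimate from the second half at a point of the first half. -/
noncomputable def crossFit (j : ℕ) : ℝ := D.ρ₁ j + D.cross₁.eval D.k ω.2 j

/-- The score estimate from the second half. -/
noncomputable def otherScore (z : ℝ) : ℝ := residualScore κ κ' a D.own₂ D.k ω.2 z

/-- The contribution of the first half to the estimator of the Fisher information. -/
noncomputable def fisherSum : ℝ :=
  ∑ j ∈ Finset.range D.m, D.otherScore κ κ' a ω (D.res ω j) ^ 2

/-- The estimator of the Fisher information. -/
noncomputable def fisher : ℝ :=
  ((D.m : ℝ) + D.k)⁻¹ * (D.fisherSum κ κ' a ω + D.swap.fisherSum κ κ' a ω.swap)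

/-- The estimator of the function `λ` that is used for the first half. -/
noncomputable def lamHat (z : ℝ) : ℝ := D.otherScore κ κ' a ω z / D.fisher κ κ' a ω - z

/-- A kernel estimator based on the residuals for the respective other half. -/
noncomputable def pooled (k : ℝ → ℝ) (z : ℝ) : ℝ :=
  ((D.m : ℝ) + D.k)⁻¹ * (∑ j ∈ Finset.range D.m, k (z - D.crossRes ω j) +
    ∑ j ∈ Finset.range D.k, k (z - D.swap.crossRes ω.swap j))

/-- The contribution of the first half to the estimated correction term. -/
noncomputable def estimate (y : ℝ) : ℝ :=
  ((D.m : ℝ) + D.k)⁻¹ * ∑ j ∈ Finset.range D.m,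
    (D.pooled ω (kernelScale κ' 1 a) (y - D.crossFit ω j) -
      (D.m : ℝ)⁻¹ * ∑ i ∈ Finset.range D.m, D.pooled ω (kernelScale κ' 1 a) (y - D.crossFit ω i)) *
      D.lamHat κ κ' a ω (D.res ω j)

/-- The contribution of the first half to the correction term, centred at the mean over that
half. -/
noncomputable def target (f f' : ℝ → ℝ) (y : ℝ) : ℝ :=
  ((D.m : ℝ) + D.k)⁻¹ * ∑ j ∈ Finset.range D.m,
    (f' (y - D.ρ₁ j) - (D.m : ℝ)⁻¹ * ∑ i ∈ Finset.range D.m, f' (y - D.ρ₁ i)) *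
      lam f f' (ω.1 j)

theorem pooled_swap (k : ℝ → ℝ) : D.swap.pooled ω.swap k = D.pooled ω k := by
  funext z
  simp only [pooled, swap, Prod.swap_swap]
  rw [add_comm (D.k : ℝ), add_comm (∑ j ∈ Finset.range D.k, _)]

theorem fisher_swap : D.swap.fisher κ κ' a ω.swap = D.fisher κ κ' a ω := by
  simp only [fisher, swap, Prod.swap_swap]
  rw [add_comm (D.k : ℝ), add_comm (fisherSum _ κ κ' a ω.swap)]

end Estimators

end SplitDesign

/-- Weights centred at their mean. -/
noncomputable def centre {E : Type*} [AddCommGroup E] [Module ℝ E] (N : ℕ) (x : ℕ → E) (j : ℕ) :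
    E :=
  x j - (N : ℝ)⁻¹ • ∑ i ∈ Finset.range N, x i

section Centre

variable {E : Type*} [AddCommGroup E] [Module ℝ E]

theorem sum_centre (N : ℕ) (x : ℕ → E) : ∑ j ∈ Finset.range N, centre N x j = 0 := by
  rcases Nat.eq_zero_or_pos N with rfl | hN
  · simp
  unfold centre
  rw [Finset.sum_sub_distrib, Finset.sum_const, Finset.card_range, ← Nat.cast_smul_eq_nsmul ℝ,
    smul_smul, mul_inv_cancel₀ (by positivity), one_smul, sub_self]

theorem sum_centre_smul (N : ℕ) (c : ℕ → ℝ) (x : ℕ → E) :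
    ∑ j ∈ Finset.range N, centre N c j • x j = ∑ j ∈ Finset.range N, c j • centre N x j := by
  unfold centre
  simp only [sub_smul, smul_sub, Finset.sum_sub_distrib]
  congr 1
  rw [← Finset.smul_sum, ← Finset.sum_smul, smul_smul, smul_eq_mul, mul_comm]

theorem centre_sub (N : ℕ) (x y : ℕ → E) (j : ℕ) :
    centre N x j - centre N y j = centre N (fun j => x j - y j) j := by
  unfold centre
  rw [Finset.sum_sub_distrib, smul_sub]
  exact sub_sub_sub_comm _ _ _ _

theorem sum_norm_centre_sq_le (N : ℕ) (x : ℕ → L2Line) :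
    ∑ j ∈ Finset.range N, ‖centre N x j‖ ^ 2 ≤ ∑ j ∈ Finset.range N, ‖x j‖ ^ 2 := by
  have h1 : ∀ j, ‖x j‖ ^ 2 = ‖centre N x j‖ ^ 2 +
      2 * inner ℝ (centre N x j) ((N : ℝ)⁻¹ • ∑ i ∈ Finset.range N, x i) +
      ‖(N : ℝ)⁻¹ • ∑ i ∈ Finset.range N, x i‖ ^ 2 := by
    intro j
    rw [← norm_add_sq_real]
    congr 2
    unfold centre
    abel
  have h2 : ∑ j ∈ Finset.range N, ‖x j‖ ^ 2 = ∑ j ∈ Finset.range N, ‖centre N x j‖ ^ 2 +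
      N * ‖(N : ℝ)⁻¹ • ∑ i ∈ Finset.range N, x i‖ ^ 2 := by
    simp_rw [h1]
    rw [Finset.sum_add_distrib, Finset.sum_add_distrib, ← Finset.mul_sum, ← sum_inner,
      sum_centre, inner_zero_left]
    simp
  rw [h2]
  exact le_add_of_nonneg_right (by positivity)

end Centre

theorem sum_shift_eq_inner {b b' : ℝ → ℝ} (hb2 : MemLp b' 2) (hb1 : Integrable b')
    (hb : ∀ z, b z = ∫ x in Iic z, b' x) (s : Finset ℕ) {c : ℕ → ℝ} (hc : ∑ j ∈ s, c j = 0)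
    (ρ : ℕ → ℝ) (y : ℝ) :
    ∑ j ∈ s, c j * b (y - ρ j) =
      inner ℝ ((memLp_comp_sub_left hb2 y).toLp) (∑ j ∈ s, c j • stepL2 (ρ j)) := by
  rw [inner_sum]
  simp_rw [real_inner_smul_right, inner_reflect_stepL2 hb2 hb1 hb, mul_sub]
  rw [Finset.sum_sub_distrib, ← Finset.sum_mul, hc, zero_mul, sub_zero]

/-- Two sums of translates with different weights and different translations, compared uniformly
in the point of evaluation. -/
theorem abs_sum_shift_sub_le {b b' : ℝ → ℝ} (hb2 : MemLp b' 2) (hb1 : Integrable b')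
    (hb : ∀ z, b z = ∫ x in Iic z, b' x) (N : ℕ) (c d ρ τ : ℕ → ℝ) (y : ℝ) :
    |∑ j ∈ Finset.range N, centre N c j * b (y - ρ j) -
      ∑ j ∈ Finset.range N, centre N d j * b (y - τ j)| ≤
    ‖hb2.toLp‖ * ‖∑ j ∈ Finset.range N, c j • centre N (fun j => stepL2 (ρ j)) j -
      ∑ j ∈ Finset.range N, d j • centre N (fun j => stepL2 (τ j)) j‖ := by
  rw [sum_shift_eq_inner hb2 hb1 hb _ (sum_centre N c), sum_shift_eq_inner hb2 hb1 hb _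
    (sum_centre N d), ← inner_sub_right, sum_centre_smul, sum_centre_smul,
    ← norm_toLp_reflect hb2 y]
  exact abs_real_inner_le_norm _ _

section

variable {f f' φ κ κ' κ'' : ℝ → ℝ} {M B₁ B₂ : ℝ} {ι : Type*} {l : Filter ι} {s a : ι → ℝ} {K : ℝ}
  {D : ι → SplitDesign}

theorem SplitDesign.Regular.inv_m_le {D : SplitDesign} {K s : ℝ} (h : D.Regular K s) :
    (D.m : ℝ)⁻¹ ≤ 3 * s ^ 8 := by
  have hm : (0 : ℝ) < D.m := by exact_mod_cast h.m_pos
  have h1 : 0 < (D.m : ℝ) + D.k := by positivity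
  have h2 : s ^ 8 = ((D.m : ℝ) + D.k)⁻¹ := eq_inv_of_mul_eq_one_left h.size
  rw [h2, inv_le_iff_one_le_mul₀ hm, mul_assoc, inv_mul_eq_div, mul_div_assoc']
  rw [le_div_iff₀ h1, one_mul]
  exact h.le_m

theorem SplitDesign.Regular.m_mul_le {D : SplitDesign} {K s : ℝ} (h : D.Regular K s) :
    (D.m : ℝ) * s ^ 8 ≤ 1 := by
  rw [← h.size, mul_comm]
  have : 0 ≤ s ^ 8 := by positivity
  have : (0 : ℝ) ≤ D.k := Nat.cast_nonneg _
  gcongr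
  linarith

theorem SplitDesign.Regular.tendsto_m (hD : ∀ i, (D i).Regular K (s i)) (hr : Regime l s a) :
    Tendsto (fun i => (D i).m) l atTop := by
  rw [← tendsto_natCast_atTop_iff (R := ℝ)]
  have h1 : Tendsto (fun i => 3 * s i ^ 8) l (𝓝[>] 0) :=
    tendsto_nhdsWithin_iff.2 ⟨by simpa using (hr.tendsto_s.pow 8).const_mul 3,
      Eventually.of_forall fun i => by have := hr.s_pos i; simp only [mem_Ioi]; positivity⟩
  refine tendsto_atTop_mono (fun i => ?_) (tendsto_inv_nhdsGT_zero.comp h1)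
  have hm : (0 : ℝ) < (D i).m := by exact_mod_cast (hD i).m_pos
  exact inv_le_of_inv_le₀ hm (hD i).inv_m_le

theorem memLp_lam (hf : IsSmoothDensity f f' φ M)
    (hJ : Integrable (fun z => score f f' z ^ 2 * f z))
    (h2 : MemLp (fun t : ℝ => t) 2 (densityMeasure f)) :
    MemLp (lam f f') 2 (densityMeasure f) := by
  have h := ((memLp_score hf hJ).mul_const (fisherInfo f f')⁻¹).sub h2
  simp only [← div_eq_mul_inv] at h
  exact h

theorem integral_lam (hf : IsSmoothDensity f f' φ M)
    (hJ : Integrable (fun z => score f f' z ^ 2 * f z))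
    [IsProbabilityMeasure (densityMeasure f)]
    (h2 : MemLp (fun t : ℝ => t) 2 (densityMeasure f)) (h0 : ∫ t, t ∂(densityMeasure f) = 0) :
    ∫ t, lam f f' t ∂(densityMeasure f) = 0 := by
  unfold lam
  rw [integral_sub (((memLp_score hf hJ).integrable one_le_two).div_const _)
    (h2.integrable one_le_two), integral_div, integral_score hf, h0]
  simp

theorem measurable_lam (hf : IsSmoothDensity f f' φ M) : Measurable (lam f f') :=
  ((measurable_score hf).div_const _).sub measurable_id

variable [IsProbabilityMeasure (densityMeasure f)]

/-- The estimator of the Fisher information is consistent. -/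
theorem opZero_fisher_sub (hκ : IsKernelTriple κ κ' κ'' B₁ B₂) (hf : IsSmoothDensity f f' φ M)
    (hJ : Integrable (fun z => score f f' z ^ 2 * f z))
    (h2 : MemLp (fun t : ℝ => t) 2 (densityMeasure f)) (h0 : ∫ t, t ∂(densityMeasure f) = 0)
    (hr : Regime l s a) (hD : ∀ i, (D i).Regular K (s i)) :
    OpZero ((errorLaw (densityMeasure f)).prod (errorLaw (densityMeasure f))) l fun i ω =>
      (D i).fisher κ κ' (a i) ω - fisherInfo f f' := by
  have half : ∀ D : ι → SplitDesign, (∀ i, (D i).Regular K (s i)) →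
      OpZero ((errorLaw (densityMeasure f)).prod (errorLaw (densityMeasure f))) l fun i ω =>
        ((D i).m : ℝ)⁻¹ * (D i).fisherSum κ κ' (a i) ω - fisherInfo f f' := by
    intro D hD
    have hL := isScoreEstimate_residualScore hκ hf hJ h2 h0 hr (fun i => (hD i).k_pos)
      (fun i => (hD i).swap.inv_m_le) fun i => (hD i).own₂
    have h := hL.opZero_mean_sq_sub (measurable_score hf) (memLp_score hf hJ) h2 h0 hr
      (SplitDesign.Regular.tendsto_m hD hr) fun i => (hD i).own₁
    rw [integral_score_sq hf] at h
    exact h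
  refine ((half D hD).abs.add (half _ fun i => (hD i).swap).comp_swap.abs).mono
    (Eventually.of_forall fun i ω => ?_)
  have hm : (0 : ℝ) < (D i).m := by exact_mod_cast (hD i).m_pos
  have hk : (0 : ℝ) < (D i).k := by exact_mod_cast (hD i).k_pos
  refine le_trans ?_ (le_abs_self _)
  set X := (D i).fisherSum κ κ' (a i) ω
  set Y := (D i).swap.fisherSum κ κ' (a i) ω.swap
  set J := fisherInfo f f'
  have e1 : (D i).fisher κ κ' (a i) ω - J =
      (((D i).m : ℝ) / ((D i).m + (D i).k)) * (((D i).m : ℝ)⁻¹ * X - J) +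
      (((D i).k : ℝ) / ((D i).m + (D i).k)) * (((D i).k : ℝ)⁻¹ * Y - J) := by
    simp only [SplitDesign.fisher]
    field_simp
    ring
  rw [e1]
  refine (abs_add_le _ _).trans (add_le_add ?_ ?_) <;> rw [abs_mul]
  · refine mul_le_of_le_one_left (abs_nonneg _) ?_
    rw [abs_of_pos (by positivity), div_le_one (by positivity)]
    linarith
  · refine mul_le_of_le_one_left (abs_nonneg _) ?_
    rw [abs_of_pos (by positivity), div_le_one (by positivity)]
    linarith

/-- The centred step functions at the fitted values are admissible weights. -/
theorem isWeights_crossFit (h2 : MemLp (fun t : ℝ => t) 2 (densityMeasure f))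
    (h0 : ∫ t, t ∂(densityMeasure f) = 0) (hr : Regime l s a)
    (hD : ∀ i, (D i).Regular K (s i)) :
    IsWeights (errorLaw (densityMeasure f)) l s (fun i => (D i).m) fun i e =>
      centre (D i).m fun j => stepL2 ((D i).ρ₁ j + (D i).cross₁.eval (D i).k e j) where
  stronglyMeasurable i j := by
    have h1 := continuous_stepL2
    refine Continuous.stronglyMeasurable ?_
    unfold centre
    fun_prop
  sum_eq_zero i e := sum_centre _ _
  opOne := by
    have h3 : OpZero (errorLaw (densityMeasure f)) l fun i e =>
        1 * (D i).cross₁.meanSq (D i).m (D i).k e :=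
      opZero_mul_meanSq h2 h0 hr (fun i => (hD i).cross₁) (c := fun _ => 1)
        (fun _ => zero_le_one) (by simpa using hr.tendsto_s.pow 6)
    refine ((opOne_const (|K| + 1)).add h3.opOne).mono (Eventually.of_forall fun i e => ?_)
    have hm : (0 : ℝ) < (D i).m := by exact_mod_cast (hD i).m_pos
    rw [abs_of_nonneg (by positivity)]
    refine le_trans ?_ (le_abs_self _)
    have h4 : ∑ j ∈ Finset.range (D i).m, ‖centre (D i).m (fun j =>
        stepL2 ((D i).ρ₁ j + (D i).cross₁.eval (D i).k e j)) j‖ ^ 2 ≤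
        ∑ j ∈ Finset.range (D i).m, (|K| + 1 + (D i).cross₁.eval (D i).k e j ^ 2) := by
      refine (sum_norm_centre_sq_le _ _).trans (Finset.sum_le_sum fun j hj => ?_)
      rw [norm_stepL2_sq]
      have h5 := (hD i).abs_ρ₁_le j (Finset.mem_range.1 hj)
      have h6 := abs_add_le ((D i).ρ₁ j) ((D i).cross₁.eval (D i).k e j)
      have h7 := sq_abs ((D i).cross₁.eval (D i).k e j)
      nlinarith [le_abs_self K, sq_nonneg (|(D i).cross₁.eval (D i).k e j| - 1),
        abs_nonneg ((D i).cross₁.eval (D i).k e j)]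
    have h8 : s i ^ 8 ≤ ((D i).m : ℝ)⁻¹ := by
      rw [← one_div, le_div_iff₀ hm, mul_comm]
      exact (hD i).m_mul_le
    calc _ ≤ ((D i).m : ℝ)⁻¹ * ∑ j ∈ Finset.range (D i).m,
          (|K| + 1 + (D i).cross₁.eval (D i).k e j ^ 2) := by
          have := hr.s_pos i
          gcongr
      _ = _ := by
          rw [Finset.sum_add_distrib, Finset.sum_const, Finset.card_range, nsmul_eq_mul,
            ShiftForm.meanSq]
          field_simp

/-- Changing the weights from the fitted values to the true values of the regression function. -/
theorem opZero_sum_lam_crossFit (hf : IsSmoothDensity f f' φ M)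
    (hJ : Integrable (fun z => score f f' z ^ 2 * f z))
    (h2 : MemLp (fun t : ℝ => t) 2 (densityMeasure f))
    (h0 : ∫ t, t ∂(densityMeasure f) = 0) (hr : Regime l s a)
    (hD : ∀ i, (D i).Regular K (s i)) :
    OpZero ((errorLaw (densityMeasure f)).prod (errorLaw (densityMeasure f))) l fun i ω =>
      s i ^ 4 * ‖∑ j ∈ Finset.range (D i).m, lam f f' (ω.1 j) • centre (D i).m (fun j =>
        stepL2 ((D i).ρ₁ j + (D i).cross₁.eval (D i).k ω.2 j) - stepL2 ((D i).ρ₁ j)) j‖ := by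
  have h3 : OpZero (errorLaw (densityMeasure f)) l fun i e =>
      1 * (D i).cross₁.meanSq (D i).m (D i).k e :=
    opZero_mul_meanSq h2 h0 hr (fun i => (hD i).cross₁) (c := fun _ => 1)
      (fun _ => zero_le_one) (by simpa using hr.tendsto_s.pow 6)
  have h4 := h3.sqrt.const_mul (∫ t, lam f f' t ^ 2 ∂(densityMeasure f))
  have hlm := measurable_lam hf
  refine opZero_of_integral_sq_le (fun i => measurable_norm_sum_smul (u := fun e =>
    centre (D i).m (fun j => stepL2 ((D i).ρ₁ j + (D i).cross₁.eval (D i).k e j) -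
      stepL2 ((D i).ρ₁ j))) (fun j =>
    hlm.comp ((measurable_pi_apply j).comp measurable_fst)) (fun j => ?_) _ _)
    (fun i e => ?_) h4
  · have h1 := continuous_stepL2
    refine Continuous.stronglyMeasurable ?_
    unfold centre
    fun_prop
  · obtain ⟨g1, g2⟩ := integral_norm_sq_sum_smul_le (memLp_lam hf hJ h2)
      (integral_lam hf hJ h2 h0) (D i).m (centre (D i).m (fun j =>
        stepL2 ((D i).ρ₁ j + (D i).cross₁.eval (D i).k e j) - stepL2 ((D i).ρ₁ j))) (s i)
    refine ⟨g1, g2.trans (mul_le_mul_of_nonneg_left ?_ (integral_nonneg fun _ => sq_nonneg _))⟩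
    have hm : (0 : ℝ) < (D i).m := by exact_mod_cast (hD i).m_pos
    have h8 : s i ^ 8 ≤ ((D i).m : ℝ)⁻¹ := by
      rw [← one_div, le_div_iff₀ hm, mul_comm]
      exact (hD i).m_mul_le
    have h5 : ∑ j ∈ Finset.range (D i).m, ‖centre (D i).m (fun j =>
        stepL2 ((D i).ρ₁ j + (D i).cross₁.eval (D i).k e j) - stepL2 ((D i).ρ₁ j)) j‖ ^ 2 ≤
        ∑ j ∈ Finset.range (D i).m, |(D i).cross₁.eval (D i).k e j| := by
      refine (sum_norm_centre_sq_le _ _).trans (Finset.sum_le_sum fun j hj => ?_)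
      rw [norm_stepL2_sub_sq, add_sub_cancel_left]
    have hs := hr.s_pos i
    calc _ ≤ ((D i).m : ℝ)⁻¹ * ∑ j ∈ Finset.range (D i).m, |(D i).cross₁.eval (D i).k e j| := by
          gcongr
      _ ≤ _ := by
          rw [one_mul]
          exact Real.le_sqrt_of_sq_le (sq_inv_mul_sum_abs_le _ _)

/-- The second derivative of the pooled density estimator is consistent in `L²`. -/
theorem exists_opZero_pooled (hκ : IsKernelTriple κ κ' κ'' B₁ B₂) (hf : IsSmoothDensity f f' φ M)
    (h2 : MemLp (fun t : ℝ => t) 2 (densityMeasure f))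
    (h0 : ∫ t, t ∂(densityMeasure f) = 0) (hr : Regime l s a)
    (hD : ∀ i, (D i).Regular K (s i)) :
    ∃ hp : ∀ i ω, MemLp ((D i).pooled ω (kernelScale κ'' 2 (a i))) 2,
    OpZero ((errorLaw (densityMeasure f)).prod (errorLaw (densityMeasure f))) l fun i ω =>
      ‖((hp i ω).sub hf.memLp_snd).toLp
        ((D i).pooled ω (kernelScale κ'' 2 (a i)) - φ)‖ := by
  have hK : ∀ i, IsKernelTriple _ _ _ _ _ := fun i => hκ.scale (hr.a_pos i)
  have e0 : ∀ i ω, (D i).pooled ω (kernelScale κ'' 2 (a i)) =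
      (((D i).m : ℝ) / ((D i).m + (D i).k)) •
        kernelMean (kernelScale κ'' 2 (a i)) (D i).m ((D i).crossRes ω) +
      (((D i).k : ℝ) / ((D i).m + (D i).k)) •
        kernelMean (kernelScale κ'' 2 (a i)) (D i).k ((D i).swap.crossRes ω.swap) := by
    intro i ω
    have hm : (0 : ℝ) < (D i).m := by exact_mod_cast (hD i).m_pos
    have hk : (0 : ℝ) < (D i).k := by exact_mod_cast (hD i).k_pos
    funext z
    simp only [SplitDesign.pooled, kernelMean, Pi.add_apply, Pi.smul_apply, smul_eq_mul]
    field_simp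
  have hp : ∀ i ω, MemLp ((D i).pooled ω (kernelScale κ'' 2 (a i))) 2 := by
    intro i ω
    rw [e0]
    exact ((memLp_kernelMean (hK i).memLp_snd _ _).const_smul _).add
      ((memLp_kernelMean (hK i).memLp_snd _ _).const_smul _)
  refine ⟨hp, ?_⟩
  have z1 := opZero_kernelMean_snd hκ hf h2 h0 hr (fun i => (hD i).m_pos)
    (fun i => (hD i).inv_m_le) fun i => (hD i).cross₁
  have z2 := (opZero_kernelMean_snd hκ hf h2 h0 hr (fun i => (hD i).swap.m_pos)
    (fun i => (hD i).swap.inv_m_le) fun i => (hD i).swap.cross₁).comp_swap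
  refine (z1.add z2).mono (Eventually.of_forall fun i ω => ?_)
  have hm : (0 : ℝ) < (D i).m := by exact_mod_cast (hD i).m_pos
  have hk : (0 : ℝ) < (D i).k := by exact_mod_cast (hD i).k_pos
  rw [abs_of_nonneg (norm_nonneg _)]
  refine le_trans ?_ (le_abs_self _)
  have y1 := norm_toLp_kernelMean_sub (hK i).memLp_snd hf.memLp_snd (hD i).m_pos
    ((D i).crossRes ω)
  have y2 := norm_toLp_kernelMean_sub (hK i).memLp_snd hf.memLp_snd (hD i).k_pos
    ((D i).swap.crossRes ω.swap)
  set k1 := (memLp_kernelMean (hK i).memLp_snd (D i).m ((D i).crossRes ω)).toLp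
    (kernelMean (kernelScale κ'' 2 (a i)) (D i).m ((D i).crossRes ω))
  set k2 := (memLp_kernelMean (hK i).memLp_snd (D i).k ((D i).swap.crossRes ω.swap)).toLp
    (kernelMean (kernelScale κ'' 2 (a i)) (D i).k ((D i).swap.crossRes ω.swap))
  set g := hf.memLp_snd.toLp φ
  set p := ((D i).m : ℝ) / ((D i).m + (D i).k) with hpd
  set q := ((D i).k : ℝ) / ((D i).m + (D i).k) with hqd
  have hpq : p + q = 1 := by rw [hpd, hqd]; field_simp
  have hp0 : 0 ≤ p := by positivity
  have hq0 : 0 ≤ q := by positivity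
  have e1 : ((hp i ω).sub hf.memLp_snd).toLp ((D i).pooled ω (kernelScale κ'' 2 (a i)) - φ) =
      p • (k1 - g) + q • (k2 - g) := by
    have : p • (k1 - g) + q • (k2 - g) = (p • k1 + q • k2) - g := by
      rw [smul_sub, smul_sub, sub_add_sub_comm, ← add_smul, hpq, one_smul]
    rw [this, MemLp.toLp_sub (hp i ω) hf.memLp_snd]
    congr 1
    simp only [k1, k2, ← MemLp.toLp_const_smul, ← MemLp.toLp_add]
    congr 1
    exact e0 i ω
  rw [e1]
  calc ‖p • (k1 - g) + q • (k2 - g)‖ ≤ p * ‖k1 - g‖ + q * ‖k2 - g‖ := by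
        refine (norm_add_le _ _).trans (le_of_eq ?_)
        rw [norm_smul, norm_smul, Real.norm_of_nonneg hp0, Real.norm_of_nonneg hq0]
    _ ≤ ‖k1 - g‖ + ‖k2 - g‖ := by
        gcongr
        · exact mul_le_of_le_one_left (norm_nonneg _) (by linarith)
        · exact mul_le_of_le_one_left (norm_nonneg _) (by linarith)
    _ = _ := by rw [y1, y2]; rfl

/-- For a fixed regular design, the contribution of the first half of the sample is estimated
uniformly with an error of smaller order than `s ^ 4 = n^(-1/2)`. -/
theorem exists_opZero_estimate_sub_target (hκ : IsKernelTriple κ κ' κ'' B₁ B₂)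
    (hf : IsSmoothDensity f f' φ M) (hJ : Integrable (fun z => score f f' z ^ 2 * f z))
    (h2 : MemLp (fun t : ℝ => t) 2 (densityMeasure f))
    (h0 : ∫ t, t ∂(densityMeasure f) = 0) (hr : Regime l s a)
    (hD : ∀ i, (D i).Regular K (s i)) :
    ∃ Z : ι → (ℕ → ℝ) × (ℕ → ℝ) → ℝ,
      OpZero ((errorLaw (densityMeasure f)).prod (errorLaw (densityMeasure f))) l Z ∧
      ∀ i ω y, |(D i).estimate κ κ' (a i) ω y - (D i).target ω f f' y| ≤ s i ^ 4 * |Z i ω| := by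
  have hK : ∀ i, IsKernelTriple _ _ _ _ _ := fun i => hκ.scale (hr.a_pos i)
  obtain ⟨hp, zp⟩ := exists_opZero_pooled hκ hf h2 h0 hr hD
  have hu := isWeights_crossFit h2 h0 hr hD
  have hL := isScoreEstimate_residualScore hκ hf hJ h2 h0 hr (fun i => (hD i).k_pos)
    (fun i => (hD i).swap.inv_m_le) fun i => (hD i).own₂
  have zq := (opZero_fisher_sub hκ hf hJ h2 h0 hr hD).inv_sub_inv (fisherInfo_pos hf hJ).ne'
  have z1 := hu.opZero_sum_estimated hf hJ h2 h0 hr (fun i => (hD i).m_pos)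
    (fun i => (hD i).m_mul_le) (fun i => (hD i).own₁) hL zq
  have o1 := hu.opOne_sum (measurable_lam hf) (memLp_lam hf hJ h2) (integral_lam hf hJ h2 h0)
  have z2 := opZero_sum_lam_crossFit hf hJ h2 h0 hr hD
  refine ⟨_, (zp.mul_opOne (z1.opOne.add o1)).add ((z1.add z2).const_mul
    ‖hf.memLp_snd.toLp φ‖), fun i ω y => ?_⟩
  have hs := hr.s_pos i
  have hn : ((D i).m + (D i).k : ℝ)⁻¹ = s i ^ 8 := by
    rw [inv_eq_of_mul_eq_one_left (hD i).size]
  set m := (D i).m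
  set lh : ℕ → ℝ := fun j => (D i).lamHat κ κ' (a i) ω ((D i).res ω j) with hlh
  set lt : ℕ → ℝ := fun j => lam f f' (ω.1 j) with hlt
  set F := (D i).pooled ω (kernelScale κ' 1 (a i)) with hF
  set F' := (D i).pooled ω (kernelScale κ'' 2 (a i)) with hF'
  set T := (D i).crossFit ω with hT
  set u := centre m fun j => stepL2 (T j) with hu'
  set v := centre m fun j => stepL2 ((D i).ρ₁ j) with hv
  -- Abel summation: the centring is moved from the functions to the coefficients
  have c1 : (D i).estimate κ κ' (a i) ω y =
      s i ^ 8 * ∑ j ∈ Finset.range m, centre m lh j * F (y - T j) := by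
    have h := sum_centre_smul m lh fun j => F (y - T j)
    simp only [smul_eq_mul] at h
    rw [h, SplitDesign.estimate, hn]
    congr 1
    refine Finset.sum_congr rfl fun j _ => ?_
    rw [mul_comm]
    rfl
  have c2 : (D i).target ω f f' y =
      s i ^ 8 * ∑ j ∈ Finset.range m, centre m lt j * f' (y - (D i).ρ₁ j) := by
    have h := sum_centre_smul m lt fun j => f' (y - (D i).ρ₁ j)
    simp only [smul_eq_mul] at h
    rw [h, SplitDesign.target, hn]
    congr 1
    refine Finset.sum_congr rfl fun j _ => ?_
    rw [mul_comm]
    rfl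
  -- the pooled derivative is the primitive of the pooled second derivative
  have hFi : Integrable F' := by
    simp only [hF']
    exact (((integrable_finsetSum _ fun j _ => (hK i).integrable_snd.comp_sub_right _).add
      (integrable_finsetSum _ fun j _ => (hK i).integrable_snd.comp_sub_right _)).const_mul _)
  have hFd : ∀ z, F z = ∫ x in Iic z, F' x := by
    intro z
    have e1 : ∀ t : ℝ, kernelScale κ' 1 (a i) (z - t) =
        ∫ x in Iic z, kernelScale κ'' 2 (a i) (x - t) := by
      intro t
      rw [(hK i).eq_integral_fst, ← integral_indicator measurableSet_Iic,
        ← integral_indicator measurableSet_Iic, ← integral_sub_right_eq_self _ t]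
      congr 1
      funext x
      by_cases hx : x ≤ z
      · rw [indicator_of_mem (by simpa using hx), indicator_of_mem (by simpa using hx)]
      · rw [indicator_of_notMem (by simpa using hx), indicator_of_notMem (by simpa using hx)]
    have e2 : ∀ t : ℝ, IntegrableOn (fun x => kernelScale κ'' 2 (a i) (x - t)) (Iic z) :=
      fun t => ((hK i).integrable_snd.comp_sub_right t).integrableOn
    simp only [hF, hF', SplitDesign.pooled, e1]
    rw [integral_const_mul, integral_add (integrable_finsetSum _ fun j _ => e2 _)
      (integrable_finsetSum _ fun j _ => e2 _), integral_finsetSum _ fun j _ => e2 _,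
      integral_finsetSum _ fun j _ => e2 _]
  have hdF : ∀ z, (F z - f' z) = ∫ x in Iic z, (F' - φ) x := by
    intro z
    rw [hFd, hf.deriv_eq_integral]
    exact (integral_sub hFi.integrableOn hf.integrable_snd.integrableOn).symm
  have b1 := abs_sum_shift_le ((hp i ω).sub hf.memLp_snd) (hFi.sub hf.integrable_snd) hdF
    (Finset.range m) (sum_centre m lh) T y
  rw [sum_centre_smul] at b1
  have b2 := abs_sum_shift_sub_le hf.memLp_snd hf.integrable_snd hf.deriv_eq_integral m lh lt T
    (D i).ρ₁ y
  have e1 : ∑ j ∈ Finset.range m, lh j • u j =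
      ∑ j ∈ Finset.range m, (lh j - lt j) • u j + ∑ j ∈ Finset.range m, lt j • u j := by
    rw [← Finset.sum_add_distrib]
    exact Finset.sum_congr rfl fun j _ => by rw [← add_smul, sub_add_cancel]
  have e2 : ∑ j ∈ Finset.range m, lh j • u j - ∑ j ∈ Finset.range m, lt j • v j =
      ∑ j ∈ Finset.range m, (lh j - lt j) • u j +
      ∑ j ∈ Finset.range m, lt j • centre m (fun j => stepL2 (T j) - stepL2 ((D i).ρ₁ j)) j := by
    rw [e1, add_sub_assoc, ← Finset.sum_sub_distrib]
    congr 1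
    refine Finset.sum_congr rfl fun j _ => ?_
    rw [← smul_sub, ← centre_sub]
  have e3 : ∀ j, lh j - lt j = ((D i).fisher κ κ' (a i) ω)⁻¹ *
      residualScore κ κ' (a i) (D i).own₂ (D i).k ω.2 (ω.1 j - (D i).own₁.eval m ω.1 j) -
      (ω.1 j - (D i).own₁.eval m ω.1 j) - lam f f' (ω.1 j) := by
    intro j
    simp only [hlh, hlt, SplitDesign.lamHat, SplitDesign.otherScore, SplitDesign.res]
    rw [div_eq_inv_mul]
  have n1 : ‖∑ j ∈ Finset.range m, lh j • u j‖ ≤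
      ‖∑ j ∈ Finset.range m, (lh j - lt j) • u j‖ + ‖∑ j ∈ Finset.range m, lt j • u j‖ := by
    rw [e1]; exact norm_add_le _ _
  have n2 := (e2 ▸ norm_add_le _ _ : ‖∑ j ∈ Finset.range m, lh j • u j -
    ∑ j ∈ Finset.range m, lt j • v j‖ ≤ _)
  simp only [e3] at n1 n2
  set X := ‖∑ j ∈ Finset.range m, (((D i).fisher κ κ' (a i) ω)⁻¹ *
      residualScore κ κ' (a i) (D i).own₂ (D i).k ω.2 (ω.1 j - (D i).own₁.eval m ω.1 j) -
      (ω.1 j - (D i).own₁.eval m ω.1 j) - lam f f' (ω.1 j)) • u j‖ with hX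
  set Y := ‖∑ j ∈ Finset.range m, lt j • u j‖ with hY
  set W := ‖∑ j ∈ Finset.range m, lt j • centre m (fun j => stepL2 (T j) -
    stepL2 ((D i).ρ₁ j)) j‖ with hW
  set G := ‖((hp i ω).sub hf.memLp_snd).toLp (F' - φ)‖ with hG
  set Φ := ‖hf.memLp_snd.toLp φ‖ with hΦ
  have hsum : |∑ j ∈ Finset.range m, centre m lh j * F (y - T j) -
      ∑ j ∈ Finset.range m, centre m lt j * f' (y - (D i).ρ₁ j)| ≤
      G * (X + Y) + Φ * (X + W) := by
    have t1 : ∑ j ∈ Finset.range m, centre m lh j * F (y - T j) -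
        ∑ j ∈ Finset.range m, centre m lt j * f' (y - (D i).ρ₁ j) =
        ∑ j ∈ Finset.range m, centre m lh j * (F (y - T j) - f' (y - T j)) +
        (∑ j ∈ Finset.range m, centre m lh j * f' (y - T j) -
          ∑ j ∈ Finset.range m, centre m lt j * f' (y - (D i).ρ₁ j)) := by
      simp only [mul_sub, Finset.sum_sub_distrib]
      ring
    rw [t1]
    refine (abs_add_le _ _).trans (add_le_add (b1.trans ?_) (b2.trans ?_))
    · exact mul_le_mul_of_nonneg_left n1 (norm_nonneg _)
    · exact mul_le_mul_of_nonneg_left n2 (norm_nonneg _)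
  rw [c1, c2, ← mul_sub, abs_mul, abs_of_nonneg (by positivity : 0 ≤ s i ^ 8)]
  calc s i ^ 8 * _ ≤ s i ^ 8 * (G * (X + Y) + Φ * (X + W)) := by gcongr
    _ = s i ^ 4 * (G * (s i ^ 4 * X + s i ^ 4 * Y) + Φ * (s i ^ 4 * X + s i ^ 4 * W)) := by ring
    _ ≤ _ := by
        gcongr
        exact le_abs_self _

end

/-! ### Local quadratic smoothers -/

/-- The normalized Gram matrix of the monomials of degree at most two in the local quadratic fit
at `t`, based on the points `x i`, `i < N`. -/
noncomputable def gramMatrix (w : ℝ → ℝ) (c : ℝ) (N : ℕ) (x : ℕ → ℝ) (t : ℝ) :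
    Matrix (Fin 3) (Fin 3) ℝ :=
  Matrix.of fun p q => ((N : ℝ) * c)⁻¹ * ∑ i ∈ Finset.range N,
    w ((x i - t) / c) * ((x i - t) / c) ^ (p.1 + q.1)

/-- The first column of the inverse of the Gram matrix, by Cramer's rule. -/
noncomputable def gramCoef (w : ℝ → ℝ) (c : ℝ) (N : ℕ) (x : ℕ → ℝ) (t : ℝ) (p : Fin 3) : ℝ :=
  (gramMatrix w c N x t).det⁻¹ * (gramMatrix w c N x t).adjugate p 0

/-- The weight of the `i`-th response in the local quadratic smoother at `t`. -/
noncomputable def fitWeight (w : ℝ → ℝ) (c : ℝ) (N : ℕ) (x : ℕ → ℝ) (t : ℝ) (i : ℕ) : ℝ :=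
  ((N : ℝ) * c)⁻¹ * (w ((x i - t) / c) * ∑ p : Fin 3, gramCoef w c N x t p * ((x i - t) / c) ^ p.1)

/-- The design points are locally rich enough for the local quadratic fit at `t`. -/
def GramBound (w : ℝ → ℝ) (c : ℝ) (N : ℕ) (x : ℕ → ℝ) (t κ₀ : ℝ) : Prop :=
  ∀ a : Fin 3 → ℝ, κ₀ * ∑ p, a p ^ 2 ≤ ((N : ℝ) * c)⁻¹ * ∑ i ∈ Finset.range N,
    w ((x i - t) / c) * (∑ p : Fin 3, a p * ((x i - t) / c) ^ p.1) ^ 2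

section

variable {w : ℝ → ℝ} {c : ℝ} {N : ℕ} {x : ℕ → ℝ} {t κ₀ : ℝ}

theorem sum_mul_gramMatrix (w : ℝ → ℝ) (c : ℝ) (N : ℕ) (x : ℕ → ℝ) (t : ℝ) (a b : Fin 3 → ℝ) :
    ∑ p, ∑ q, a p * gramMatrix w c N x t p q * b q =
      ((N : ℝ) * c)⁻¹ * ∑ i ∈ Finset.range N, w ((x i - t) / c) *
        ((∑ p : Fin 3, a p * ((x i - t) / c) ^ p.1) *
          ∑ q : Fin 3, b q * ((x i - t) / c) ^ q.1) := by
  have h1 : ∀ p q : Fin 3, a p * gramMatrix w c N x t p q * b q =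
      ((N : ℝ) * c)⁻¹ * ∑ i ∈ Finset.range N, w ((x i - t) / c) *
        ((a p * ((x i - t) / c) ^ p.1) * (b q * ((x i - t) / c) ^ q.1)) := by
    intro p q
    simp only [gramMatrix, Matrix.of_apply, pow_add, Finset.mul_sum, Finset.sum_mul]
    exact Finset.sum_congr rfl fun i _ => by ring
  simp only [h1, ← Finset.mul_sum]
  congr 1
  rw [Finset.sum_congr rfl fun p _ => Finset.sum_comm, Finset.sum_comm]
  refine Finset.sum_congr rfl fun i _ => ?_
  simp only [← Finset.mul_sum, ← Finset.sum_mul]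

theorem GramBound.det_ne_zero (h : GramBound w c N x t κ₀) (hκ : 0 < κ₀) :
    (gramMatrix w c N x t).det ≠ 0 := by
  intro h0
  obtain ⟨v, hv, hv0⟩ := Matrix.exists_mulVec_eq_zero_iff.2 h0
  have h1 := h v
  have h2 := sum_mul_gramMatrix w c N x t v v
  have h3 : ∑ p, ∑ q, v p * gramMatrix w c N x t p q * v q = 0 := by
    have : ∀ p, ∑ q, v p * gramMatrix w c N x t p q * v q =
        v p * (gramMatrix w c N x t).mulVec v p := by
      intro p
      simp only [Matrix.mulVec, dotProduct, Finset.mul_sum, mul_assoc]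
    simp [this, hv0]
  simp only [← sq] at h2
  rw [← h2, h3] at h1
  have h4 : 0 < ∑ p, v p ^ 2 := by
    obtain ⟨p, hp⟩ := Function.ne_iff.1 hv
    exact Finset.sum_pos' (fun _ _ => sq_nonneg _) ⟨p, Finset.mem_univ _, by
      simp only [Pi.zero_apply] at hp; positivity⟩
  have := mul_pos hκ h4
  linarith

theorem GramBound.sum_gram_mul_coef (h : GramBound w c N x t κ₀) (hκ : 0 < κ₀) (p : Fin 3) :
    ∑ q, gramMatrix w c N x t p q * gramCoef w c N x t q = if p = 0 then 1 else 0 := by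
  have hd := h.det_ne_zero hκ
  have h1 := congrFun (congrFun (Matrix.mul_adjugate (gramMatrix w c N x t)) p) 0
  rw [Matrix.mul_apply, Matrix.smul_apply, Matrix.one_apply, smul_eq_mul] at h1
  simp only [gramCoef, mul_left_comm _ (_⁻¹)]
  rw [← Finset.mul_sum, h1, ← mul_assoc, inv_mul_cancel₀ hd, one_mul]

/-- The smoother reproduces polynomials of degree at most two. -/
theorem GramBound.sum_fitWeight_mul (h : GramBound w c N x t κ₀) (hκ : 0 < κ₀) (b : Fin 3 → ℝ) :
    ∑ i ∈ Finset.range N, fitWeight w c N x t i * ∑ p : Fin 3, b p * ((x i - t) / c) ^ p.1 =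
      b 0 := by
  have h1 := sum_mul_gramMatrix w c N x t b (gramCoef w c N x t)
  have h2 : ∑ p, ∑ q, b p * gramMatrix w c N x t p q * gramCoef w c N x t q = b 0 := by
    have : ∀ p, ∑ q, b p * gramMatrix w c N x t p q * gramCoef w c N x t q =
        b p * if p = 0 then 1 else 0 := by
      intro p
      rw [← h.sum_gram_mul_coef hκ p, Finset.mul_sum]
      exact Finset.sum_congr rfl fun q _ => mul_assoc _ _ _
    simp [this]
  rw [← h2, h1, Finset.mul_sum]
  refine Finset.sum_congr rfl fun i _ => ?_
  unfold fitWeight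
  ring

theorem GramBound.sum_fitWeight (h : GramBound w c N x t κ₀) (hκ : 0 < κ₀) :
    ∑ i ∈ Finset.range N, fitWeight w c N x t i = 1 := by
  have := h.sum_fitWeight_mul hκ ![1, 0, 0]
  simpa [Fin.sum_univ_three] using this

theorem GramBound.sum_fitWeight_mul_sub (h : GramBound w c N x t κ₀) (hκ : 0 < κ₀)
    (hc : 0 < c) : ∑ i ∈ Finset.range N, fitWeight w c N x t i * (x i - t) = 0 := by
  have := h.sum_fitWeight_mul hκ ![0, 1, 0]
  simp only [Fin.sum_univ_three, Matrix.cons_val_zero, Matrix.cons_val_one, Matrix.cons_val] at this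
  have h1 : ∑ i ∈ Finset.range N, fitWeight w c N x t i * (x i - t) =
      c * ∑ i ∈ Finset.range N, fitWeight w c N x t i *
        (0 * ((x i - t) / c) ^ (0 : Fin 3).1 + 1 * ((x i - t) / c) ^ (1 : Fin 3).1 +
          0 * ((x i - t) / c) ^ (2 : Fin 3).1) := by
    rw [Finset.mul_sum]
    refine Finset.sum_congr rfl fun i _ => ?_
    simp
    field_simp
  rw [h1, this, mul_zero]

theorem le_inv_sq_of_sq_mul_le {k S : ℝ} (hk : 0 < k) (hS : 0 ≤ S) (h : (k * S) ^ 2 ≤ S) :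
    S ≤ k⁻¹ ^ 2 := by
  rcases hS.eq_or_lt with h6 | h6
  · rw [← h6]; positivity
  · have h7 : k ^ 2 * S ≤ 1 := by
      refine le_of_mul_le_mul_right ?_ h6
      calc k ^ 2 * S * S = (k * S) ^ 2 := by ring
        _ ≤ 1 * S := by rwa [one_mul]
    rw [inv_pow, ← one_div, le_div_iff₀ (by positivity), mul_comm]
    exact h7

theorem GramBound.sum_sq_gramCoef_le (h : GramBound w c N x t κ₀) (hκ : 0 < κ₀) :
    ∑ p, gramCoef w c N x t p ^ 2 ≤ (κ₀⁻¹) ^ 2 := by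
  have h2 := h.sum_fitWeight_mul hκ (gramCoef w c N x t)
  have h1 := h (gramCoef w c N x t)
  have h3 : ((N : ℝ) * c)⁻¹ * ∑ i ∈ Finset.range N,
      w ((x i - t) / c) * (∑ p : Fin 3, gramCoef w c N x t p * ((x i - t) / c) ^ p.1) ^ 2 =
      gramCoef w c N x t 0 := by
    rw [← h2, Finset.mul_sum]
    refine Finset.sum_congr rfl fun i _ => ?_
    rw [fitWeight]
    ring
  rw [h3] at h1
  have hS : 0 ≤ ∑ p, gramCoef w c N x t p ^ 2 := Finset.sum_nonneg fun _ _ => sq_nonneg _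
  refine le_inv_sq_of_sq_mul_le hκ hS ((pow_le_pow_left₀ (mul_nonneg hκ.le hS) h1 2).trans ?_)
  exact Finset.single_le_sum (f := fun p => gramCoef w c N x t p ^ 2)
    (fun p _ => sq_nonneg _) (Finset.mem_univ 0)

/-- The weights of the smoother are of the order of the reciprocal of the number of points in a
window. -/
theorem GramBound.abs_fitWeight_le (h : GramBound w c N x t κ₀) (hκ : 0 < κ₀) (hc : 0 < c)
    {w₁ : ℝ} (hw1 : ∀ u, |w u| ≤ w₁) (hw0 : ∀ u, u ∉ Icc (-1 : ℝ) 1 → w u = 0) (i : ℕ) :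
    |fitWeight w c N x t i| ≤ ((N : ℝ) * c)⁻¹ * (w₁ * (2 * κ₀⁻¹)) := by
  have hw1' : 0 ≤ w₁ := (abs_nonneg _).trans (hw1 0)
  have hNc : 0 ≤ ((N : ℝ) * c)⁻¹ := by positivity
  unfold fitWeight
  rw [abs_mul, abs_of_nonneg hNc, abs_mul]
  refine mul_le_mul_of_nonneg_left ?_ hNc
  set u := (x i - t) / c
  by_cases hu : u ∈ Icc (-1 : ℝ) 1
  · refine mul_le_mul (hw1 u) ?_ (abs_nonneg _) hw1'
    have hu1 : |u| ≤ 1 := abs_le.2 hu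
    have h1 := h.sum_sq_gramCoef_le hκ
    refine abs_le_of_sq_le_sq ?_ (by positivity)
    have h2 : (∑ p : Fin 3, gramCoef w c N x t p * u ^ p.1) ^ 2 ≤
        (∑ p, gramCoef w c N x t p ^ 2) * ∑ p : Fin 3, (u ^ p.1) ^ 2 :=
      Finset.sum_mul_sq_le_sq_mul_sq _ _ _
    have h3 : ∑ p : Fin 3, (u ^ p.1) ^ 2 ≤ 3 := by
      have : ∀ p : Fin 3, (u ^ p.1) ^ 2 ≤ 1 := fun p => by
        rw [← sq_abs, abs_pow]
        exact pow_le_one₀ (by positivity) (pow_le_one₀ (abs_nonneg _) hu1)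
      calc _ ≤ ∑ p : Fin 3, (1 : ℝ) := Finset.sum_le_sum fun p _ => this p
        _ = 3 := by simp
    calc _ ≤ _ := h2
      _ ≤ (κ₀⁻¹) ^ 2 * 3 := mul_le_mul h1 h3 (Finset.sum_nonneg fun _ _ => sq_nonneg _)
          (sq_nonneg _)
      _ ≤ _ := by nlinarith [sq_nonneg κ₀⁻¹]
  · rw [hw0 u hu, abs_zero, zero_mul]
    positivity

theorem fitWeight_eq_zero (hc : 0 < c) (hw0 : ∀ u, u ∉ Icc (-1 : ℝ) 1 → w u = 0) {i : ℕ}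
    (hi : c < |x i - t|) : fitWeight w c N x t i = 0 := by
  have : (x i - t) / c ∉ Icc (-1 : ℝ) 1 := by
    intro h
    have h1 := abs_le.2 h
    rw [abs_div, abs_of_pos hc, div_le_one hc] at h1
    linarith
  rw [fitWeight, hw0 _ this]
  simp

/-- A minimizer of the local least squares criterion is the weighted mean of the responses with
the weights `fitWeight`: the normal equation in the direction `gramCoef`. -/
theorem GramBound.minimizer_eq (h : GramBound w c N x t κ₀) (hκ : 0 < κ₀) (hc : 0 < c)
    (hN : 0 < N) {y : ℕ → ℝ} {β : Fin 3 → ℝ}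
    (hβ : ∀ β', localLoss w c (Finset.range N) x y t β ≤
      localLoss w c (Finset.range N) x y t β') :
    β 0 = ∑ i ∈ Finset.range N, fitWeight w c N x t i * y i := by
  set α := gramCoef w c N x t with hα
  set u : ℕ → ℝ := fun i => (x i - t) / c
  set S := Finset.range N
  set A : ℕ → ℝ := fun i => ∑ p : Fin 3, α p * u i ^ p.1 with hA
  set Bp : ℕ → ℝ := fun i => ∑ p : Fin 3, β p * u i ^ p.1 with hBp
  have hNc : 0 < ((N : ℝ) * c) := by positivity
  have hloss : ∀ τ : ℝ, localLoss w c S x y t (fun p => β p + τ * α p) =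
      1 / ((N : ℝ) * c) * ∑ i ∈ S, w (u i) * (y i - Bp i - τ * A i) ^ 2 := by
    intro τ
    simp only [localLoss, S, Finset.card_range, hA, hBp, Fin.sum_univ_three, u]
    congr 1
    refine Finset.sum_congr rfl fun i _ => ?_
    simp
    left
    ring
  have hmin : ∀ τ : ℝ, 0 ≤ (∑ i ∈ S, w (u i) * A i ^ 2) * (τ * τ) +
      (-2 * ∑ i ∈ S, w (u i) * ((y i - Bp i) * A i)) * τ + 0 := by
    intro τ
    have h1 := hβ fun p => β p + τ * α p
    have h0 := hloss 0
    simp only [zero_mul, add_zero, sub_zero] at h0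
    rw [hloss τ, h0] at h1
    have h2 := le_of_mul_le_mul_left h1 (by positivity)
    have h3 : ∑ i ∈ S, w (u i) * (y i - Bp i - τ * A i) ^ 2 =
        ∑ i ∈ S, w (u i) * (y i - Bp i) ^ 2 + (∑ i ∈ S, w (u i) * A i ^ 2) * (τ * τ) +
        (-2 * ∑ i ∈ S, w (u i) * ((y i - Bp i) * A i)) * τ := by
      simp only [Finset.sum_mul, Finset.mul_sum, ← Finset.sum_add_distrib]
      exact Finset.sum_congr rfl fun i _ => by ring
    linarith
  have h0 := discrim_le_zero hmin
  have hz : ∑ i ∈ S, w (u i) * ((y i - Bp i) * A i) = 0 := by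
    unfold discrim at h0
    nlinarith [sq_nonneg (∑ i ∈ S, w (u i) * ((y i - Bp i) * A i))]
  have hrep := h.sum_fitWeight_mul hκ β
  rw [← hrep, ← sub_eq_zero, ← Finset.sum_sub_distrib, ← neg_eq_zero, ← Finset.sum_neg_distrib]
  have : ∀ i ∈ S, -(fitWeight w c N x t i * ∑ p : Fin 3, β p * ((x i - t) / c) ^ p.1 -
      fitWeight w c N x t i * y i) =
      ((N : ℝ) * c)⁻¹ * (w (u i) * ((y i - Bp i) * A i)) := by
    intro i _
    simp only [fitWeight, hA, hBp, u, hα]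
    ring
  rw [Finset.sum_congr rfl this, ← Finset.mul_sum, hz, mul_zero]

end

/-! ### Evenly spread design points -/

/-- The number of the points `x j`, `j < N`, in the `k`-th cell of mesh `h`. -/
noncomputable def cellCount (N : ℕ) (x : ℕ → ℝ) (h : ℝ) (k : ℕ) : ℕ :=
  ((Finset.range N).filter fun j => ⌊x j / h⌋₊ = k).card

/-- The points `x j`, `j < N`, lie in the unit interval and each cell of mesh `h` contains a number
of them that is comparable to its length. -/
structure IsSpread (N : ℕ) (x : ℕ → ℝ) (h b B : ℝ) : Prop where
  mem : ∀ j < N, x j ∈ Icc (0 : ℝ) 1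
  count_le : ∀ k, (cellCount N x h k : ℝ) ≤ B * (N * h)
  le_count : ∀ k : ℕ, ((k : ℝ) + 1) * h ≤ 1 → b * (N * h) ≤ cellCount N x h k

/-- A window of half-width `c` meets at most `2 * c / h + 2` cells. -/
theorem IsSpread.card_window_le {N : ℕ} {x : ℕ → ℝ} {h b B : ℝ} (hs : IsSpread N x h b B)
    (hh : 0 < h) (hB : 0 ≤ B) (t : ℝ) {c : ℝ} (hc : 0 ≤ c) :
    (((Finset.range N).filter fun j => |x j - t| ≤ c).card : ℝ) ≤
      (2 * c / h + 2) * (B * (N * h)) := by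
  have hsub : ((Finset.range N).filter fun j => |x j - t| ≤ c) ⊆
      (Finset.Icc ⌊(t - c) / h⌋₊ ⌊(t + c) / h⌋₊).biUnion
        fun k => (Finset.range N).filter fun j => ⌊x j / h⌋₊ = k := by
    intro j hj
    rw [Finset.mem_filter] at hj
    rw [Finset.mem_biUnion]
    have h1 := abs_le.1 hj.2
    refine ⟨⌊x j / h⌋₊, Finset.mem_Icc.2 ⟨?_, ?_⟩, Finset.mem_filter.2 ⟨hj.1, rfl⟩⟩ <;>
    · refine Nat.floor_le_floor ?_
      gcongr
      linarith
  by_cases htc : 0 ≤ t + c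
  · have h1 : (((Finset.range N).filter fun j => |x j - t| ≤ c).card : ℝ) ≤
        ∑ k ∈ Finset.Icc ⌊(t - c) / h⌋₊ ⌊(t + c) / h⌋₊, (cellCount N x h k : ℝ) := by
      exact_mod_cast (Finset.card_le_card hsub).trans Finset.card_biUnion_le
    have h2 : ((Finset.Icc ⌊(t - c) / h⌋₊ ⌊(t + c) / h⌋₊).card : ℝ) ≤ 2 * c / h + 2 := by
      rw [Nat.card_Icc]
      have h3 := Nat.lt_floor_add_one ((t - c) / h)
      have h4 := Nat.floor_le (div_nonneg htc hh.le)
      have h5 : (t + c) / h = (t - c) / h + 2 * c / h := by ring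
      have h6 : ((⌊(t + c) / h⌋₊ + 1 - ⌊(t - c) / h⌋₊ : ℕ) : ℝ) ≤
          max ((⌊(t + c) / h⌋₊ : ℝ) + 1 - ⌊(t - c) / h⌋₊) 0 := by
        rcases le_total ⌊(t - c) / h⌋₊ (⌊(t + c) / h⌋₊ + 1) with h7 | h7
        · rw [Nat.cast_sub h7]
          push_cast
          exact le_max_left _ _
        · rw [Nat.sub_eq_zero_of_le h7]
          simp
      refine h6.trans (max_le (by linarith) (by positivity))
    calc _ ≤ _ := h1
      _ ≤ ∑ k ∈ Finset.Icc ⌊(t - c) / h⌋₊ ⌊(t + c) / h⌋₊, B * (N * h) :=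
        Finset.sum_le_sum fun k _ => hs.count_le k
      _ = (Finset.Icc ⌊(t - c) / h⌋₊ ⌊(t + c) / h⌋₊).card * (B * (N * h)) := by
        rw [Finset.sum_const, nsmul_eq_mul]
      _ ≤ _ := by gcongr
  · have : ((Finset.range N).filter fun j => |x j - t| ≤ c) = ∅ := by
      refine Finset.filter_eq_empty_iff.2 fun j hj h1 => htc ?_
      have := (hs.mem j (Finset.mem_range.1 hj)).1
      have := (abs_le.1 h1).2
      linarith
    rw [this]
    simp only [Finset.card_empty, Nat.cast_zero]
    positivity

/-- A quadratic polynomial is controlled by its values at three separated points. -/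
theorem sum_sq_coef_le_of_three_points {v₁ v₂ v₃ d : ℝ} (hd : 0 < d) (hd1 : d ≤ 1)
    (h1 : |v₁| ≤ 1) (h2 : |v₂| ≤ 1) (h12 : d ≤ v₂ - v₁) (h23 : d ≤ v₃ - v₂) (a : Fin 3 → ℝ) :
    d ^ 4 * ∑ p, a p ^ 2 ≤ 121 * ((∑ p : Fin 3, a p * v₁ ^ p.1) ^ 2 +
      (∑ p : Fin 3, a p * v₂ ^ p.1) ^ 2 + (∑ p : Fin 3, a p * v₃ ^ p.1) ^ 2) := by
  simp only [Fin.sum_univ_three, Fin.val_zero, Fin.val_one, Fin.val_two, pow_zero, pow_one, mul_one]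
  obtain ⟨q₁, hq1⟩ : ∃ q, a 0 + a 1 * v₁ + a 2 * v₁ ^ 2 = q := ⟨_, rfl⟩
  obtain ⟨q₂, hq2⟩ : ∃ q, a 0 + a 1 * v₂ + a 2 * v₂ ^ 2 = q := ⟨_, rfl⟩
  obtain ⟨q₃, hq3⟩ : ∃ q, a 0 + a 1 * v₃ + a 2 * v₃ ^ 2 = q := ⟨_, rfl⟩
  rw [hq1, hq2, hq3]
  obtain ⟨E, hE0, hE⟩ : ∃ E, 0 ≤ E ∧ E ^ 2 = q₁ ^ 2 + q₂ ^ 2 + q₃ ^ 2 :=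
    ⟨√(q₁ ^ 2 + q₂ ^ 2 + q₃ ^ 2), Real.sqrt_nonneg _, Real.sq_sqrt (by positivity)⟩
  have e1 : |q₁| ≤ E := abs_le_of_sq_le_sq (by nlinarith [sq_nonneg q₂, sq_nonneg q₃]) hE0
  have e2 : |q₂| ≤ E := abs_le_of_sq_le_sq (by nlinarith [sq_nonneg q₁, sq_nonneg q₃]) hE0
  have e3 : |q₃| ≤ E := abs_le_of_sq_le_sq (by nlinarith [sq_nonneg q₂, sq_nonneg q₁]) hE0
  rw [← hE]
  obtain ⟨A, hA⟩ : ∃ A, a 1 + a 2 * (v₁ + v₂) = A := ⟨_, rfl⟩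
  obtain ⟨B, hB⟩ : ∃ B, a 1 + a 2 * (v₂ + v₃) = B := ⟨_, rfl⟩
  -- divided differences of the first order
  have hA1 : d * |A| ≤ 2 * E := by
    have h3 : (v₂ - v₁) * A = q₂ - q₁ := by rw [← hA, ← hq1, ← hq2]; ring
    calc d * |A| ≤ (v₂ - v₁) * |A| := by gcongr
      _ = |(v₂ - v₁) * A| := by rw [abs_mul, abs_of_nonneg (hd.le.trans h12)]
      _ ≤ |q₂| + |q₁| := by rw [h3]; exact abs_sub _ _
      _ ≤ _ := by linarith
  have hB1 : d * |B| ≤ 2 * E := by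
    have h3 : (v₃ - v₂) * B = q₃ - q₂ := by rw [← hB, ← hq3, ← hq2]; ring
    calc d * |B| ≤ (v₃ - v₂) * |B| := by gcongr
      _ = |(v₃ - v₂) * B| := by rw [abs_mul, abs_of_nonneg (hd.le.trans h23)]
      _ ≤ |q₃| + |q₂| := by rw [h3]; exact abs_sub _ _
      _ ≤ _ := by linarith
  have hC : d ^ 2 * |a 2| ≤ 2 * E := by
    have h3 : (v₃ - v₁) * a 2 = B - A := by rw [← hB, ← hA]; ring
    have h4 : 2 * d * |a 2| ≤ |B| + |A| := by
      calc 2 * d * |a 2| ≤ (v₃ - v₁) * |a 2| := by gcongr; linarith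
        _ = |(v₃ - v₁) * a 2| := by rw [abs_mul, abs_of_nonneg (by linarith : 0 ≤ v₃ - v₁)]
        _ ≤ |B| + |A| := by rw [h3]; exact abs_sub _ _
    nlinarith [mul_le_mul_of_nonneg_left h4 hd.le]
  have hd2 : d ^ 2 ≤ d := by nlinarith
  have hA2 : d ^ 2 * |A| ≤ 2 * E := (mul_le_mul_of_nonneg_right hd2 (abs_nonneg _)).trans hA1
  have h1' : d ^ 2 * |a 1| ≤ 6 * E := by
    have h3 : |a 1| ≤ |A| + 2 * |a 2| := by
      have h4 : a 1 = A - a 2 * (v₁ + v₂) := by rw [← hA]; ring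
      calc |a 1| ≤ |A| + |a 2 * (v₁ + v₂)| := by rw [h4]; exact abs_sub _ _
        _ ≤ |A| + |a 2| * 2 := by
          rw [abs_mul]
          gcongr
          linarith [abs_add_le v₁ v₂]
        _ = _ := by ring
    nlinarith [mul_le_mul_of_nonneg_left h3 (sq_nonneg d)]
  have h0' : d ^ 2 * |a 0| ≤ 9 * E := by
    have h3 : |a 0| ≤ E + |a 1| + |a 2| := by
      have h4 : a 0 = q₁ - a 1 * v₁ - a 2 * v₁ ^ 2 := by rw [← hq1]; ring
      have h5 : |a 1 * v₁| ≤ |a 1| := by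
        rw [abs_mul]; exact mul_le_of_le_one_right (abs_nonneg _) h1
      have h6 : |a 2 * v₁ ^ 2| ≤ |a 2| := by
        rw [abs_mul, abs_pow]
        exact mul_le_of_le_one_right (abs_nonneg _) (pow_le_one₀ (abs_nonneg _) h1)
      have h7 := abs_sub (q₁ - a 1 * v₁) (a 2 * v₁ ^ 2)
      have h8 := abs_sub q₁ (a 1 * v₁)
      rw [← h4] at h7
      linarith
    have h9 : d ^ 2 * E ≤ E := mul_le_of_le_one_left hE0 (by nlinarith)
    nlinarith [mul_le_mul_of_nonneg_left h3 (sq_nonneg d)]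
  have key : ∀ (z k : ℝ), d ^ 2 * |z| ≤ k * E → d ^ 4 * z ^ 2 ≤ k ^ 2 * E ^ 2 := by
    intro z k hz
    calc d ^ 4 * z ^ 2 = (d ^ 2 * |z|) ^ 2 := by rw [mul_pow, sq_abs]; ring
      _ ≤ (k * E) ^ 2 := pow_le_pow_left₀ (by positivity) hz 2
      _ = _ := by ring
  have := key _ _ h0'
  have := key _ _ h1'
  have := key _ _ hC
  -- `9 ^ 2 + 6 ^ 2 + 2 ^ 2 = 121`
  linarith

theorem exists_mem_card_mul_le_sum {α : Type*} {s : Finset α} {f : α → ℝ} (hs : s.Nonempty) :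
    ∃ i ∈ s, s.card * f i ≤ ∑ j ∈ s, f j := by
  obtain ⟨i, hi, hmin⟩ := s.exists_min_image f hs
  exact ⟨i, hi, by rw [← nsmul_eq_mul]; exact Finset.card_nsmul_le_sum _ _ _ hmin⟩

/-- If the weight function is bounded away from zero on an interval of `6` cells that lies inside
the unit interval, then the Gram matrix is bounded away from singularity. -/
theorem IsSpread.gramBound_of_cells {w : ℝ → ℝ} (hw : ∀ u, 0 ≤ w u) {N : ℕ} {x : ℕ → ℝ}
    {c d b B t α w₀ : ℝ} (hs : IsSpread N x (c * d) b B) (hN : 0 < N) (hc : 0 < c) (hd : 0 < d)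
    (hd1 : d ≤ 1) (hb : 0 < b) (hw₀ : 0 < w₀) (hα : -1 ≤ α) (hα1 : α + 6 * d ≤ 1)
    (hle : ∀ u ∈ Icc α (α + 6 * d), w₀ ≤ w u) (ht : 0 ≤ t + c * α)
    (ht1 : t + c * (α + 6 * d) ≤ 1) :
    GramBound w c N x t (w₀ * b * d ^ 5 / 121) := by
  intro a
  have hh : 0 < c * d := by positivity
  have hNc : (0 : ℝ) < N * c := by positivity
  obtain ⟨k, hk⟩ : ∃ k, ⌊(t + c * α) / (c * d)⌋₊ = k := ⟨_, rfl⟩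
  have hk1 : (k : ℝ) * (c * d) ≤ t + c * α := by
    rw [← le_div_iff₀ hh, ← hk]
    exact Nat.floor_le (by positivity)
  have hk2 : t + c * α < ((k : ℝ) + 1) * (c * d) := by
    rw [← div_lt_iff₀ hh, ← hk]
    exact Nat.lt_floor_add_one _
  set q : ℕ → ℝ := fun i => (∑ p : Fin 3, a p * ((x i - t) / c) ^ p.1) ^ 2 with hq
  set F : ℕ → Finset ℕ := fun l => (Finset.range N).filter fun j => ⌊x j / (c * d)⌋₊ = l with hF
  -- each of the cells that are used contains a point at which the polynomial is small
  have hcell : ∀ l : ℕ, ((l : ℝ) + 1) * (c * d) ≤ t + c * (α + 6 * d) →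
      ∃ i ∈ F l, b * (N * (c * d)) * q i ≤ ∑ j ∈ F l, q j := by
    intro l hl
    have h1 := hs.le_count l (hl.trans ht1)
    have h2 : (0 : ℝ) < (F l).card := lt_of_lt_of_le (by positivity) h1
    obtain ⟨i, hi, h3⟩ := exists_mem_card_mul_le_sum (f := q)
      (Finset.card_pos.1 (by exact_mod_cast h2))
    exact ⟨i, hi, (mul_le_mul_of_nonneg_right h1 (sq_nonneg _)).trans h3⟩
  have hmem : ∀ l i, i ∈ F l → (l : ℝ) * (c * d) ≤ x i ∧ x i < ((l : ℝ) + 1) * (c * d) := by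
    intro l i hi
    simp only [hF, Finset.mem_filter, Finset.mem_range] at hi
    have h1 := (hs.mem i hi.1).1
    rw [← le_div_iff₀ hh, ← div_lt_iff₀ hh, ← hi.2]
    exact ⟨Nat.floor_le (by positivity), Nat.lt_floor_add_one _⟩
  obtain ⟨i₁, hi1, hs1⟩ := hcell (k + 1) (by push_cast; nlinarith)
  obtain ⟨i₂, hi2, hs2⟩ := hcell (k + 3) (by push_cast; nlinarith)
  obtain ⟨i₃, hi3, hs3⟩ := hcell (k + 5) (by push_cast; nlinarith)
  have hu : ∀ l i, k + 1 ≤ l → l ≤ k + 5 → i ∈ F l → (x i - t) / c ∈ Icc α (α + 6 * d) := by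
    intro l i hl hl5 hi
    have h1 := hmem l i hi
    have h2 : (k : ℝ) + 1 ≤ l := by exact_mod_cast hl
    have h3 : (l : ℝ) ≤ k + 5 := by exact_mod_cast hl5
    rw [mem_Icc, le_div_iff₀ hc, div_le_iff₀ hc]
    constructor <;> nlinarith
  have habs : ∀ l i, k + 1 ≤ l → l ≤ k + 5 → i ∈ F l → |(x i - t) / c| ≤ 1 := by
    intro l i hl hl5 hi
    have h1 := hu l i hl hl5 hi
    exact abs_le.2 ⟨by linarith [h1.1], by linarith [h1.2]⟩
  have hsep : ∀ l i j, i ∈ F l → j ∈ F (l + 2) → d ≤ (x j - t) / c - (x i - t) / c := by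
    intro l i j hi hj
    have h1 := (hmem l i hi).2
    have h2 := (hmem (l + 2) j hj).1
    push_cast at h2
    rw [← sub_div, le_div_iff₀ hc]
    nlinarith
  have h3p := sum_sq_coef_le_of_three_points hd hd1 (habs _ _ (by omega) (by omega) hi1)
    (habs _ _ (by omega) (by omega) hi2) (hsep _ _ _ hi1 hi2) (hsep _ _ _ hi2 hi3) a
  have hdisj : ∀ l l', l ≠ l' → Disjoint (F l) (F l') := by
    intro l l' hll
    refine Finset.disjoint_left.2 fun i hi hi' => hll ?_
    rw [← (Finset.mem_filter.1 hi).2, (Finset.mem_filter.1 hi').2]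
  have hsum : w₀ * (∑ j ∈ F (k + 1), q j + ∑ j ∈ F (k + 3), q j + ∑ j ∈ F (k + 5), q j) ≤
      ∑ i ∈ Finset.range N, w ((x i - t) / c) * q i := by
    rw [← Finset.sum_union (hdisj _ _ (by omega)), ← Finset.sum_union
      (Finset.disjoint_union_left.2 ⟨hdisj _ _ (by omega), hdisj _ _ (by omega)⟩), Finset.mul_sum]
    refine (Finset.sum_le_sum fun i hi => ?_).trans (Finset.sum_le_sum_of_subset_of_nonneg ?_
      fun i _ _ => mul_nonneg (hw _) (sq_nonneg _))
    · refine mul_le_mul_of_nonneg_right (hle _ ?_) (sq_nonneg _)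
      rcases Finset.mem_union.1 hi with hi | hi
      · rcases Finset.mem_union.1 hi with hi | hi
        · exact hu _ _ (by omega) (by omega) hi
        · exact hu _ _ (by omega) (by omega) hi
      · exact hu _ _ (by omega) (by omega) hi
    · exact Finset.union_subset (Finset.union_subset (Finset.filter_subset _ _)
        (Finset.filter_subset _ _)) (Finset.filter_subset _ _)
  rw [inv_mul_eq_div, le_div_iff₀ hNc]
  refine le_trans ?_ hsum
  have h4 : w₀ * (b * (N * (c * d)) * (q i₁ + q i₂ + q i₃)) ≤
      w₀ * (∑ j ∈ F (k + 1), q j + ∑ j ∈ F (k + 3), q j + ∑ j ∈ F (k + 5), q j) :=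
    mul_le_mul_of_nonneg_left (by linarith) hw₀.le
  refine le_trans ?_ h4
  have h5 : 0 ≤ w₀ * b * (N * (c * d)) := by positivity
  have h6 := mul_le_mul_of_nonneg_left h3p h5
  calc _ = w₀ * b * (N * (c * d)) * (d ^ 4 * ∑ p, a p ^ 2) / 121 := by ring
    _ ≤ w₀ * b * (N * (c * d)) * (121 * (q i₁ + q i₂ + q i₃)) / 121 := by gcongr
    _ = _ := by ring

/-- A smoother weight is bounded away from zero on an interval to the right of the origin. -/
theorem IsSmootherWeight.exists_le {w : ℝ → ℝ} (hw : IsSmootherWeight w) :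
    ∃ α d w₀ : ℝ, 0 ≤ α ∧ 0 < d ∧ α + 6 * d ≤ 1 ∧ 0 < w₀ ∧
      ∀ u ∈ Icc α (α + 6 * d), w₀ ≤ w u := by
  have hcont := hw.contDiff.continuous
  obtain ⟨u, hu⟩ : ∃ u, 0 < w u := by
    by_contra! h
    have : w = fun _ => 0 := funext fun u => le_antisymm (h u) (hw.density.nonneg u)
    have h1 := hw.density.integral_eq_one
    rw [this] at h1
    simp at h1
  wlog hu0 : 0 ≤ u generalizing u
  · exact this (-u) (by rwa [hw.symmetric]) (by linarith)
  have hu1 : u ≤ 1 := by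
    by_contra! h
    rw [hw.support u fun h' => by linarith [h'.2]] at hu
    exact lt_irrefl _ hu
  obtain ⟨η, hη, hball⟩ := Metric.continuousAt_iff.1 hcont.continuousAt (w u / 2)
    (half_pos hu)
  have hball' : ∀ v, |v - u| < η → w u / 2 ≤ w v := by
    intro v hv
    have h1 := hball (x := v) (by rwa [Real.dist_eq])
    rw [Real.dist_eq] at h1
    linarith [(abs_lt.1 h1).1]
  have hd : 0 < min (η / 2) (1 / 2) := by positivity
  have hd1 : min (η / 2) (1 / 2) ≤ η / 2 := min_le_left _ _
  have hd2 : min (η / 2) (1 / 2 : ℝ) ≤ 1 / 2 := min_le_right _ _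
  obtain ⟨d, hdd⟩ : ∃ d, d = min (η / 2) (1 / 2) := ⟨_, rfl⟩
  rw [← hdd] at hd hd1 hd2
  rcases le_total u (1 / 2) with h | h
  · refine ⟨u, d / 6, w u / 2, hu0, by positivity, by linarith, half_pos hu, fun v hv => ?_⟩
    exact hball' v (abs_lt.2 ⟨by linarith [hv.1], by linarith [hv.2]⟩)
  · refine ⟨u - d, d / 6, w u / 2, by linarith, by positivity, by linarith, half_pos hu,
      fun v hv => ?_⟩
    exact hball' v (abs_lt.2 ⟨by linarith [hv.1], by linarith [hv.2]⟩)

/-- For spread design points the Gram matrices are bounded away from singularity, uniformly over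
the unit interval: at each point there is room for a window of half the bandwidth on one side. -/
theorem IsSpread.gramBound {w : ℝ → ℝ} (hw : IsSmootherWeight w) {N : ℕ} {x : ℕ → ℝ}
    {c d b B t α w₀ : ℝ} (hs : IsSpread N x (c * d) b B) (hN : 0 < N) (hc : 0 < c)
    (hc2 : c ≤ 1 / 2) (hd : 0 < d) (hb : 0 < b) (hw₀ : 0 < w₀) (hα : 0 ≤ α)
    (hα1 : α + 6 * d ≤ 1) (hle : ∀ u ∈ Icc α (α + 6 * d), w₀ ≤ w u) (ht : t ∈ Icc (0 : ℝ) 1) :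
    GramBound w c N x t (w₀ * b * d ^ 5 / 121) := by
  have h1 : c * (α + 6 * d) ≤ 1 / 2 := by nlinarith
  rcases le_total t (1 / 2) with h | h
  · refine hs.gramBound_of_cells hw.density.nonneg hN hc hd (by linarith) hb hw₀ (by linarith) hα1
      hle ?_ (by linarith)
    have := ht.1
    positivity
  · refine hs.gramBound_of_cells (α := -(α + 6 * d)) hw.density.nonneg hN hc hd (by linarith) hb hw₀
      (by linarith) (by linarith) (fun u hu => ?_) (by linarith) ?_
    · rw [← hw.symmetric]
      exact hle _ ⟨by linarith [hu.2], by linarith [hu.1]⟩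
    · have : 0 ≤ c * α := by positivity
      linarith [ht.2]

/-! ### Smoothers at evenly spread design points -/

/-- A second order expansion of the regression function, uniformly on the unit interval. -/
theorem RegressionAssumption.exists_abs_sub_le {r : ℝ → ℝ} (hR : RegressionAssumption r) :
    ∃ K, 0 ≤ K ∧ ∀ x ∈ Icc (0 : ℝ) 1, ∀ t ∈ Icc (0 : ℝ) 1,
      |r x - r t - derivWithin r (Icc 0 1) t * (x - t)| ≤ K * (x - t) ^ 2 := by
  have hu : UniqueDiffOn ℝ (Icc (0 : ℝ) 1) := uniqueDiffOn_Icc zero_lt_one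
  have h1 : ContDiffOn ℝ 1 (derivWithin r (Icc 0 1)) (Icc 0 1) :=
    hR.contDiffOn.derivWithin hu (by norm_num)
  have h2 : ContinuousOn (derivWithin (derivWithin r (Icc 0 1)) (Icc 0 1)) (Icc 0 1) :=
    h1.continuousOn_derivWithin hu le_rfl
  obtain ⟨K, hK⟩ := isCompact_Icc.exists_bound_of_continuousOn h2
  have hK0 : 0 ≤ K := (norm_nonneg _).trans (hK 0 (by simp))
  have hlip : ∀ x ∈ Icc (0 : ℝ) 1, ∀ t ∈ Icc (0 : ℝ) 1,
      ‖derivWithin r (Icc 0 1) x - derivWithin r (Icc 0 1) t‖ ≤ K * ‖x - t‖ := fun x hx t ht =>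
    (convex_Icc (0 : ℝ) 1).norm_image_sub_le_of_norm_derivWithin_le
      (h1.differentiableOn (by norm_num)) hK ht hx
  refine ⟨K, hK0, fun x hx t ht => ?_⟩
  have hsub : uIcc t x ⊆ Icc (0 : ℝ) 1 := by
    rw [← segment_eq_uIcc]
    exact (convex_Icc (0 : ℝ) 1).segment_subset ht hx
  have hder : ∀ z ∈ uIcc t x, HasDerivWithinAt
      (fun z => r z - derivWithin r (Icc 0 1) t * z)
      (derivWithin r (Icc 0 1) z - derivWithin r (Icc 0 1) t) (uIcc t x) z := by
    intro z hz
    have h3 : HasDerivWithinAt r (derivWithin r (Icc 0 1) z) (Icc 0 1) z :=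
      (hR.contDiffOn.differentiableOn (by norm_num) z (hsub hz)).hasDerivWithinAt
    have h4 := (h3.mono hsub).fun_sub
      (((hasDerivAt_id' z).const_mul (derivWithin r (Icc 0 1) t)).hasDerivWithinAt)
    rwa [mul_one] at h4
  have hbd : ∀ z ∈ uIcc t x, ‖derivWithin r (Icc 0 1) z - derivWithin r (Icc 0 1) t‖ ≤
      K * |x - t| := by
    intro z hz
    refine (hlip z (hsub hz) t ht).trans (mul_le_mul_of_nonneg_left ?_ hK0)
    exact abs_sub_left_of_mem_uIcc hz
  have h5 := (convex_uIcc t x).norm_image_sub_le_of_norm_hasDerivWithin_le hder hbd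
    left_mem_uIcc right_mem_uIcc
  rw [Real.norm_eq_abs, Real.norm_eq_abs, mul_assoc, abs_mul_abs_self, ← sq] at h5
  convert h5 using 2
  ring

/-- The estimation error at the points `y j` of the local quadratic smoother based on the points
`x i`, `i < N`, as an affine form in the errors. -/
noncomputable def smootherForm (w : ℝ → ℝ) (c : ℝ) (r : ℝ → ℝ) (N : ℕ) (x y : ℕ → ℝ) :
    ShiftForm where
  b j := ∑ i ∈ Finset.range N, fitWeight w c N x (y j) i * r (x i) - r (y j)
  W j i := fitWeight w c N x (y j) i

/-- At evenly spread points and for a bandwidth of order `s ^ 2`, the bias is of order `s ^ 4`, as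
the smoother reproduces linear functions, and the weights are of order `s ^ 6`. The mesh of the
cells is the fraction `d` of the bandwidth, where `w ≥ w₀` on an interval of length `6 * d`. -/
theorem exists_smootherForm_bounded {w r : ℝ → ℝ} (hw : IsSmootherWeight w)
    (hR : RegressionAssumption r) {α d w₀ b B γ : ℝ} (hd : 0 < d) (hb : 0 < b) (hB : 0 ≤ B)
    (hγ : 0 < γ) (hw₀ : 0 < w₀) (hα : 0 ≤ α) (hα1 : α + 6 * d ≤ 1)
    (hle : ∀ u ∈ Icc α (α + 6 * d), w₀ ≤ w u) :
    ∃ K, ∀ (N M : ℕ) (x y : ℕ → ℝ) (s : ℝ), 0 < N → (M : ℝ) ≤ 2 * N → 0 < s →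
      1 ≤ 3 * (s ^ 8 * N) → γ * s ^ 2 ≤ 1 / 2 → IsSpread N x (γ * s ^ 2 * d) b B →
      IsSpread M y (γ * s ^ 2 * d) b B →
      (smootherForm w (γ * s ^ 2) r N x y).Bounded K s M N := by
  obtain ⟨Kr, hKr0, hKr⟩ := hR.exists_abs_sub_le
  obtain ⟨w₁, hw1⟩ : ∃ w₁, ∀ u, |w u| ≤ w₁ := by
    obtain ⟨w₁, h⟩ := (isCompact_Icc (a := (-1 : ℝ)) (b := 1)).exists_bound_of_continuousOn
      hw.contDiff.continuous.continuousOn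
    refine ⟨w₁, fun u => ?_⟩
    by_cases hu : u ∈ Icc (-1 : ℝ) 1
    · exact h u hu
    · rw [hw.support u hu, abs_zero]
      exact (norm_nonneg _).trans (h 0 (by norm_num))
  have hw1' : 0 ≤ w₁ := (abs_nonneg _).trans (hw1 0)
  obtain ⟨κ₀, hκ₀⟩ : ∃ κ₀, κ₀ = w₀ * b * d ^ 5 / 121 := ⟨_, rfl⟩
  have hκ : 0 < κ₀ := by rw [hκ₀]; positivity
  obtain ⟨A, hA⟩ : ∃ A, A = w₁ * (2 * κ₀⁻¹) := ⟨_, rfl⟩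
  have hA0 : 0 ≤ A := by rw [hA]; positivity
  obtain ⟨R, hRR⟩ : ∃ R, R = (2 + 2 * d) * B * A := ⟨_, rfl⟩
  have hR0 : 0 ≤ R := by rw [hRR]; positivity
  refine ⟨3 * A / γ + 2 * R + R * Kr * γ ^ 2, fun N M x y s hN hMN hs hsN hc2 hx hy => ?_⟩
  have hc : 0 < γ * s ^ 2 := by positivity
  obtain ⟨c, hcc⟩ : ∃ c, c = γ * s ^ 2 := ⟨_, rfl⟩
  rw [← hcc] at hc hc2 hx hy ⊢
  have hN' : (0 : ℝ) < N := by exact_mod_cast hN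
  have hh : 0 < c * d := by positivity
  have hG : ∀ j < M, GramBound w c N x (y j) κ₀ := fun j hj => by
    rw [hκ₀]
    exact hx.gramBound hw hN hc hc2 hd hb hw₀ hα hα1 hle (hy.mem j hj)
  have hW : ∀ j < M, ∀ i, |fitWeight w c N x (y j) i| ≤ ((N : ℝ) * c)⁻¹ * A := fun j hj i => by
    rw [hA]
    exact (hG j hj).abs_fitWeight_le hκ hc hw1 hw.support i
  have hzero : ∀ t i, ¬ |x i - t| ≤ c → |fitWeight w c N x t i| = 0 := fun t i hi => by
    rw [fitWeight_eq_zero hc hw.support (not_le.1 hi), abs_zero]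
  have hwin : ∀ L : ℕ, (2 * c / (c * d) + 2) * (B * (L * (c * d))) =
      (2 + 2 * d) * B * (L * c) := fun L => by field_simp
  have hrow : ∀ j < M, ∑ i ∈ Finset.range N, |fitWeight w c N x (y j) i| ≤ R := by
    intro j hj
    have hcard := hx.card_window_le hh hB (y j) hc.le
    rw [hwin] at hcard
    calc _ = ∑ i ∈ (Finset.range N).filter fun i => |x i - y j| ≤ c,
          |fitWeight w c N x (y j) i| := by
          rw [Finset.sum_filter]
          exact Finset.sum_congr rfl fun i _ => by
            split_ifs with h
            · rfl
            · exact hzero _ _ h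
      _ ≤ ∑ i ∈ (Finset.range N).filter fun i => |x i - y j| ≤ c, ((N : ℝ) * c)⁻¹ * A :=
        Finset.sum_le_sum fun i _ => hW j hj i
      _ ≤ ((2 + 2 * d) * B * (N * c)) * (((N : ℝ) * c)⁻¹ * A) := by
        rw [Finset.sum_const, nsmul_eq_mul]
        gcongr
      _ = R := by rw [hRR]; field_simp
  have hcol : ∀ i < N, ∑ j ∈ Finset.range M, |fitWeight w c N x (y j) i| ≤ 2 * R := by
    intro i _
    have hcard := hy.card_window_le hh hB (x i) hc.le
    rw [hwin] at hcard
    calc _ = ∑ j ∈ (Finset.range M).filter fun j => |y j - x i| ≤ c,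
          |fitWeight w c N x (y j) i| := by
          rw [Finset.sum_filter]
          exact Finset.sum_congr rfl fun j _ => by
            split_ifs with h
            · rfl
            · exact hzero _ _ (by rwa [abs_sub_comm])
      _ ≤ ∑ j ∈ (Finset.range M).filter fun j => |y j - x i| ≤ c, ((N : ℝ) * c)⁻¹ * A :=
        Finset.sum_le_sum fun j hj =>
          hW j (Finset.mem_range.1 (Finset.mem_filter.1 hj).1) i
      _ ≤ ((2 + 2 * d) * B * (M * c)) * (((N : ℝ) * c)⁻¹ * A) := by
        rw [Finset.sum_const, nsmul_eq_mul]
        gcongr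
      _ ≤ ((2 + 2 * d) * B * (2 * N * c)) * (((N : ℝ) * c)⁻¹ * A) := by gcongr
      _ = 2 * R := by rw [hRR]; field_simp
  have e1 : 0 ≤ 3 * A / γ := by positivity
  have e2 : 0 ≤ R * Kr * γ ^ 2 := by positivity
  refine ⟨fun j hj => ?_, fun j hj i _ => ?_, fun j hj => ?_, fun i hi => ?_⟩
  -- the fit reproduces constants and linear functions, so only the quadratic remainder is left
  · have hbias : (smootherForm w c r N x y).b j = ∑ i ∈ Finset.range N,
        fitWeight w c N x (y j) i *
          (r (x i) - r (y j) - derivWithin r (Icc 0 1) (y j) * (x i - y j)) := by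
      have h1 := (hG j hj).sum_fitWeight hκ
      have h2 := (hG j hj).sum_fitWeight_mul_sub hκ hc
      have h3 : ∑ i ∈ Finset.range N, fitWeight w c N x (y j) i *
          (r (x i) - r (y j) - derivWithin r (Icc 0 1) (y j) * (x i - y j)) =
          ∑ i ∈ Finset.range N, fitWeight w c N x (y j) i * r (x i) -
          (∑ i ∈ Finset.range N, fitWeight w c N x (y j) i) * r (y j) -
          derivWithin r (Icc 0 1) (y j) *
            ∑ i ∈ Finset.range N, fitWeight w c N x (y j) i * (x i - y j) := by
        rw [Finset.sum_mul, Finset.mul_sum, ← Finset.sum_sub_distrib, ← Finset.sum_sub_distrib]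
        exact Finset.sum_congr rfl fun i _ => by ring
      rw [h3, h1, h2, one_mul, mul_zero, sub_zero]
      rfl
    rw [hbias]
    calc _ ≤ ∑ i ∈ Finset.range N, |fitWeight w c N x (y j) i *
          (r (x i) - r (y j) - derivWithin r (Icc 0 1) (y j) * (x i - y j))| :=
        Finset.abs_sum_le_sum_abs _ _
      _ ≤ ∑ i ∈ Finset.range N, |fitWeight w c N x (y j) i| * (Kr * c ^ 2) := by
        refine Finset.sum_le_sum fun i hi => ?_
        rw [abs_mul]
        by_cases h : |x i - y j| ≤ c
        · refine mul_le_mul_of_nonneg_left ((hKr _ (hx.mem i (Finset.mem_range.1 hi)) _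
            (hy.mem j hj)).trans (mul_le_mul_of_nonneg_left ?_ hKr0)) (abs_nonneg _)
          exact sq_le_sq' (by linarith [(abs_le.1 h).1]) (abs_le.1 h).2
        · rw [hzero _ _ h, zero_mul, zero_mul]
      _ ≤ R * (Kr * c ^ 2) := by
        rw [← Finset.sum_mul]
        exact mul_le_mul_of_nonneg_right (hrow j hj) (by positivity)
      _ = R * Kr * γ ^ 2 * s ^ 4 := by rw [hcc]; ring
      _ ≤ _ := mul_le_mul_of_nonneg_right (by linarith) (by positivity)
  · calc _ ≤ ((N : ℝ) * c)⁻¹ * A := hW j hj i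
      _ ≤ 3 * s ^ 6 / γ * A := by
        refine mul_le_mul_of_nonneg_right ?_ hA0
        rw [inv_le_iff_one_le_mul₀ (by positivity), hcc]
        refine hsN.trans (le_of_eq ?_)
        field_simp
      _ = 3 * A / γ * s ^ 6 := by ring
      _ ≤ _ := mul_le_mul_of_nonneg_right (by linarith) (by positivity)
  · exact (hrow j hj).trans (by linarith)
  · exact (hcol i hi).trans (by linarith)

/-- The split design for given covariates `x j`, `j < n`, when the regression function is
estimated by local quadratic smoothers with bandwidth `c`. -/
noncomputable def regressionDesign (w : ℝ → ℝ) (c : ℝ) (r : ℝ → ℝ) (n : ℕ) (x : ℕ → ℝ) :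
    SplitDesign where
  m := n / 2
  k := n - n / 2
  ρ₁ j := r (x j)
  ρ₂ j := r (x (n / 2 + j))
  own₁ := smootherForm w c r (n / 2) x x
  own₂ := smootherForm w c r (n - n / 2) (fun j => x (n / 2 + j)) fun j => x (n / 2 + j)
  cross₁ := smootherForm w c r (n - n / 2) (fun j => x (n / 2 + j)) x
  cross₂ := smootherForm w c r (n / 2) x fun j => x (n / 2 + j)

/-- Both halves of the covariates are evenly spread. -/
def IsSplitSpread (n : ℕ) (x : ℕ → ℝ) (h b B : ℝ) : Prop :=
  IsSpread (n / 2) x h b B ∧ IsSpread (n - n / 2) (fun j => x (n / 2 + j)) h b B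

/-- The design of evenly spread covariates is regular, with a constant that is the same for all
of them. -/
theorem exists_regressionDesign_regular {w r : ℝ → ℝ} (hw : IsSmootherWeight w)
    (hR : RegressionAssumption r) {α d w₀ b B γ : ℝ} (hd : 0 < d) (hb : 0 < b) (hB : 0 ≤ B)
    (hγ : 0 < γ) (hw₀ : 0 < w₀) (hα : 0 ≤ α) (hα1 : α + 6 * d ≤ 1)
    (hle : ∀ u ∈ Icc α (α + 6 * d), w₀ ≤ w u) :
    ∃ K, ∀ (n : ℕ) (x : ℕ → ℝ) (s : ℝ), 2 ≤ n → 0 < s → s ^ 8 * n = 1 → γ * s ^ 2 ≤ 1 / 2 →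
      IsSplitSpread n x (γ * s ^ 2 * d) b B →
      (regressionDesign w (γ * s ^ 2) r n x).Regular K s := by
  obtain ⟨K, hK⟩ := exists_smootherForm_bounded hw hR hd hb hB hγ hw₀ hα hα1 hle
  obtain ⟨K', hK'⟩ := isCompact_Icc.exists_bound_of_continuousOn hR.contDiffOn.continuousOn
  refine ⟨max K K', fun n x s hn hs hsn hc hx => ?_⟩
  have mono : ∀ {A : ShiftForm} {M N : ℕ}, A.Bounded K s M N → A.Bounded (max K K') s M N :=
    fun h => ⟨fun j hj => (h.abs_b_le j hj).trans
      (mul_le_mul_of_nonneg_right (le_max_left _ _) (by positivity)),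
      fun j hj i hi => (h.abs_W_le j hj i hi).trans
        (mul_le_mul_of_nonneg_right (le_max_left _ _) (by positivity)),
      fun j hj => (h.row_le j hj).trans (le_max_left _ _),
      fun i hi => (h.col_le i hi).trans (le_max_left _ _)⟩
  have hm : 0 < n / 2 := by omega
  have hk : 0 < n - n / 2 := by omega
  have h1 : ((n - n / 2 : ℕ) : ℝ) + (n / 2 : ℕ) = n := by exact_mod_cast (by omega)
  have h2 : (n : ℝ) ≤ 3 * (n / 2 : ℕ) := by exact_mod_cast (by omega)
  have h3 : (n : ℝ) ≤ 3 * (n - n / 2 : ℕ) := by exact_mod_cast (by omega)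
  have h4 : (1 : ℝ) ≤ 3 * (s ^ 8 * (n / 2 : ℕ)) := by
    rw [← hsn, mul_left_comm]; gcongr
  have h5 : (1 : ℝ) ≤ 3 * (s ^ 8 * (n - n / 2 : ℕ)) := by
    rw [← hsn, mul_left_comm]; gcongr
  have h6 : ((n / 2 : ℕ) : ℝ) ≤ 2 * (n / 2 : ℕ) := by exact_mod_cast (by omega)
  have h7 : ((n - n / 2 : ℕ) : ℝ) ≤ 2 * (n - n / 2 : ℕ) := by exact_mod_cast (by omega)
  have h8 : ((n / 2 : ℕ) : ℝ) ≤ 2 * (n - n / 2 : ℕ) := by exact_mod_cast (by omega)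
  have h9 : ((n - n / 2 : ℕ) : ℝ) ≤ 2 * (n / 2 : ℕ) := by exact_mod_cast (by omega)
  refine ⟨?_, hm, hk, ?_, ?_, fun j hj => ?_, fun j hj => ?_, mono ?_, mono ?_, mono ?_, mono ?_⟩
  · rw [← hsn, ← h1, add_comm]; rfl
  · rw [add_comm]; exact h1.trans_le h2
  · rw [add_comm]; exact h1.trans_le h3
  · exact (hK' _ (hx.1.mem j hj)).trans (le_max_right _ _)
  · exact (hK' _ (hx.2.mem j hj)).trans (le_max_right _ _)
  · exact hK _ _ _ _ _ hm h6 hs h4 hc hx.1 hx.1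
  · exact hK _ _ _ _ _ hk h7 hs h5 hc hx.2 hx.2
  · exact hK _ _ _ _ _ hk h8 hs h5 hc hx.2 hx.1
  · exact hK _ _ _ _ _ hm h9 hs h4 hc hx.1 hx.2

/-! ### Random points are evenly spread with high probability -/

/-- A law on the unit interval that is comparable to the uniform distribution there. -/
structure IsQuasiUniform (μ : Measure ℝ) (b B : ℝ) : Prop where
  compl_eq_zero : μ (Icc 0 1)ᶜ = 0
  le_mul : ∀ u v, u ≤ v → μ.real (Ico u v) ≤ B * (v - u)
  mul_le : ∀ u v, 0 ≤ u → u ≤ v → v ≤ 1 → b * (v - u) ≤ μ.real (Ico u v)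

theorem CovariateAssumption.aemeasurable {g : ℝ → ℝ} (hG : CovariateAssumption g) :
    AEMeasurable g := by
  by_contra h
  have h1 := hG.density.integral_eq_one
  rw [integral_undef fun h' => h h'.aemeasurable] at h1
  exact zero_ne_one h1

theorem CovariateAssumption.integrable {g : ℝ → ℝ} (hG : CovariateAssumption g) :
    Integrable g := by
  by_contra h
  have h1 := hG.density.integral_eq_one
  rw [integral_undef h] at h1
  exact zero_ne_one h1

theorem CovariateAssumption.isProbabilityMeasure {g : ℝ → ℝ} (hG : CovariateAssumption g) :
    IsProbabilityMeasure (densityMeasure g) :=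
  isProbabilityMeasure_densityMeasure hG.density.nonneg hG.density.integral_eq_one

theorem CovariateAssumption.isQuasiUniform {g : ℝ → ℝ} (hG : CovariateAssumption g) :
    ∃ b B, 0 < b ∧ 0 ≤ B ∧ IsQuasiUniform (densityMeasure g) b B := by
  have := hG.isProbabilityMeasure
  obtain ⟨B, hB⟩ := hG.bounded
  obtain ⟨b, hb, hbg⟩ := hG.bounded_below
  have hB0 : 0 ≤ B := hb.le.trans ((hbg 0 (by simp)).trans (hB 0 (by simp)))
  have hgB : ∀ x, g x ≤ B := fun x => by
    by_cases hx : x ∈ Icc (0 : ℝ) 1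
    · exact hB x hx
    · rw [hG.zero_outside x hx]; exact hB0
  refine ⟨b, B, hb, hB0, ⟨?_, fun u v huv => ?_, fun u v hu huv hv => ?_⟩⟩
  · rw [densityMeasure, withDensity_apply _ measurableSet_Icc.compl]
    refine (setLIntegral_congr_fun measurableSet_Icc.compl fun x hx => ?_).trans lintegral_zero
    simp only [hG.zero_outside x hx, ENNReal.ofReal_zero]
  · refine ENNReal.toReal_le_of_le_ofReal (by nlinarith) ?_
    rw [densityMeasure, withDensity_apply _ measurableSet_Ico]
    calc _ ≤ ∫⁻ _ in Ico u v, ENNReal.ofReal B := by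
          gcongr with x
          exact hgB x
      _ = _ := by rw [setLIntegral_const, Real.volume_Ico, ENNReal.ofReal_mul hB0]
  · refine (ENNReal.ofReal_le_iff_le_toReal (measure_ne_top _ _)).1 ?_
    rw [densityMeasure, withDensity_apply _ measurableSet_Ico]
    calc _ = ∫⁻ _ in Ico u v, ENNReal.ofReal b := by
          rw [setLIntegral_const, Real.volume_Ico, ENNReal.ofReal_mul hb.le]
      _ ≤ _ := setLIntegral_mono' measurableSet_Ico fun x hx =>
          ENNReal.ofReal_le_ofReal (hbg x ⟨hu.trans hx.1, hx.2.le.trans hv⟩)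

theorem cast_cellCount (N : ℕ) (x : ℕ → ℝ) (h : ℝ) (k : ℕ) :
    (cellCount N x h k : ℝ) =
      ∑ j ∈ Finset.range N, {t : ℝ | ⌊t / h⌋₊ = k}.indicator (fun _ => (1 : ℝ)) (x j) := by
  rw [cellCount, Finset.card_filter]
  push_cast
  exact Finset.sum_congr rfl fun j _ => by simp [Set.indicator_apply]

theorem measurableSet_cell (h : ℝ) (k : ℕ) : MeasurableSet {t : ℝ | ⌊t / h⌋₊ = k} := by
  have : Measurable fun t : ℝ => ⌊t / h⌋₊ := by fun_prop
  exact this (measurableSet_singleton k)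

theorem measurable_cellCount (N : ℕ) (h : ℝ) (k : ℕ) :
    Measurable fun x : ℕ → ℝ => (cellCount N x h k : ℝ) := by
  simp only [cast_cellCount]
  refine Finset.measurable_fun_sum _ fun j _ => ?_
  exact (measurable_const.indicator (measurableSet_cell h k)).comp (measurable_pi_apply j)

theorem measurableSet_isSpread (N : ℕ) (h b B : ℝ) :
    MeasurableSet {x : ℕ → ℝ | IsSpread N x h b B} := by
  have : {x : ℕ → ℝ | IsSpread N x h b B} = (⋂ j, ⋂ (_ : j < N), {x | x j ∈ Icc (0 : ℝ) 1}) ∩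
      ((⋂ k, {x | (cellCount N x h k : ℝ) ≤ B * (N * h)}) ∩
      ⋂ k : ℕ, ⋂ (_ : ((k : ℝ) + 1) * h ≤ 1), {x | b * (N * h) ≤ cellCount N x h k}) := by
    ext x
    simp only [mem_ofPred_eq, mem_inter_iff, mem_iInter]
    exact ⟨fun hx => ⟨hx.1, hx.2, hx.3⟩, fun hx => ⟨hx.1, hx.2.1, hx.2.2⟩⟩
  rw [this]
  refine MeasurableSet.inter (MeasurableSet.iInter fun j => MeasurableSet.iInter fun _ =>
    measurable_pi_apply j measurableSet_Icc) (MeasurableSet.inter (MeasurableSet.iInter fun k =>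
      measurableSet_le (measurable_cellCount N h k) measurable_const)
      (MeasurableSet.iInter fun k => MeasurableSet.iInter fun _ =>
        measurableSet_le measurable_const (measurable_cellCount N h k)))

theorem IsQuasiUniform.measure_cell_le {μ : Measure ℝ} [IsProbabilityMeasure μ] {b B : ℝ}
    (hμ : IsQuasiUniform μ b B) {h : ℝ} (hh : 0 < h) (k : ℕ) :
    μ.real {t : ℝ | ⌊t / h⌋₊ = k} ≤ B * h := by
  have h1 : μ.real {t : ℝ | ⌊t / h⌋₊ = k} ≤ μ.real (Ico (k * h) ((k + 1) * h) ∪ (Icc 0 1)ᶜ) := by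
    refine measureReal_mono fun t ht => ?_
    rw [mem_ofPred_eq] at ht
    by_cases h0 : t ∈ Icc (0 : ℝ) 1
    · left
      have := h0.1
      rw [mem_Ico, ← le_div_iff₀ hh, ← div_lt_iff₀ hh, ← ht]
      exact ⟨Nat.floor_le (by positivity), Nat.lt_floor_add_one _⟩
    · right; exact h0
  have h2 : μ.real (Icc (0 : ℝ) 1)ᶜ = 0 := by rw [measureReal_def, hμ.compl_eq_zero]; rfl
  calc _ ≤ _ := h1
    _ ≤ _ := measureReal_union_le _ _
    _ ≤ B * ((k + 1) * h - k * h) + 0 := by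
      rw [h2]
      exact add_le_add (hμ.le_mul _ _ (by nlinarith)) le_rfl
    _ = _ := by ring

theorem IsQuasiUniform.le_measure_cell {μ : Measure ℝ} [IsProbabilityMeasure μ] {b B : ℝ}
    (hμ : IsQuasiUniform μ b B) {h : ℝ} (hh : 0 < h) {k : ℕ} (hk : ((k : ℝ) + 1) * h ≤ 1) :
    b * h ≤ μ.real {t : ℝ | ⌊t / h⌋₊ = k} := by
  have h1 := hμ.mul_le (k * h) ((k + 1) * h) (by positivity) (by nlinarith) hk
  calc b * h = b * ((k + 1) * h - k * h) := by ring
    _ ≤ _ := h1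
    _ ≤ _ := measureReal_mono fun t ht => by
      rw [mem_Ico, ← le_div_iff₀ hh, ← div_lt_iff₀ hh] at ht
      rw [mem_ofPred_eq, Nat.floor_eq_iff ((Nat.cast_nonneg k).trans ht.1)]
      exact ht

/-- Independent points with a quasi-uniform law are evenly spread with high probability, by
Chebyshev's inequality in each of the cells. -/
theorem IsQuasiUniform.measure_not_isSpread_le {Ω : Type*} [MeasurableSpace Ω] {P : Measure Ω}
    [IsProbabilityMeasure P] {μ : Measure ℝ} [IsProbabilityMeasure μ] {b B : ℝ}
    (hμ : IsQuasiUniform μ b B) (hb : 0 < b) (hB : 0 ≤ B) {ξ : ℕ → Ω → ℝ}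
    (hξ : ∀ j, Measurable (ξ j)) (hlaw : ∀ j, P.map (ξ j) = μ)
    (hind : ∀ i j, i ≠ j → IndepFun (ξ i) (ξ j) P) {N : ℕ} (hN : 0 < N) {h : ℝ} (hh : 0 < h)
    (hh1 : h ≤ 1) :
    P {ω | ¬ IsSpread N (fun j => ξ j ω) h (b / 2) (B + b)} ≤
      ENNReal.ofReal (8 * B / b ^ 2 * (N * h ^ 2)⁻¹) := by
  have hN' : (0 : ℝ) < N := by exact_mod_cast hN
  set p : ℕ → ℝ := fun k => μ.real {t : ℝ | ⌊t / h⌋₊ = k} with hp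
  set D : ℕ → Ω → ℝ := fun k ω => (cellCount N (fun j => ξ j ω) h k : ℝ) - N * p k with hD
  -- the number of cells that meet the unit interval
  obtain ⟨M, hM⟩ : ∃ M, ⌊1 / h⌋₊ + 1 = M := ⟨_, rfl⟩
  have hMle : (M : ℝ) ≤ 2 / h := by
    rw [← hM]
    push_cast
    have h1 := Nat.floor_le (by positivity : (0 : ℝ) ≤ 1 / h)
    have h2 : 1 ≤ 1 / h := by rw [le_div_iff₀ hh]; linarith
    have h3 : 2 / h = 1 / h + 1 / h := by ring
    linarith
  have hDm : ∀ k, Measurable (D k) := fun k =>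
    ((measurable_cellCount N h k).comp (measurable_pi_lambda _ hξ)).sub_const _
  have hδ : 0 < (b / 2 * (N * h)) ^ 2 := by positivity
  have hcheb : ∀ k, P {ω | (b / 2 * (N * h)) ^ 2 < |D k ω ^ 2|} ≤
      ENNReal.ofReal (N * (B * h) / (b / 2 * (N * h)) ^ 2) := by
    intro k
    refine measure_lt_abs_le_of_lintegral ((hDm k).pow_const 2) hδ ?_
    have hmem : MemLp ({t : ℝ | ⌊t / h⌋₊ = k}.indicator (fun _ => (1 : ℝ))) 2 μ :=
      (memLp_const 1).indicator (measurableSet_cell h k)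
    have h1 := integral_norm_sq_sum_sub_mean_le hξ hlaw hind (Finset.range N)
      (Ψ := fun _ => {t : ℝ | ⌊t / h⌋₊ = k}.indicator (fun _ => (1 : ℝ))) (fun _ _ => hmem)
    have h2 : ∫ t, {t : ℝ | ⌊t / h⌋₊ = k}.indicator (fun _ => (1 : ℝ)) t ∂μ = p k :=
      integral_indicator_one (measurableSet_cell h k)
    have h3 : ∀ t, ‖{t : ℝ | ⌊t / h⌋₊ = k}.indicator (fun _ => (1 : ℝ)) t‖ ^ 2 =
        {t : ℝ | ⌊t / h⌋₊ = k}.indicator (fun _ => (1 : ℝ)) t := by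
      intro t
      by_cases ht : t ∈ {t : ℝ | ⌊t / h⌋₊ = k} <;> simp [ht]
    have h4 : ∀ ω, ‖∑ j ∈ Finset.range N,
        ({t : ℝ | ⌊t / h⌋₊ = k}.indicator (fun _ => (1 : ℝ)) (ξ j ω) - p k)‖ ^ 2 = D k ω ^ 2 := by
      intro ω
      rw [Real.norm_eq_abs, sq_abs, Finset.sum_sub_distrib, ← cast_cellCount N (fun j => ξ j ω)]
      simp [hD]
    simp only [h2, h3, h4, Finset.sum_const, Finset.card_range, nsmul_eq_mul] at h1
    exact lintegral_ofReal_abs_le h1.1 (fun ω => sq_nonneg _)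
      (h1.2.trans (mul_le_mul_of_nonneg_left (hμ.measure_cell_le hh k) hN'.le))
  have hsub : {ω | ¬ IsSpread N (fun j => ξ j ω) h (b / 2) (B + b)} ⊆
      (⋃ j ∈ Finset.range N, ξ j ⁻¹' (Icc 0 1)ᶜ) ∪
      ⋃ k ∈ Finset.range M, {ω | (b / 2 * (N * h)) ^ 2 < |D k ω ^ 2|} := by
    intro ω hω
    by_contra hcon
    simp only [mem_union, mem_iUnion, not_or, not_exists, Finset.mem_range, mem_ofPred_eq,
      mem_preimage, mem_compl_iff, not_not, not_lt] at hcon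
    obtain ⟨hc1, hc2⟩ := hcon
    have hc3 : ∀ k < M, |D k ω| ≤ b / 2 * (N * h) := fun k hk => by
      refine abs_le_of_sq_le_sq ?_ (by positivity)
      have := hc2 k hk
      rwa [abs_of_nonneg (sq_nonneg _)] at this
    refine hω ⟨hc1, fun k => ?_, fun k hk => ?_⟩
    · by_cases hk : k < M
      · have h1 := (abs_le.1 (hc3 k hk)).2
        have h2 := mul_le_mul_of_nonneg_left (hμ.measure_cell_le hh k) hN'.le
        have h3 : 0 ≤ b * (N * h) := by positivity
        simp only [hD, hp] at h1
        linarith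
      · have h0 : cellCount N (fun j => ξ j ω) h k = 0 := by
          rw [cellCount, Finset.card_eq_zero]
          refine Finset.filter_eq_empty_iff.2 fun j hj hjk => hk ?_
          rw [← hjk, ← hM]
          refine Nat.lt_succ_of_le (Nat.floor_le_floor ?_)
          gcongr
          exact (hc1 j (Finset.mem_range.1 hj)).2
        rw [h0, Nat.cast_zero]
        positivity
    · have hkM : k < M := by
        rw [← hM]
        refine Nat.lt_succ_of_le (Nat.le_floor ?_)
        rw [le_div_iff₀ hh]
        linarith
      have h1 := (abs_le.1 (hc3 k hkM)).1
      have h2 := mul_le_mul_of_nonneg_left (hμ.le_measure_cell hh hk) hN'.le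
      simp only [hD, hp] at h1
      linarith
  have h0 : P (⋃ j ∈ Finset.range N, ξ j ⁻¹' (Icc 0 1)ᶜ) = 0 := by
    refine (measure_biUnion_null_iff (Finset.range N).countable_toSet).2 fun j _ => ?_
    rw [← Measure.map_apply (hξ j) measurableSet_Icc.compl, hlaw, hμ.compl_eq_zero]
  calc _ ≤ _ := measure_mono hsub
    _ ≤ _ := measure_union_le _ _
    _ ≤ 0 + ∑ k ∈ Finset.range M, P {ω | (b / 2 * (N * h)) ^ 2 < |D k ω ^ 2|} := by
      rw [h0]
      exact add_le_add le_rfl (measure_biUnion_finset_le _ _)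
    _ ≤ 0 + ∑ k ∈ Finset.range M, ENNReal.ofReal (N * (B * h) / (b / 2 * (N * h)) ^ 2) :=
      add_le_add le_rfl (Finset.sum_le_sum fun k _ => hcheb k)
    _ = ENNReal.ofReal (M * (N * (B * h) / (b / 2 * (N * h)) ^ 2)) := by
      rw [zero_add, Finset.sum_const, Finset.card_range, nsmul_eq_mul,
        ENNReal.ofReal_mul (Nat.cast_nonneg M), ENNReal.ofReal_natCast]
    _ ≤ _ := by
      refine ENNReal.ofReal_le_ofReal ?_
      calc _ ≤ 2 / h * (N * (B * h) / (b / 2 * (N * h)) ^ 2) := by gcongr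
        _ = _ := by field_simp; ring

theorem measurableSet_isSplitSpread (n : ℕ) (h b B : ℝ) :
    MeasurableSet {x : ℕ → ℝ | IsSplitSpread n x h b B} :=
  (measurableSet_isSpread (n / 2) h b B).inter
    ((measurable_pi_lambda _ fun j => measurable_pi_apply (n / 2 + j) :
      Measurable fun x : ℕ → ℝ => fun j => x (n / 2 + j))
      (measurableSet_isSpread (n - n / 2) h b B))

theorem IsQuasiUniform.measure_not_isSplitSpread_le {Ω : Type*} [MeasurableSpace Ω] {P : Measure Ω}
    [IsProbabilityMeasure P] {μ : Measure ℝ} [IsProbabilityMeasure μ] {b B : ℝ}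
    (hμ : IsQuasiUniform μ b B) (hb : 0 < b) (hB : 0 ≤ B) {ξ : ℕ → Ω → ℝ}
    (hξ : ∀ j, Measurable (ξ j)) (hlaw : ∀ j, P.map (ξ j) = μ)
    (hind : ∀ i j, i ≠ j → IndepFun (ξ i) (ξ j) P) {n : ℕ} (hn : 2 ≤ n) {h : ℝ} (hh : 0 < h)
    (hh1 : h ≤ 1) :
    P {ω | ¬ IsSplitSpread n (fun j => ξ j ω) h (b / 2) (B + b)} ≤
      ENNReal.ofReal (48 * B / b ^ 2 * (n * h ^ 2)⁻¹) := by
  have hn' : (0 : ℝ) < n := by exact_mod_cast (by omega : 0 < n)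
  have h1 := hμ.measure_not_isSpread_le hb hB hξ hlaw hind (N := n / 2) (by omega) hh hh1
  have h2 := hμ.measure_not_isSpread_le hb hB (fun j => hξ (n / 2 + j)) (fun j => hlaw _)
    (fun i j hij => hind _ _ (by omega)) (N := n - n / 2) (by omega) hh hh1
  have h3 : ∀ N : ℕ, (n : ℝ) ≤ 3 * N → ENNReal.ofReal (8 * B / b ^ 2 * (N * h ^ 2)⁻¹) ≤
      ENNReal.ofReal (24 * B / b ^ 2 * (n * h ^ 2)⁻¹) := by
    intro N hN
    have hN0 : (0 : ℝ) < N := by linarith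
    refine ENNReal.ofReal_le_ofReal ?_
    calc 8 * B / b ^ 2 * (N * h ^ 2)⁻¹ = 24 * B / b ^ 2 * (3 * N * h ^ 2)⁻¹ := by
          field_simp; ring
      _ ≤ _ := by gcongr
  calc _ ≤ P ({ω | ¬ IsSpread (n / 2) (fun j => ξ j ω) h (b / 2) (B + b)} ∪
        {ω | ¬ IsSpread (n - n / 2) (fun j => ξ (n / 2 + j) ω) h (b / 2) (B + b)}) := by
        refine measure_mono fun ω hω => ?_
        simp only [mem_ofPred_eq, IsSplitSpread, not_and_or] at hω
        exact hω
    _ ≤ _ := measure_union_le _ _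
    _ ≤ ENNReal.ofReal (24 * B / b ^ 2 * (n * h ^ 2)⁻¹) +
        ENNReal.ofReal (24 * B / b ^ 2 * (n * h ^ 2)⁻¹) := by
      refine add_le_add (h1.trans (h3 _ ?_)) (h2.trans (h3 _ ?_)) <;>
        exact_mod_cast (by omega)
    _ = _ := by
      rw [← ENNReal.ofReal_add (by positivity) (by positivity)]
      congr 1
      ring

/-! ### The joint law of covariates and errors -/

namespace IsRegressionSample

variable {Ω : Type*} [MeasurableSpace Ω] {P : Measure Ω} [IsProbabilityMeasure P]
  {f g r : ℝ → ℝ} {X ε Y : ℕ → Ω → ℝ}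

/-- All the covariates and errors are independent, as a single family; `true` marks the errors. -/
theorem iIndepFun_bool (hS : IsRegressionSample P f g r X ε Y) :
    iIndepFun (fun (p : ℕ × Bool) ω => bif p.2 then ε p.1 ω else X p.1 ω) P := by
  refine iIndepFun_uncurry' (X := fun (i : ℕ) (b : Bool) ω => bif b then ε i ω else X i ω)
    (fun i b => ?_) ?_ fun i => ?_
  · cases b
    · exact hS.measurable_covariate i
    · exact hS.measurable_error i
  · have h1 := hS.indep.comp (fun _ (p : ℝ × ℝ) (b : Bool) => bif b then p.2 else p.1)
      fun _ => measurable_pi_lambda _ fun b => by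
        cases b
        · exact measurable_fst
        · exact measurable_snd
    exact h1
  · refine iIndepFun_iff_measure_inter_preimage_eq_mul.2 fun S sets hsets => ?_
    have h2 := indepFun_iff_measure_inter_preimage_eq_mul.1 (hS.indep_error i)
    rcases (by decide : ∀ S : Finset Bool, S = ∅ ∨ S = {false} ∨ S = {true} ∨
      S = {false, true}) S with rfl | rfl | rfl | rfl
    · simp
    · simp
    · simp
    · have h3 := h2 (sets false) (sets true) (hsets _ (by simp)) (hsets _ (by simp))
      rw [Finset.set_biInter_insert, Finset.set_biInter_singleton, Finset.prod_pair (by decide)]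
      exact h3

/-- The covariates together with two disjoint subsequences of the errors are three independent
sequences of independent variables. -/
theorem map_eq_prod (hS : IsRegressionSample P f g r X ε Y)
    [IsProbabilityMeasure (densityMeasure f)] [IsProbabilityMeasure (densityMeasure g)]
    {σ₁ σ₂ : ℕ → ℕ} (h1 : Function.Injective σ₁) (h2 : Function.Injective σ₂)
    (h12 : ∀ i j, σ₁ i ≠ σ₂ j) :
    P.map (fun ω => ((fun j => X j ω), ((fun j => ε (σ₁ j) ω), fun j => ε (σ₂ j) ω))) =
      (errorLaw (densityMeasure g)).prod
        ((errorLaw (densityMeasure f)).prod (errorLaw (densityMeasure f))) := by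
  set V : Fin 3 → ℕ → Ω → ℝ := ![X, fun j => ε (σ₁ j), fun j => ε (σ₂ j)] with hV
  have hVm : ∀ p j, Measurable (V p j) := by
    intro p j
    fin_cases p
    · exact hS.measurable_covariate j
    · exact hS.measurable_error _
    · exact hS.measurable_error _
  have hind : iIndepFun (fun (p : Fin 3 × ℕ) ω => V p.1 p.2 ω) P := by
    have hinj : Function.Injective (fun p : Fin 3 × ℕ =>
        (![fun j => (j, false), fun j => (σ₁ j, true), fun j => (σ₂ j, true)] :
          Fin 3 → ℕ → ℕ × Bool) p.1 p.2) := by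
      rintro ⟨p, i⟩ ⟨q, j⟩ hpq
      fin_cases p <;> fin_cases q <;> simp at hpq ⊢
      · exact hpq
      · exact h1 hpq
      · exact h12 _ _ hpq
      · exact h12 _ _ hpq.symm
      · exact h2 hpq
    convert hS.iIndepFun_bool.precomp hinj using 1
    ext ⟨p, j⟩ ω
    fin_cases p <;> rfl
  have hAm : ∀ p : Fin 3, Measurable fun ω => fun j => V p j ω := fun p =>
    measurable_pi_lambda _ (hVm p)
  have hlaw : ∀ p, P.map (fun ω => fun j => V p j ω) =
      Measure.infinitePi fun j => P.map (V p j) := by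
    intro p
    refine (iIndepFun_iff_map_fun_eq_infinitePi_map (hVm p)).1 ?_
    exact hind.precomp (g := fun j => (p, j)) fun i j h => (Prod.mk.inj h).2
  have hA : iIndepFun (fun (p : Fin 3) ω => fun j => V p j ω) P := by
    have : ∀ p j, IsProbabilityMeasure (P.map (V p j)) := fun p j =>
      Measure.isProbabilityMeasure_map (hVm p j).aemeasurable
    rw [iIndepFun_iff_map_fun_eq_infinitePi_map hAm]
    refine Eq.trans ?_ (congrArg Measure.infinitePi (funext hlaw).symm)
    rw [← Measure.infinitePi_map_curry fun p j => P.map (V p j)]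
    have h3 := (iIndepFun_iff_map_fun_eq_infinitePi_map fun p : Fin 3 × ℕ => hVm p.1 p.2).1 hind
    rw [← h3, Measure.map_map (MeasurableEquiv.measurable _)
      (measurable_pi_lambda _ fun p : Fin 3 × ℕ => hVm p.1 p.2)]
    rfl
  have e0 : P.map (fun ω => fun j => V 0 j ω) = errorLaw (densityMeasure g) := by
    rw [hlaw]
    exact congrArg _ (funext fun j => hS.covariate_law j)
  have e1 : P.map (fun ω => fun j => V 1 j ω) = errorLaw (densityMeasure f) := by
    rw [hlaw]
    exact congrArg _ (funext fun j => hS.error_law _)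
  have e2 : P.map (fun ω => fun j => V 2 j ω) = errorLaw (densityMeasure f) := by
    rw [hlaw]
    exact congrArg _ (funext fun j => hS.error_law _)
  have i1 := (hA.indepFun_prodMk hAm 1 2 0 (by decide) (by decide)).symm
  have i2 := hA.indepFun (by decide : (1 : Fin 3) ≠ 2)
  have h4 := i1.map_prod_eq_prod_map_map (hAm 0).aemeasurable ((hAm 1).prodMk (hAm 2)).aemeasurable
  have h5 := i2.map_prod_eq_prod_map_map (hAm 1).aemeasurable (hAm 2).aemeasurable
  rw [h5, e0, e1, e2] at h4
  exact h4

end IsRegressionSample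

/-! ### Random designs -/

/-- By continuity, a supremum over the line is one over the rational numbers. -/
theorem measurableSet_exists_lt {T : Type*} [MeasurableSpace T] {F : T → ℝ → ℝ}
    (hm : ∀ y, Measurable fun p => F p y) (hc : ∀ p, Continuous (F p)) (c : ℝ) :
    MeasurableSet {p | ∃ y, c < F p y} := by
  have : {p | ∃ y, c < F p y} = ⋃ q : ℚ, {p | c < F p q} := by
    ext p
    simp only [mem_ofPred_eq, mem_iUnion]
    refine ⟨fun ⟨y, hy⟩ => ?_, fun ⟨q, hq⟩ => ⟨q, hq⟩⟩
    exact Rat.denseRange_cast.exists_mem_open (isOpen_lt continuous_const (hc p)) ⟨y, hy⟩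
  rw [this]
  exact MeasurableSet.iUnion fun q => measurableSet_lt measurable_const (hm q)

/-- A family of designs with constant sizes of the halves that depends measurably on a
parameter. -/
structure IsMeasurableDesign {T : Type*} [MeasurableSpace T] (D : T → SplitDesign)
    (m k : ℕ) : Prop where
  m_eq : ∀ x, (D x).m = m
  k_eq : ∀ x, (D x).k = k
  measurable_ρ₁ : ∀ j, Measurable fun x => (D x).ρ₁ j
  measurable_ρ₂ : ∀ j, Measurable fun x => (D x).ρ₂ j
  measurable_own₁ : ∀ N j, Measurable fun p : T × (ℕ → ℝ) => (D p.1).own₁.eval N p.2 j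
  measurable_own₂ : ∀ N j, Measurable fun p : T × (ℕ → ℝ) => (D p.1).own₂.eval N p.2 j
  measurable_cross₁ : ∀ N j, Measurable fun p : T × (ℕ → ℝ) => (D p.1).cross₁.eval N p.2 j
  measurable_cross₂ : ∀ N j, Measurable fun p : T × (ℕ → ℝ) => (D p.1).cross₂.eval N p.2 j

namespace IsMeasurableDesign

variable {T : Type*} [MeasurableSpace T] {D : T → SplitDesign} {m k : ℕ}

theorem swap (hD : IsMeasurableDesign D m k) : IsMeasurableDesign (fun x => (D x).swap) k m :=
  ⟨hD.2, hD.1, hD.4, hD.3, hD.6, hD.5, hD.8, hD.7⟩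

theorem measurable_comp_swap {F : T → (ℕ → ℝ) × (ℕ → ℝ) → ℝ}
    (h : Measurable fun p : T × ((ℕ → ℝ) × (ℕ → ℝ)) => F p.1 p.2) :
    Measurable fun p : T × ((ℕ → ℝ) × (ℕ → ℝ)) => F p.1 p.2.swap :=
  h.comp (measurable_fst.prodMk (measurable_swap.comp measurable_snd))

theorem measurable_res (hD : IsMeasurableDesign D m k) (j : ℕ) :
    Measurable fun p : T × ((ℕ → ℝ) × (ℕ → ℝ)) => (D p.1).res p.2 j := by
  unfold SplitDesign.res
  simp only [hD.m_eq]
  exact ((measurable_pi_apply j).comp (measurable_fst.comp measurable_snd)).sub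
    ((hD.measurable_own₁ m j).comp (measurable_fst.prodMk (measurable_fst.comp measurable_snd)))

theorem measurable_crossRes (hD : IsMeasurableDesign D m k) (j : ℕ) :
    Measurable fun p : T × ((ℕ → ℝ) × (ℕ → ℝ)) => (D p.1).crossRes p.2 j := by
  unfold SplitDesign.crossRes
  simp only [hD.k_eq]
  exact ((measurable_pi_apply j).comp (measurable_fst.comp measurable_snd)).sub
    ((hD.measurable_cross₁ k j).comp (measurable_fst.prodMk (measurable_snd.comp measurable_snd)))

theorem measurable_crossFit (hD : IsMeasurableDesign D m k) (j : ℕ) :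
    Measurable fun p : T × ((ℕ → ℝ) × (ℕ → ℝ)) => (D p.1).crossFit p.2 j := by
  unfold SplitDesign.crossFit
  simp only [hD.k_eq]
  exact ((hD.measurable_ρ₁ j).comp measurable_fst).add
    ((hD.measurable_cross₁ k j).comp (measurable_fst.prodMk (measurable_snd.comp measurable_snd)))

variable {κ κ' : ℝ → ℝ}

theorem measurable_kernelScale {k : ℝ → ℝ} (hk : Measurable k) (q : ℕ) (a : ℝ) :
    Measurable (kernelScale k q a) := by
  unfold kernelScale
  fun_prop

theorem measurable_otherScore (hD : IsMeasurableDesign D m k) (hκ : Measurable κ)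
    (hκ' : Measurable κ') (a : ℝ) {z : T × ((ℕ → ℝ) × (ℕ → ℝ)) → ℝ} (hz : Measurable z) :
    Measurable fun p : T × ((ℕ → ℝ) × (ℕ → ℝ)) => (D p.1).otherScore κ κ' a p.2 (z p) := by
  have h1 : ∀ j, Measurable fun p : T × ((ℕ → ℝ) × (ℕ → ℝ)) =>
      p.2.2 j - (D p.1).own₂.eval k p.2.2 j := fun j =>
    ((measurable_pi_apply j).comp (measurable_snd.comp measurable_snd)).sub
      ((hD.measurable_own₂ k j).comp (measurable_fst.prodMk (measurable_snd.comp measurable_snd)))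
  have h2 := measurable_kernelScale hκ 0 a
  have h3 := measurable_kernelScale hκ' 1 a
  unfold SplitDesign.otherScore residualScore regScore kernelMean
  simp only [hD.k_eq]
  exact ((Finset.measurable_fun_sum _ fun j _ => h3.comp (hz.sub (h1 j))).const_mul _).neg.div
    (((Finset.measurable_fun_sum _ fun j _ => h2.comp (hz.sub (h1 j))).const_mul _).const_add _)

theorem measurable_fisherSum (hD : IsMeasurableDesign D m k) (hκ : Measurable κ)
    (hκ' : Measurable κ') (a : ℝ) :
    Measurable fun p : T × ((ℕ → ℝ) × (ℕ → ℝ)) => (D p.1).fisherSum κ κ' a p.2 := by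
  unfold SplitDesign.fisherSum
  simp only [hD.m_eq]
  exact Finset.measurable_fun_sum _ fun j _ =>
    (hD.measurable_otherScore hκ hκ' a (hD.measurable_res j)).pow_const 2

theorem measurable_fisher (hD : IsMeasurableDesign D m k) (hκ : Measurable κ)
    (hκ' : Measurable κ') (a : ℝ) :
    Measurable fun p : T × ((ℕ → ℝ) × (ℕ → ℝ)) => (D p.1).fisher κ κ' a p.2 := by
  unfold SplitDesign.fisher
  simp only [hD.m_eq, hD.k_eq]
  exact ((hD.measurable_fisherSum hκ hκ' a).add
    (measurable_comp_swap (F := fun x ω => (D x).swap.fisherSum κ κ' a ω)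
      (hD.swap.measurable_fisherSum hκ hκ' a))).const_mul _

theorem measurable_pooled (hD : IsMeasurableDesign D m k) {q : ℝ → ℝ} (hq : Measurable q)
    {z : T × ((ℕ → ℝ) × (ℕ → ℝ)) → ℝ} (hz : Measurable z) :
    Measurable fun p : T × ((ℕ → ℝ) × (ℕ → ℝ)) => (D p.1).pooled p.2 q (z p) := by
  unfold SplitDesign.pooled
  simp only [hD.m_eq, hD.k_eq]
  exact ((Finset.measurable_fun_sum _ fun j _ => hq.comp (hz.sub (hD.measurable_crossRes j))).add
    (Finset.measurable_fun_sum _ fun j _ => hq.comp (hz.sub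
      (measurable_comp_swap (F := fun x ω => (D x).swap.crossRes ω j)
        (hD.swap.measurable_crossRes j))))).const_mul _

theorem measurable_estimate (hD : IsMeasurableDesign D m k) (hκ : Measurable κ)
    (hκ' : Measurable κ') (a y : ℝ) :
    Measurable fun p : T × ((ℕ → ℝ) × (ℕ → ℝ)) => (D p.1).estimate κ κ' a p.2 y := by
  have h1 := fun j => hD.measurable_pooled (measurable_kernelScale hκ' 1 a)
    ((hD.measurable_crossFit j).const_sub y)
  unfold SplitDesign.estimate SplitDesign.lamHat
  simp only [hD.m_eq, hD.k_eq]
  exact (Finset.measurable_fun_sum _ fun j _ => ((h1 j).sub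
    ((Finset.measurable_fun_sum _ fun i _ => h1 i).const_mul _)).mul
    (((hD.measurable_otherScore hκ hκ' a (hD.measurable_res j)).div
      (hD.measurable_fisher hκ hκ' a)).sub (hD.measurable_res j))).const_mul _

theorem measurable_target (hD : IsMeasurableDesign D m k) {f f' : ℝ → ℝ} (hf' : Measurable f')
    (hl : Measurable (lam f f')) (y : ℝ) :
    Measurable fun p : T × ((ℕ → ℝ) × (ℕ → ℝ)) => (D p.1).target p.2 f f' y := by
  have h1 : ∀ j, Measurable fun p : T × ((ℕ → ℝ) × (ℕ → ℝ)) => f' (y - (D p.1).ρ₁ j) := fun j =>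
    hf'.comp (((hD.measurable_ρ₁ j).comp measurable_fst).const_sub y)
  unfold SplitDesign.target
  simp only [hD.m_eq, hD.k_eq]
  exact (Finset.measurable_fun_sum _ fun j _ => ((h1 j).sub
    ((Finset.measurable_fun_sum _ fun i _ => h1 i).const_mul _)).mul
    (hl.comp ((measurable_pi_apply j).comp (measurable_fst.comp measurable_snd)))).const_mul _

end IsMeasurableDesign

theorem SplitDesign.continuous_estimate (D : SplitDesign) (κ : ℝ → ℝ) {κ' : ℝ → ℝ}
    (hκ' : Continuous κ') (a : ℝ) (ω : (ℕ → ℝ) × (ℕ → ℝ)) :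
    Continuous (D.estimate κ κ' a ω) := by
  have h1 : Continuous (D.pooled ω (kernelScale κ' 1 a)) := by
    unfold SplitDesign.pooled kernelScale
    fun_prop
  unfold SplitDesign.estimate
  fun_prop

theorem SplitDesign.continuous_target (D : SplitDesign) (f : ℝ → ℝ) {f' : ℝ → ℝ}
    (hf' : Continuous f') (ω : (ℕ → ℝ) × (ℕ → ℝ)) : Continuous (D.target ω f f') := by
  unfold SplitDesign.target
  fun_prop

/-- The error of the split-sample estimator for a fixed design. -/
noncomputable def SplitDesign.discrepancy (D : SplitDesign) (κ κ' f f' : ℝ → ℝ) (a : ℝ)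
    (ω : (ℕ → ℝ) × (ℕ → ℝ)) (y : ℝ) : ℝ :=
  (D.estimate κ κ' a ω y - D.target ω f f' y) +
    (D.swap.estimate κ κ' a ω.swap y - D.swap.target ω.swap f f' y)

theorem continuous_gramMatrix {w : ℝ → ℝ} (hw : Continuous w) (c : ℝ) (N : ℕ) {T : Type*}
    [TopologicalSpace T] {x : T → ℕ → ℝ} {t : T → ℝ} (hx : Continuous x) (ht : Continuous t) :
    Continuous fun τ => gramMatrix w c N (x τ) (t τ) := by
  have hxi : ∀ i, Continuous fun τ => x τ i := fun i => (continuous_apply i).comp hx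
  refine continuous_matrix fun p q => ?_
  simp only [gramMatrix, Matrix.of_apply]
  fun_prop

theorem measurable_fitWeight {w : ℝ → ℝ} (hw : Continuous w) (c : ℝ) (N : ℕ) {T : Type*}
    [TopologicalSpace T] [MeasurableSpace T] [OpensMeasurableSpace T] {x : T → ℕ → ℝ} {t : T → ℝ}
    (hx : Continuous x) (ht : Continuous t) (i : ℕ) :
    Measurable fun τ => fitWeight w c N (x τ) (t τ) i := by
  have hxi : Continuous fun τ => x τ i := (continuous_apply i).comp hx
  have hG := continuous_gramMatrix hw c N hx ht
  have h1 : Measurable fun τ => (gramMatrix w c N (x τ) (t τ)).det := hG.matrix_det.measurable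
  have h2 : ∀ p, Measurable fun τ => (gramMatrix w c N (x τ) (t τ)).adjugate p 0 := fun p =>
    (hG.matrix_adjugate.matrix_elem p 0).measurable
  have h3 : Measurable fun τ => (x τ i - t τ) / c := (by fun_prop : Continuous _).measurable
  unfold fitWeight gramCoef
  exact ((hw.measurable.comp h3).mul (Finset.measurable_fun_sum _ fun p _ =>
    ((h1.inv.mul (h2 p)).mul (h3.pow_const _)))).const_mul _

theorem measurable_smootherForm_eval {w r : ℝ → ℝ} (hw : Continuous w) (hr : Continuous r) (c : ℝ)
    (N : ℕ) {x y : (ℕ → ℝ) → ℕ → ℝ} (hx : Continuous x) (hy : Continuous y) (L j : ℕ) :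
    Measurable fun p : (ℕ → ℝ) × (ℕ → ℝ) => (smootherForm w c r N (x p.1)
        (y p.1)).eval L p.2 j := by
  have hyj : Continuous fun τ => y τ j := (continuous_apply j).comp hy
  have h1 := fun i => (measurable_fitWeight hw c N hx hyj i).comp
    (measurable_fst : Measurable (Prod.fst : (ℕ → ℝ) × (ℕ → ℝ) → ℕ → ℝ))
  have hrx : ∀ i, Measurable fun τ => r (x τ i) := fun i =>
    (hr.comp ((continuous_apply i).comp hx)).measurable
  simp only [ShiftForm.eval, affineShift, smootherForm]
  refine ((Finset.measurable_fun_sum _ fun i _ => (h1 i).mul ((hrx i).comp measurable_fst)).sub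
    ((hr.comp hyj).measurable.comp measurable_fst)).add
    (Finset.measurable_fun_sum _ fun i _ => (h1 i).mul
      ((measurable_pi_apply i).comp measurable_snd))

theorem isMeasurableDesign_regressionDesign {w r : ℝ → ℝ} (hw : Continuous w) (hr : Continuous r)
    (c : ℝ) (n : ℕ) :
    IsMeasurableDesign (fun x => regressionDesign w c r n x) (n / 2) (n - n / 2) := by
  have h1 : Continuous fun (x : ℕ → ℝ) j => x (n / 2 + j) :=
    continuous_pi fun j => continuous_apply _
  have h2 : ∀ j, Measurable fun x : ℕ → ℝ => r (x j) := fun j =>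
    (hr.comp (continuous_apply j)).measurable
  refine ⟨fun _ => rfl, fun _ => rfl, h2, fun j => h2 _, fun N j => ?_, fun N j => ?_,
    fun N j => ?_, fun N j => ?_⟩
  · exact measurable_smootherForm_eval hw hr c _ continuous_id continuous_id N j
  · exact measurable_smootherForm_eval hw hr c _ h1 h1 N j
  · exact measurable_smootherForm_eval hw hr c _ h1 continuous_id N j
  · exact measurable_smootherForm_eval hw hr c _ continuous_id h1 N j

theorem SplitDesign.continuous_discrepancy (D : SplitDesign) (κ f : ℝ → ℝ) {κ' f' : ℝ → ℝ}
    (hκ' : Continuous κ') (hf' : Continuous f') (a : ℝ) (ω : (ℕ → ℝ) × (ℕ → ℝ)) :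
    Continuous (D.discrepancy κ κ' f f' a ω) := by
  have h1 := D.continuous_estimate κ hκ' a ω
  have h2 := D.swap.continuous_estimate κ hκ' a ω.swap
  have h3 := D.continuous_target f hf' ω
  have h4 := D.swap.continuous_target f hf' ω.swap
  unfold SplitDesign.discrepancy
  fun_prop

theorem IsMeasurableDesign.measurable_discrepancy {T : Type*} [MeasurableSpace T]
    {D : T → SplitDesign} {m k : ℕ} (hD : IsMeasurableDesign D m k) {κ κ' f f' : ℝ → ℝ}
    (hκ : Measurable κ) (hκ' : Measurable κ') (hf' : Measurable f') (hl : Measurable (lam f f'))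
    (a y : ℝ) :
    Measurable fun p : T × ((ℕ → ℝ) × (ℕ → ℝ)) => (D p.1).discrepancy κ κ' f f' a p.2 y := by
  unfold SplitDesign.discrepancy
  exact ((hD.measurable_estimate hκ hκ' a y).sub (hD.measurable_target hf' hl y)).add
    ((measurable_comp_swap (F := fun x ω => (D x).swap.estimate κ κ' a ω y)
      (hD.swap.measurable_estimate hκ hκ' a y)).sub
    (measurable_comp_swap (F := fun x ω => (D x).swap.target ω f f' y)
      (hD.swap.measurable_target hf' hl y)))

/-- A product measure of a set is small if the first coordinate is with high probability such that
the sections are small. -/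
theorem prod_measure_le_of_sections {T Ω : Type*} [MeasurableSpace T] [MeasurableSpace Ω]
    {μ : Measure T} {ν : Measure Ω} [IsProbabilityMeasure μ] [IsProbabilityMeasure ν] {G : Set T}
    {E : Set (T × Ω)} (hG : MeasurableSet G) (hE : MeasurableSet E) {η : ℝ≥0∞}
    (h : ∀ x ∈ G, ν {ω | (x, ω) ∈ E} ≤ η) :
    (μ.prod ν) {p | p.1 ∉ G ∨ p ∈ E} ≤ μ Gᶜ + η := by
  have hGE : MeasurableSet ((Prod.fst ⁻¹' G) ∩ E) := (measurable_fst hG).inter hE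
  calc (μ.prod ν) {p | p.1 ∉ G ∨ p ∈ E} ≤ (μ.prod ν) (Gᶜ ×ˢ univ ∪ (Prod.fst ⁻¹' G) ∩ E) := by
        refine measure_mono fun p hp => ?_
        by_cases hpG : p.1 ∈ G
        · exact Or.inr ⟨hpG, hp.resolve_left fun h => h hpG⟩
        · exact Or.inl ⟨hpG, mem_univ _⟩
    _ ≤ _ := measure_union_le _ _
    _ ≤ μ Gᶜ + η := by
      refine add_le_add (by rw [Measure.prod_prod, measure_univ, mul_one]) ?_
      rw [Measure.prod_apply hGE]
      calc _ ≤ ∫⁻ _, η ∂μ := by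
            refine lintegral_mono fun x => ?_
            by_cases hx : x ∈ G
            · exact (measure_mono fun ω hω => hω.2).trans (h x hx)
            · have : Prod.mk x ⁻¹' ((Prod.fst ⁻¹' G) ∩ E) = ∅ :=
                eq_empty_of_forall_notMem fun ω hω => hx hω.1
              simp [this]
        _ = η := by simp

section

variable {f f' φ κ κ' κ'' w r : ℝ → ℝ} {M B₁ B₂ : ℝ} {s a : ℕ → ℝ}
  [IsProbabilityMeasure (densityMeasure f)]

/-- The error of the split-sample estimator is of smaller order than `s ^ 4`, uniformly over the
spread designs; hence the same holds for a random design. -/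
theorem eventually_measure_discrepancy_le (hκ : IsKernelTriple κ κ' κ'' B₁ B₂)
    (hf : IsSmoothDensity f f' φ M) (hJ : Integrable (fun z => score f f' z ^ 2 * f z))
    (h2 : MemLp (fun t : ℝ => t) 2 (densityMeasure f))
    (h0 : ∫ t, t ∂(densityMeasure f) = 0) (hw : IsSmootherWeight w) (hR : RegressionAssumption r)
    (hr : Continuous r) {μ : Measure ℝ} [IsProbabilityMeasure μ] {b B : ℝ}
    (hμ : IsQuasiUniform μ b B) (hb : 0 < b) (hB : 0 ≤ B) {α d w₀ γ : ℝ} (hd : 0 < d)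
    (hγ : 0 < γ) (hw₀ : 0 < w₀) (hα : 0 ≤ α) (hα1 : α + 6 * d ≤ 1)
    (hle : ∀ u ∈ Icc α (α + 6 * d), w₀ ≤ w u) (hs : ∀ n, 2 ≤ n → 0 < s n)
    (hs1 : ∀ n, 2 ≤ n → s n ≤ 1) (hsn : ∀ n, 2 ≤ n → s n ^ 8 * n = 1) (ha : ∀ n, 0 < a n)
    (hs0 : Tendsto s atTop (𝓝 0)) (ha0 : Tendsto a atTop (𝓝 0))
    (hsa : Tendsto (fun n => s n / a n) atTop (𝓝 0)) {δ η : ℝ} (hδ : 0 < δ)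
    (hη : 0 < η) :
    ∀ᶠ n in atTop, ((errorLaw μ).prod
      ((errorLaw (densityMeasure f)).prod (errorLaw (densityMeasure f))))
      {p | p.1 ∉ {x | IsSplitSpread n x (γ * s n ^ 2 * d) (b / 2) (B + b)} ∨
        p ∈ {p | ∃ y, δ * s n ^ 4 < |(regressionDesign w (γ * s n ^ 2) r n p.1).discrepancy
          κ κ' f f' (a n) p.2 y|}} ≤ ENNReal.ofReal η := by
  obtain ⟨K, hK⟩ := exists_regressionDesign_regular hw hR (b := b / 2) (B := B + b) hd
      (by positivity)
    (by positivity) hγ hw₀ hα hα1 hle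
  -- Pairs of a sample size and an evenly spread design, along the filter of large sample sizes:
  -- convergence in this index is convergence uniformly over the designs.
  let ι := {p : ℕ × (ℕ → ℝ) // 2 ≤ p.1 ∧ γ * s p.1 ^ 2 ≤ 1 / 2 ∧
    IsSplitSpread p.1 p.2 (γ * s p.1 ^ 2 * d) (b / 2) (B + b)}
  let N : ι → ℕ := fun i => i.1.1
  have hN : Tendsto N (comap N atTop) atTop := tendsto_comap
  have hreg : Regime (comap N atTop) (fun i => s (N i)) fun i => a (N i) :=
    ⟨fun i => hs _ i.2.1, fun i => hs1 _ i.2.1, fun i => ha _, hs0.comp hN, ha0.comp hN,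
      hsa.comp hN⟩
  let D : ι → SplitDesign := fun i => regressionDesign w (γ * s (N i) ^ 2) r (N i) i.1.2
  have hD : ∀ i, (D i).Regular K (s (N i)) := fun i =>
    hK (N i) i.1.2 (s (N i)) i.2.1 (hs _ i.2.1) (hsn _ i.2.1) i.2.2.1 i.2.2.2
  obtain ⟨Z₁, hZ1, hD1⟩ := exists_opZero_estimate_sub_target hκ hf hJ h2 h0 hreg hD
  obtain ⟨Z₂, hZ2, hD2⟩ := exists_opZero_estimate_sub_target hκ hf hJ h2 h0 hreg
    fun i => (hD i).swap
  have hZ := (hZ1.abs.add hZ2.comp_swap.abs) δ hδ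
  have hη2 : 0 < η / 2 := half_pos hη
  have hspread : Tendsto (fun n : ℕ => (errorLaw μ)
      {x | IsSplitSpread n x (γ * s n ^ 2 * d) (b / 2) (B + b)}ᶜ) atTop (𝓝 0) := by
    have h1 : Tendsto (fun n => ENNReal.ofReal (48 * B / b ^ 2 / (γ * d) ^ 2 * s n ^ 4)) atTop
        (𝓝 0) := by
      rw [← ENNReal.ofReal_zero]
      refine ENNReal.tendsto_ofReal ?_
      simpa using (hs0.pow 4).const_mul (48 * B / b ^ 2 / (γ * d) ^ 2)
    have h2 : ∀ᶠ n in atTop, γ * s n ^ 2 * d ≤ 1 := by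
      have h3 : Tendsto (fun n => γ * s n ^ 2 * d) atTop (𝓝 0) := by
        simpa using ((hs0.pow 2).const_mul γ).mul_const d
      exact h3.eventually_le_const zero_lt_one
    refine tendsto_of_tendsto_of_tendsto_of_le_of_le' tendsto_const_nhds h1
      (Eventually.of_forall fun _ => zero_le) ?_
    filter_upwards [h2, eventually_ge_atTop 2] with n hn hn2
    have hsp := hs n hn2
    refine (hμ.measure_not_isSplitSpread_le (P := errorLaw μ) (ξ := fun j x => x j) hb hB
      measurable_pi_apply errorLaw_map_eval errorLaw_indepFun hn2 (by positivity) hn).trans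
      (ENNReal.ofReal_le_ofReal (le_of_eq ?_))
    have hn' : (n : ℝ) = (s n ^ 8)⁻¹ := (inv_eq_of_mul_eq_one_right (hsn n hn2)).symm
    rw [hn']
    field_simp
  have hc : ∀ᶠ n in atTop, γ * s n ^ 2 ≤ 1 / 2 := by
    have h3 : Tendsto (fun n => γ * s n ^ 2) atTop (𝓝 0) := by
      simpa using (hs0.pow 2).const_mul γ
    exact h3.eventually_le_const (by norm_num)
  filter_upwards [(ENNReal.tendsto_nhds_zero.1 hspread) _ (ENNReal.ofReal_pos.2 hη2),
    eventually_comap.1 (hZ _ hη2), eventually_ge_atTop 2, hc] with n hn1 hn2 hn3 hn4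
  refine (prod_measure_le_of_sections (η := ENNReal.ofReal (η / 2))
    (measurableSet_isSplitSpread _ _ _ _) ?_ fun x hx => ?_).trans ((add_le_add hn1 le_rfl).trans
      (le_of_eq ?_))
  -- measurability is needed here for Fubini's theorem
  · refine measurableSet_exists_lt (fun y => ?_) (fun p => ?_) _
    · exact ((isMeasurableDesign_regressionDesign hw.contDiff.continuous hr _
        n).measurable_discrepancy
        hκ.continuous_zero.measurable hκ.continuous_fst.measurable hf.continuous_deriv.measurable
        (measurable_lam hf) _ y).abs
    · exact (SplitDesign.continuous_discrepancy _ _ _ hκ.continuous_fst hf.continuous_deriv _ _).abs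
  · refine le_trans (measure_mono fun ω hω => ?_) (hn2 ⟨(n, x), hn3, hn4, hx⟩ rfl)
    obtain ⟨y, hy⟩ := hω
    have hsp : 0 < s n ^ 4 := pow_pos (hs n hn3) 4
    have e1 := hD1 ⟨(n, x), hn3, hn4, hx⟩ ω y
    have e2 := hD2 ⟨(n, x), hn3, hn4, hx⟩ ω.swap y
    have e3 := hy.trans_le (abs_add_le _ _)
    have e4 := e3.trans_le (add_le_add e1 e2)
    rw [← mul_add, mul_comm δ] at e4
    rw [mem_ofPred_eq, abs_of_nonneg (by positivity)]
    exact lt_of_mul_lt_mul_left e4 hsp.le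
  · rw [← ENNReal.ofReal_add hη2.le hη2.le, add_halves]

end

/-! ### Centring at the response density -/

section IID

variable {Ω : Type*} [MeasurableSpace Ω] {P : Measure Ω} [IsProbabilityMeasure P] {μ : Measure ℝ}
  [IsProbabilityMeasure μ] {e : ℕ → Ω → ℝ}

/-- A mean of independent centred variables is of order `n^(-1/2)`; the offset `o n` allows for
either half of a sample. -/
theorem opOne_sqrt_mul_mean (he : ∀ j, Measurable (e j)) (hlaw : ∀ j, P.map (e j) = μ)
    (hind : ∀ i j, i ≠ j → IndepFun (e i) (e j) P) {ψ : ℝ → ℝ} (hψm : Measurable ψ)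
    (hψ : MemLp ψ 2 μ) (hψ0 : ∫ t, ψ t ∂μ = 0) {N o : ℕ → ℕ} (hN : ∀ n, N n ≤ n) :
    OpOne P atTop fun (n : ℕ) ω => √n * ((n : ℝ)⁻¹ * ∑ j ∈ Finset.range (N n), ψ (e
        (o n + j) ω)) := by
  have h1 : OpOne P atTop fun (n : ℕ) ω =>
      (√n * ((n : ℝ)⁻¹ * ∑ j ∈ Finset.range (N n), ψ (e (o n + j) ω))) ^ 2 := by
    refine opOne_of_lintegral (V := ∫ t, ‖ψ t‖ ^ 2 ∂μ) (fun n => ?_) ?_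
    · exact (((Finset.measurable_fun_sum _ fun j _ => hψm.comp (he _)).const_mul _).const_mul
        _).pow_const 2
    · filter_upwards [eventually_gt_atTop 0] with n hn
      have hn' : (0 : ℝ) < n := by exact_mod_cast hn
      have h2 := integral_norm_sq_sum_sub_mean_le (fun j => he (o n + j)) (fun j => hlaw _)
        (fun i j hij => hind _ _ (by omega)) (Finset.range (N n)) (Ψ := fun _ => ψ)
        fun _ _ => hψ
      simp only [hψ0, sub_zero, Finset.sum_const, Finset.card_range, nsmul_eq_mul] at h2
      have h3 : ∀ ω, (√n * ((n : ℝ)⁻¹ * ∑ j ∈ Finset.range (N n), ψ (e (o n + j) ω))) ^ 2 =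
          (n : ℝ)⁻¹ * ‖∑ j ∈ Finset.range (N n), ψ (e (o n + j) ω)‖ ^ 2 := by
        intro ω
        rw [mul_pow, Real.sq_sqrt hn'.le, Real.norm_eq_abs, sq_abs]
        field_simp
      simp only [h3]
      refine lintegral_ofReal_abs_le (h2.1.const_mul _) (fun ω => by positivity) ?_
      rw [integral_const_mul]
      have h4 : 0 ≤ ∫ t, ‖ψ t‖ ^ 2 ∂μ := integral_nonneg fun t => by positivity
      calc _ ≤ (n : ℝ)⁻¹ * (N n * ∫ t, ‖ψ t‖ ^ 2 ∂μ) := by gcongr; exact h2.2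
        _ ≤ (n : ℝ)⁻¹ * (n * ∫ t, ‖ψ t‖ ^ 2 ∂μ) := by gcongr; exact hN n
        _ = _ := by field_simp
  refine h1.sqrt.mono (Eventually.of_forall fun n ω => ?_)
  rw [Real.sqrt_sq_eq_abs, abs_abs]

/-- The weak law of large numbers in a Hilbert space. -/
theorem opZero_norm_mean_sub (he : ∀ j, Measurable (e j)) (hlaw : ∀ j, P.map (e j) = μ)
    (hind : ∀ i j, i ≠ j → IndepFun (e i) (e j) P) {E : Type*} [NormedAddCommGroup E]
    [InnerProductSpace ℝ E] [CompleteSpace E] {Ψ : ℝ → E} (hΨm : StronglyMeasurable Ψ)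
    (hΨ : MemLp Ψ 2 μ) {N o : ℕ → ℕ} (hN : Tendsto N atTop atTop) :
    OpZero P atTop fun n ω =>
      ‖(N n : ℝ)⁻¹ • ∑ j ∈ Finset.range (N n), (Ψ (e (o n + j) ω) - ∫ t, Ψ t ∂μ)‖ := by
  have h1 : OpZero P atTop fun n ω =>
      ‖(N n : ℝ)⁻¹ • ∑ j ∈ Finset.range (N n), (Ψ (e (o n + j) ω) - ∫ t, Ψ t ∂μ)‖ ^ 2 := by
    refine opZero_of_lintegral (V := fun n => (N n : ℝ)⁻¹ * ∫ t, ‖Ψ t‖ ^ 2 ∂μ) (fun n => ?_) ?_ ?_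
    · exact (((Finset.stronglyMeasurable_fun_sum _ fun j _ => (hΨm.comp_measurable (he _)).sub
        stronglyMeasurable_const).const_smul _).norm.measurable).pow_const 2
    · filter_upwards [hN.eventually_gt_atTop 0] with n hn
      have hn' : (0 : ℝ) < N n := by exact_mod_cast hn
      have h2 := integral_norm_sq_sum_sub_mean_le (fun j => he (o n + j)) (fun j => hlaw _)
        (fun i j hij => hind _ _ (by omega)) (Finset.range (N n)) (Ψ := fun _ => Ψ)
        fun _ _ => hΨ
      simp only [Finset.sum_const, Finset.card_range, nsmul_eq_mul] at h2
      simp only [norm_smul, mul_pow]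
      refine lintegral_ofReal_abs_le (h2.1.const_mul _) (fun ω => by positivity) ?_
      rw [integral_const_mul]
      calc _ ≤ ‖(N n : ℝ)⁻¹‖ ^ 2 * (N n * ∫ t, ‖Ψ t‖ ^ 2 ∂μ) := by gcongr; exact h2.2
        _ = _ := by
          rw [Real.norm_of_nonneg (by positivity)]
          field_simp
    · have h3 : Tendsto (fun n => (N n : ℝ)⁻¹) atTop (𝓝 0) :=
        tendsto_inv_atTop_zero.comp (tendsto_natCast_atTop_atTop.comp hN)
      simpa using h3.mul_const (∫ t, ‖Ψ t‖ ^ 2 ∂μ)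
  refine h1.sqrt.mono (Eventually.of_forall fun n ω => ?_)
  rw [Real.sqrt_sq (norm_nonneg _)]

end IID

theorem hasDerivAt_responseDensity {f f' φ g r : ℝ → ℝ} {M : ℝ} (hf : IsSmoothDensity f f' φ M)
    (hg : Integrable g) (hr : Continuous r) (y : ℝ) :
    HasDerivAt (responseDensity f g r) (∫ x, f' (y - r x) * g x) y := by
  have hfc := hf.continuous
  have hfc' := hf.continuous_deriv
  have hsm : ∀ (u : ℝ → ℝ) (z : ℝ), Continuous u →
      AEStronglyMeasurable (fun x => u (z - r x) * g x) := fun u z hu =>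
    (hu.comp (continuous_const.sub hr)).aestronglyMeasurable.mul hg.aestronglyMeasurable
  refine (hasDerivAt_integral_of_dominated_loc_of_deriv_le (F := fun y x => f (y - r x) * g x)
    (F' := fun y x => f' (y - r x) * g x) (bound := fun x => M * |g x|) (s := univ) univ_mem
    (Eventually.of_forall fun z => hsm f z hfc) ?_ (hsm f' y hfc') ?_ (hg.abs.const_mul M)
    ?_).2
  · refine (hg.abs.const_mul M).mono' (hsm f y hfc) (Eventually.of_forall fun x => ?_)
    rw [norm_mul, Real.norm_of_nonneg (hf.nonneg _)]
    exact mul_le_mul_of_nonneg_right (hf.le_bound _) (abs_nonneg _)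
  · refine Eventually.of_forall fun x z _ => ?_
    rw [norm_mul]
    exact mul_le_mul_of_nonneg_right (hf.abs_deriv_le _) (abs_nonneg _)
  · exact Eventually.of_forall fun x z _ => ((hf.hasDerivAt _).comp_sub_const z (r x)).mul_const _

section

variable {f f' φ r : ℝ → ℝ} {M : ℝ} {μ : Measure ℝ} [IsProbabilityMeasure μ]

theorem memLp_stepL2_comp (hr : Continuous r) {R : ℝ} (hrR : ∀ x, |r x| ≤ R) :
    MemLp (fun x => stepL2 (r x)) 2 μ := by
  refine MemLp.of_bound (continuous_stepL2.comp hr).stronglyMeasurable.aestronglyMeasurable (√R)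
    (Eventually.of_forall fun x => ?_)
  rw [← Real.sqrt_sq (norm_nonneg (stepL2 (r x))), norm_stepL2_sq]
  exact Real.sqrt_le_sqrt (hrR x)

theorem integral_deriv_comp_sub (hf : IsSmoothDensity f f' φ M) (hr : Continuous r) {R : ℝ}
    (hrR : ∀ x, |r x| ≤ R) (y : ℝ) :
    ∫ x, f' (y - r x) ∂μ = inner ℝ ((memLp_comp_sub_left hf.memLp_snd y).toLp)
      (∫ x, stepL2 (r x) ∂μ) + f' y := by
  have hi : Integrable (fun x => stepL2 (r x)) μ :=
    (memLp_stepL2_comp hr hrR).integrable one_le_two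
  rw [← integral_inner hi]
  simp_rw [inner_reflect_stepL2 hf.memLp_snd hf.integrable_snd hf.deriv_eq_integral]
  have h1 : Integrable (fun x => f' (y - r x)) μ :=
    Integrable.of_bound (hf.continuous_deriv.comp (continuous_const.sub hr)).aestronglyMeasurable M
      (Eventually.of_forall fun x => hf.abs_deriv_le _)
  rw [integral_sub h1 (integrable_const _)]
  simp

/-- The mean of translates of `f'` over the design points is close to the corresponding
expectation, uniformly in the point of evaluation. -/
theorem abs_mean_deriv_sub_le (hf : IsSmoothDensity f f' φ M) (hr : Continuous r) {R : ℝ}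
    (hrR : ∀ x, |r x| ≤ R) {N : ℕ} (hN : 0 < N) (x : ℕ → ℝ) (y : ℝ) :
    |(N : ℝ)⁻¹ * ∑ j ∈ Finset.range N, f' (y - r (x j)) - ∫ t, f' (y - r t) ∂μ| ≤
      ‖hf.memLp_snd.toLp‖ *
        ‖(N : ℝ)⁻¹ • ∑ j ∈ Finset.range N, (stepL2 (r (x j)) - ∫ t, stepL2 (r t) ∂μ)‖ := by
  have hN' : (N : ℝ) ≠ 0 := by exact_mod_cast hN.ne'
  have h1 : (N : ℝ)⁻¹ * ∑ j ∈ Finset.range N, f' (y - r (x j)) - ∫ t, f' (y - r t) ∂μ =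
      inner ℝ ((memLp_comp_sub_left hf.memLp_snd y).toLp)
        ((N : ℝ)⁻¹ • ∑ j ∈ Finset.range N, (stepL2 (r (x j)) - ∫ t, stepL2 (r t) ∂μ)) := by
    rw [integral_deriv_comp_sub hf hr hrR, real_inner_smul_right, inner_sum]
    simp_rw [inner_sub_right,
      inner_reflect_stepL2 hf.memLp_snd hf.integrable_snd hf.deriv_eq_integral]
    simp only [Finset.sum_sub_distrib, Finset.sum_const, Finset.card_range, nsmul_eq_mul]
    field_simp
    ring
  rw [h1, ← norm_toLp_reflect hf.memLp_snd y]
  exact abs_real_inner_le_norm _ _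

end

/-! ### The estimator of the statement as a split-design estimator -/

theorem hasDerivAt_of_eq_integral_Iic {F g : ℝ → ℝ} (hg : Integrable g) (hgc : Continuous g)
    (hF : ∀ z, F z = ∫ x in Iic z, g x) (z : ℝ) : HasDerivAt F (g z) z := by
  have h1 : F = fun z => F 0 + ∫ x in (0 : ℝ)..z, g x := by
    funext z
    rw [hF z, hF 0, ← intervalIntegral.integral_Iic_sub_Iic hg.integrableOn hg.integrableOn]
    ring
  rw [h1]
  exact (intervalIntegral.integral_hasDerivAt_right (hgc.intervalIntegrable _ _)
    hgc.stronglyMeasurable.stronglyMeasurableAtFilter hgc.continuousAt).const_add _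

theorem continuous_of_eq_integral_Iic {F g : ℝ → ℝ} (hg : Integrable g)
    (hF : ∀ z, F z = ∫ x in Iic z, g x) : Continuous F := by
  have h1 : F = fun z => F 0 + ∫ x in (0 : ℝ)..z, g x := by
    funext z
    rw [hF z, hF 0, ← intervalIntegral.integral_Iic_sub_Iic hg.integrableOn hg.integrableOn]
    ring
  rw [h1]
  exact continuous_const.add
    (intervalIntegral.continuous_primitive (fun a b => hg.intervalIntegrable) 0)

namespace ErrorAssumption

variable {f f' f'' : ℝ → ℝ}

theorem exists_isSmoothDensity (hF : ErrorAssumption f f' f'') :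
    ∃ φ M, IsSmoothDensity f f' φ M := by
  obtain ⟨B, hB⟩ := hF.bounded_fst
  obtain ⟨B', hB'⟩ := hF.bounded_snd
  have hm := hF.integrable_snd.aestronglyMeasurable
  have hae := hm.ae_eq_mk
  have hc := continuous_of_eq_integral_Iic hF.integrable_snd hF.primitive_snd
  have h2 : MemLp f'' 2 := by
    rw [memLp_two_iff_integrable_sq hm]
    refine (hF.integrable_snd.abs.const_mul B').mono' (hm.pow 2)
      (Eventually.of_forall fun z => ?_)
    rw [Real.norm_of_nonneg (sq_nonneg _), ← sq_abs, sq]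
    exact mul_le_mul_of_nonneg_right (hB' z) (abs_nonneg _)
  refine ⟨hm.mk f'', max (∫ x, |f' x|) B, hF.density.nonneg, hF.density.integral_eq_one,
    hasDerivAt_of_eq_integral_Iic hF.integrable_fst hc hF.primitive_fst, hc, hF.integrable_fst,
    fun z => ?_, fun z => (hB z).trans (le_max_right _ _),
    hm.stronglyMeasurable_mk.measurable, hF.integrable_snd.congr hae, h2.ae_eq hae,
    hF.primitive_fst, fun z => ?_⟩
  · refine le_trans ?_ (le_max_left _ _)
    rw [hF.primitive_fst z]
    exact (integral_mono hF.integrable_fst.integrableOn hF.integrable_fst.abs.integrableOn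
      fun x => le_abs_self _).trans (setIntegral_le_integral hF.integrable_fst.abs
        (Eventually.of_forall fun x => abs_nonneg _))
  · rw [hF.primitive_snd z]
    exact integral_congr_ae (ae_restrict_of_ae hae)

theorem memLp_id (hF : ErrorAssumption f f' f'') :
    MemLp (fun t : ℝ => t) 2 (densityMeasure f) := by
  obtain ⟨φ, M, hf⟩ := hF.exists_isSmoothDensity
  obtain ⟨p, hp, hint⟩ := hF.moment
  rw [memLp_two_iff_integrable_sq (by fun_prop),
    integrable_densityMeasure_iff hf.continuous.measurable hf.nonneg]
  refine (hf.integrable.add hint).mono'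
    (hf.continuous.mul (continuous_id.pow 2)).aestronglyMeasurable
    (Eventually.of_forall fun z => ?_)
  have h1 : z ^ 2 ≤ 1 + |z| ^ p := by
    rcases le_total |z| 1 with h | h
    · have := Real.rpow_nonneg (abs_nonneg z) p
      have : |z| ^ 2 ≤ 1 := pow_le_one₀ (abs_nonneg z) h
      rw [← sq_abs]
      linarith
    · have := Real.rpow_le_rpow_of_exponent_le h (by linarith : (2 : ℝ) ≤ p)
      rw [Real.rpow_two, sq_abs] at this
      linarith
  rw [norm_mul, Real.norm_of_nonneg (hf.nonneg z), Real.norm_of_nonneg (sq_nonneg z)]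
  calc f z * z ^ 2 ≤ f z * (1 + |z| ^ p) := mul_le_mul_of_nonneg_left h1 (hf.nonneg z)
    _ = _ := by simp only [Pi.add_apply]; ring

theorem integral_id_eq_zero (hF : ErrorAssumption f f' f'') :
    ∫ t, t ∂(densityMeasure f) = 0 := by
  obtain ⟨φ, M, hf⟩ := hF.exists_isSmoothDensity
  rw [integral_densityMeasure hf.continuous.measurable.aemeasurable hf.nonneg, ← hF.mean_zero]
  exact integral_congr_ae (Eventually.of_forall fun z => mul_comm _ _)

end ErrorAssumption

theorem IsScoreKernel.exists_isKernelTriple {κ : ℝ → ℝ} (hκ : IsScoreKernel κ) :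
    ∃ B, IsKernelTriple κ (deriv κ) (deriv (deriv κ)) B B := by
  obtain ⟨B, hB⟩ := hκ.dominated
  have h1 : ContDiff ℝ 1 (deriv κ) := hκ.contDiff.deriv' (n := 1)
  exact ⟨B, hκ.density.nonneg, hκ.density.integral_eq_one,
    fun u => (hκ.contDiff.differentiable (by norm_num) u).hasDerivAt,
    fun u => (h1.differentiable (by norm_num) u).hasDerivAt, h1.continuous_deriv le_rfl,
    fun u => (hB u).1, fun u => (hB u).2⟩

theorem localLoss_Ico (w : ℝ → ℝ) (c : ℝ) (m n : ℕ) (x y : ℕ → ℝ) (t : ℝ) (β : Fin 3 → ℝ) :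
    localLoss w c (Finset.Ico m n) x y t β =
      localLoss w c (Finset.range (n - m)) (fun j => x (m + j)) (fun j => y (m + j)) t β := by
  simp only [localLoss, Nat.card_Ico, Finset.card_range, Finset.sum_Ico_eq_sum_range]

theorem IsLocalQuadraticSmoother.of_Ico {w : ℝ → ℝ} {c : ℝ} {m n : ℕ} {x y : ℕ → ℝ} {ρ : ℝ → ℝ}
    (h : IsLocalQuadraticSmoother w c (Finset.Ico m n) x y ρ) :
    IsLocalQuadraticSmoother w c (Finset.range (n - m)) (fun j => x (m + j))
      (fun j => y (m + j)) ρ := by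
  intro t ht
  obtain ⟨β, h1, h2⟩ := h t ht
  exact ⟨β, fun β' => by simpa only [localLoss_Ico] using h1 β', h2⟩

/-- The value of the local quadratic smoother at a point is the value of the regression function
plus an affine form in the errors. -/
theorem IsLocalQuadraticSmoother.eq_add_eval {w r : ℝ → ℝ} {c : ℝ} {N : ℕ} {x y e z : ℕ → ℝ}
    {ρ : ℝ → ℝ} (h : IsLocalQuadraticSmoother w c (Finset.range N) x y ρ) (hc : 0 < c) (hN : 0 < N)
    (hy : ∀ i < N, y i = r (x i) + e i) {κ₀ : ℝ} (hκ : 0 < κ₀) {j : ℕ}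
    (hz : z j ∈ Icc (0 : ℝ) 1) (hG : GramBound w c N x (z j) κ₀) :
    ρ (z j) = r (z j) + (smootherForm w c r N x z).eval N e j := by
  obtain ⟨β, h1, h2⟩ := h (z j) hz
  rw [h2, hG.minimizer_eq hκ hc hN h1]
  simp only [ShiftForm.eval, affineShift, smootherForm]
  rw [← add_assoc, add_sub_cancel, ← Finset.sum_add_distrib]
  refine Finset.sum_congr rfl fun i hi => ?_
  rw [hy i (Finset.mem_range.1 hi)]
  ring

/-- The residuals and fitted values in the sample-split estimator are those of a split design with
errors `ω`. -/
structure SplitInput.Matches (S : SplitInput) (D : SplitDesign) (ω : (ℕ → ℝ) × (ℕ → ℝ)) :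
    Prop where
  m_eq : D.m = S.n / 2
  k_eq : D.k = S.n - S.n / 2
  res₁ : ∀ j < D.m, S.res₁ j = D.res ω j
  res₂ : ∀ j < D.m, S.res₂ j = D.crossRes ω j
  fit₂ : ∀ j < D.m, S.r₂ (S.x j) = D.crossFit ω j
  swap_res₂ : ∀ j < D.k, S.res₂ (D.m + j) = D.swap.res ω.swap j
  swap_res₁ : ∀ j < D.k, S.res₁ (D.m + j) = D.swap.crossRes ω.swap j
  swap_fit₁ : ∀ j < D.k, S.r₁ (S.x (D.m + j)) = D.swap.crossFit ω.swap j

namespace SplitInput.Matches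

variable {S : SplitInput} {D : SplitDesign} {ω : (ℕ → ℝ) × (ℕ → ℝ)} {κ' κ'' : ℝ → ℝ} {B₁ B₂ : ℝ}

theorem sum_I₁ (h : S.Matches D ω) (F G : ℕ → ℝ) (hFG : ∀ j < D.m, F j = G j) :
    ∑ j ∈ S.I₁, F j = ∑ j ∈ Finset.range D.m, G j := by
  rw [SplitInput.I₁, SplitInput.m, ← h.m_eq]
  exact Finset.sum_congr rfl fun j hj => hFG j (Finset.mem_range.1 hj)

theorem sum_I₂ (h : S.Matches D ω) (F G : ℕ → ℝ) (hFG : ∀ j < D.k, F (D.m + j) = G j) :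
    ∑ j ∈ S.I₂, F j = ∑ j ∈ Finset.range D.k, G j := by
  rw [SplitInput.I₂, SplitInput.m, Finset.sum_Ico_eq_sum_range, ← h.k_eq, ← h.m_eq]
  exact Finset.sum_congr rfl fun j hj => hFG j (Finset.mem_range.1 hj)

theorem cast_m (h : S.Matches D ω) : (S.m : ℝ) = D.m := by rw [h.m_eq]; rfl

theorem cast_n (h : S.Matches D ω) : (S.n : ℝ) = D.m + D.k := by
  rw [h.m_eq, h.k_eq]
  exact_mod_cast (by omega)

theorem cast_n_sub_m (h : S.Matches D ω) : (S.n : ℝ) - S.m = D.k := by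
  rw [h.cast_n, h.cast_m]
  ring

theorem scaledKernel_eq (S : SplitInput) : S.scaledKernel = kernelScale S.κ 0 S.a := by
  funext u
  simp [SplitInput.scaledKernel, kernelScale]

theorem f₁_eq (h : S.Matches D ω) :
    S.f₁ = kernelMean (kernelScale S.κ 0 S.a) D.m (D.res ω) := by
  funext z
  rw [SplitInput.f₁, kernelMean, h.cast_m, scaledKernel_eq, one_div]
  congr 1
  exact h.sum_I₁ _ _ fun j hj => by rw [h.res₁ j hj]

theorem f₂_eq (h : S.Matches D ω) :
    S.f₂ = kernelMean (kernelScale S.κ 0 S.a) D.k (D.swap.res ω.swap) := by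
  funext z
  rw [SplitInput.f₂, kernelMean, h.cast_n_sub_m, scaledKernel_eq, one_div]
  congr 1
  exact h.sum_I₂ _ _ fun j hj => by rw [h.swap_res₂ j hj]

theorem f₃_eq (h : S.Matches D ω) : S.f₃ = D.pooled ω (kernelScale S.κ 0 S.a) := by
  funext z
  rw [SplitInput.f₃, SplitDesign.pooled, h.cast_n, scaledKernel_eq, one_div, ← mul_add]
  congr 2
  · exact h.sum_I₁ _ _ fun j hj => by rw [h.res₂ j hj]
  · exact h.sum_I₂ _ _ fun j hj => by rw [h.swap_res₁ j hj]

theorem deriv_f₃_eq (h : S.Matches D ω) (hκ : IsKernelTriple S.κ κ' κ'' B₁ B₂) (ha : 0 < S.a)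
    (z : ℝ) : deriv S.f₃ z = D.pooled ω (kernelScale κ' 1 S.a) z := by
  have h1 := (hκ.scale ha).hasDerivAt_fst
  rw [h.f₃_eq]
  refine HasDerivAt.deriv ?_
  unfold SplitDesign.pooled
  exact HasDerivAt.const_mul _ ((HasDerivAt.fun_sum fun j _ => (h1 _).comp_sub_const z _).add
    (HasDerivAt.fun_sum fun j _ => (h1 _).comp_sub_const z _))

theorem score₂_eq (h : S.Matches D ω) (hκ : IsKernelTriple S.κ κ' κ'' B₁ B₂) (ha : 0 < S.a)
    (z : ℝ) : S.score₂ z = D.otherScore S.κ κ' S.a ω z := by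
  rw [SplitInput.score₂, h.f₂_eq,
    (hasDerivAt_kernelMean (hκ.scale ha).hasDerivAt_fst D.k _ z).deriv]
  rfl

theorem score₁_eq (h : S.Matches D ω) (hκ : IsKernelTriple S.κ κ' κ'' B₁ B₂) (ha : 0 < S.a)
    (z : ℝ) : S.score₁ z = D.swap.otherScore S.κ κ' S.a ω.swap z := by
  rw [SplitInput.score₁, h.f₁_eq,
    (hasDerivAt_kernelMean (hκ.scale ha).hasDerivAt_fst D.m _ z).deriv]
  rfl

theorem J_eq (h : S.Matches D ω) (hκ : IsKernelTriple S.κ κ' κ'' B₁ B₂) (ha : 0 < S.a) :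
    S.J = D.fisher S.κ κ' S.a ω := by
  rw [SplitInput.J, SplitDesign.fisher, h.cast_n, one_div, ← mul_add]
  congr 2
  · exact h.sum_I₁ _ _ fun j hj => by rw [h.res₁ j hj, h.score₂_eq hκ ha]
  · exact h.sum_I₂ _ _ fun j hj => by rw [h.swap_res₂ j hj, h.score₁_eq hκ ha]

theorem C₁_eq (h : S.Matches D ω) (hκ : IsKernelTriple S.κ κ' κ'' B₁ B₂) (ha : 0 < S.a) (y : ℝ) :
    S.C₁ y = D.estimate S.κ κ' S.a ω y := by
  rw [SplitInput.C₁, SplitDesign.estimate, h.cast_n, h.cast_m, one_div, one_div]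
  congr 1
  refine h.sum_I₁ _ _ fun j hj => ?_
  rw [h.sum_I₁ _ (fun i => D.pooled ω (kernelScale κ' 1 S.a) (y - D.crossFit ω i))
    fun i hi => by rw [h.deriv_f₃_eq hκ ha, h.fit₂ i hi], h.deriv_f₃_eq hκ ha, h.fit₂ j hj,
    SplitInput.lam₂, SplitDesign.lamHat, h.score₂_eq hκ ha, h.J_eq hκ ha, h.res₁ j hj]

theorem C₂_eq (h : S.Matches D ω) (hκ : IsKernelTriple S.κ κ' κ'' B₁ B₂) (ha : 0 < S.a) (y : ℝ) :
    S.C₂ y = D.swap.estimate S.κ κ' S.a ω.swap y := by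
  rw [SplitInput.C₂, SplitDesign.estimate, h.cast_n_sub_m, h.cast_n, one_div, one_div,
    add_comm (D.m : ℝ)]
  congr 1
  refine h.sum_I₂ _ _ fun j hj => ?_
  rw [SplitDesign.pooled_swap]
  rw [h.sum_I₂ _ (fun i => D.pooled ω (kernelScale κ' 1 S.a) (y - D.swap.crossFit ω.swap i))
    fun i hi => by rw [h.deriv_f₃_eq hκ ha, h.swap_fit₁ i hi], h.deriv_f₃_eq hκ ha,
    h.swap_fit₁ j hj, SplitInput.lam₁, SplitDesign.lamHat, h.score₁_eq hκ ha, h.J_eq hκ ha,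
    h.swap_res₂ j hj, SplitDesign.fisher_swap]
  rfl

end SplitInput.Matches

/-- For locally rich covariates, any minimizers in the definition of the smoothers give residuals
and fits that are affine in the errors. -/
theorem SplitInput.matches_regressionDesign {S : SplitInput} {w r : ℝ → ℝ} {c κ₀ : ℝ}
    {ω : (ℕ → ℝ) × (ℕ → ℝ)} (hn : 2 ≤ S.n) (hc : 0 < c) (hκ₀ : 0 < κ₀)
    (hr₁ : IsLocalQuadraticSmoother w c (Finset.range (S.n / 2)) S.x S.y S.r₁)
    (hr₂ : IsLocalQuadraticSmoother w c (Finset.Ico (S.n / 2) S.n) S.x S.y S.r₂)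
    (hy₁ : ∀ j < S.n / 2, S.y j = r (S.x j) + ω.1 j)
    (hy₂ : ∀ j < S.n - S.n / 2, S.y (S.n / 2 + j) = r (S.x (S.n / 2 + j)) + ω.2 j)
    (hx₁ : ∀ j < S.n / 2, S.x j ∈ Icc (0 : ℝ) 1)
    (hx₂ : ∀ j < S.n - S.n / 2, S.x (S.n / 2 + j) ∈ Icc (0 : ℝ) 1)
    (hG₁ : ∀ t ∈ Icc (0 : ℝ) 1, GramBound w c (S.n / 2) S.x t κ₀)
    (hG₂ : ∀ t ∈ Icc (0 : ℝ) 1,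
      GramBound w c (S.n - S.n / 2) (fun j => S.x (S.n / 2 + j)) t κ₀) :
    S.Matches (regressionDesign w c r S.n S.x) ω := by
  have hm : 0 < S.n / 2 := by omega
  have hk : 0 < S.n - S.n / 2 := by omega
  set D := regressionDesign w c r S.n S.x with hD
  have h11 : ∀ j < D.m, S.r₁ (S.x j) = r (S.x j) + D.own₁.eval D.m ω.1 j := fun j hj =>
    hr₁.eq_add_eval (z := S.x) hc hm hy₁ hκ₀ (hx₁ j hj) (hG₁ _ (hx₁ j hj))
  have h21 : ∀ j < D.m, S.r₂ (S.x j) = r (S.x j) + D.cross₁.eval D.k ω.2 j := fun j hj =>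
    hr₂.of_Ico.eq_add_eval (z := S.x) hc hk hy₂ hκ₀ (hx₁ j hj) (hG₂ _ (hx₁ j hj))
  have h12 : ∀ j < D.k, S.r₁ (S.x (S.n / 2 + j)) =
      r (S.x (S.n / 2 + j)) + D.cross₂.eval D.m ω.1 j := fun j hj =>
    hr₁.eq_add_eval (z := fun j => S.x (S.n / 2 + j)) hc hm hy₁ hκ₀ (hx₂ j hj) (hG₁ _ (hx₂ j hj))
  have h22 : ∀ j < D.k, S.r₂ (S.x (S.n / 2 + j)) =
      r (S.x (S.n / 2 + j)) + D.own₂.eval D.k ω.2 j := fun j hj =>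
    hr₂.of_Ico.eq_add_eval (z := fun j => S.x (S.n / 2 + j)) hc hk hy₂ hκ₀ (hx₂ j hj)
      (hG₂ _ (hx₂ j hj))
  refine ⟨rfl, rfl, fun j hj => ?_, fun j hj => ?_, fun j hj => ?_, fun j hj => ?_, fun j hj => ?_,
    fun j hj => ?_⟩
  · rw [SplitInput.res₁, h11 j hj, hy₁ j hj]
    exact add_sub_add_left_eq_sub _ _ _
  · rw [SplitInput.res₂, h21 j hj, hy₁ j hj]
    exact add_sub_add_left_eq_sub _ _ _
  · exact h21 j hj
  · change S.res₂ (S.n / 2 + j) = _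
    rw [SplitInput.res₂, h22 j hj, hy₂ j hj]
    exact add_sub_add_left_eq_sub _ _ _
  · change S.res₁ (S.n / 2 + j) = _
    rw [SplitInput.res₁, h12 j hj, hy₂ j hj]
    exact add_sub_add_left_eq_sub _ _ _
  · exact h12 j hj

/-- The contribution of one half of the sample to the effect of centring at the derivative `v` of
the response density, rather than at the mean over that half. -/
noncomputable def centringTerm (f f' r : ℝ → ℝ) (n N : ℕ) (x e : ℕ → ℝ) (v y : ℝ) : ℝ :=
  (n : ℝ)⁻¹ * (∑ j ∈ Finset.range N, lam f f' (e j)) *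
    ((N : ℝ)⁻¹ * ∑ j ∈ Finset.range N, f' (y - r (x j)) - v)

theorem sum_mul_sub_eq (N : ℕ) (l u : ℕ → ℝ) (ν v : ℝ) :
    ν * ∑ j ∈ Finset.range N, l j * (u j - v) =
      ν * ∑ j ∈ Finset.range N, (u j - (N : ℝ)⁻¹ * ∑ i ∈ Finset.range N, u i) * l j +
      ν * (∑ j ∈ Finset.range N, l j) * ((N : ℝ)⁻¹ * ∑ j ∈ Finset.range N, u j - v) := by
  rw [mul_assoc, ← mul_add, Finset.sum_mul, ← Finset.sum_add_distrib]
  congr 1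
  exact Finset.sum_congr rfl fun j _ => by ring

/-- The correction term is the sum of its versions centred in each half and of the effect of the
change of centring. -/
theorem correction_eq {f f' g r w : ℝ → ℝ} {c : ℝ} {n : ℕ} (x e : ℕ → ℝ)
    {ω : (ℕ → ℝ) × (ℕ → ℝ)} (h1 : ∀ j < n / 2, e j = ω.1 j)
    (h2 : ∀ j < n - n / 2, e (n / 2 + j) = ω.2 j) (y : ℝ) :
    correction f f' g r n x e y =
      (regressionDesign w c r n x).target ω f f' y +
      (regressionDesign w c r n x).swap.target ω.swap f f' y +
      (centringTerm f f' r n (n / 2) x ω.1 (deriv (responseDensity f g r) y) y +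
      centringTerm f f' r n (n - n / 2) (fun j => x (n / 2 + j)) ω.2
        (deriv (responseDensity f g r) y) y) := by
  obtain ⟨v, hv⟩ : ∃ v, deriv (responseDensity f g r) y = v := ⟨_, rfl⟩
  have hsum : ((n / 2 : ℕ) : ℝ) + ((n - n / 2 : ℕ) : ℝ) = n := by exact_mod_cast (by omega)
  have hsum' : ((n - n / 2 : ℕ) : ℝ) + ((n / 2 : ℕ) : ℝ) = n := by exact_mod_cast (by omega)
  have t1 : (regressionDesign w c r n x).target ω f f' y = (n : ℝ)⁻¹ *
      ∑ j ∈ Finset.range (n / 2), (f' (y - r (x j)) - ((n / 2 : ℕ) : ℝ)⁻¹ *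
        ∑ i ∈ Finset.range (n / 2), f' (y - r (x i))) * lam f f' (ω.1 j) := by
    rw [← hsum]; rfl
  have t2 : (regressionDesign w c r n x).swap.target ω.swap f f' y = (n : ℝ)⁻¹ *
      ∑ j ∈ Finset.range (n - n / 2), (f' (y - r (x (n / 2 + j))) - ((n - n / 2 : ℕ) : ℝ)⁻¹ *
        ∑ i ∈ Finset.range (n - n / 2), f' (y - r (x (n / 2 + i)))) * lam f f' (ω.2 j) := by
    rw [← hsum']; rfl
  have hsplit : correction f f' g r n x e y =
      (n : ℝ)⁻¹ * ∑ j ∈ Finset.range (n / 2), lam f f' (ω.1 j) * (f' (y - r (x j)) - v) +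
      (n : ℝ)⁻¹ * ∑ j ∈ Finset.range (n - n / 2),
        lam f f' (ω.2 j) * (f' (y - r (x (n / 2 + j))) - v) := by
    rw [correction, hv, one_div, ← mul_add]
    congr 1
    have h3 := Finset.sum_range_add (fun j => lam f f' (e j) * (f' (y - r (x j)) - v)) (n / 2)
      (n - n / 2)
    rw [show n / 2 + (n - n / 2) = n by omega] at h3
    rw [h3]
    congr 1
    · exact Finset.sum_congr rfl fun j hj => by rw [h1 j (Finset.mem_range.1 hj)]
    · exact Finset.sum_congr rfl fun j hj => by rw [h2 j (Finset.mem_range.1 hj)]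
  rw [hsplit, hv, t1, t2, sum_mul_sub_eq (n / 2), sum_mul_sub_eq (n - n / 2), centringTerm,
    centringTerm]
  ring

theorem abs_C_sub_correction_le {S : SplitInput} {f f' g r w κ' κ'' : ℝ → ℝ} {c B₁ B₂ : ℝ}
    {ω : (ℕ → ℝ) × (ℕ → ℝ)} (h : S.Matches (regressionDesign w c r S.n S.x) ω)
    (hκ : IsKernelTriple S.κ κ' κ'' B₁ B₂) (ha : 0 < S.a) {e : ℕ → ℝ}
    (h1 : ∀ j < S.n / 2, e j = ω.1 j) (h2 : ∀ j < S.n - S.n / 2, e (S.n / 2 + j) = ω.2 j) (y : ℝ) :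
    |S.C y - correction f f' g r S.n S.x e y| ≤
      |(regressionDesign w c r S.n S.x).discrepancy S.κ κ' f f' S.a ω y| +
      (|centringTerm f f' r S.n (S.n / 2) S.x ω.1 (deriv (responseDensity f g r) y) y| +
      |centringTerm f f' r S.n (S.n - S.n / 2) (fun j => S.x (S.n / 2 + j)) ω.2
        (deriv (responseDensity f g r) y) y|) := by
  rw [SplitInput.C, h.C₁_eq hκ ha, h.C₂_eq hκ ha, correction_eq (w := w) (c := c) S.x e h1 h2]
  refine le_trans (le_of_eq ?_) ((abs_sub _ _).trans (add_le_add le_rfl (abs_add_le _ _)))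
  congr 1
  unfold SplitDesign.discrepancy
  ring

theorem responseDensity_congr {f g r r' : ℝ → ℝ} (hg : ∀ x, x ∉ Icc (0 : ℝ) 1 → g x = 0)
    (h : EqOn r r' (Icc 0 1)) : responseDensity f g r = responseDensity f g r' := by
  funext y
  refine integral_congr_ae (Eventually.of_forall fun x => ?_)
  by_cases hx : x ∈ Icc (0 : ℝ) 1
  · simp only [h hx]
  · simp only [hg x hx, mul_zero]

theorem correction_congr {f f' g r r' : ℝ → ℝ} (hg : ∀ x, x ∉ Icc (0 : ℝ) 1 → g x = 0)
    (h : EqOn r r' (Icc 0 1)) {n : ℕ} {x : ℕ → ℝ} (hx : ∀ j < n, x j ∈ Icc (0 : ℝ) 1)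
    (e : ℕ → ℝ) (y : ℝ) : correction f f' g r n x e y = correction f f' g r' n x e y := by
  rw [correction, correction, responseDensity_congr hg h]
  congr 1
  exact Finset.sum_congr rfl fun j hj => by rw [h (hx j (Finset.mem_range.1 hj))]

/-- The regression function can be replaced by a bounded continuous function on the line. -/
theorem RegressionAssumption.exists_extension {r : ℝ → ℝ} (hR : RegressionAssumption r) :
    ∃ r' : ℝ → ℝ, Continuous r' ∧ (∃ R, ∀ x, |r' x| ≤ R) ∧ EqOn r r' (Icc 0 1) ∧
      RegressionAssumption r' := by
  have hc := hR.contDiffOn.continuousOn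
  have hrc : Continuous ((Icc (0 : ℝ) 1).domRestrict r) :=
      continuousOn_iff_continuous_domRestrict.1 hc
  have heq : EqOn r (IccExtend zero_le_one ((Icc (0 : ℝ) 1).domRestrict r)) (Icc 0 1) := fun x hx =>
    (IccExtend_of_mem zero_le_one ((Icc (0 : ℝ) 1).domRestrict r) hx).symm
  obtain ⟨R, hRR⟩ := isCompact_Icc.exists_bound_of_continuousOn hc
  refine ⟨IccExtend zero_le_one ((Icc (0 : ℝ) 1).domRestrict r), hrc.Icc_extend', ⟨R, fun x => ?_⟩,
    heq, hR.contDiffOn.congr fun x hx => (heq hx).symm, fun x hx => ?_⟩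
  · exact hRR _ (projIcc 0 1 zero_le_one x).2
  · rw [← derivWithin_congr heq (heq hx)]
    exact hR.deriv_pos x hx

/-! ### Rates and the passage to the sample -/

theorem tendsto_zero_of_forall_le_ofReal {u : ℕ → ℝ≥0∞}
    (h : ∀ η : ℝ, 0 < η → ∀ᶠ n in atTop, u n ≤ ENNReal.ofReal η) : Tendsto u atTop (𝓝 0) := by
  rw [ENNReal.tendsto_nhds_zero]
  intro ε hε
  by_cases htop : ε = ∞
  · exact Eventually.of_forall fun n => htop ▸ le_top
  · filter_upwards [h ε.toReal (ENNReal.toReal_pos hε.ne' htop)] with n hn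
    rwa [ENNReal.ofReal_toReal htop] at hn

/-- The unit of the asymptotics: the bandwidth of the smoother is of the order of its square. -/
noncomputable def baseRate (n : ℕ) : ℝ := (n : ℝ) ^ (-(1 / 8) : ℝ)

section Rate

variable {n : ℕ}

theorem baseRate_pos (hn : 1 ≤ n) : 0 < baseRate n :=
  Real.rpow_pos_of_pos (by exact_mod_cast hn) _

theorem baseRate_le_one (hn : 1 ≤ n) : baseRate n ≤ 1 :=
  Real.rpow_le_one_of_one_le_of_nonpos (by exact_mod_cast hn) (by norm_num)

theorem baseRate_pow (n q : ℕ) : baseRate n ^ q = (n : ℝ) ^ (-(q / 8) : ℝ) := by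
  rw [baseRate, ← Real.rpow_natCast, ← Real.rpow_mul (Nat.cast_nonneg n)]
  congr 1
  ring

theorem baseRate_pow_eight_mul (hn : 1 ≤ n) : baseRate n ^ 8 * n = 1 := by
  have hn' : (0 : ℝ) < n := by exact_mod_cast hn
  rw [baseRate_pow, show (-(((8 : ℕ) : ℝ) / 8) : ℝ) = -1 by norm_num, Real.rpow_neg_one,
    inv_mul_cancel₀ hn'.ne']

theorem baseRate_sq (n : ℕ) : baseRate n ^ 2 = (n : ℝ) ^ (-(1 / 4) : ℝ) := by
  rw [baseRate_pow]
  norm_num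

theorem sqrt_mul_baseRate_pow_four (hn : 1 ≤ n) : √n * baseRate n ^ 4 = 1 := by
  have hn' : (0 : ℝ) < n := by exact_mod_cast hn
  rw [Real.sqrt_eq_rpow, baseRate_pow, ← Real.rpow_add hn']
  norm_num

theorem tendsto_baseRate : Tendsto baseRate atTop (𝓝 0) :=
  (tendsto_rpow_neg_atTop (by norm_num : (0 : ℝ) < 1 / 8)).comp tendsto_natCast_atTop_atTop

theorem tendsto_baseRate_div {a : ℕ → ℝ} (ha : ∀ n, 0 < a n)
    (h : Tendsto (fun n : ℕ => a n ^ 8 * (n : ℝ)) atTop atTop) :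
    Tendsto (fun n => baseRate n / a n) atTop (𝓝 0) := by
  have h1 : Tendsto (fun n : ℕ => ((a n ^ 8 * (n : ℝ))⁻¹) ^ ((8 : ℕ) : ℝ)⁻¹) atTop (𝓝 0) := by
    have := (tendsto_inv_atTop_zero.comp h).rpow_const (p := ((8 : ℕ) : ℝ)⁻¹)
      (Or.inr (by norm_num))
    rwa [Real.zero_rpow (by norm_num)] at this
  refine h1.congr' ?_
  filter_upwards [eventually_ge_atTop 1] with n hn
  have hp : 0 ≤ baseRate n / a n := (div_pos (baseRate_pos hn) (ha n)).le
  have hn' : (0 : ℝ) < n := by exact_mod_cast hn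
  have h2 : (a n ^ 8 * (n : ℝ))⁻¹ = (baseRate n / a n) ^ 8 := by
    rw [div_pow, ← inv_eq_of_mul_eq_one_left (baseRate_pow_eight_mul hn), mul_inv, div_eq_mul_inv,
      mul_comm]
  rw [h2, Real.pow_rpow_inv_natCast hp (by norm_num)]

end Rate

/-- The indices of the errors of the first half of a sample of size `n`, continued to an infinite
sequence. -/
def firstIndex (n j : ℕ) : ℕ := if j < n / 2 then j else n + 2 * j

/-- The indices of the errors of the second half of a sample of size `n`, continued to an infinite
sequence that is disjoint from the one for the first half. -/
def secondIndex (n j : ℕ) : ℕ := if j < n - n / 2 then n / 2 + j else n + 2 * j + 1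

theorem firstIndex_injective (n : ℕ) : Function.Injective (firstIndex n) := by
  intro i j h
  unfold firstIndex at h
  split_ifs at h <;> omega

theorem secondIndex_injective (n : ℕ) : Function.Injective (secondIndex n) := by
  intro i j h
  unfold secondIndex at h
  split_ifs at h <;> omega

theorem firstIndex_ne_secondIndex (n i j : ℕ) : firstIndex n i ≠ secondIndex n j := by
  intro h
  unfold firstIndex secondIndex at h
  split_ifs at h <;> omega

/-- The centring term is of smaller order than `n^(-1/2)`, uniformly in `y`: the bound is
free of `y`. -/
theorem abs_centringTerm_le {f f' φ g r : ℝ → ℝ} {M R : ℝ} (hf : IsSmoothDensity f f' φ M)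
    (hG : CovariateAssumption g) [IsProbabilityMeasure (densityMeasure g)] (hr : Continuous r)
    (hrR : ∀ x, |r x| ≤ R) {n N : ℕ} (hn : 1 ≤ n) (hN : 0 < N) (x e : ℕ → ℝ) (y : ℝ) :
    |centringTerm f f' r n N x e (deriv (responseDensity f g r) y) y| ≤
      baseRate n ^ 4 * |‖hf.memLp_snd.toLp‖ * (‖(N : ℝ)⁻¹ • ∑ j ∈ Finset.range N,
        (stepL2 (r (x j)) - ∫ t, stepL2 (r t) ∂(densityMeasure g))‖ *
        (√n * ((n : ℝ)⁻¹ * ∑ j ∈ Finset.range N, lam f f' (e j))))| := by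
  have hd : deriv (responseDensity f g r) y = ∫ t, f' (y - r t) ∂(densityMeasure g) := by
    rw [(hasDerivAt_responseDensity hf hG.integrable hr y).deriv,
      integral_densityMeasure hG.aemeasurable hG.density.nonneg]
    exact integral_congr_ae (Eventually.of_forall fun t => mul_comm _ _)
  have h1 := abs_mean_deriv_sub_le (μ := densityMeasure g) hf hr hrR hN x y
  have h2 := sqrt_mul_baseRate_pow_four hn
  rw [centringTerm, hd, abs_mul]
  refine (mul_le_mul_of_nonneg_left h1 (abs_nonneg _)).trans (le_of_eq ?_)
  have key : ∀ A V S : ℝ, 0 ≤ A → 0 ≤ V → |(n : ℝ)⁻¹ * S| * (A * V) =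
      baseRate n ^ 4 * |A * (V * (√n * ((n : ℝ)⁻¹ * S)))| := by
    intro A V S hA hV
    rw [abs_mul A, abs_mul V, abs_mul (√n), abs_of_nonneg hA, abs_of_nonneg hV,
      abs_of_nonneg (Real.sqrt_nonneg _)]
    linear_combination (-(|(n : ℝ)⁻¹ * S| * (A * V))) * h2
  exact key _ _ _ (norm_nonneg _) (norm_nonneg _)

theorem theorem3 {Ω : Type*} [MeasurableSpace Ω] (P : Measure Ω) [IsProbabilityMeasure P]
    (f f' f'' g r w κ : ℝ → ℝ) (X ε Y : ℕ → Ω → ℝ)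
    (hF : ErrorAssumption f f' f'') (hG : CovariateAssumption g) (hR : RegressionAssumption r)
    (hJ : HasFiniteFisherInfo f f')
    (hS : IsRegressionSample P f g r X ε Y)
    (hw : IsSmootherWeight w) (hκ : IsScoreKernel κ)
    (c : ℕ → ℝ) (hc : ∃ γ : ℝ, 0 < γ ∧ ∀ n : ℕ, 1 ≤ n → c n = γ * (n : ℝ) ^ (-(1 / 4) : ℝ))
    (a : ℕ → ℝ) (ha_pos : ∀ n, 0 < a n) (ha_zero : Tendsto a atTop (𝓝 0))
    (ha_rate : Tendsto (fun n : ℕ => a n ^ 8 * (n : ℝ)) atTop atTop)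
    (r₁ r₂ : ℕ → Ω → ℝ → ℝ)
    (hr₁ : ∀ n ω, IsLocalQuadraticSmoother w (c n) (Finset.range (n / 2))
      (fun j => X j ω) (fun j => Y j ω) (r₁ n ω))
    (hr₂ : ∀ n ω, IsLocalQuadraticSmoother w (c n) (Finset.Ico (n / 2) n)
      (fun j => X j ω) (fun j => Y j ω) (r₂ n ω)) :
    IsLittleOpRootN P (fun n ω => supNorm (fun y =>
      SplitInput.C ⟨κ, a n, n, fun j => X j ω, fun j => Y j ω, r₁ n ω, r₂ n ω⟩ y -
        correction f f' g r n (fun j => X j ω) (fun j => ε j ω) y)) := by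
  obtain ⟨γ, hγ, hcγ⟩ := hc
  obtain ⟨φ, M, hf⟩ := hF.exists_isSmoothDensity
  obtain ⟨B₁, hK⟩ := hκ.exists_isKernelTriple
  obtain ⟨b, B, hb, hB, hμ⟩ := hG.isQuasiUniform
  obtain ⟨α, d, w₀, hα, hd, hα1, hw₀, hle⟩ := hw.exists_le
  obtain ⟨ρ, hρc, ⟨R, hρR⟩, hrρ, hRρ⟩ := hR.exists_extension
  have := hG.isProbabilityMeasure
  have : IsProbabilityMeasure (densityMeasure f) :=
    isProbabilityMeasure_densityMeasure hf.nonneg hf.integral_eq_one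
  have hXind : ∀ i j, i ≠ j → IndepFun (X i) (X j) P := fun i j hij =>
    (hS.indep.comp (fun _ p => p.1) fun _ => measurable_fst).indepFun hij
  have hεind : ∀ i j, i ≠ j → IndepFun (ε i) (ε j) P := fun i j hij =>
    (hS.indep.comp (fun _ p => p.2) fun _ => measurable_snd).indepFun hij
  have hΨ : MemLp (fun x => stepL2 (ρ x)) 2 (densityMeasure g) := memLp_stepL2_comp hρc hρR
  have hΨm : StronglyMeasurable fun x => stepL2 (ρ x) :=
    (continuous_stepL2.comp hρc).stronglyMeasurable
  have hhalf : Tendsto (fun n : ℕ => n / 2) atTop atTop := Nat.tendsto_div_const_atTop two_ne_zero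
  have hhalf' : Tendsto (fun n : ℕ => n - n / 2) atTop atTop :=
    tendsto_atTop_mono (fun n => by omega) hhalf
  -- the effect of centring at the derivative of the response density
  have hrem : ∀ N o : ℕ → ℕ, Tendsto N atTop atTop → (∀ n, N n ≤ n) →
      OpZero P atTop fun (n : ℕ) ω => ‖hf.memLp_snd.toLp‖ * (‖(N n : ℝ)⁻¹ •
        ∑ j ∈ Finset.range (N n), (stepL2 (ρ (X (o n + j) ω)) -
          ∫ t, stepL2 (ρ t) ∂(densityMeasure g))‖ *
        (√n * ((n : ℝ)⁻¹ * ∑ j ∈ Finset.range (N n), lam f f' (ε (o n + j) ω)))) :=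
    fun N o hN hNn => OpZero.const_mul (OpZero.mul_opOne
      (opZero_norm_mean_sub hS.measurable_covariate hS.covariate_law hXind hΨm hΨ hN)
      (opOne_sqrt_mul_mean hS.measurable_error hS.error_law hεind (measurable_lam hf)
        (memLp_lam hf hJ hF.memLp_id) (integral_lam hf hJ hF.memLp_id hF.integral_id_eq_zero)
        hNn)) _
  have hrem' := (hrem (fun n => n / 2) (fun _ => 0) hhalf fun n => Nat.div_le_self n 2).abs.add
    (hrem (fun n => n - n / 2) (fun n => n / 2) hhalf' fun n => Nat.sub_le n _).abs
  simp only [zero_add] at hrem'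
  intro δ hδ
  refine tendsto_zero_of_forall_le_ofReal fun η hη => ?_
  have hη2 : 0 < η / 2 := half_pos hη
  have hcs : ∀ᶠ n in atTop, γ * baseRate n ^ 2 ≤ 1 / 2 := by
    have h3 : Tendsto (fun n => γ * baseRate n ^ 2) atTop (𝓝 0) := by
      simpa using (tendsto_baseRate.pow 2).const_mul γ
    exact h3.eventually_le_const (by norm_num)
  filter_upwards [eventually_measure_discrepancy_le hK hf hJ hF.memLp_id hF.integral_id_eq_zero hw
      hRρ hρc hμ hb hB hd hγ hw₀ hα hα1 hle (s := baseRate) (a := a)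
      (fun n hn => baseRate_pos (by omega)) (fun n hn => baseRate_le_one (by omega))
      (fun n hn => baseRate_pow_eight_mul (by omega)) ha_pos tendsto_baseRate ha_zero
      (tendsto_baseRate_div ha_pos ha_rate) (half_pos hδ) hη2, hrem' _ (half_pos hδ) _ hη2,
    hcs, eventually_ge_atTop 2] with n hn1 hn2 hcn hn
  have hcn' : c n = γ * baseRate n ^ 2 := by rw [hcγ n (by omega), baseRate_sq]
  have hcpos : 0 < γ * baseRate n ^ 2 := mul_pos hγ (pow_pos (baseRate_pos (by omega)) 2)
  -- the covariates and the errors of the two halves, whose joint law is a product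
  set F : Ω → (ℕ → ℝ) × ((ℕ → ℝ) × (ℕ → ℝ)) := fun ω => ((fun j => X j ω),
    ((fun j => ε (firstIndex n j) ω), fun j => ε (secondIndex n j) ω)) with hFdef
  have hFm : Measurable F := (measurable_pi_lambda _ hS.measurable_covariate).prodMk
    ((measurable_pi_lambda _ fun j => hS.measurable_error _).prodMk
      (measurable_pi_lambda _ fun j => hS.measurable_error _))
  rw [← hS.map_eq_prod (firstIndex_injective n) (secondIndex_injective n)
    (firstIndex_ne_secondIndex n)] at hn1
  -- the inequality holds for any set, so the measurability of the event is not at issue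
  have hn1' := (Measure.le_map_apply hFm.aemeasurable _).trans hn1
  refine (measure_mono fun ω hω => ?_).trans ((measure_union_le _ _).trans
    ((add_le_add hn1' hn2).trans (le_of_eq (by
      rw [← ENNReal.ofReal_add hη2.le hη2.le, add_halves]))))
  by_contra hcon
  rw [mem_union, not_or] at hcon
  obtain ⟨hc1, hc2⟩ := hcon
  simp only [mem_preimage, mem_ofPred_eq, not_or, not_not, not_exists, not_lt] at hc1 hc2
  obtain ⟨hsp, hdisc⟩ := hc1
  have hx₁ := hsp.1.mem
  have hx₂ := hsp.2.mem
  -- on the complement of the exceptional sets the bound is deterministic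
  have hx : ∀ j < n, X j ω ∈ Icc (0 : ℝ) 1 := by
    intro j hj
    rcases lt_or_ge j (n / 2) with h | h
    · exact hx₁ j h
    · have := hx₂ (j - n / 2) (by omega)
      simp only [hFdef] at this
      rwa [show n / 2 + (j - n / 2) = j by omega] at this
  have hY : ∀ j < n, Y j ω = ρ (X j ω) + ε j ω := fun j hj => by
    rw [hS.response, hrρ (hx j hj)]
  have e1 : ∀ j < n / 2, ε j ω = (F ω).2.1 j := fun j hj => by
    simp only [hFdef, firstIndex, if_pos hj]
  have e2 : ∀ j < n - n / 2, ε (n / 2 + j) ω = (F ω).2.2 j := fun j hj => by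
    simp only [hFdef, secondIndex, if_pos hj]
  have hb2 : 0 < b / 2 := half_pos hb
  have hmatch : SplitInput.Matches
      ⟨κ, a n, n, fun j => X j ω, fun j => Y j ω, r₁ n ω, r₂ n ω⟩
      (regressionDesign w (γ * baseRate n ^ 2) ρ n fun j => X j ω) (F ω).2 :=
    SplitInput.matches_regressionDesign
      (S := ⟨κ, a n, n, fun j => X j ω, fun j => Y j ω, r₁ n ω, r₂ n ω⟩)
      (κ₀ := w₀ * (b / 2) * d ^ 5 / 121) hn hcpos (by positivity) (hcn' ▸ hr₁ n ω)
      (hcn' ▸ hr₂ n ω) (fun j (hj : j < n / 2) => by rw [← e1 j hj]; exact hY j (by omega))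
      (fun j (hj : j < n - n / 2) => by rw [← e2 j hj]; exact hY (n / 2 + j) (by omega)) hx₁ hx₂
      (fun t ht => hsp.1.gramBound hw (by omega) hcpos hcn hd hb2 hw₀ hα hα1 hle ht)
      (fun t ht => hsp.2.gramBound hw (by omega) hcpos hcn hd hb2 hw₀ hα hα1 hle ht)
  have hs4 : 0 < baseRate n ^ 4 := pow_pos (baseRate_pos (by omega)) 4
  have hbound : supNorm (fun y =>
      SplitInput.C ⟨κ, a n, n, fun j => X j ω, fun j => Y j ω, r₁ n ω, r₂ n ω⟩ y -
        correction f f' g r n (fun j => X j ω) (fun j => ε j ω) y) ≤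
      ENNReal.ofReal (baseRate n ^ 4 * δ) := by
    refine iSup_le fun y => ENNReal.ofReal_le_ofReal ?_
    beta_reduce
    rw [correction_congr hG.zero_outside hrρ hx]
    refine (abs_C_sub_correction_le hmatch hK (ha_pos n) e1 e2 y).trans ?_
    have t1 := abs_centringTerm_le hf hG hρc hρR (n := n) (N := n / 2) (by omega) (by omega)
      (fun j => X j ω) (F ω).2.1 y
    have t2 := abs_centringTerm_le hf hG hρc hρR (n := n) (N := n - n / 2) (by omega) (by omega)
      (fun j => X (n / 2 + j) ω) (F ω).2.2 y
    rw [Finset.sum_congr rfl fun j hj => congrArg (lam f f') (e1 j (Finset.mem_range.1 hj)).symm]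
      at t1
    rw [Finset.sum_congr rfl fun j hj => congrArg (lam f f') (e2 j (Finset.mem_range.1 hj)).symm]
      at t2
    have t3 := hdisc y
    have t4 := mul_le_mul_of_nonneg_left ((le_abs_self _).trans hc2) hs4.le
    rw [mul_add] at t4
    calc _ ≤ _ := add_le_add t3 ((add_le_add t1 t2).trans t4)
      _ = _ := by ring
  have hcontra : ENNReal.ofReal (√n) * ENNReal.ofReal (baseRate n ^ 4 * δ) = ENNReal.ofReal δ := by
    rw [← ENNReal.ofReal_mul (Real.sqrt_nonneg _), ← mul_assoc,
      sqrt_mul_baseRate_pow_four (by omega), one_mul]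
  rw [mem_ofPred_eq] at hω
  refine absurd hω (not_lt.2 ?_)
  rw [← hcontra]
  exact mul_le_mul_right hbound _
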